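/- **Setting.** Let $\mathcal M=(\mathcal S,\mathcal A,\{p_h\}_{h\in[H]},s_1,H)$ be a tabular episodic MDP with $S=|\mathcal S|<\infty$, $1\le A=|\mathcal A|<\infty$, $H\ge 1$. In each episode the learner starts in $s_1$, plays a policy, and at stages $h=1,\dots,H$ takes $a_h$ and observes $s_{h+1}\sim p_h(\cdot|s_h,a_h)$. For a (stochastic, Markov) policy $\pi$ let $p_h^\pi(s)=\mathbb P^\pi(s_h=s)$, $p_h^\pi(s,a)=\mathbb P^\pi(s_h=s,a_h=a)$, $V_1^\pi(s_1;r)=\sum_{h,s,a}p_h^\pi(s,a)r_h(s,a)$ and $V_1^\star(s_1;r)=\sup_\pi V_1^\pi(s_1;r)$. For a target function $c$ put $$\varphi^\star(c)=\inf_{\pi}\ \max_{(h,s,a):\,c_h(s,a)>0}\frac{c_h(s,a)}{p_h^\pi(s,a)}$$ ($c/0=\infty$ for $c>0$; $\varphi^\star(c)=0$ if no $c_h(s,a)$ is positive). For a list of episodes, $n_h(s)$, $n_h(s,a)$ are the numbers of visits at stage $h$, and $\widehat p_h(\cdot|s,a)$ the empirical transition frequencies (uniform if $n_h(s,a)=0$).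 **UCBVI** with data, parameter $\delta$ and current reward $r$ plays a policy $\pi_h(s)\in\arg\max_a\overline Q_h(s,a)$ (any fixed tie-breaking rule), where $\overline Q_H=r_H$ and, for $h<H$, with $\overline V_{h+1}(s)=\max_a\overline Q_{h+1}(s,a)$, $n=n_h(s,a)$, $\beta=\log(2SAH/\delta)+S\log(8e(n+1))$, $$\overline Q_h(s,a)=\min\Big\{1,\ r_h(s,a)+\textstyle\sum_{x}\widehat p_h(x|s,a)\overline V_{h+1}(x)+\max\Big\{\sqrt{8\,\mathrm{Var}_{\widehat p_h(\cdot|s,a)}(\overline V_{h+1})\beta/n},\ 8\beta/n\Big\}\Big\},$$ and $\overline Q_h(s,a)=1$ if $n=0$. Let $\mathcal R_\delta(T)=65536\,SAH^2(\log(2SAH/\delta)+6S)\log(T+1)^2$. **EstimateReachability**$((h,s);\varepsilon_0,\delta)$: let $T=\inf\{T\in\mathbb N: 4\mathcal R_{\delta/2}(T)+6\log(4/\delta)\le\varepsilon_0T/4\}$, play $T$ episodes of UCBVI (on its own data, parameter $\delta/2$) with reward $\mathbf 1\{h'=h,s'=s\}$, and return $\underline W_h(s)=\max\{\frac{n_h(s)}{2T}-\frac{\varepsilon_0}{16},0\}$,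 $\overline W_h(s)=\min\{\frac{2n_h(s)}{T}+\frac{\varepsilon_0}{4},1\}$. **CovGame**$(c,\delta)$: let $c_{\min}=\max\{1,\min_{c_h(s,a)>0}c_h(s,a)\}$, $\mathcal X_0=\{c>0\}$, $\mathcal X_k=\{c>c_{\min}2^k\}$ for $k\ge1$, and start at level $k=0$. In round $t\ge 1$ play UCBVI (on the data of this run, parameter $\delta/2$) with reward $\lambda^t$. Terminate at the end of the first round at which $n_h(s,a)\ge c_h(s,a)$ for all $(h,s,a)$, returning all episodes of the run. Otherwise set the new level to the largest $j$ such that $n_h(s,a)\ge c_h(s,a)$ on $\mathcal X_0\setminus\mathcal X_j$. The reward $\lambda^t$ is the weight vector of the weighted majority forecaster on the current $\mathcal X_k$, reset whenever the level changes: $\lambda_h(s,a)\propto \exp(-\eta L_h(s,a))$ on $\mathcal X_k$ and $0$ elsewhere, where $L_h(s,a)$ is the number of visits of $(h,s,a)$ since the reset, $\eta=\min\{1,\sqrt{2(\sqrt2-1)/(e-2)}\sqrt{\log|\mathcal X_k|/V}\}$ ($\eta=1$ if $V=0$), and $V$ is the sum over the rounds since the reset of the variance, under $\lambda^t$, of the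 $0$-$1$ visit indicator of $(h,s,a)$ in that round. **PCE**$(\varepsilon,\delta)$: run EstimateReachability$((h,s);\frac{\varepsilon}{4SH^2},\frac{\delta}{3SH})$ for every $(h,s)$, one after the other; let $\widehat{\mathcal X}=\{(h,s,a):\underline W_h(s)\ge\frac{\varepsilon}{32SH^2}\}$. Run CovGame$(\mathbf 1_{\widehat{\mathcal X}},\delta/6)$ (phase $0$). For $k=1,2,\dots$ run CovGame$(c^k,\frac{\delta}{6(k+1)^2})$ with $c_h^k(s,a)=2^k\,\overline W_h(s)\mathbf 1\{(h,s,a)\in\widehat{\mathcal X}\}$; let $t_k$ be the number of episodes of phases $0,\dots,k$ and stop, returning the estimate $\widehat p$ computed from these $t_k$ episodes, as soon as $\sqrt{H\beta^{RF}(t_k,\delta/3)2^{4-k}}\le\varepsilon$, where $\beta^{RF}(t,\delta)=4H^2\log(1/\delta)+24SH^3\log(A(1+t))$. Its sample complexity $\tau$ is the total number of episodes played, including those of EstimateReachability ($\tau=\infty$ if it does not stop). **Theorem.** There are universal constants $C>0$ and $q\in\mathbb N$ such that for every such MDP, every tie-breaking rule, every $\varepsilon>0$ and $\delta\in(0,1)$: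 1. With probability at least $1-\delta$, PCE stops and, for every reward function $r\in[0,1]^{SAH}$ and every policy $\widehat\pi_r$ that is optimal in the MDP $(\widehat p,r)$, $|V_1^{\widehat\pi_r}(s_1;r)-V_1^\star(s_1;r)|\le\varepsilon$. 2. If $\varepsilon\le H$, then with probability at least $1-\delta$, $$\tau\le C L^q\left(\big(H^3\log(1/\delta)+SH^4\big)\,\varphi^\star\!\left(\left[\frac{\sup_\pi p_h^\pi(s)\,\mathbf 1\{\sup_\pi p_h^\pi(s)\ge\frac{\varepsilon}{32SH^2}\}}{\varepsilon^2}\right]_{h,s,a}\right)+\frac{S^3A^2H^5(\log(1/\delta)+S)}{\varepsilon}\right),$$ where $L=1+\log S+\log A+\log H+|\log\varepsilon|+\log(1+\log(1/\delta))$. -/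

import Mathlib

open MeasureTheory

noncomputable section

namespace RewardFree

/-! ### Episodic Markov decision processes

The stages `1, …, H` are indexed by `Fin H`, so that the first stage has index `0`. -/

/-- A tabular MDP with horizon `H`: initial state and transition probabilities `p_h(· | s, a)`. -/
structure MDP (S A : Type*) (H : ℕ) where
  init : S
  trans : Fin H → S → A → PMF S

/-- Stochastic policies: `(π h s).1 a` is the probability of action `a` in state `s` at stage `h`. -/
abbrev Policy (S A : Type*) [Fintype A] (H : ℕ) := Fin H → S → stdSimplex ℝ A

/-- Deterministic policies. -/
abbrev DetPolicy (S A : Type*) (H : ℕ) := Fin H → S → A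

/-- Real functions of `(h, s, a)`: rewards and target functions. -/
abbrev Table (S A : Type*) (H : ℕ) := Fin H → S → A → ℝ

/-- A transition model: `P h s a x` is the probability to move from `s` to `x`. -/
abbrev Model (S A : Type*) (H : ℕ) := Fin H → S → A → S → ℝ

/-- The transition probabilities of an MDP as real numbers. -/
def MDP.model {S A : Type*} {H : ℕ} (M : MDP S A H) : Model S A H :=
  fun h s a x => (M.trans h s a x).toReal

section Values

variable {S A : Type*} [Fintype S] [Fintype A] {H : ℕ}

open scoped Classical in
/-- `p_h^π(s)`: probability that state `s` is occupied at stage `h` under the policy `π`. -/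
def stateOcc (P : Model S A H) (s₁ : S) (π : Policy S A H) : ℕ → S → ℝ
  | 0, s => if s = s₁ then 1 else 0
  | h + 1, s =>
      if hh : h < H then
        ∑ x, ∑ a, stateOcc P s₁ π h x * (π ⟨h, hh⟩ x).1 a * P ⟨h, hh⟩ x a s
      else 0

/-- `p_h^π(s, a)`. -/
def occ (P : Model S A H) (s₁ : S) (π : Policy S A H) (h : Fin H) (s : S) (a : A) : ℝ :=
  stateOcc P s₁ π h s * (π h s).1 a

/-- `V_1^π(s₁; r) = ∑_{h,s,a} p_h^π(s, a) r_h(s, a)`. -/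
def value (P : Model S A H) (s₁ : S) (π : Policy S A H) (r : Table S A H) : ℝ :=
  ∑ h, ∑ s, ∑ a, occ P s₁ π h s a * r h s a

/-- `π` maximizes the expected return in the MDP with transitions `P` and rewards `r`. -/
def IsOptimalPolicy (P : Model S A H) (s₁ : S) (r : Table S A H) (π : Policy S A H) : Prop :=
  ∀ π₂ : Policy S A H, value P s₁ π₂ r ≤ value P s₁ π r

/-- `V_1^⋆(s₁; r)`. -/
def MDP.optValue (M : MDP S A H) (r : Table S A H) : ℝ :=
  ⨆ π : Policy S A H, value M.model M.init π r

/-- `sup_π p_h^π(s)`. -/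
def MDP.maxReach (M : MDP S A H) (h : Fin H) (s : S) : ℝ :=
  ⨆ π : Policy S A H, stateOcc M.model M.init π h s

/-- The coverage complexity `φ⋆(c) = inf_ρ max_{(h,s,a) : c_h(s,a) > 0} c_h(s,a) / ρ_h(s,a)`, where
`ρ` ranges over the state-action distributions of stochastic policies and `c / 0 = ∞` for `c > 0`
(the division is that of `ℝ≥0∞`). -/
def MDP.coverage (M : MDP S A H) (c : Table S A H) : ENNReal :=
  ⨅ π : Policy S A H, ⨆ (h : Fin H) (s : S) (a : A) (_ : 0 < c h s a),
    ENNReal.ofReal (c h s a) / ENNReal.ofReal (occ M.model M.init π h s a)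

end Values

/-! ### Interaction -/

/-- The trajectory `s_1, a_1, s_2, …, s_H, a_H, s_{H+1}` of one episode. -/
structure Episode (S A : Type*) (H : ℕ) where
  state : Fin (H + 1) → S
  action : Fin H → A

/-- The randomness of one episode: `u (h, s, a)` is the state that follows `s` if the action `a`
is taken in `s` at stage `h`. -/
abbrev Seed (S A : Type*) (H : ℕ) := Fin H × S × A → S

/-- The environment seen by a learner: `env t π` is the trajectory that the policy `π` generates
when it is played in episode `t` (episodes are counted from `0`). -/
abbrev Env (S A : Type*) (H : ℕ) := ℕ → DetPolicy S A H → Episode S A H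

section Interaction

variable {S A : Type*} {H : ℕ}

/-- The successive states of an episode in which the policy `π` is played. -/
def rolloutState (s₁ : S) (π : DetPolicy S A H) (u : Seed S A H) : ℕ → S
  | 0 => s₁
  | h + 1 =>
      if hh : h < H then
        u (⟨h, hh⟩, rolloutState s₁ π u h, π ⟨h, hh⟩ (rolloutState s₁ π u h))
      else rolloutState s₁ π u h

/-- The trajectory of an episode in which the policy `π` is played. -/
def rollout (s₁ : S) (π : DetPolicy S A H) (u : Seed S A H) : Episode S A H where
  state i := rolloutState s₁ π u i
  action h := π h (rolloutState s₁ π u h)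

/-- The next states `u (h, s, a) ∼ p_h(· | s, a)` are independent. As each `(h, s, a)` is met at
most once in an episode, the trajectory of a policy under this law has its law in the MDP. -/
def MDP.seedLaw [Fintype S] [Fintype A] [MeasurableSpace S] (M : MDP S A H) :
    Measure (Seed S A H) :=
  Measure.pi fun x => (M.trans x.1 x.2.1 x.2.2).toMeasure

instance [Fintype S] [Fintype A] [MeasurableSpace S] (M : MDP S A H) :
    IsProbabilityMeasure M.seedLaw := by
  unfold MDP.seedLaw
  infer_instance

/-- The randomness of all episodes: independent episodes. -/
def MDP.law [Fintype S] [Fintype A] [MeasurableSpace S] (M : MDP S A H) :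
    Measure (ℕ → Seed S A H) :=
  Measure.infinitePi fun _ : ℕ => M.seedLaw

/-- The interaction with `M` when the randomness of the episodes is `ω`. -/
def MDP.env (M : MDP S A H) (ω : ℕ → Seed S A H) : Env S A H :=
  fun t π => rollout M.init π (ω t)

/-- The environment from episode `m` on. -/
def Env.shift (env : Env S A H) (m : ℕ) : Env S A H := fun t => env (m + t)

end Interaction

/-! ### Statistics of a dataset -/

section Statistics

variable {S A : Type*} {H : ℕ}

open scoped Classical in
/-- Number of visits of state `s` at stage `h`. -/
def visits (D : List (Episode S A H)) (h : Fin H) (s : S) : ℕ :=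
  D.countP fun e => e.state h.castSucc = s

open scoped Classical in
/-- `n_h(s, a)`. -/
def count (D : List (Episode S A H)) (h : Fin H) (s : S) (a : A) : ℕ :=
  D.countP fun e => e.state h.castSucc = s ∧ e.action h = a

open scoped Classical in
/-- Number of observed transitions from `s` to `x` under the action `a` at stage `h`. -/
def countNext (D : List (Episode S A H)) (h : Fin H) (s : S) (a : A) (x : S) : ℕ :=
  D.countP fun e => e.state h.castSucc = s ∧ e.action h = a ∧ e.state h.succ = x

/-- The maximum likelihood estimate of the transition probabilities; rows without any observation
are set to the uniform distribution. -/
def empirical [Fintype S] (D : List (Episode S A H)) : Model S A H :=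
  fun h s a x =>
    if count D h s a = 0 then 1 / (Fintype.card S : ℝ)
    else (countNext D h s a x : ℝ) / (count D h s a : ℝ)

end Statistics

/-! ### UCBVI with changing rewards -/

/-- A rule that picks a maximizer of any real function of the action. -/
def IsArgmaxRule {A : Type*} (sel : (A → ℝ) → A) : Prop :=
  ∀ (f : A → ℝ) (a : A), f a ≤ f (sel f)

section UCBVI

variable {S A : Type*} [Fintype S] [Fintype A] {H : ℕ}

/-- `β(n, δ) = log(2SAH/δ) + S log(8e(n+1))`. -/
def ucbviThreshold (S A : Type*) [Fintype S] [Fintype A] (H n : ℕ) (δ : ℝ) : ℝ :=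
  Real.log (2 * Fintype.card S * Fintype.card A * H / δ) +
    Fintype.card S * Real.log (8 * Real.exp 1 * (n + 1))

/-- Expectation of `V` under the probability vector `q`. -/
def expect (q V : S → ℝ) : ℝ := ∑ x, q x * V x

/-- Variance of `V` under the probability vector `q`. -/
def variance (q V : S → ℝ) : ℝ := ∑ x, q x * (V x - expect q V) ^ 2

/-- The exploration bonus after `n ≥ 1` visits, with empirical transition probabilities `q` and
optimistic values `V` at the next stage. -/
def bonus (A : Type*) [Fintype A] (H : ℕ) (δ : ℝ) (n : ℕ) (q V : S → ℝ) : ℝ :=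
  max (Real.sqrt (8 * variance q V * ucbviThreshold S A H n δ / n))
    (8 * ucbviThreshold S A H n δ / n)

/-- The optimistic action values. At the last stage this is the reward. At a triplet that has
not been visited the bonus is infinite, and the value is truncated to `1`. -/
def ucbQ (D : List (Episode S A H)) (δ : ℝ) (r : Table S A H) (h : Fin H) (s : S) (a : A) : ℝ :=
  if hh : (h : ℕ) + 1 < H then
    if count D h s a = 0 then 1
    else
      min (r h s a
          + expect (empirical D h s a) (fun x => ⨆ b, ucbQ D δ r ⟨h + 1, hh⟩ x b)
          + bonus A H δ (count D h s a) (empirical D h s a)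
              (fun x => ⨆ b, ucbQ D δ r ⟨h + 1, hh⟩ x b)) 1
  else r h s a
termination_by H - (h : ℕ)
decreasing_by all_goals omega

/-- The policy of UCBVI with data `D`, confidence `1 - δ` and current reward `r`. -/
def ucbviPolicy (sel : (A → ℝ) → A) (D : List (Episode S A H)) (δ : ℝ) (r : Table S A H) :
    DetPolicy S A H :=
  fun h s => sel (ucbQ D δ r h s)

/-- The regret rate of UCBVI:
`R_δ(T) = 65536 S A H² (log(2SAH/δ) + 6S) log(T+1)²`. -/
def ucbviRegret (S A : Type*) [Fintype S] [Fintype A] (H : ℕ) (δ : ℝ) (T : ℕ) : ℝ :=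
  65536 * Fintype.card S * Fintype.card A * (H : ℝ) ^ 2 *
    (Real.log (2 * Fintype.card S * Fintype.card A * H / δ) + 6 * Fintype.card S) *
    Real.log (T + 1) ^ 2

end UCBVI

/-! ### Estimation of the reachability of a state -/

section Reachability

variable {S A : Type*} [Fintype S] [Fintype A] {H : ℕ}

open scoped Classical in
/-- The reward that pays `1` for being in state `s` at stage `h`. -/
def reachReward (A : Type*) (h : Fin H) (s : S) : Table S A H :=
  fun g x _ => if g = h ∧ x = s then 1 else 0

/-- The number of episodes used for one pair `(h, s)`. -/
def reachEpisodes (S A : Type*) [Fintype S] [Fintype A] (H : ℕ) (ε₀ δ : ℝ) : ℕ :=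
  sInf {T : ℕ | 4 * ucbviRegret S A H (δ / 2) T + 6 * Real.log (4 / δ) ≤ ε₀ / 4 * T}

/-- The first `t` episodes of UCBVI with confidence `1 - δ/2` and the reward of `(h, s)`. -/
def reachData (sel : (A → ℝ) → A) (env : Env S A H) (δ : ℝ) (h : Fin H) (s : S) :
    ℕ → List (Episode S A H)
  | 0 => []
  | t + 1 =>
      reachData sel env δ h s t ++
        [env t (ucbviPolicy sel (reachData sel env δ h s t) (δ / 2) (reachReward A h s))]

/-- The lower confidence bound on `sup_π p_h^π(s)`. -/
def reachLower (sel : (A → ℝ) → A) (env : Env S A H) (ε₀ δ : ℝ) (h : Fin H) (s : S) : ℝ :=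
  max ((visits (reachData sel env δ h s (reachEpisodes S A H ε₀ δ)) h s : ℝ) /
    (2 * reachEpisodes S A H ε₀ δ) - ε₀ / 16) 0

/-- The upper confidence bound on `sup_π p_h^π(s)`. -/
def reachUpper (sel : (A → ℝ) → A) (env : Env S A H) (ε₀ δ : ℝ) (h : Fin H) (s : S) : ℝ :=
  min (2 * (visits (reachData sel env δ h s (reachEpisodes S A H ε₀ δ)) h s : ℝ) /
    reachEpisodes S A H ε₀ δ + ε₀ / 4) 1

end Reachability

/-! ### CovGame -/

section CovGame

variable {S A : Type*} [Fintype S] [Fintype A] {H : ℕ}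

/-- `c_min = (min_{c_h(s,a) > 0} c_h(s,a)) ∨ 1`. -/
def cmin (c : Table S A H) : ℝ :=
  max (sInf {y : ℝ | ∃ h s a, 0 < c h s a ∧ y = c h s a}) 1

open scoped Classical in
/-- `X_0 = {c > 0}` and `X_k = {c > c_min 2^k}` for `k ≥ 1`. -/
def level (c : Table S A H) (k : ℕ) : Finset (Fin H × S × A) :=
  {x | if k = 0 then 0 < c x.1 x.2.1 x.2.2 else cmin c * 2 ^ k < c x.1 x.2.1 x.2.2}

/-- The state of CovGame between two rounds: the episodes played so far, the current level `k`,
and, since the last reset of the weighted majority forecaster, the cumulated losses of the triplets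
and the cumulated variance of the losses under the weights of the forecaster. -/
structure CovState (S A : Type*) (H : ℕ) where
  data : List (Episode S A H)
  lvl : ℕ
  loss : Table S A H
  var : ℝ

/-- The variance-dependent learning rate `min {1, C √(log N / V)}` of the weighted majority
forecaster with `N` experts, where `C = √(2(√2 - 1)/(e - 2))`; it is `1` if `V = 0`. -/
def learningRate (N : ℕ) (V : ℝ) : ℝ :=
  if V = 0 then 1
  else min 1 (Real.sqrt (2 * (Real.sqrt 2 - 1) / (Real.exp 1 - 2)) *
    Real.sqrt (Real.log N / V))

open scoped Classical in
/-- The weights `λ` of the forecaster on the current level, and zero outside of it. -/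
def weights (c : Table S A H) (σ : CovState S A H) : Table S A H :=
  fun h s a =>
    if (h, s, a) ∈ level c σ.lvl then
      Real.exp (-(learningRate (level c σ.lvl).card σ.var * σ.loss h s a)) /
        ∑ x ∈ level c σ.lvl,
          Real.exp (-(learningRate (level c σ.lvl).card σ.var * σ.loss x.1 x.2.1 x.2.2))
    else 0

open scoped Classical in
/-- The loss of a triplet in an episode: `1` if it is visited. -/
def hit (e : Episode S A H) : Table S A H :=
  fun h s a => if e.state h.castSucc = s ∧ e.action h = a then 1 else 0

/-- Mean loss of the forecaster in an episode. -/
def meanLoss (w : Table S A H) (e : Episode S A H) : ℝ :=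
  ∑ h, ∑ s, ∑ a, w h s a * hit e h s a

/-- Variance of the loss of the forecaster in an episode. -/
def varLoss (w : Table S A H) (e : Episode S A H) : ℝ :=
  ∑ h, ∑ s, ∑ a, w h s a * (hit e h s a - meanLoss w e) ^ 2

/-- The largest `j` such that all the triplets outside of `X_j` are covered by the data. -/
def nextLevel (c : Table S A H) (D : List (Episode S A H)) : ℕ :=
  sSup {j : ℕ | ∀ x ∈ level c 0, x ∉ level c j →
    c x.1 x.2.1 x.2.2 ≤ count D x.1 x.2.1 x.2.2}

/-- Update of the state of CovGame with the trajectory `e`. -/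
def covUpdate (c : Table S A H) (σ : CovState S A H) (e : Episode S A H) : CovState S A H :=
  if nextLevel c (σ.data ++ [e]) = σ.lvl then
    { data := σ.data ++ [e]
      lvl := σ.lvl
      loss := fun h s a => σ.loss h s a + hit e h s a
      var := σ.var + varLoss (weights c σ) e }
  else
    { data := σ.data ++ [e]
      lvl := nextLevel c (σ.data ++ [e])
      loss := fun _ _ _ => 0
      var := 0 }

/-- The state of CovGame after `t` rounds, if it has not terminated before. -/
def covState (sel : (A → ℝ) → A) (env : Env S A H) (c : Table S A H) (δ : ℝ) :
    ℕ → CovState S A H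
  | 0 => { data := [], lvl := 0, loss := fun _ _ _ => 0, var := 0 }
  | t + 1 =>
      covUpdate c (covState sel env c δ t)
        (env t (ucbviPolicy sel (covState sel env c δ t).data (δ / 2)
          (weights c (covState sel env c δ t))))

/-- The termination test of CovGame at the end of round `t ≥ 1`. -/
def CovDone (sel : (A → ℝ) → A) (env : Env S A H) (c : Table S A H) (δ : ℝ) (t : ℕ) : Prop :=
  1 ≤ t ∧ ∀ h s a, c h s a ≤ count (covState sel env c δ t).data h s a

open scoped Classical in
/-- CovGame with target `c` and confidence `1 - δ`: the dataset of all the episodes played until it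
terminates, and `none` if it never does. -/
def covGame (sel : (A → ℝ) → A) (env : Env S A H) (c : Table S A H) (δ : ℝ) :
    Option (List (Episode S A H)) :=
  if ht : ∃ t, CovDone sel env c δ t then some (covState sel env c δ (Nat.find ht)).data
  else none

end CovGame

/-! ### Proportional Coverage Exploration (PCE) -/

section PCE

variable {S A : Type*} [Fintype S] [Fintype A] {H : ℕ}

/-- The threshold `ε₀ = ε / (4SH²)` of the reachability phase. -/
def pceThreshold (S : Type*) [Fintype S] (H : ℕ) (ε : ℝ) : ℝ :=
  ε / (4 * Fintype.card S * (H : ℝ) ^ 2)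

/-- The confidence parameter `δ / (3SH)` of the reachability phase. -/
def pceReachConf (S : Type*) [Fintype S] (H : ℕ) (δ : ℝ) : ℝ := δ / (3 * Fintype.card S * H)

/-- Number of episodes of the reachability phase for one pair `(h, s)`. -/
def pceReachEpisodes (S A : Type*) [Fintype S] [Fintype A] (H : ℕ) (ε δ : ℝ) : ℕ :=
  reachEpisodes S A H (pceThreshold S H ε) (pceReachConf S H δ)

/-- Total number of episodes of the reachability phase. -/
def pceInit (S A : Type*) [Fintype S] [Fintype A] (H : ℕ) (ε δ : ℝ) : ℕ :=
  Fintype.card (Fin H × S) * pceReachEpisodes S A H ε δ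

/-- The part of the interaction in which the reachability of `(h, s)` is estimated; the pairs are
treated one after the other. -/
def pceReachEnv (env : Env S A H) (ε δ : ℝ) (h : Fin H) (s : S) : Env S A H :=
  env.shift ((Fintype.equivFin (Fin H × S) (h, s) : ℕ) * pceReachEpisodes S A H ε δ)

/-- The lower confidence bound on `sup_π p_h^π(s)` used by PCE. -/
def pceLower (sel : (A → ℝ) → A) (env : Env S A H) (ε δ : ℝ) (h : Fin H) (s : S) : ℝ :=
  reachLower sel (pceReachEnv env ε δ h s) (pceThreshold S H ε) (pceReachConf S H δ) h s

/-- The upper confidence bound on `sup_π p_h^π(s)` used by PCE. -/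
def pceUpper (sel : (A → ℝ) → A) (env : Env S A H) (ε δ : ℝ) (h : Fin H) (s : S) : ℝ :=
  reachUpper sel (pceReachEnv env ε δ h s) (pceThreshold S H ε) (pceReachConf S H δ) h s

open scoped Classical in
/-- The target function of phase `k`, where phase `0` is the burn-in phase. -/
def pceTarget (sel : (A → ℝ) → A) (env : Env S A H) (ε δ : ℝ) (k : ℕ) : Table S A H :=
  fun h s _ =>
    if ε / (32 * Fintype.card S * (H : ℝ) ^ 2) ≤ pceLower sel env ε δ h s then
      if k = 0 then 1 else 2 ^ k * pceUpper sel env ε δ h s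
    else 0

/-- All the episodes of the phases `0, …, k` (if PCE has not terminated before), and `none` if one
of these phases does not end. -/
def pceData (sel : (A → ℝ) → A) (env : Env S A H) (ε δ : ℝ) : ℕ → Option (List (Episode S A H))
  | 0 => covGame sel (env.shift (pceInit S A H ε δ)) (pceTarget sel env ε δ 0) (δ / 6)
  | k + 1 =>
      (pceData sel env ε δ k).bind fun D =>
        (covGame sel (env.shift (pceInit S A H ε δ + D.length)) (pceTarget sel env ε δ (k + 1))
          (δ / (6 * ((k : ℝ) + 2) ^ 2))).map fun D₂ => D ++ D₂

/-- `β^RF(t, δ) = 4H² log(1/δ) + 24 S H³ log(A(1+t))`. -/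
def betaRF (S A : Type*) [Fintype S] [Fintype A] (H t : ℕ) (δ : ℝ) : ℝ :=
  4 * (H : ℝ) ^ 2 * Real.log (1 / δ) +
    24 * Fintype.card S * (H : ℝ) ^ 3 * Real.log (Fintype.card A * (1 + t))

/-- The termination test of PCE at the end of phase `k ≥ 1`. -/
def PCEDone (sel : (A → ℝ) → A) (env : Env S A H) (ε δ : ℝ) (k : ℕ) : Prop :=
  1 ≤ k ∧ ∃ D, pceData sel env ε δ k = some D ∧
    Real.sqrt (H * betaRF S A H D.length (δ / 3) * (2 : ℝ) ^ ((4 : ℤ) - k)) ≤ ε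

open scoped Classical in
/-- The data collected by PCE in the phases `0, 1, …` when it terminates, and `none` if it never
does. -/
def pceRun (sel : (A → ℝ) → A) (env : Env S A H) (ε δ : ℝ) : Option (List (Episode S A H)) :=
  if hk : ∃ k, PCEDone sel env ε δ k then pceData sel env ε δ (Nat.find hk) else none

/-- The estimate of the transition probabilities returned by PCE. -/
def pceOutput (sel : (A → ℝ) → A) (env : Env S A H) (ε δ : ℝ) : Option (Model S A H) :=
  (pceRun sel env ε δ).map empirical

/-- The sample complexity of PCE: the total number of episodes played, reachability phase
included. It is `∞` if PCE does not terminate. -/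
def pceEpisodes (sel : (A → ℝ) → A) (env : Env S A H) (ε δ : ℝ) : ENNReal :=
  match pceRun sel env ε δ with
  | some D => ((pceInit S A H ε δ + D.length : ℕ) : ENNReal)
  | none => ⊤

open scoped Classical in
/-- The target function `sup_π p_h^π(s) 1{sup_π p_h^π(s) ≥ ε/(32SH²)} / ε²`. -/
def MDP.pceComplexityTarget (M : MDP S A H) (ε : ℝ) : Table S A H :=
  fun h s _ =>
    if ε / (32 * Fintype.card S * (H : ℝ) ^ 2) ≤ M.maxReach h s then M.maxReach h s / ε ^ 2 else 0

end PCE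

/-- `1 + log S + log A + log H + |log ε| + log(1 + log(1/δ))`, whose powers dominate all
poly-logarithmic factors in `S`, `A`, `H`, `ε` and `log(1/δ)`. -/
def logFactor (S A : Type*) [Fintype S] [Fintype A] (H : ℕ) (ε δ : ℝ) : ℝ :=
  1 + Real.log (Fintype.card S) + Real.log (Fintype.card A) + Real.log H + |Real.log ε| +
    Real.log (1 + Real.log (1 / δ))

end RewardFree

end

/-! All randomness sits in independent seeds, one per episode. Both claims are deterministic
consequences of a single event, `PCEEvent`, which fails with probability at most δ (`law_pceEvent`).
Every deviation bound behind it is an instance of `ville`; bounds for the later stages of the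
algorithm, which start at random times, are transported by `strong_markov` and `law_shift_le`.

UCBVI. The likelihood ratio of the Laplace estimator is a nonnegative supermartingale, and it
dominates exp(n · Hellinger²) up to a factor (n+1)^S. This gives Hellinger confidence regions
(`law_hell`). Hellinger balls yield Bernstein-type control of means and compare standard deviations
under the two laws, so the bonus gives optimism (`backV_le_ucbV`) and an explicit gap
(`optimistic_gap`). For rewards whose sum along a trajectory is at most 1, the total variance of a
policy is at most its value (`value_varTable_le`). The regret is therefore multiplicative: any
comparator earns at most 5/4 of what UCBVI earns plus a term of order log(T+1)², with no √T
(`law_ucbvi_regret`). With the indicator of a state as reward this estimates its reachability W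
(`law_reach`).

CovGame. UCBVI plays against a forecaster that puts weight on the triplets of the current level.
While a triplet of X_j outside X_(j+1) is uncovered, it has few visits, so the small-loss bound
`ForecasterInv.loss_bound` keeps the loss of the forecaster on level j of order c_min 2^j. A
comparator that visits every triplet of the level with probability at least m earns at least m per
round. Hence (rounds at level j) · m is at most of order c_min 2^j plus the regret. The comparator
is half a distribution proportional to the target and half an explorer with visit probability μ, so
a level costs of order φ + regret/μ (`CovEvent.rounds_le`).

PCE. After phase k every triplet kept has at least 2^k W visits, and the discarded states contribute
at most ε/4 to any value. The simulation lemma and the concentration `law_transition_error`, uniform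
over policies and value functions, then give accuracy ε/2 for all policies once the stopping rule
holds (`abs_value_sub_value_le`), whence ε for the planned policy. The rule holds after a number of
phases linear in the logarithmic factor L, at a phase K with ε² 2^K at most of order (H³ log(1/δ) +
S H⁴)(L + K). Phase k costs 2^k ε² φ⋆ and regret/μ with μ = ε/(64 S²AH³), up to logarithms; the
second part is the S³A²H⁵/ε term. A crude polynomial bound (`PCEEvent.length_le`) shows beforehand
that the logarithms of the episode counts are of order L + k. -/

set_option linter.unusedSectionVars false

noncomputable section

namespace RewardFree

section

open scoped Classical


variable {S A : Type*} {H : ℕ}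

/-! ### The law of the interaction -/

/-- Prepend the randomness of one episode. -/
def consSeed (u : Seed S A H) (ω : ℕ → Seed S A H) : ℕ → Seed S A H
  | 0 => u
  | n + 1 => ω n

/-- Forget the randomness of the first `m` episodes. -/
def shiftSeed (m : ℕ) (ω : ℕ → Seed S A H) : ℕ → Seed S A H := fun t => ω (m + t)

/-- The dataset of the first `t` episodes of a learner that plays `alg D` when its dataset is `D`. -/
def runData (alg : List (Episode S A H) → DetPolicy S A H) (env : Env S A H) :
    ℕ → List (Episode S A H)
  | 0 => []
  | t + 1 => runData alg env t ++ [env t (alg (runData alg env t))]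

@[simp] lemma length_runData (alg : List (Episode S A H) → DetPolicy S A H) (env : Env S A H)
    (t : ℕ) : (runData alg env t).length = t := by
  induction t with
  | zero => rfl
  | succ t ih => simp [runData, ih]

variable [Fintype S] [Fintype A] [MeasurableSpace S] [DiscreteMeasurableSpace S]

instance (M : MDP S A H) : IsProbabilityMeasure M.law := by
  unfold MDP.law; infer_instance

lemma measurable_consSeed :
    Measurable fun x : Seed S A H × (ℕ → Seed S A H) => consSeed x.1 x.2 := by
  refine measurable_pi_lambda _ fun n => ?_
  cases n with
  | zero => exact measurable_fst
  | succ n => exact (measurable_pi_apply n).comp measurable_snd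

/-- An infinite product of equal laws is unchanged when an independent factor is put in front. It is
enough to compare cylinders, whose preimages are rectangles: a condition on coordinate 0 times a
shifted cylinder. -/
lemma map_consSeed (M : MDP S A H) :
    (M.seedLaw.prod M.law).map (fun x => consSeed x.1 x.2) = M.law := by
  refine Measure.eq_infinitePi _ fun s t ht => ?_
  rw [Measure.map_apply measurable_consSeed
    (MeasurableSet.pi s.countable_toSet fun i _ => ht i)]
  have key : ((fun x : Seed S A H × (ℕ → Seed S A H) => consSeed x.1 x.2) ⁻¹' Set.pi s t)
      = (if 0 ∈ s then t 0 else Set.univ) ×ˢ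
        Set.pi ((s.erase 0).image Nat.pred) (fun n => t (n + 1)) := by
    ext ⟨u, ω⟩
    simp only [Set.mem_preimage, Set.mem_pi, SetLike.mem_coe, Set.mem_prod, Finset.mem_image,
      Finset.mem_erase]
    constructor
    · intro h
      refine ⟨?_, ?_⟩
      · split_ifs with h0
        · exact h 0 h0
        · trivial
      · rintro i ⟨j, ⟨hj0, hj⟩, rfl⟩
        obtain ⟨j, rfl⟩ := Nat.exists_eq_succ_of_ne_zero hj0
        exact h _ hj
    · rintro ⟨h0, h1⟩ i hi
      cases i with
      | zero => simpa [hi, consSeed] using h0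
      | succ i => exact h1 i ⟨i + 1, ⟨by simp, hi⟩, rfl⟩
  rw [key, Measure.prod_prod, MDP.law, Measure.infinitePi_pi _ fun i _ => ht _]
  rw [Finset.prod_image]
  · by_cases h0 : 0 ∈ s
    · rw [if_pos h0, ← Finset.mul_prod_erase s _ h0]
      congr 1
      refine Finset.prod_congr rfl fun i hi => ?_
      rw [Nat.pred_eq_sub_one, Nat.sub_add_cancel (Nat.pos_of_ne_zero (Finset.ne_of_mem_erase hi))]
    · rw [if_neg h0, measure_univ, one_mul, Finset.erase_eq_of_notMem h0]
      refine Finset.prod_congr rfl fun i hi => ?_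
      rw [Nat.pred_eq_sub_one, Nat.sub_add_cancel (Nat.pos_of_ne_zero fun h => h0 (h ▸ hi))]
  · intro i hi j hj hij
    have h1 := Finset.ne_of_mem_erase hi
    have h2 := Finset.ne_of_mem_erase hj
    simp only [Nat.pred_eq_sub_one] at hij
    omega

/-- Conditioning on the first episode. -/
lemma law_le_sum (M : MDP S A H) (E : Set (ℕ → Seed S A H)) :
    M.law E ≤ ∑ u : Seed S A H, M.seedLaw {u} * M.law (consSeed u ⁻¹' E) := by
  -- `E` is not assumed measurable, so each slice is replaced by a measurable hull of the same
  -- measure. This costs only that the conclusion is an inequality, and it spares all later events a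
  -- measurability proof.
  let T : Seed S A H → Set (ℕ → Seed S A H) := fun u => toMeasurable M.law (consSeed u ⁻¹' E)
  have hT : MeasurableSet (⋃ u, {u} ×ˢ T u) :=
    MeasurableSet.iUnion fun u => (measurableSet_singleton u).prod (measurableSet_toMeasurable _ _)
  have hpre : (fun x : Seed S A H × (ℕ → Seed S A H) => consSeed x.1 x.2) ⁻¹' E ⊆
      ⋃ u, {u} ×ˢ T u := by
    rintro ⟨u, ω⟩ h
    exact Set.mem_iUnion.2 ⟨u, rfl, subset_toMeasurable _ _ h⟩
  have hsurj : E ⊆ (fun ω => (ω 0, shiftSeed 1 ω)) ⁻¹' (⋃ u, {u} ×ˢ T u) := by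
    intro ω h
    refine hpre (?_ : consSeed (ω 0) (shiftSeed 1 ω) ∈ E)
    convert h using 1
    funext n
    cases n with
    | zero => rfl
    | succ n => simp [consSeed, shiftSeed, Nat.add_comm]
  have hmeas : Measurable fun ω : ℕ → Seed S A H => (ω 0, shiftSeed 1 ω) :=
    (measurable_pi_apply 0).prodMk (measurable_pi_lambda _ fun n => measurable_pi_apply _)
  calc M.law E ≤ M.law ((fun ω => (ω 0, shiftSeed 1 ω)) ⁻¹' (⋃ u, {u} ×ˢ T u)) :=
        measure_mono hsurj
    _ = (M.seedLaw.prod M.law) (⋃ u, {u} ×ˢ T u) := by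
        conv_lhs => rw [← map_consSeed M]
        rw [Measure.map_apply measurable_consSeed (hmeas hT)]
        congr 1
        ext ⟨u, ω⟩
        have : shiftSeed 1 (consSeed u ω) = ω := by
          funext n; simp [shiftSeed, Nat.add_comm 1 n, consSeed]
        simp [this, consSeed]
    _ ≤ ∑ u, (M.seedLaw.prod M.law) ({u} ×ˢ T u) := measure_iUnion_fintype_le _ _
    _ = ∑ u : Seed S A H, M.seedLaw {u} * M.law (consSeed u ⁻¹' E) := by
        refine Finset.sum_congr rfl fun u _ => ?_
        rw [Measure.prod_prod, measure_toMeasurable]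

lemma sum_seedLaw (M : MDP S A H) : ∑ u : Seed S A H, M.seedLaw {u} = 1 := by
  rw [sum_measure_singleton, Finset.coe_univ, measure_univ]

lemma law_le_of_forall_cons (M : MDP S A H) {E : Set (ℕ → Seed S A H)} {d : ENNReal}
    (h : ∀ u, M.law (consSeed u ⁻¹' E) ≤ d) : M.law E ≤ d := by
  refine (law_le_sum M E).trans ?_
  calc ∑ u : Seed S A H, M.seedLaw {u} * M.law (consSeed u ⁻¹' E)
      ≤ ∑ u : Seed S A H, M.seedLaw {u} * d := by gcongr; exact h _
    _ = d := by rw [← Finset.sum_mul, sum_seedLaw, one_mul]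

/-- Two seed sequences that agree on the first `m` episodes. -/
def AgreeBelow (m : ℕ) (ω ω' : ℕ → Seed S A H) : Prop := ∀ t < m, ω t = ω' t

lemma AgreeBelow.cons {m : ℕ} {ω ω' : ℕ → Seed S A H} (h : AgreeBelow m ω ω') (u : Seed S A H) :
    AgreeBelow (m + 1) (consSeed u ω) (consSeed u ω') := by
  intro t ht
  cases t with
  | zero => rfl
  | succ t => exact h t (by omega)

lemma shiftSeed_succ_cons (m : ℕ) (u : Seed S A H) (ω : ℕ → Seed S A H) :
    shiftSeed (m + 1) (consSeed u ω) = shiftSeed m ω := by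
  funext t
  simp only [shiftSeed]
  rw [show m + 1 + t = (m + t) + 1 by omega]; rfl

/-- Induction on a bound for the random time. Locality at `m = 0` is vacuous agreement, so `E 0` is
empty or everything. In the second case the time is 0 by disjointness and the bound on `B 0`
applies; in the first case one conditions on the first episode and lowers all times by one. -/
lemma strong_markov_aux (M : MDP S A H) (d : ENNReal) (n : ℕ) :
    ∀ (E : ℕ → Set (ℕ → Seed S A H)) (B : ℕ → (ℕ → Seed S A H) → Set (ℕ → Seed S A H)),
    (∀ m ω ω', AgreeBelow m ω ω' → ω ∈ E m → ω' ∈ E m ∧ B m ω = B m ω') →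
    (∀ m m' ω, ω ∈ E m → ω ∈ E m' → m = m') →
    (∀ m ω, ω ∈ E m → M.law (B m ω) ≤ d) →
    M.law {ω | ∃ m ≤ n, ω ∈ E m ∧ shiftSeed m ω ∈ B m ω} ≤ d := by
  have hz : ∀ ω : ℕ → Seed S A H, shiftSeed 0 ω = ω := fun ω => by
    funext t; simp [shiftSeed]
  induction n with
  | zero =>
    intro E B hloc _ hB
    by_cases hE : ∃ ω₀, ω₀ ∈ E 0
    · obtain ⟨ω₀, h0⟩ := hE
      refine (measure_mono ?_).trans (hB 0 ω₀ h0)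
      rintro ω ⟨m, hm, h1, h2⟩
      obtain rfl : m = 0 := by omega
      rw [(hloc 0 ω₀ ω (fun t ht => by omega) h0).2]
      rwa [hz] at h2
    · refine (measure_mono (t := ∅) ?_).trans (by simp)
      rintro ω ⟨m, hm, h1, h2⟩
      obtain rfl : m = 0 := by omega
      exact hE ⟨ω, h1⟩
  | succ n ih =>
    intro E B hloc hdisj hB
    by_cases hE : ∃ ω₀, ω₀ ∈ E 0
    · obtain ⟨ω₀, h0⟩ := hE
      refine (measure_mono ?_).trans (hB 0 ω₀ h0)
      rintro ω ⟨m, hm, h1, h2⟩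
      have h3 := hloc 0 ω₀ ω (fun t ht => by omega) h0
      obtain rfl : m = 0 := hdisj m 0 ω h1 h3.1
      rw [h3.2]
      rwa [hz] at h2
    · refine law_le_of_forall_cons M fun u => ?_
      refine (measure_mono ?_).trans (ih (fun m => consSeed u ⁻¹' E (m + 1))
        (fun m ω => B (m + 1) (consSeed u ω)) ?_ ?_ ?_)
      · rintro ω ⟨m, hm, h1, h2⟩
        cases m with
        | zero => exact absurd ⟨_, h1⟩ hE
        | succ m =>
          refine ⟨m, by omega, h1, ?_⟩
          rwa [shiftSeed_succ_cons] at h2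
      · intro m ω ω' hag h
        exact hloc (m + 1) _ _ (hag.cons u) h
      · intro m m' ω h h'
        have := hdisj _ _ _ h h'
        omega
      · intro m ω h
        exact hB _ _ h

/-- The strong Markov property, as a bound on the probability that an event of probability at most
`d` happens after a random time. -/
lemma strong_markov (M : MDP S A H) (d : ENNReal) (E : ℕ → Set (ℕ → Seed S A H))
    (B : ℕ → (ℕ → Seed S A H) → Set (ℕ → Seed S A H))
    (hloc : ∀ m ω ω', AgreeBelow m ω ω' → ω ∈ E m → ω' ∈ E m ∧ B m ω = B m ω')
    (hdisj : ∀ m m' ω, ω ∈ E m → ω ∈ E m' → m = m')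
    (hB : ∀ m ω, ω ∈ E m → M.law (B m ω) ≤ d) :
    M.law {ω | ∃ m, ω ∈ E m ∧ shiftSeed m ω ∈ B m ω} ≤ d := by
  have hU : {ω | ∃ m, ω ∈ E m ∧ shiftSeed m ω ∈ B m ω} =
      ⋃ n, {ω | ∃ m ≤ n, ω ∈ E m ∧ shiftSeed m ω ∈ B m ω} := by
    ext ω
    simp only [Set.mem_ofPred_eq, Set.mem_iUnion]
    exact ⟨fun ⟨m, h⟩ => ⟨m, m, le_rfl, h⟩, fun ⟨_, m, _, h⟩ => ⟨m, h⟩⟩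
  rw [hU, Monotone.measure_iUnion]
  · exact iSup_le fun n => strong_markov_aux M d n E B hloc hdisj hB
  · rintro n n' hn ω ⟨m, hm, h⟩
    exact ⟨m, hm.trans hn, h⟩

/-- The part of the interaction from a fixed episode on, for events chosen by the past. -/
lemma law_shift_le (M : MDP S A H) (d : ENNReal) (m : ℕ)
    (B : (ℕ → Seed S A H) → Set (ℕ → Seed S A H))
    (hloc : ∀ ω ω', AgreeBelow m ω ω' → B ω = B ω') (hB : ∀ ω, M.law (B ω) ≤ d) :
    M.law {ω | shiftSeed m ω ∈ B ω} ≤ d := by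
  refine (measure_mono ?_).trans (strong_markov M d (fun n => {_ω | n = m}) (fun _ => B) ?_ ?_ ?_)
  · intro ω h
    exact ⟨m, rfl, h⟩
  · rintro n ω ω' hag rfl
    exact ⟨rfl, hloc _ _ hag⟩
  · rintro n n' ω rfl rfl
    rfl
  · intro n ω _
    exact hB ω

/-! ### Adaptive learners -/

/-- Conditioning on the first episode turns a run started from `D` into a run started from `D`
extended by that episode; this is the induction step of `ville_aux`. -/
lemma runData_cons (M : MDP S A H) (alg : List (Episode S A H) → DetPolicy S A H)
    (D : List (Episode S A H)) (u : Seed S A H) (ω : ℕ → Seed S A H) (t : ℕ) :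
    D ++ runData (fun D' => alg (D ++ D')) (M.env (consSeed u ω)) (t + 1) =
      (D ++ [rollout M.init (alg D) u]) ++
        runData (fun D' => alg ((D ++ [rollout M.init (alg D) u]) ++ D')) (M.env ω) t := by
  induction t with
  | zero => simp [runData, MDP.env, consSeed]
  | succ t ih =>
    rw [runData, ← List.append_assoc, ih, runData, ← List.append_assoc]
    rfl

/-- The finite-horizon inequality is proved for every starting dataset `D` at once. If `Z D` is
already above the level the bound exceeds 1; otherwise one episode is played and `hstep` averages
the bounds of the continuations. -/
lemma ville_aux (M : MDP S A H) (Z : List (Episode S A H) → ℝ) (hZ : ∀ D, 0 ≤ Z D) {a : ℝ}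
    (ha : 0 < a) (alg : List (Episode S A H) → DetPolicy S A H)
    (hstep : ∀ D, ∫ u, Z (D ++ [rollout M.init (alg D) u]) ∂M.seedLaw ≤ Z D) (n : ℕ) :
    ∀ D, M.law {ω | ∃ t ≤ n, a ≤ Z (D ++ runData (fun D' => alg (D ++ D')) (M.env ω) t)} ≤
      ENNReal.ofReal (Z D / a) := by
  have htriv : ∀ (D) (E : Set (ℕ → Seed S A H)), a ≤ Z D → M.law E ≤ ENNReal.ofReal (Z D / a) := by
    intro D E h
    refine prob_le_one.trans ?_
    rw [← ENNReal.ofReal_one]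
    exact ENNReal.ofReal_le_ofReal ((one_le_div ha).2 h)
  induction n with
  | zero =>
    intro D
    by_cases h : a ≤ Z D
    · exact htriv D _ h
    · refine (measure_mono (t := ∅) ?_).trans (by simp)
      rintro ω ⟨t, ht, h1⟩
      obtain rfl : t = 0 := by omega
      simp only [runData, List.append_nil] at h1
      exact h h1
  | succ n ih =>
    intro D
    by_cases h : a ≤ Z D
    · exact htriv D _ h
    refine (law_le_sum M _).trans ?_
    have h1 : ∀ u : Seed S A H, M.law (consSeed u ⁻¹' {ω | ∃ t ≤ n + 1,
        a ≤ Z (D ++ runData (fun D' => alg (D ++ D')) (M.env ω) t)}) ≤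
        ENNReal.ofReal (Z (D ++ [rollout M.init (alg D) u]) / a) := by
      intro u
      refine (measure_mono ?_).trans (ih (D ++ [rollout M.init (alg D) u]))
      rintro ω ⟨t, ht, h2⟩
      cases t with
      | zero =>
        simp only [runData, List.append_nil] at h2
        exact absurd h2 h
      | succ t =>
        rw [runData_cons] at h2
        exact ⟨t, by omega, h2⟩
    calc ∑ u : Seed S A H, M.seedLaw {u} * M.law (consSeed u ⁻¹' {ω | ∃ t ≤ n + 1,
          a ≤ Z (D ++ runData (fun D' => alg (D ++ D')) (M.env ω) t)})
        ≤ ∑ u : Seed S A H, M.seedLaw {u} *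
            ENNReal.ofReal (Z (D ++ [rollout M.init (alg D) u]) / a) := by
          gcongr with u; exact h1 u
      _ = ENNReal.ofReal (∑ u : Seed S A H, M.seedLaw.real {u} *
            (Z (D ++ [rollout M.init (alg D) u]) / a)) := by
          rw [ENNReal.ofReal_sum_of_nonneg
            (fun u _ => mul_nonneg measureReal_nonneg (div_nonneg (hZ _) ha.le))]
          refine Finset.sum_congr rfl fun u _ => ?_
          rw [ENNReal.ofReal_mul measureReal_nonneg, ofReal_measureReal]
      _ ≤ ENNReal.ofReal (Z D / a) := by
          apply ENNReal.ofReal_le_ofReal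
          have h2 := hstep D
          rw [integral_fintype (Integrable.of_finite)] at h2
          simp only [smul_eq_mul] at h2
          calc _ = (∑ u : Seed S A H, M.seedLaw.real {u} *
                Z (D ++ [rollout M.init (alg D) u])) / a := by
                rw [Finset.sum_div]; exact Finset.sum_congr rfl fun u _ => by ring
            _ ≤ Z D / a := by gcongr

/-- Ville's maximal inequality for nonnegative supermartingales of the data of a learner. -/
theorem ville (M : MDP S A H) (Z : List (Episode S A H) → ℝ) (hZ : ∀ D, 0 ≤ Z D)
    (alg : List (Episode S A H) → DetPolicy S A H)
    (hstep : ∀ D, ∫ u, Z (D ++ [rollout M.init (alg D) u]) ∂M.seedLaw ≤ Z D) (h0 : Z [] ≤ 1)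
    {δ : ℝ} (hδ : 0 < δ) :
    M.law {ω | ∃ t, 1 / δ ≤ Z (runData alg (M.env ω) t)} ≤ ENNReal.ofReal δ := by
  have hU : {ω | ∃ t, 1 / δ ≤ Z (runData alg (M.env ω) t)} =
      ⋃ n, {ω | ∃ t ≤ n, 1 / δ ≤ Z ([] ++ runData (fun D' => alg ([] ++ D')) (M.env ω) t)} := by
    ext ω
    simp only [Set.mem_ofPred_eq, Set.mem_iUnion, List.nil_append]
    exact ⟨fun ⟨m, h⟩ => ⟨m, m, le_rfl, h⟩, fun ⟨_, m, _, h⟩ => ⟨m, h⟩⟩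
  rw [hU, Monotone.measure_iUnion]
  · refine iSup_le fun n => (ville_aux M Z hZ (one_div_pos.2 hδ) alg hstep n []).trans ?_
    apply ENNReal.ofReal_le_ofReal
    rw [div_div_eq_mul_div, div_one]
    nlinarith
  · rintro n n' hn ω ⟨m, hm, h⟩
    exact ⟨m, hm.trans hn, h⟩

end

section

open scoped Classical


variable {S A : Type*} {H : ℕ}

/-! ### Deterministic policies and single episodes -/

/-- A deterministic policy as a stochastic policy. -/
def DetPolicy.toPolicy [Fintype A] (π : DetPolicy S A H) : Policy S A H :=
  fun h s => ⟨fun a => if a = π h s then 1 else 0, by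
    refine ⟨fun a => by positivity, by simp⟩⟩

@[simp] lemma DetPolicy.toPolicy_apply [Fintype A] (π : DetPolicy S A H) (h : Fin H) (s : S)
    (a : A) : (π.toPolicy h s).1 a = if a = π h s then 1 else 0 := rfl

lemma rolloutState_succ (s₁ : S) (π : DetPolicy S A H) (u : Seed S A H) (h : Fin H) :
    rolloutState s₁ π u (h + 1) = u (h, rolloutState s₁ π u h, π h (rolloutState s₁ π u h)) := by
  rw [rolloutState, dif_pos h.2]

/-- The seed coordinate `j` is read only in the move from stage `j.1` to the next one. -/
lemma rolloutState_update (s₁ : S) (π : DetPolicy S A H) (u : Seed S A H) (j : Fin H × S × A)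
    (x : S) (h : ℕ) (hj : h ≤ j.1) :
    rolloutState s₁ π (Function.update u j x) h = rolloutState s₁ π u h := by
  induction h with
  | zero => rfl
  | succ h ih =>
    have hh : h < H := by omega
    rw [rolloutState, rolloutState, dif_pos hh, dif_pos hh, ih (by omega), Function.update_of_ne]
    intro h'
    have := congrArg (fun y : Fin H × S × A => (y.1 : ℕ)) h'
    simp only at this
    omega

variable [Fintype S] [Fintype A]

lemma MDP.model_nonneg (M : MDP S A H) (h : Fin H) (s : S) (a : A) (x : S) :
    0 ≤ M.model h s a x := ENNReal.toReal_nonneg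

lemma MDP.sum_model (M : MDP S A H) (h : Fin H) (s : S) (a : A) :
    ∑ x, M.model h s a x = 1 := by
  unfold MDP.model
  rw [← ENNReal.toReal_sum (fun x _ => PMF.apply_ne_top _ _), ← tsum_fintype (L := .unconditional _),
    PMF.tsum_coe, ENNReal.toReal_one]

variable [MeasurableSpace S] [DiscreteMeasurableSpace S]

/-- Independence in the form used below: a coordinate of a product law may be redrawn from its own
marginal. -/
lemma map_update_seedLaw (M : MDP S A H) (j : Fin H × S × A) :
    (M.seedLaw.prod (M.trans j.1 j.2.1 j.2.2).toMeasure).map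
      (fun y => Function.update y.1 j y.2) = M.seedLaw := by
  symm
  refine Measure.pi_eq fun t ht => ?_
  have hm : Measurable fun y : Seed S A H × S => Function.update y.1 j y.2 := by
    exact measurable_of_finite _
  rw [Measure.map_apply hm (MeasurableSet.univ_pi ht)]
  have : (fun y : Seed S A H × S => Function.update y.1 j y.2) ⁻¹' Set.pi Set.univ t =
      (Set.pi Set.univ (Function.update t j Set.univ)) ×ˢ t j := by
    ext ⟨u, x⟩
    simp only [Set.mem_preimage, Set.mem_pi, Set.mem_univ, true_implies, Set.mem_prod]
    constructor
    · intro h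
      refine ⟨fun i => ?_, by simpa using h j⟩
      by_cases hi : i = j
      · subst hi; simp
      · simpa [hi] using h i
    · rintro ⟨h1, h2⟩ i
      by_cases hi : i = j
      · subst hi; simpa using h2
      · simpa [hi] using h1 i
  rw [this, Measure.prod_prod, MDP.seedLaw, Measure.pi_pi,
    ← Finset.mul_prod_erase Finset.univ _ (Finset.mem_univ j),
    ← Finset.mul_prod_erase Finset.univ (fun i => (M.trans i.1 i.2.1 i.2.2).toMeasure (t i))
      (Finset.mem_univ j)]
  simp only [Function.update_self, measure_univ, one_mul]
  rw [mul_comm]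
  congr 1
  refine Finset.prod_congr rfl fun i hi => ?_
  rw [Function.update_of_ne (Finset.ne_of_mem_erase hi)]

/-- Resampling of one coordinate. -/
lemma integral_resample (M : MDP S A H) (j : Fin H × S × A) (f : Seed S A H → ℝ) :
    ∫ u, f u ∂M.seedLaw =
      ∫ u, ∑ x, M.model j.1 j.2.1 j.2.2 x * f (Function.update u j x) ∂M.seedLaw := by
  conv_lhs => rw [← map_update_seedLaw M j]
  rw [integral_map (measurable_of_finite _).aemeasurable
    (measurable_of_finite f).aestronglyMeasurable, integral_prod _ Integrable.of_finite]
  refine integral_congr_ae (Filter.Eventually.of_forall fun u => ?_)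
  simp only
  rw [PMF.integral_eq_sum]
  simp [MDP.model]

/-- The transition at stage `k` is independent of what does not depend on the randomness of this
stage. -/
lemma integral_step (M : MDP S A H) (π : DetPolicy S A H) (k : Fin H) (g : Seed S A H → ℝ)
    (hg : ∀ u s a x, g (Function.update u (k, s, a) x) = g u) (f : S → A → S → ℝ) :
    ∫ u, g u * f (rolloutState M.init π u k) (π k (rolloutState M.init π u k))
        (rolloutState M.init π u (k + 1)) ∂M.seedLaw =
      ∫ u, g u * ∑ x, M.model k (rolloutState M.init π u k) (π k (rolloutState M.init π u k)) x *
        f (rolloutState M.init π u k) (π k (rolloutState M.init π u k)) x ∂M.seedLaw := by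
  -- Which coordinate has to be redrawn depends on the random state at stage `k`. Splitting over the
  -- value `s` of this state makes the coordinate `(k, s, π k s)` deterministic on each piece.
  have split : ∀ F : S → Seed S A H → ℝ,
      ∫ u, F (rolloutState M.init π u k) u ∂M.seedLaw =
        ∑ s, ∫ u, (if rolloutState M.init π u k = s then F s u else 0) ∂M.seedLaw := by
    intro F
    rw [← integral_finsetSum _ fun _ _ => Integrable.of_finite]
    refine integral_congr_ae (Filter.Eventually.of_forall fun u => ?_)
    simp
  simp only [rolloutState_succ]
  rw [split fun s u => g u * f s (π k s) (u (k, s, π k s)),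
    split fun s u => g u * ∑ x, M.model k s (π k s) x * f s (π k s) x]
  refine Finset.sum_congr rfl fun s _ => ?_
  rw [integral_resample M (k, s, π k s)]
  refine integral_congr_ae (Filter.Eventually.of_forall fun u => ?_)
  simp only [rolloutState_update M.init π u (k, s, π k s) _ k le_rfl, hg, Function.update_self]
  split_ifs
  · rw [Finset.mul_sum]
    exact Finset.sum_congr rfl fun x _ => by ring
  · simp

/-- This identifies the simulation by seeds with the occupancy recursion of the MDP; all
expectations of returns rest on it. -/
lemma integral_state (M : MDP S A H) (π : DetPolicy S A H) (h : ℕ) (hh : h ≤ H) (s : S) :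
    ∫ u, (if rolloutState M.init π u h = s then (1 : ℝ) else 0) ∂M.seedLaw =
      stateOcc M.model M.init π.toPolicy h s := by
  induction h generalizing s with
  | zero =>
    simp only [rolloutState, stateOcc, eq_comm]
    simp
  | succ k ih =>
    have hk : k < H := by omega
    have h1 := integral_step M π ⟨k, hk⟩ (fun _ => 1) (fun _ _ _ _ => rfl)
      (fun _ _ y => if y = s then (1 : ℝ) else 0)
    simp only [one_mul, mul_ite, mul_one, mul_zero, Finset.sum_ite_eq', Finset.mem_univ,
      if_true] at h1
    rw [h1, stateOcc, dif_pos hk]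
    have h2 : ∀ u, M.model ⟨k, hk⟩ (rolloutState M.init π u k)
        (π ⟨k, hk⟩ (rolloutState M.init π u k)) s =
        ∑ x, (if rolloutState M.init π u k = x then (1 : ℝ) else 0) *
          M.model ⟨k, hk⟩ x (π ⟨k, hk⟩ x) s := by
      intro u; simp
    simp only [h2]
    rw [integral_finsetSum _ fun _ _ => Integrable.of_finite]
    refine Finset.sum_congr rfl fun x _ => ?_
    rw [integral_mul_const, ih (by omega)]
    simp [DetPolicy.toPolicy_apply]

/-- The return of an episode. -/
def trajReturn (r : Table S A H) (e : Episode S A H) : ℝ :=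
  ∑ h, r h (e.state h.castSucc) (e.action h)

lemma value_toPolicy (P : Model S A H) (s₁ : S) (π : DetPolicy S A H) (r : Table S A H) :
    value P s₁ π.toPolicy r = ∑ h : Fin H, ∑ s, stateOcc P s₁ π.toPolicy h s * r h s (π h s) := by
  unfold value occ
  refine Finset.sum_congr rfl fun h _ => Finset.sum_congr rfl fun s _ => ?_
  simp

lemma integral_trajReturn (M : MDP S A H) (π : DetPolicy S A H) (r : Table S A H) :
    ∫ u, trajReturn r (rollout M.init π u) ∂M.seedLaw = value M.model M.init π.toPolicy r := by
  change ∫ u, ∑ h : Fin H, r h (rolloutState M.init π u h) (π h (rolloutState M.init π u h)) ∂M.seedLaw = _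
  rw [value_toPolicy, integral_finsetSum _ fun _ _ => Integrable.of_finite]
  refine Finset.sum_congr rfl fun h _ => ?_
  have h2 : ∀ u, r h (rolloutState M.init π u h) (π h (rolloutState M.init π u h)) =
      ∑ x, (if rolloutState M.init π u h = x then (1 : ℝ) else 0) * r h x (π h x) := by
    intro u; simp
  simp only [h2]
  rw [integral_finsetSum _ fun _ _ => Integrable.of_finite]
  refine Finset.sum_congr rfl fun x _ => ?_
  rw [integral_mul_const, integral_state M π h h.2.le]

/-- Product of stage-wise factors over the stages of an episode. -/
def trajProd (F : Fin H → S → A → S → ℝ) (e : Episode S A H) : ℝ :=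
  ∏ h, F h (e.state h.castSucc) (e.action h) (e.state h.succ)

/-- The factor of the last stage has conditional mean at most 1 given the earlier stages, so the
stages are peeled off one by one. Both mixture martingales, for the Hellinger bound and for the
model error, are multiplied by such a product in each episode. -/
lemma integral_trajProd_le (M : MDP S A H) (π : DetPolicy S A H) (F : Fin H → S → A → S → ℝ)
    (hF : ∀ h s a x, 0 ≤ F h s a x) (hF1 : ∀ h s a, ∑ x, M.model h s a x * F h s a x ≤ 1) :
    ∫ u, trajProd F (rollout M.init π u) ∂M.seedLaw ≤ 1 := by
  have main : ∀ k ≤ H, ∫ u, ∏ h : Fin H with h.val < k, F h (rolloutState M.init π u h)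
      (π h (rolloutState M.init π u h)) (rolloutState M.init π u (h + 1)) ∂M.seedLaw ≤ 1 := by
    intro k
    induction k with
    | zero => simp
    | succ k ih =>
      intro hk
      have hk' : k < H := by omega
      have hset : (Finset.univ.filter fun h : Fin H => h.val < k + 1) =
          insert ⟨k, hk'⟩ (Finset.univ.filter fun h : Fin H => h.val < k) := by
        ext h
        simp only [Finset.mem_filter, Finset.mem_univ, true_and, Finset.mem_insert, Fin.ext_iff]
        omega
      have hnot : (⟨k, hk'⟩ : Fin H) ∉ Finset.univ.filter fun h : Fin H => h.val < k := by simp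
      simp only [hset, Finset.prod_insert hnot]
      have h1 := integral_step M π ⟨k, hk'⟩ (fun u => ∏ h : Fin H with h.val < k,
        F h (rolloutState M.init π u h)
        (π h (rolloutState M.init π u h)) (rolloutState M.init π u (h + 1))) ?_ (F ⟨k, hk'⟩)
      · simp only [mul_comm (F ⟨k, hk'⟩ _ _ _)]
        refine (h1.le.trans ?_).trans (ih (by omega))
        refine integral_mono Integrable.of_finite Integrable.of_finite fun u => ?_
        refine mul_le_of_le_one_right (Finset.prod_nonneg fun _ _ => hF _ _ _ _) (hF1 _ _ _)
      · intro u s a x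
        refine Finset.prod_congr rfl fun h hh => ?_
        have hh' : h.val < k := by simpa using hh
        rw [rolloutState_update _ _ _ _ _ _ (show h.val ≤ k by omega),
          rolloutState_update _ _ _ _ _ _ (show h.val + 1 ≤ k by omega)]
  have := main H le_rfl
  simpa [trajProd, rollout] using this

/-- Almost surely, no transition of probability zero occurs. -/
lemma law_zero_transition (M : MDP S A H) :
    M.law {ω | ∃ t, ∃ j : Fin H × S × A, M.model j.1 j.2.1 j.2.2 (ω t j) = 0} = 0 := by
  have : {ω : ℕ → Seed S A H | ∃ t, ∃ j : Fin H × S × A, M.model j.1 j.2.1 j.2.2 (ω t j) = 0} =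
      ⋃ t, ⋃ j : Fin H × S × A, {ω | M.model j.1 j.2.1 j.2.2 (ω t j) = 0} := by
    ext ω; simp
  rw [this]
  refine measure_iUnion_null fun t => measure_iUnion_null fun j => ?_
  have h1 : MeasurePreserving (fun ω : ℕ → Seed S A H => ω t) M.law M.seedLaw :=
    measurePreserving_eval_infinitePi _ t
  have h2 : MeasurePreserving (fun u : Seed S A H => u j) M.seedLaw
      (M.trans j.1 j.2.1 j.2.2).toMeasure :=
    measurePreserving_eval (fun x : Fin H × S × A => (M.trans x.1 x.2.1 x.2.2).toMeasure) j
  have h3 := (h2.comp h1).measure_preimage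
    (s := {x | M.model j.1 j.2.1 j.2.2 x = 0}) (MeasurableSet.of_discrete).nullMeasurableSet
  refine h3.trans ?_
  rw [PMF.toMeasure_apply_eq_zero_iff _ MeasurableSet.of_discrete, Set.disjoint_left]
  intro x hx hx'
  rw [PMF.mem_support_iff] at hx
  have : ((M.trans j.1 j.2.1 j.2.2) x).toReal = 0 := hx'
  rw [ENNReal.toReal_eq_zero_iff] at this
  exact this.elim hx (PMF.apply_ne_top _ _)

end

section

open scoped Classical


variable {S A : Type*} {H : ℕ}

/-! ### Sums along a dataset -/

/-- The sum of `f D e` over the episodes `e` of a dataset, where `D` holds the earlier episodes. -/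
def pathSum (f : List (Episode S A H) → Episode S A H → ℝ) (D : List (Episode S A H)) : ℝ :=
  ∑ i ∈ Finset.range D.length, (D[i]?).elim 0 (f (D.take i))

@[simp] lemma pathSum_nil (f : List (Episode S A H) → Episode S A H → ℝ) : pathSum f [] = 0 := rfl

lemma pathSum_append (f : List (Episode S A H) → Episode S A H → ℝ) (D : List (Episode S A H))
    (e : Episode S A H) : pathSum f (D ++ [e]) = pathSum f D + f D e := by
  unfold pathSum
  rw [List.length_append, List.length_singleton, Finset.sum_range_succ]
  congr 1
  · refine Finset.sum_congr rfl fun i hi => ?_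
    have hi' := Finset.mem_range.1 hi
    rw [List.getElem?_append_left hi', List.take_append_of_le_length hi'.le]
  · simp

lemma pathSum_runData (f : List (Episode S A H) → Episode S A H → ℝ)
    (alg : List (Episode S A H) → DetPolicy S A H) (env : Env S A H) (T : ℕ) :
    pathSum f (runData alg env T) =
      ∑ t ∈ Finset.range T, f (runData alg env t) (env t (alg (runData alg env t))) := by
  induction T with
  | zero => simp [runData]
  | succ T ih => rw [runData, pathSum_append, ih, Finset.sum_range_succ]

/-- By convexity the chord over [0,1] lies above the exponential, and 1/e ≤ 3/8. The slope 5/8 is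
the source of the factors 8/5 below. -/
lemma exp_neg_le_of_mem_Icc {y : ℝ} (h0 : 0 ≤ y) (h1 : y ≤ 1) : Real.exp (-y) ≤ 1 - 5 / 8 * y := by
  have h := convexOn_exp.2 (Set.mem_univ (-1)) (Set.mem_univ 0) h0 (sub_nonneg.2 h1) (by ring)
  simp only [smul_eq_mul, mul_zero, add_zero, Real.exp_zero, mul_one, mul_neg] at h
  have h2 : Real.exp (-1) ≤ 3 / 8 := by
    rw [Real.exp_neg, inv_le_comm₀ (Real.exp_pos 1) (by norm_num)]
    have := Real.exp_one_gt_d9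
    norm_num; linarith
  nlinarith

/-- The chord again, with e - 1 ≤ 7/4. -/
lemma exp_le_of_mem_Icc {y : ℝ} (h0 : 0 ≤ y) (h1 : y ≤ 1) : Real.exp y ≤ 1 + 7 / 4 * y := by
  have h := convexOn_exp.2 (Set.mem_univ 1) (Set.mem_univ 0) h0 (sub_nonneg.2 h1) (by ring)
  simp only [smul_eq_mul, mul_zero, add_zero, Real.exp_zero, mul_one] at h
  have := Real.exp_one_lt_d9
  nlinarith

/-! ### Visit counts and empirical frequencies. -/

section Counts

lemma count_append (D : List (Episode S A H)) (e : Episode S A H) (h : Fin H) (s : S) (a : A) :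
    count (D ++ [e]) h s a =
      count D h s a + if e.state h.castSucc = s ∧ e.action h = a then 1 else 0 := by
  unfold count
  rw [List.countP_append, List.countP_singleton]
  simp

lemma countNext_append (D : List (Episode S A H)) (e : Episode S A H) (h : Fin H) (s : S) (a : A)
    (x : S) : countNext (D ++ [e]) h s a x = countNext D h s a x +
      if e.state h.castSucc = s ∧ e.action h = a ∧ e.state h.succ = x then 1 else 0 := by
  unfold countNext
  rw [List.countP_append, List.countP_singleton]
  simp

lemma visits_append (D : List (Episode S A H)) (e : Episode S A H) (h : Fin H) (s : S) :
    visits (D ++ [e]) h s = visits D h s + if e.state h.castSucc = s then 1 else 0 := by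
  unfold visits
  rw [List.countP_append, List.countP_singleton]
  simp

@[simp] lemma count_nil (h : Fin H) (s : S) (a : A) :
    count ([] : List (Episode S A H)) h s a = 0 := rfl

@[simp] lemma countNext_nil (h : Fin H) (s : S) (a : A) (x : S) :
    countNext ([] : List (Episode S A H)) h s a x = 0 := rfl

lemma count_append_list (D D' : List (Episode S A H)) (h : Fin H) (s : S) (a : A) :
    count (D ++ D') h s a = count D h s a + count D' h s a := by
  unfold count; exact List.countP_append

lemma count_le_length (D : List (Episode S A H)) (h : Fin H) (s : S) (a : A) :
    count D h s a ≤ D.length := List.countP_le_length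

variable [Fintype S]

lemma sum_countNext (D : List (Episode S A H)) (h : Fin H) (s : S) (a : A) :
    ∑ x, countNext D h s a x = count D h s a := by
  induction D using List.reverseRecOn with
  | nil => simp
  | append_singleton D e ih =>
    simp only [countNext_append, count_append, Finset.sum_add_distrib, ih]
    congr 1
    by_cases hc : e.state h.castSucc = s ∧ e.action h = a
    · simp [hc]
    · rw [if_neg hc]
      refine Finset.sum_eq_zero fun x _ => if_neg fun h' => hc ⟨h'.1, h'.2.1⟩

lemma empirical_nonneg (D : List (Episode S A H)) (h : Fin H) (s : S) (a : A) (x : S) :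
    0 ≤ empirical D h s a x := by
  unfold empirical; split_ifs <;> positivity

lemma sum_empirical [Nonempty S] (D : List (Episode S A H)) (h : Fin H) (s : S) (a : A) :
    ∑ x, empirical D h s a x = 1 := by
  unfold empirical
  split_ifs with hc
  · simp [Finset.sum_const, Finset.card_univ]
  · rw [← Finset.sum_div, ← Nat.cast_sum, sum_countNext, div_self (by exact_mod_cast hc)]

end Counts

variable [Fintype S] [Fintype A] [MeasurableSpace S] [DiscreteMeasurableSpace S]

/-! ### Returns and values -/

/-- For a return X in [0,1] with mean v, E exp(-X) ≤ 1 - 5v/8 ≤ exp(-5v/8), so exp(∑ (5v/8 - X)) is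
a supermartingale. Losing a constant factor instead of adding a √T deviation is what keeps all later
bounds of first order. -/
lemma sum_value_le_sum_return (M : MDP S A H) (alg : List (Episode S A H) → DetPolicy S A H)
    (tab : List (Episode S A H) → Table S A H)
    (h0 : ∀ D e, 0 ≤ trajReturn (tab D) e) (h1 : ∀ D e, trajReturn (tab D) e ≤ 1)
    {δ : ℝ} (hδ : 0 < δ) :
    M.law {ω | ∃ T, 8 / 5 * (∑ t ∈ Finset.range T, trajReturn (tab (runData alg (M.env ω) t))
          (M.env ω t (alg (runData alg (M.env ω) t))) + Real.log (1 / δ)) ≤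
        ∑ t ∈ Finset.range T, value M.model M.init (alg (runData alg (M.env ω) t)).toPolicy
          (tab (runData alg (M.env ω) t))} ≤ ENNReal.ofReal δ := by
  let f : List (Episode S A H) → Episode S A H → ℝ := fun D e =>
    5 / 8 * value M.model M.init (alg D).toPolicy (tab D) - trajReturn (tab D) e
  refine (measure_mono ?_).trans (ville M (fun D => Real.exp (pathSum f D))
    (fun D => (Real.exp_pos _).le) alg ?_ (by simp) hδ)
  · rintro ω ⟨T, hT⟩
    refine ⟨T, ?_⟩
    rw [← Real.log_le_iff_le_exp (one_div_pos.2 hδ), pathSum_runData]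
    simp only [f, Finset.sum_sub_distrib, ← Finset.mul_sum]
    linarith
  · intro D
    simp only [pathSum_append, Real.exp_add]
    rw [integral_const_mul]
    refine mul_le_of_le_one_right (Real.exp_pos _).le ?_
    set v := value M.model M.init (alg D).toPolicy (tab D) with hv
    calc ∫ u, Real.exp (f D (rollout M.init (alg D) u)) ∂M.seedLaw
        ≤ ∫ u, Real.exp (5 / 8 * v) *
            (1 - 5 / 8 * trajReturn (tab D) (rollout M.init (alg D) u)) ∂M.seedLaw := by
          refine integral_mono Integrable.of_finite Integrable.of_finite fun u => ?_
          simp only [f, sub_eq_add_neg, Real.exp_add]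
          gcongr
          exact exp_neg_le_of_mem_Icc (h0 _ _) (h1 _ _)
      _ = Real.exp (5 / 8 * v) * (1 - 5 / 8 * v) := by
          rw [integral_const_mul, integral_sub Integrable.of_finite Integrable.of_finite,
            integral_const_mul, integral_trajReturn]
          simp [hv]
      _ ≤ Real.exp (5 / 8 * v) * Real.exp (-(5 / 8 * v)) := by
          gcongr
          linarith [Real.add_one_le_exp (-(5 / 8 * v))]
      _ = 1 := by rw [← Real.exp_add]; simp

/-- The mirror image: E exp(X) ≤ 1 + 7v/4 ≤ exp(7v/4). -/
lemma sum_return_le_sum_value (M : MDP S A H) (alg : List (Episode S A H) → DetPolicy S A H)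
    (tab : List (Episode S A H) → Table S A H)
    (h0 : ∀ D e, 0 ≤ trajReturn (tab D) e) (h1 : ∀ D e, trajReturn (tab D) e ≤ 1)
    {δ : ℝ} (hδ : 0 < δ) :
    M.law {ω | ∃ T, 7 / 4 * (∑ t ∈ Finset.range T,
          value M.model M.init (alg (runData alg (M.env ω) t)).toPolicy
          (tab (runData alg (M.env ω) t))) + Real.log (1 / δ) ≤
        ∑ t ∈ Finset.range T, trajReturn (tab (runData alg (M.env ω) t))
          (M.env ω t (alg (runData alg (M.env ω) t)))} ≤ ENNReal.ofReal δ := by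
  let f : List (Episode S A H) → Episode S A H → ℝ := fun D e =>
    trajReturn (tab D) e - 7 / 4 * value M.model M.init (alg D).toPolicy (tab D)
  refine (measure_mono ?_).trans (ville M (fun D => Real.exp (pathSum f D))
    (fun D => (Real.exp_pos _).le) alg ?_ (by simp) hδ)
  · rintro ω ⟨T, hT⟩
    refine ⟨T, ?_⟩
    rw [← Real.log_le_iff_le_exp (one_div_pos.2 hδ), pathSum_runData]
    simp only [f, Finset.sum_sub_distrib, ← Finset.mul_sum]
    linarith
  · intro D
    simp only [pathSum_append, Real.exp_add]
    rw [integral_const_mul]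
    refine mul_le_of_le_one_right (Real.exp_pos _).le ?_
    set v := value M.model M.init (alg D).toPolicy (tab D) with hv
    calc ∫ u, Real.exp (f D (rollout M.init (alg D) u)) ∂M.seedLaw
        ≤ ∫ u, (1 + 7 / 4 * trajReturn (tab D) (rollout M.init (alg D) u)) *
            Real.exp (-(7 / 4 * v)) ∂M.seedLaw := by
          refine integral_mono Integrable.of_finite Integrable.of_finite fun u => ?_
          simp only [f, sub_eq_add_neg, Real.exp_add]
          gcongr
          exact exp_le_of_mem_Icc (h0 _ _) (h1 _ _)
      _ = (1 + 7 / 4 * v) * Real.exp (-(7 / 4 * v)) := by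
          rw [integral_mul_const, integral_add Integrable.of_finite Integrable.of_finite,
            integral_const_mul, integral_trajReturn]
          simp [hv]
      _ ≤ Real.exp (7 / 4 * v) * Real.exp (-(7 / 4 * v)) := by
          gcongr
          linarith [Real.add_one_le_exp (7 / 4 * v)]
      _ = 1 := by rw [← Real.exp_add]; simp

/-! ### Concentration of the empirical transition probabilities -/

/-- The squared Hellinger distance (without normalization). -/
def hell (p q : S → ℝ) : ℝ := ∑ x, (Real.sqrt (p x) - Real.sqrt (q x)) ^ 2

/-- The likelihood of the Laplace estimator relative to `p`, for the counts `N`. -/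
def laplaceRatio (p : S → ℝ) (N : S → ℕ) : ℝ :=
  ((Fintype.card S - 1).factorial * ∏ x, ((N x).factorial : ℝ)) /
    (((∑ x, N x) + Fintype.card S - 1).factorial * ∏ x, p x ^ N x)

lemma laplaceRatio_nonneg {p : S → ℝ} (hp : ∀ x, 0 ≤ p x) (N : S → ℕ) : 0 ≤ laplaceRatio p N := by
  unfold laplaceRatio
  have : 0 ≤ ∏ x, p x ^ N x := Finset.prod_nonneg fun x _ => pow_nonneg (hp x) _
  positivity

lemma laplaceRatio_zero (p : S → ℝ) : laplaceRatio p (fun _ => 0) = 1 := by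
  unfold laplaceRatio
  simp [Nat.factorial_ne_zero]

/-- Each observation multiplies the ratio by the predictive probability (N_x + 1)/(n + S) of the
Laplace rule divided by the true probability. -/
lemma laplaceRatio_update [Nonempty S] (p : S → ℝ) (N : S → ℕ) (x : S) :
    laplaceRatio p (fun y => N y + if y = x then 1 else 0) =
      laplaceRatio p N * ((N x + 1) / (((∑ y, N y : ℕ) + Fintype.card S) * p x)) := by
  have hK : 1 ≤ Fintype.card S := Fintype.card_pos
  unfold laplaceRatio
  have e1 : ∏ y, ((N y + if y = x then 1 else 0).factorial : ℝ) =
      (N x + 1) * ∏ y, ((N y).factorial : ℝ) := by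
    rw [← Finset.mul_prod_erase _ _ (Finset.mem_univ x),
      ← Finset.mul_prod_erase _ (fun y => ((N y).factorial : ℝ)) (Finset.mem_univ x), ← mul_assoc]
    congr 1
    · simp [Nat.factorial_succ]
    · refine Finset.prod_congr rfl fun y hy => ?_
      simp [Finset.ne_of_mem_erase hy]
  have e2 : ∏ y, p y ^ (N y + if y = x then 1 else 0) = p x * ∏ y, p y ^ N y := by
    simp only [pow_add, Finset.prod_mul_distrib]
    rw [mul_comm]
    congr 1
    simp
  have e3 : (∑ y, (N y + if y = x then 1 else 0)) = (∑ y, N y) + 1 := by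
    simp [Finset.sum_add_distrib]
  have e4 : (∑ y, N y) + 1 + Fintype.card S - 1 = ((∑ y, N y) + Fintype.card S - 1) + 1 := by omega
  rw [e1, e2, e3, e4, Nat.factorial_succ]
  have e5 : (((∑ y, N y) + Fintype.card S - 1 + 1 : ℕ) : ℝ) =
      ((∑ y, N y : ℕ) : ℝ) + Fintype.card S := by
    rw [show (∑ y, N y) + Fintype.card S - 1 + 1 = (∑ y, N y) + Fintype.card S by omega]
    push_cast; ring
  rw [Nat.cast_mul, e5, div_mul_div_comm]
  congr 1 <;> ring

/-- With `k = S - 1` this bounds the number of possible count vectors, which is the price of the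
Laplace rule against the maximum likelihood; it becomes the S log(n + 1) of the thresholds. -/
lemma choose_add_le_pow (n k : ℕ) : (n + k).choose k ≤ (n + 1) ^ k := by
  induction k with
  | zero => simp
  | succ k ih =>
    have h1 : (n + (k + 1)).choose (k + 1) * (k + 1) = (n + k + 1) * (n + k).choose k := by
      have := Nat.add_one_mul_choose_eq (n + k) k
      rw [show n + (k + 1) = n + k + 1 by ring]
      linarith
    have h2 : (n + k + 1) * (n + k).choose k ≤ ((n + 1) ^ (k + 1)) * (k + 1) := by
      calc (n + k + 1) * (n + k).choose k ≤ ((n + 1) * (k + 1)) * (n + 1) ^ k := by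
            gcongr
            nlinarith [Nat.zero_le (n * k)]
        _ = _ := by ring
    exact Nat.le_of_mul_le_mul_right (h1.trans_le h2) (Nat.succ_pos k)

/-- The left-hand side, divided by the product of the factorials, is one term of the expansion of (∑
q)^n = 1. -/
lemma multinomial_term_le {q : S → ℝ} (hq : ∀ x, 0 ≤ q x) (hq1 : ∑ x, q x = 1) (N : S → ℕ) :
    ((∑ x, N x).factorial : ℝ) * ∏ x, q x ^ N x ≤ ∏ x, ((N x).factorial : ℝ) := by
  have h1 := Finset.sum_pow_eq_sum_piAntidiag Finset.univ q (∑ x, N x)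
  rw [hq1, one_pow] at h1
  have h2 : (Nat.multinomial Finset.univ N : ℝ) * ∏ x, q x ^ N x ≤ 1 := by
    rw [h1]
    refine Finset.single_le_sum (f := fun k => (Nat.multinomial Finset.univ k : ℝ) *
      ∏ x, q x ^ k x) (fun k _ => ?_) ?_
    · exact mul_nonneg (by positivity) (Finset.prod_nonneg fun x _ => pow_nonneg (hq x) _)
    · simp [Finset.mem_piAntidiag]
  have h3 := Nat.multinomial_spec Finset.univ N
  rw [← h3]
  push_cast
  calc (∏ x, ((N x).factorial : ℝ)) * (Nat.multinomial Finset.univ N : ℝ) * ∏ x, q x ^ N x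
      = (∏ x, ((N x).factorial : ℝ)) * ((Nat.multinomial Finset.univ N : ℝ) * ∏ x, q x ^ N x) := by
        ring
    _ ≤ (∏ x, ((N x).factorial : ℝ)) * 1 := by gcongr
    _ = _ := mul_one _

/-- With y = √(p/q), the inequality y² ≤ exp(2(y - 1)) bounds each likelihood factor. Weighted by
the counts n q, the exponents sum to -n · `hell q p`, since both vectors have mass 1. -/
lemma prod_pow_le_exp_hell {p q : S → ℝ} (hp : ∀ x, 0 ≤ p x) (hp1 : ∑ x, p x = 1)
    (hq : ∀ x, 0 ≤ q x) (hq1 : ∑ x, q x = 1) (N : S → ℕ) (n : ℕ)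
    (hN : ∀ x, (N x : ℝ) = n * q x) (hpos : ∀ x, 0 < N x → 0 < q x) :
    Real.exp (n * hell q p) * ∏ x, p x ^ N x ≤ ∏ x, q x ^ N x := by
  have h1 : ∀ x, p x ^ N x ≤ Real.exp (2 * n * (Real.sqrt (q x) * Real.sqrt (p x) - q x)) *
      q x ^ N x := by
    intro x
    rcases Nat.eq_zero_or_pos (N x) with h0 | h0
    · have h00 : (n : ℝ) * q x = 0 := by rw [← hN, h0, Nat.cast_zero]
      have : 2 * (n : ℝ) * (Real.sqrt (q x) * Real.sqrt (p x) - q x) = 0 := by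
        rcases mul_eq_zero.1 h00 with h | h <;> simp [h]
      simp [h0, this]
    · have hqx := hpos x h0
      set y := Real.sqrt (p x) / Real.sqrt (q x) with hy
      have hsq : 0 < Real.sqrt (q x) := Real.sqrt_pos.2 hqx
      have hpx : p x = y ^ 2 * q x := by
        rw [hy, div_pow, Real.sq_sqrt (hp x), Real.sq_sqrt hqx.le, div_mul_cancel₀ _ hqx.ne']
      have hy0 : 0 ≤ y := by positivity
      have hexp : 2 * (n : ℝ) * (Real.sqrt (q x) * Real.sqrt (p x) - q x) =
          (N x : ℝ) * (2 * (y - 1)) := by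
        rw [hN, hy]
        field_simp
        linear_combination (n : ℝ) * Real.sqrt (p x) * Real.sq_sqrt hqx.le
      rw [hexp, Real.exp_nat_mul, ← mul_pow, hpx]
      refine pow_le_pow_left₀ (by positivity) ?_ _
      gcongr
      rw [two_mul, Real.exp_add, ← sq]
      gcongr
      linarith [Real.add_one_le_exp (y - 1)]
  have h2 : (n : ℝ) * hell q p + ∑ x, 2 * n * (Real.sqrt (q x) * Real.sqrt (p x) - q x) = 0 := by
    unfold hell
    have : ∀ x, (Real.sqrt (q x) - Real.sqrt (p x)) ^ 2 =
        q x + p x - 2 * (Real.sqrt (q x) * Real.sqrt (p x)) := by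
      intro x
      rw [sub_sq, Real.sq_sqrt (hp x), Real.sq_sqrt (hq x)]; ring
    simp only [this, ← Finset.mul_sum, Finset.sum_sub_distrib, Finset.sum_add_distrib, hp1, hq1]
    ring
  calc Real.exp (n * hell q p) * ∏ x, p x ^ N x
      ≤ Real.exp (n * hell q p) * ∏ x, (Real.exp (2 * n * (Real.sqrt (q x) * Real.sqrt (p x) - q x))
          * q x ^ N x) := by
        gcongr with x
        · intro x _; exact pow_nonneg (hp x) _
        · exact h1 x
    _ = ∏ x, q x ^ N x := by
        rw [Finset.prod_mul_distrib, ← Real.exp_sum, ← mul_assoc, ← Real.exp_add, h2, Real.exp_zero,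
          one_mul]

/-- The Laplace likelihood is within (n+1)^S of the maximum likelihood, and the latter beats the
likelihood of `p` by exp(n · `hell q p`). The exponent S - 1 would do; S matches the threshold. -/
lemma exp_hell_le_laplaceRatio [Nonempty S] {p q : S → ℝ} (hp : ∀ x, 0 ≤ p x)
    (hp1 : ∑ x, p x = 1) (hq : ∀ x, 0 ≤ q x) (hq1 : ∑ x, q x = 1) (N : S → ℕ) (n : ℕ)
    (hn : ∑ x, N x = n) (hN : ∀ x, (N x : ℝ) = n * q x) (hpos : ∀ x, 0 < N x → 0 < q x)
    (hsupp : ∀ x, 0 < N x → 0 < p x) :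
    Real.exp (n * hell q p) ≤ laplaceRatio p N * ((n : ℝ) + 1) ^ (Fintype.card S) := by
  have hK : 1 ≤ Fintype.card S := Fintype.card_pos
  obtain ⟨k, hk⟩ : ∃ k, Fintype.card S = k + 1 := ⟨_, (Nat.sub_add_cancel hK).symm⟩
  have hP : 0 < ∏ x, p x ^ N x := by
    refine Finset.prod_pos fun x _ => ?_
    rcases Nat.eq_zero_or_pos (N x) with h0 | h0
    · simp [h0]
    · exact pow_pos (hsupp x h0) _
  have h1 := prod_pow_le_exp_hell hp hp1 hq hq1 N n hN hpos
  have h2 := multinomial_term_le hq hq1 N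
  rw [hn] at h2
  have hch : ((n + k).factorial : ℝ) ≤ ((n : ℝ) + 1) ^ (k + 1) * (n.factorial * k.factorial) := by
    have h3 := choose_add_le_pow n k
    have h4 := Nat.add_choose_mul_factorial_mul_factorial n k
    rw [← h4]
    push_cast
    rw [mul_assoc]
    gcongr
    calc ((n + k).choose k : ℝ) ≤ ((n : ℝ) + 1) ^ k := by exact_mod_cast h3
      _ ≤ ((n : ℝ) + 1) ^ (k + 1) := pow_le_pow_right₀ (by linarith [Nat.cast_nonneg (α := ℝ) n])
          (Nat.le_succ k)
  unfold laplaceRatio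
  rw [hn, hk, show n + (k + 1) - 1 = n + k by omega, Nat.add_sub_cancel, div_mul_eq_mul_div,
    le_div_iff₀ (by positivity)]
  calc Real.exp (n * hell q p) * ((n + k).factorial * ∏ x, p x ^ N x)
      = (Real.exp (n * hell q p) * ∏ x, p x ^ N x) * (n + k).factorial := by ring
    _ ≤ (∏ x, q x ^ N x) * (((n : ℝ) + 1) ^ (k + 1) * (n.factorial * k.factorial)) := by
        gcongr
        exact Finset.prod_nonneg fun x _ => pow_nonneg (hq x) _
    _ = (n.factorial * ∏ x, q x ^ N x) * (k.factorial * ((n : ℝ) + 1) ^ (k + 1)) := by ring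
    _ ≤ (∏ x, ((N x).factorial : ℝ)) * (k.factorial * ((n : ℝ) + 1) ^ (k + 1)) := by gcongr
    _ = _ := by ring

/-- Every observed transition has positive probability. -/
def Supported (M : MDP S A H) (D : List (Episode S A H)) : Prop :=
  ∀ h s a x, 0 < countNext D h s a x → 0 < M.model h s a x

lemma supported_runData (M : MDP S A H) (alg : List (Episode S A H) → DetPolicy S A H)
    (ω : ℕ → Seed S A H) (hω : ∀ t, ∀ j : Fin H × S × A, M.model j.1 j.2.1 j.2.2 (ω t j) ≠ 0)
    (t : ℕ) : Supported M (runData alg (M.env ω) t) := by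
  induction t with
  | zero => intro h s a x hx; simp [runData] at hx
  | succ t ih =>
    intro h s a x hx
    rw [runData, countNext_append] at hx
    by_cases hc : 0 < countNext (runData alg (M.env ω) t) h s a x
    · exact ih h s a x hc
    · split_ifs at hx with hc2
      · obtain ⟨h1, h2, h3⟩ := hc2
        simp only [MDP.env, rollout] at h1 h2 h3
        rw [Fin.val_succ, rolloutState_succ] at h3
        simp only [Fin.val_castSucc] at h1
        rw [h2, h1] at h3
        refine lt_of_le_of_ne (M.model_nonneg _ _ _ _) (Ne.symm ?_)
        rw [← h3]
        exact hω t (h, s, a)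
      · omega

/-- Writing the multiplier of one episode as a `trajProd`, trivial away from `(h, s, a)`, brings it
under `integral_trajProd_le`. -/
lemma laplaceRatio_append [Nonempty S] (p : S → ℝ) (D : List (Episode S A H)) (e : Episode S A H)
    (h : Fin H) (s : S) (a : A) :
    laplaceRatio p (countNext (D ++ [e]) h s a) = laplaceRatio p (countNext D h s a) *
      trajProd (fun h' s' a' x => if h' = h ∧ s' = s ∧ a' = a then
        ((countNext D h s a x : ℝ) + 1) / ((count D h s a + Fintype.card S) * p x) else 1) e := by
  have hprod : trajProd (fun h' s' a' x => if h' = h ∧ s' = s ∧ a' = a then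
        ((countNext D h s a x : ℝ) + 1) / ((count D h s a + Fintype.card S) * p x) else 1) e =
      if e.state h.castSucc = s ∧ e.action h = a then
        ((countNext D h s a (e.state h.succ) : ℝ) + 1) /
          ((count D h s a + Fintype.card S) * p (e.state h.succ)) else 1 := by
    unfold trajProd
    rw [Finset.prod_eq_single h]
    · simp
    · intro b _ hb; exact if_neg (fun h' => hb h'.1)
    · simp
  rw [hprod]
  split_ifs with hc
  · have : countNext (D ++ [e]) h s a =
        fun y => countNext D h s a y + if y = e.state h.succ then 1 else 0 := by
      funext y
      rw [countNext_append]
      simp [hc, eq_comm]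
    rw [this, laplaceRatio_update, sum_countNext]
  · rw [mul_one]
    congr 1
    funext y
    rw [countNext_append, if_neg (fun h' => hc ⟨h'.1, h'.2.1⟩), add_zero]

/-- The predictive probabilities of the Laplace rule sum to 1, so the ratio is a supermartingale
started at 1, whatever the policies are. -/
lemma law_hell_single (M : MDP S A H) (alg : List (Episode S A H) → DetPolicy S A H)
    (h : Fin H) (s : S) (a : A) {δ : ℝ} (hδ : 0 < δ) :
    M.law {ω | ∃ t, 1 / δ ≤ laplaceRatio (M.model h s a)
      (countNext (runData alg (M.env ω) t) h s a)} ≤ ENNReal.ofReal δ := by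
  have : Nonempty S := ⟨M.init⟩
  refine ville M (fun D => laplaceRatio (M.model h s a) (countNext D h s a))
    (fun D => laplaceRatio_nonneg (M.model_nonneg h s a) _) alg ?_ ?_ hδ
  · intro D
    simp only [laplaceRatio_append]
    rw [integral_const_mul]
    refine mul_le_of_le_one_right (laplaceRatio_nonneg (M.model_nonneg h s a) _) ?_
    have hden : (0 : ℝ) < count D h s a + Fintype.card S := by
      have : 0 < Fintype.card S := Fintype.card_pos
      positivity
    refine integral_trajProd_le M (alg D) _ ?_ ?_
    · intro h' s' a' x
      split_ifs
      · have := M.model_nonneg h s a x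
        positivity
      · exact zero_le_one
    · intro h' s' a'
      by_cases hc : h' = h ∧ s' = s ∧ a' = a
      · obtain ⟨rfl, rfl, rfl⟩ := hc
        simp only [and_self, if_true]
        calc _ ≤ ∑ x, ((countNext D h' s' a' x : ℝ) + 1) / (count D h' s' a' + Fintype.card S) := by
              refine Finset.sum_le_sum fun x _ => ?_
              -- Where the true probability vanishes the summand is 0 and the predictive mass of `x`
              -- is lost, hence only an inequality.
              rcases eq_or_lt_of_le (M.model_nonneg h' s' a' x) with h0 | h0
              · rw [← h0, zero_mul]; positivity
              · exact le_of_eq (by field_simp)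
          _ = 1 := by
              rw [← Finset.sum_div, Finset.sum_add_distrib, ← Nat.cast_sum, sum_countNext]
              simp only [Finset.sum_const, Finset.card_univ, nsmul_eq_mul, mul_one]
              exact div_self hden.ne'
      · simp only [if_neg hc, mul_one, M.sum_model, le_refl]
  · exact (laplaceRatio_zero _).le

/-- The empirical transition probabilities are close to the true ones in Hellinger distance,
uniformly in time. -/
theorem law_hell (M : MDP S A H) [Nonempty A] (hH : 0 < H)
    (alg : List (Episode S A H) → DetPolicy S A H)
    {δ : ℝ} (hδ : 0 < δ) :
    M.law {ω | ¬ ∀ t h s a, 0 < count (runData alg (M.env ω) t) h s a →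
      count (runData alg (M.env ω) t) h s a *
        hell (empirical (runData alg (M.env ω) t) h s a) (M.model h s a) ≤
      Real.log (Fintype.card S * Fintype.card A * H / δ) +
        Fintype.card S * Real.log (count (runData alg (M.env ω) t) h s a + 1)} ≤
      ENNReal.ofReal δ := by
  have : Nonempty S := ⟨M.init⟩
  set c : ℝ := Fintype.card S * Fintype.card A * H with hc
  have hc0 : 0 < c := by
    have : 0 < Fintype.card S := Fintype.card_pos
    have : 0 < Fintype.card A := Fintype.card_pos
    positivity
  have hsub : {ω | ¬ ∀ t h s a, 0 < count (runData alg (M.env ω) t) h s a →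
      count (runData alg (M.env ω) t) h s a *
        hell (empirical (runData alg (M.env ω) t) h s a) (M.model h s a) ≤
      Real.log (c / δ) +
        Fintype.card S * Real.log (count (runData alg (M.env ω) t) h s a + 1)} ⊆
      {ω | ∃ t, ∃ j : Fin H × S × A, M.model j.1 j.2.1 j.2.2 (ω t j) = 0} ∪
      ⋃ j : Fin H × S × A, {ω | ∃ t, 1 / (δ / c) ≤ laplaceRatio (M.model j.1 j.2.1 j.2.2)
        (countNext (runData alg (M.env ω) t) j.1 j.2.1 j.2.2)} := by
    intro ω hω
    by_contra hcon
    simp only [Set.mem_union, Set.mem_iUnion, not_or, not_exists, Set.mem_ofPred_eq, not_le] at hcon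
    obtain ⟨hz, hL⟩ := hcon
    refine hω fun t h s a hn => ?_
    -- The ratio divides by powers of true probabilities. An observed transition of probability zero
    -- would make it 0 by convention and void the bound; this is why null transitions are excluded.
    have hsup := supported_runData M alg ω (fun t j => hz t j) t
    set D := runData alg (M.env ω) t with hD
    have hn' : (count D h s a : ℝ) ≠ 0 := by exact_mod_cast hn.ne'
    have hemp : ∀ x, (countNext D h s a x : ℝ) = count D h s a * empirical D h s a x := by
      intro x
      unfold empirical
      rw [if_neg hn.ne']
      field_simp
    have h1 := exp_hell_le_laplaceRatio (M.model_nonneg h s a) (M.sum_model h s a)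
      (empirical_nonneg D h s a) (sum_empirical D h s a) (countNext D h s a) (count D h s a)
      (sum_countNext D h s a) hemp
      (fun x hx => by
        have h2 : (0 : ℝ) < countNext D h s a x := by exact_mod_cast hx
        rw [hemp] at h2
        exact pos_of_mul_pos_right h2 (by positivity))
      (hsup h s a)
    have h2 := hL (h, s, a) t
    have h3 : Real.exp (count D h s a * hell (empirical D h s a) (M.model h s a)) ≤
        c / δ * ((count D h s a : ℝ) + 1) ^ Fintype.card S := by
      refine h1.trans ?_
      gcongr
      refine h2.le.trans (le_of_eq ?_)
      field_simp
    rw [← Real.le_log_iff_exp_le (by positivity), Real.log_mul (by positivity) (by positivity),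
      Real.log_pow] at h3
    exact h3
  refine (measure_mono hsub).trans ((measure_union_le _ _).trans ?_)
  rw [law_zero_transition, zero_add]
  refine (measure_iUnion_fintype_le _ _).trans ?_
  calc _ ≤ ∑ j : Fin H × S × A, ENNReal.ofReal (δ / c) :=
        Finset.sum_le_sum fun j _ => law_hell_single M alg j.1 j.2.1 j.2.2 (by positivity)
    _ = ENNReal.ofReal δ := by
        rw [Finset.sum_const, nsmul_eq_mul, ← ENNReal.ofReal_natCast,
          ← ENNReal.ofReal_mul (by positivity)]
        congr 1
        rw [Finset.card_univ, Fintype.card_prod, Fintype.card_prod, Fintype.card_fin]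
        push_cast
        rw [show (H : ℝ) * (Fintype.card S * Fintype.card A) = c by rw [hc]; ring]
        field_simp

end

section

open scoped Classical


/-! ### Means and variances under nearby probability vectors -/

section Vectors

variable {S : Type*} [Fintype S]

lemma sqrt_sum_sq_add_le (a b : S → ℝ) :
    Real.sqrt (∑ x, (a x + b x) ^ 2) ≤ Real.sqrt (∑ x, a x ^ 2) + Real.sqrt (∑ x, b x ^ 2) := by
  have h := norm_add_le (WithLp.toLp 2 a : EuclideanSpace ℝ S) (WithLp.toLp 2 b)
  simpa [EuclideanSpace.norm_eq] using h

lemma expect_sub (q U V : S → ℝ) : expect q (fun x => U x - V x) = expect q U - expect q V := by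
  unfold expect
  rw [← Finset.sum_sub_distrib]
  exact Finset.sum_congr rfl fun x _ => by ring

lemma expect_mono {q U V : S → ℝ} (hq : ∀ x, 0 ≤ q x) (h : ∀ x, U x ≤ V x) :
    expect q U ≤ expect q V :=
  Finset.sum_le_sum fun x _ => mul_le_mul_of_nonneg_left (h x) (hq x)

lemma expect_const {q : S → ℝ} (hq : ∑ x, q x = 1) (c : ℝ) : expect q (fun _ => c) = c := by
  unfold expect
  rw [← Finset.sum_mul, hq, one_mul]

lemma expect_nonneg {q V : S → ℝ} (hq : ∀ x, 0 ≤ q x) (h : ∀ x, 0 ≤ V x) : 0 ≤ expect q V :=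
  Finset.sum_nonneg fun x _ => mul_nonneg (hq x) (h x)

lemma expect_le {q V : S → ℝ} (hq : ∀ x, 0 ≤ q x) (hq1 : ∑ x, q x = 1) {c : ℝ}
    (h : ∀ x, V x ≤ c) : expect q V ≤ c :=
  (expect_mono hq h).trans (expect_const hq1 c).le

lemma variance_nonneg {q : S → ℝ} (hq : ∀ x, 0 ≤ q x) (V : S → ℝ) : 0 ≤ variance q V :=
  Finset.sum_nonneg fun x _ => mul_nonneg (hq x) (sq_nonneg _)

lemma variance_eq {q : S → ℝ} (hq1 : ∑ x, q x = 1) (V : S → ℝ) :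
    variance q V = expect q (fun x => V x ^ 2) - expect q V ^ 2 := by
  have h : ∀ x, q x * (V x - expect q V) ^ 2 =
      q x * V x ^ 2 - 2 * expect q V * (q x * V x) + expect q V ^ 2 * q x := fun x => by ring
  unfold variance
  simp only [h, Finset.sum_add_distrib, Finset.sum_sub_distrib, ← Finset.mul_sum, hq1]
  change expect q (fun x => V x ^ 2) - 2 * expect q V * expect q V + _ = _
  ring

lemma variance_le_center {q : S → ℝ} (hq1 : ∑ x, q x = 1) (V : S → ℝ) (c : ℝ) :
    variance q V ≤ ∑ x, q x * (V x - c) ^ 2 := by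
  have h : ∀ x, q x * (V x - c) ^ 2 =
      q x * V x ^ 2 - 2 * c * (q x * V x) + c ^ 2 * q x := fun x => by ring
  rw [variance_eq hq1]
  simp only [h, Finset.sum_add_distrib, Finset.sum_sub_distrib, ← Finset.mul_sum, hq1]
  change expect q (fun x => V x ^ 2) - _ ≤ expect q (fun x => V x ^ 2) - 2 * c * expect q V + _
  nlinarith [sq_nonneg (expect q V - c)]

lemma hell_comm (p q : S → ℝ) : hell p q = hell q p :=
  Finset.sum_congr rfl fun x _ => by ring

/-- Minkowski's inequality in ℓ² for √q g = √p g + (√q - √p) g. -/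
lemma sqrt_sum_le_add_hell {p q : S → ℝ} (hp : ∀ x, 0 ≤ p x) (hq : ∀ x, 0 ≤ q x) {g : S → ℝ}
    (hg : ∀ x, g x ^ 2 ≤ 1) {y : ℝ} (hy : hell q p ≤ y) :
    Real.sqrt (∑ x, q x * g x ^ 2) ≤ Real.sqrt (∑ x, p x * g x ^ 2) + Real.sqrt y := by
  have h := sqrt_sum_sq_add_le (fun x => Real.sqrt (p x) * g x)
    (fun x => (Real.sqrt (q x) - Real.sqrt (p x)) * g x)
  have e1 : ∀ x, (Real.sqrt (p x) * g x + (Real.sqrt (q x) - Real.sqrt (p x)) * g x) ^ 2 =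
      q x * g x ^ 2 := fun x => by
    rw [← add_mul, add_sub_cancel, mul_pow, Real.sq_sqrt (hq x)]
  have e2 : ∀ x, (Real.sqrt (p x) * g x) ^ 2 = p x * g x ^ 2 := fun x => by
    rw [mul_pow, Real.sq_sqrt (hp x)]
  simp only [e1, e2] at h
  refine h.trans ?_
  gcongr
  refine le_trans ?_ hy
  refine Finset.sum_le_sum fun x _ => ?_
  rw [mul_pow]
  exact mul_le_of_le_one_right (sq_nonneg _) (hg x)

/-- Both vectors have mass 1, so V may be centred at its `q`-mean. Cauchy–Schwarz applied to p - q =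
(√p - √q)(√p + √q), followed by √p + √q = 2√q + (√p - √q), produces a Bernstein-type bound with the
variance under `q`, the vector known to the learner. -/
lemma abs_expect_sub_le {p q : S → ℝ} (hp : ∀ x, 0 ≤ p x) (hp1 : ∑ x, p x = 1)
    (hq : ∀ x, 0 ≤ q x) (hq1 : ∑ x, q x = 1) {V : S → ℝ} (hV0 : ∀ x, 0 ≤ V x) (hV1 : ∀ x, V x ≤ 1)
    {y : ℝ} (hy : hell q p ≤ y) :
    |expect p V - expect q V| ≤ Real.sqrt y * (2 * Real.sqrt (variance q V) + Real.sqrt y) := by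
  set c := expect q V with hc
  have hc0 : 0 ≤ c := expect_nonneg hq hV0
  have hc1 : c ≤ 1 := expect_le hq hq1 hV1
  have hg : ∀ x, (V x - c) ^ 2 ≤ 1 := fun x => by nlinarith [hV0 x, hV1 x]
  have e0 : expect p V - c = ∑ x, (Real.sqrt (p x) - Real.sqrt (q x)) *
      ((Real.sqrt (p x) + Real.sqrt (q x)) * (V x - c)) := by
    have h1 : ∀ x, (Real.sqrt (p x) - Real.sqrt (q x)) *
      ((Real.sqrt (p x) + Real.sqrt (q x)) * (V x - c)) =
        p x * V x - q x * V x - c * (p x - q x) := fun x => by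
      have h2 := Real.sq_sqrt (hp x)
      have h3 := Real.sq_sqrt (hq x)
      linear_combination (V x - c) * h2 - (V x - c) * h3
    simp only [h1, Finset.sum_sub_distrib, ← Finset.mul_sum, hp1, hq1]
    change _ = expect p V - expect q V - _
    rw [hc]; ring
  have hyn : 0 ≤ y := le_trans (Finset.sum_nonneg fun x _ => sq_nonneg _) hy
  have e1 : |∑ x, (Real.sqrt (p x) - Real.sqrt (q x)) *
      ((Real.sqrt (p x) + Real.sqrt (q x)) * (V x - c))| ≤
      Real.sqrt (∑ x, (Real.sqrt (p x) - Real.sqrt (q x)) ^ 2) *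
      Real.sqrt (∑ x, ((Real.sqrt (p x) + Real.sqrt (q x)) * (V x - c)) ^ 2) := by
    rw [← Real.sqrt_mul (Finset.sum_nonneg fun x _ => sq_nonneg _)]
    apply Real.abs_le_sqrt
    exact Finset.sum_mul_sq_le_sq_mul_sq _ _ _
  have e2 : Real.sqrt (∑ x, ((Real.sqrt (p x) + Real.sqrt (q x)) * (V x - c)) ^ 2) ≤
      2 * Real.sqrt (variance q V) + Real.sqrt y := by
    have h := sqrt_sum_sq_add_le (fun x => 2 * (Real.sqrt (q x) * (V x - c)))
      (fun x => (Real.sqrt (p x) - Real.sqrt (q x)) * (V x - c))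
    have h1 : ∀ x, 2 * (Real.sqrt (q x) * (V x - c)) +
        (Real.sqrt (p x) - Real.sqrt (q x)) * (V x - c) =
        (Real.sqrt (p x) + Real.sqrt (q x)) * (V x - c) := fun x => by ring
    have h2 : ∀ x, (2 * (Real.sqrt (q x) * (V x - c))) ^ 2 = 2 ^ 2 * (q x * (V x - c) ^ 2) :=
      fun x => by rw [mul_pow, mul_pow, Real.sq_sqrt (hq x)]
    simp only [h1, h2, ← Finset.mul_sum] at h
    rw [Real.sqrt_mul (by norm_num), Real.sqrt_sq (by norm_num)] at h
    refine h.trans ?_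
    change 2 * Real.sqrt (variance q V) + _ ≤ _
    gcongr
    refine le_trans ?_ hy
    rw [hell_comm]
    refine Finset.sum_le_sum fun x _ => ?_
    rw [mul_pow]
    exact mul_le_of_le_one_right (sq_nonneg _) (hg x)
  rw [e0]
  refine e1.trans (mul_le_mul ?_ e2 (Real.sqrt_nonneg _) (Real.sqrt_nonneg _))
  apply Real.sqrt_le_sqrt
  change hell p q ≤ y
  rwa [hell_comm]

/-- The standard deviation is a seminorm. -/
lemma sd_sub_le {q : S → ℝ} (hq : ∀ x, 0 ≤ q x) (U V : S → ℝ) :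
    Real.sqrt (variance q V) ≤
      Real.sqrt (variance q U) + Real.sqrt (variance q (fun x => V x - U x)) := by
  have h := sqrt_sum_sq_add_le (fun x => Real.sqrt (q x) * (U x - expect q U))
    (fun x => Real.sqrt (q x) * ((V x - U x) - expect q (fun x => V x - U x)))
  have e1 : ∀ x, (Real.sqrt (q x) * (U x - expect q U) + Real.sqrt (q x) *
      ((V x - U x) - expect q (fun x => V x - U x))) ^ 2 = q x * (V x - expect q V) ^ 2 := by
    intro x
    rw [← mul_add, mul_pow, Real.sq_sqrt (hq x), expect_sub]; ring
  simp only [e1, mul_pow, Real.sq_sqrt (hq _)] at h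
  exact h

/-- Monotonicity of the optimistic Bellman operator. -/
lemma expect_add_max_mono {q : S → ℝ} (hq : ∀ x, 0 ≤ q x) (hq1 : ∑ x, q x = 1) {U V : S → ℝ}
    (hU0 : ∀ x, 0 ≤ U x) (hU1 : ∀ x, U x ≤ 1) (hUV : ∀ x, U x ≤ V x) {y : ℝ} (hy : 0 ≤ y) :
    expect q U + max (Real.sqrt (8 * variance q U * y)) (8 * y) ≤
      expect q V + max (Real.sqrt (8 * variance q V * y)) (8 * y) := by
  have hE := expect_mono hq hUV
  rcases le_total (Real.sqrt (8 * variance q U * y)) (8 * y) with h | h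
  · rw [max_eq_right h]
    exact add_le_add hE (le_max_right _ _)
  rw [max_eq_left h]
  refine le_trans ?_ (add_le_add_right (le_max_left _ _) _)
  set w := Real.sqrt (8 * y) with hw
  have hw0 : 0 ≤ w := Real.sqrt_nonneg _
  have hw2 : w ^ 2 = 8 * y := Real.sq_sqrt (by positivity)
  have hsplit : ∀ W : S → ℝ, Real.sqrt (8 * variance q W * y) = w * Real.sqrt (variance q W) := by
    intro W
    rw [hw, ← Real.sqrt_mul (by positivity)]
    congr 1; ring
  rw [hsplit] at h ⊢
  rw [hsplit]
  set sU := Real.sqrt (variance q U) with hsU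
  set sV := Real.sqrt (variance q V) with hsV
  have hsU0 : 0 ≤ sU := Real.sqrt_nonneg _
  have hsV0 : 0 ≤ sV := Real.sqrt_nonneg _
  have hsU2 : sU ^ 2 = variance q U := Real.sq_sqrt (variance_nonneg hq U)
  have hsV2 : sV ^ 2 = variance q V := Real.sq_sqrt (variance_nonneg hq V)
  rcases le_total sU sV with hle | hle
  · have := mul_le_mul_of_nonneg_left hle hw0
    linarith
  -- Only the case remains where the square root attains the maximum for `U` and the standard
  -- deviation drops from `U` to `V`. The maximum then says w² ≤ w · sU. Below, sU² - (E V - E U) ≤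
  -- Cov(U, V) ≤ sU · sV, so the gain in mean is at least sU (sU - sV), which exceeds the loss w (sU
  -- - sV) in the bonus.
  have hwU : w ≤ sU := by
    by_contra hcon
    push Not at hcon
    have : w * sU < w * w := mul_lt_mul_of_pos_left hcon (lt_of_le_of_lt hsU0 hcon)
    nlinarith
  have hcov : ∑ x, q x * (U x - expect q U) * (V x - expect q V) ≤ sU * sV := by
    have h1 := Finset.sum_mul_sq_le_sq_mul_sq Finset.univ
      (fun x => Real.sqrt (q x) * (U x - expect q U)) (fun x => Real.sqrt (q x) * (V x - expect q V))
    simp only [mul_pow, Real.sq_sqrt (hq _)] at h1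
    change _ ≤ variance q U * variance q V at h1
    rw [← hsU2, ← hsV2, ← mul_pow] at h1
    refine le_trans (Finset.sum_le_sum fun x _ => le_of_eq ?_) (abs_le_of_sq_le_sq' h1
      (by positivity)).2
    have := Real.mul_self_sqrt (hq x)
    linear_combination -(U x - expect q U) * (V x - expect q V) * this
  have hlow : variance q U - (expect q V - expect q U) ≤
      ∑ x, q x * (U x - expect q U) * (V x - expect q V) := by
    have h0 : ∑ x, q x * (U x - expect q U) = 0 := by
      simp only [mul_sub, Finset.sum_sub_distrib, ← Finset.sum_mul, hq1]
      change expect q U - _ = 0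
      ring
    have h1 : ∑ x, q x * (U x - expect q U) * (V x - expect q V) =
        variance q U + ∑ x, q x * (U x - expect q U) * (V x - U x) := by
      have h2 : ∀ x, q x * (U x - expect q U) * (V x - expect q V) =
          q x * (U x - expect q U) ^ 2 + q x * (U x - expect q U) * (V x - U x) -
            (expect q V - expect q U) * (q x * (U x - expect q U)) := fun x => by ring
      simp only [h2, Finset.sum_sub_distrib, Finset.sum_add_distrib, ← Finset.mul_sum, h0]
      rw [mul_zero, sub_zero]; rfl
    have h3 : -(expect q V - expect q U) ≤ ∑ x, q x * (U x - expect q U) * (V x - U x) := by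
      rw [← expect_sub]
      unfold expect
      rw [← Finset.sum_neg_distrib]
      refine Finset.sum_le_sum fun x _ => ?_
      have h4 : expect q U ≤ 1 := expect_le hq hq1 hU1
      have h5 := mul_nonneg (hq x) (sub_nonneg.2 (hUV x))
      have h6 : -1 ≤ U x - expect q U := by linarith [hU0 x]
      change _ ≤ q x * (U x - expect q U) * (V x - U x)
      nlinarith
    linarith
  nlinarith [mul_nonneg (sub_nonneg.2 hwU) (sub_nonneg.2 hle)]

/-- The bonus computed with `U` dominates the deviation between `p` and `q`; `expect_add_max_mono`
then replaces `U` by the larger `V`, so no confidence bound for the random function `V` itself is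
needed. -/
lemma expect_le_optimistic {p q : S → ℝ} (hp : ∀ x, 0 ≤ p x) (hp1 : ∑ x, p x = 1)
    (hq : ∀ x, 0 ≤ q x) (hq1 : ∑ x, q x = 1) {U V : S → ℝ}
    (hU0 : ∀ x, 0 ≤ U x) (hU1 : ∀ x, U x ≤ 1) (hUV : ∀ x, U x ≤ V x) {y : ℝ}
    (hy : hell q p ≤ y) :
    expect p U ≤ expect q V + max (Real.sqrt (8 * variance q V * y)) (8 * y) := by
  have hyn : 0 ≤ y := le_trans (Finset.sum_nonneg fun x _ => sq_nonneg _) hy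
  refine le_trans ?_ (expect_add_max_mono hq hq1 hU0 hU1 hUV hyn)
  have h1 := (abs_le.1 (abs_expect_sub_le hp hp1 hq hq1 hU0 hU1 hy)).2
  set s := Real.sqrt y with hs
  have hs0 : 0 ≤ s := Real.sqrt_nonneg _
  have hs2 : s ^ 2 = y := Real.sq_sqrt hyn
  set v := Real.sqrt (variance q U) with hv
  have hv0 : 0 ≤ v := Real.sqrt_nonneg _
  have hsplit : Real.sqrt (8 * variance q U * y) = Real.sqrt 8 * (v * s) := by
    rw [Real.sqrt_mul (by have := variance_nonneg hq U; positivity), Real.sqrt_mul (by norm_num),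
      mul_assoc]
  have h8 : (2.8 : ℝ) ≤ Real.sqrt 8 := by
    apply Real.le_sqrt_of_sq_le; norm_num
  rw [hsplit]
  -- The left-hand side is a combination of 2.8 v s and 8 s² with weights 2/2.8 and 1/8, of sum
  -- below 1.
  have h2 : s * (2 * v + s) ≤ max (Real.sqrt 8 * (v * s)) (8 * y) := by
    have hvs : 0 ≤ v * s := by positivity
    have h3 := le_max_left (Real.sqrt 8 * (v * s)) (8 * y)
    have h4 := le_max_right (Real.sqrt 8 * (v * s)) (8 * y)
    have h5 := mul_le_mul_of_nonneg_right h8 hvs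
    nlinarith
  linarith

/-- One-step bound on the difference between the optimistic value and the value. -/
lemma optimistic_gap {p q : S → ℝ} (hp : ∀ x, 0 ≤ p x) (hp1 : ∑ x, p x = 1)
    (hq : ∀ x, 0 ≤ q x) (hq1 : ∑ x, q x = 1) {U V : S → ℝ}
    (hU0 : ∀ x, 0 ≤ U x) (hV1 : ∀ x, V x ≤ 1) (hUV : ∀ x, U x ≤ V x) {y : ℝ}
    (hy : hell q p ≤ y) {n : ℝ} (hn : 1 ≤ n) :
    expect q V + max (Real.sqrt (8 * variance q V * y)) (8 * y) - expect p U ≤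
      (1 + 1 / n) * expect p (fun x => V x - U x) + 1 / 12 * variance p U + 96 * n * y := by
  have hyn : 0 ≤ y := le_trans (Finset.sum_nonneg fun x _ => sq_nonneg _) hy
  have hV0 : ∀ x, 0 ≤ V x := fun x => (hU0 x).trans (hUV x)
  have h1 := (abs_le.1 (abs_expect_sub_le hp hp1 hq hq1 hV0 hV1 hy)).1
  set s := Real.sqrt y with hs
  have hs0 : 0 ≤ s := Real.sqrt_nonneg _
  have hs2 : s ^ 2 = y := Real.sq_sqrt hyn
  set v := Real.sqrt (variance q V) with hv
  have hv0 : 0 ≤ v := Real.sqrt_nonneg _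
  have hsplit : Real.sqrt (8 * variance q V * y) = Real.sqrt 8 * (v * s) := by
    rw [Real.sqrt_mul (by have := variance_nonneg hq V; positivity), Real.sqrt_mul (by norm_num),
      mul_assoc]
  have h8 : Real.sqrt 8 ≤ 3 := by
    apply Real.sqrt_le_iff.2; norm_num
  have hmax : max (Real.sqrt (8 * variance q V * y)) (8 * y) ≤ 3 * (v * s) + 8 * s ^ 2 := by
    rw [hsplit, hs2]
    have hvs : 0 ≤ v * s := by positivity
    have := mul_le_mul_of_nonneg_right h8 hvs
    exact max_le (by linarith) (by linarith)
  -- The variance under `q` only grows when it is centred at the `p`-mean; then the two laws are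
  -- compared in ℓ².
  have hvp : v ≤ Real.sqrt (variance p V) + s := by
    have hc0 : 0 ≤ expect p V := expect_nonneg hp hV0
    have hc1 : expect p V ≤ 1 := expect_le hp hp1 hV1
    refine le_trans (Real.sqrt_le_sqrt (variance_le_center hq1 V (expect p V))) ?_
    exact sqrt_sum_le_add_hell hp hq (fun x => by nlinarith [hV0 x, hV1 x]) hy
  set d := expect p (fun x => V x - U x) with hd
  have hd0 : 0 ≤ d := expect_nonneg hp fun x => sub_nonneg.2 (hUV x)
  have hd' : d = expect p V - expect p U := expect_sub _ _ _
  have hsd : Real.sqrt (variance p V) ≤ Real.sqrt (variance p U) + Real.sqrt d := by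
    refine (sd_sub_le hp U V).trans ?_
    gcongr
    rw [variance_eq hp1]
    refine le_trans (sub_le_self _ (sq_nonneg _)) (expect_mono hp fun x => ?_)
    have h3 := sub_nonneg.2 (hUV x)
    have h4 : V x - U x ≤ 1 := by linarith [hU0 x, hV1 x]
    nlinarith
  set e := Real.sqrt d with he
  have he0 : 0 ≤ e := Real.sqrt_nonneg _
  have he2 : e ^ 2 = d := Real.sq_sqrt hd0
  set w := Real.sqrt (variance p U) with hw
  have hw0 : 0 ≤ w := Real.sqrt_nonneg _
  have hw2 : w ^ 2 = variance p U := Real.sq_sqrt (variance_nonneg hp U)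
  have hvs : s * v ≤ s * (w + e + s) := mul_le_mul_of_nonneg_left (by linarith) hs0
  -- So far the excess over d is at most 5 s v + 9 s², hence 5 s w + 5 s e + 14 s². The two products
  -- are split by Young's inequality: weight 1/n on d, so that H stages amplify by at most (1 +
  -- 1/H)^H, and weight 1/12 on the variance, which becomes 1/4 after a factor 3.
  have h5 : 5 * (s * e) ≤ 1 / n * d + 25 / 4 * n * s ^ 2 := by
    rw [← he2]
    have h6 : 1 / n * e ^ 2 + 25 / 4 * n * s ^ 2 - 5 * (s * e) = 1 / n * (e - 5 / 2 * n * s) ^ 2 := by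
      field_simp; ring
    have h7 : 0 ≤ 1 / n * (e - 5 / 2 * n * s) ^ 2 := by positivity
    linarith
  have h9 : 5 * (s * w) ≤ 1 / 12 * w ^ 2 + 75 * s ^ 2 := by
    nlinarith [sq_nonneg (w - 30 * s)]
  have h10 : (75 + 14) * s ^ 2 + 25 / 4 * n * s ^ 2 ≤ 96 * n * y := by
    rw [hs2]
    nlinarith [mul_le_mul_of_nonneg_right hn hyn]
  rw [← hw2]
  linarith

end Vectors

end

section

open scoped Classical


variable {S A : Type*} [Fintype S] [Fintype A] {H : ℕ}

/-! ### Values by backward recursion -/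

/-- All rows of the transition model are probability vectors. -/
def IsStochastic (P : Model S A H) : Prop :=
  ∀ h s a, (∀ x, 0 ≤ P h s a x) ∧ ∑ x, P h s a x = 1

lemma MDP.isStochastic (M : MDP S A H) : IsStochastic M.model :=
  fun h s a => ⟨M.model_nonneg h s a, M.sum_model h s a⟩

lemma isStochastic_empirical [Nonempty S] (D : List (Episode S A H)) :
    IsStochastic (empirical D) :=
  fun h s a => ⟨empirical_nonneg D h s a, sum_empirical D h s a⟩

/-- The value function of a policy from stage `h` on. -/
def backV (P : Model S A H) (π : Policy S A H) (r : Table S A H) (h : ℕ) : S → ℝ :=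
  if hh : h < H then
    fun s => ∑ a, (π ⟨h, hh⟩ s).1 a * (r ⟨h, hh⟩ s a + expect (P ⟨h, hh⟩ s a) (backV P π r (h + 1)))
  else fun _ => 0
termination_by H - h

lemma backV_of_lt (P : Model S A H) (π : Policy S A H) (r : Table S A H) (h : Fin H) (s : S) :
    backV P π r h s =
      ∑ a, (π h s).1 a * (r h s a + expect (P h s a) (backV P π r (h + 1))) := by
  rw [backV, dif_pos h.2]

lemma backV_of_ge (P : Model S A H) (π : Policy S A H) (r : Table S A H) {h : ℕ} (hh : H ≤ h)
    (s : S) : backV P π r h s = 0 := by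
  rw [backV, dif_neg (by omega)]

lemma backV_toPolicy (P : Model S A H) (π : DetPolicy S A H) (r : Table S A H) (h : Fin H) (s : S) :
    backV P π.toPolicy r h s =
      r h s (π h s) + expect (P h s (π h s)) (backV P π.toPolicy r (h + 1)) := by
  rw [backV_of_lt]; simp

/-- Induction over the stages, from the last one to the first one. -/
lemma stage_induction {Q : ℕ → Prop} (hbase : Q H) (hstep : ∀ h : Fin H, Q (h + 1) → Q h) :
    ∀ h ≤ H, Q h := by
  have key : ∀ n h, h + n = H → Q h := by
    intro n
    induction n with
    | zero => intro h hh; obtain rfl : h = H := by omega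
              exact hbase
    | succ n ih => intro h hh; exact hstep ⟨h, by omega⟩ (ih (h + 1) (by omega))
  intro h hh
  exact key (H - h) h (by omega)

lemma occ_sum_action (P : Model S A H) (s₁ : S) (π : Policy S A H) (h : Fin H) (s : S) :
    ∑ a, occ P s₁ π h s a = stateOcc P s₁ π h s := by
  unfold occ
  rw [← Finset.mul_sum, (π h s).2.2, mul_one]

lemma sum_occ_expect (P : Model S A H) (s₁ : S) (π : Policy S A H) (h : Fin H) (W : S → ℝ) :
    ∑ s, ∑ a, occ P s₁ π h s a * expect (P h s a) W = ∑ y, stateOcc P s₁ π (h + 1) y * W y := by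
  simp only [stateOcc, dif_pos h.2, occ, expect, Finset.sum_mul, Finset.mul_sum]
  conv_rhs => rw [Finset.sum_comm]
  refine Finset.sum_congr rfl fun s _ => ?_
  conv_rhs => rw [Finset.sum_comm]
  exact Finset.sum_congr rfl fun a _ => Finset.sum_congr rfl fun y _ => by ring

/-- The mean of W_h under the occupancies telescopes along the stages. Taking for `W` the value
functions of the same model or of another model gives `value_eq_backV` and the simulation lemma. -/
lemma occ_telescope (P : Model S A H) (s₁ : S) (π : Policy S A H) (W : ℕ → S → ℝ)
    (hW : ∀ s, W H s = 0) :
    W 0 s₁ = ∑ h : Fin H, (∑ s, stateOcc P s₁ π h s * W h s -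
      ∑ s, ∑ a, occ P s₁ π h s a * expect (P h s a) (W (h + 1))) := by
  simp only [sum_occ_expect]
  rw [Fin.sum_univ_eq_sum_range (fun h => ∑ s, stateOcc P s₁ π h s * W h s -
    ∑ y, stateOcc P s₁ π (h + 1) y * W (h + 1) y) H,
    Finset.sum_range_sub' (fun h => ∑ s, stateOcc P s₁ π h s * W h s)]
  simp [hW, stateOcc]

lemma stateOcc_mul_backV (P P' : Model S A H) (s₁ : S) (π : Policy S A H) (r : Table S A H)
    (h : Fin H) : ∑ s, stateOcc P s₁ π h s * backV P' π r h s =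
      ∑ s, ∑ a, occ P s₁ π h s a * r h s a +
        ∑ s, ∑ a, occ P s₁ π h s a * expect (P' h s a) (backV P' π r (h + 1)) := by
  simp only [backV_of_lt, occ, ← Finset.sum_add_distrib, Finset.mul_sum]
  exact Finset.sum_congr rfl fun s _ => Finset.sum_congr rfl fun a _ => by ring

lemma value_eq_backV (P : Model S A H) (s₁ : S) (π : Policy S A H) (r : Table S A H) :
    value P s₁ π r = backV P π r 0 s₁ := by
  rw [occ_telescope P s₁ π (backV P π r) (fun s => backV_of_ge P π r le_rfl s)]
  unfold value
  refine Finset.sum_congr rfl fun h _ => ?_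
  rw [stateOcc_mul_backV]; ring

/-- The simulation lemma. -/
lemma value_sub_value (P P' : Model S A H) (s₁ : S) (π : Policy S A H) (r : Table S A H) :
    value P' s₁ π r - value P s₁ π r = ∑ h : Fin H, ∑ s, ∑ a, occ P s₁ π h s a *
      (expect (P' h s a) (backV P' π r (h + 1)) - expect (P h s a) (backV P' π r (h + 1))) := by
  rw [value_eq_backV P' s₁ π r,
    occ_telescope P s₁ π (backV P' π r) (fun s => backV_of_ge P' π r le_rfl s)]
  unfold value
  rw [← Finset.sum_sub_distrib]
  refine Finset.sum_congr rfl fun h _ => ?_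
  rw [stateOcc_mul_backV]
  simp only [mul_sub, Finset.sum_sub_distrib]
  ring

lemma stateOcc_nonneg {P : Model S A H} (hP : IsStochastic P) (s₁ : S) (π : Policy S A H) (h : ℕ)
    (s : S) : 0 ≤ stateOcc P s₁ π h s := by
  induction h generalizing s with
  | zero => unfold stateOcc; positivity
  | succ k ih =>
    unfold stateOcc
    split_ifs with hk
    · exact Finset.sum_nonneg fun x _ => Finset.sum_nonneg fun a _ =>
        mul_nonneg (mul_nonneg (ih x) ((π ⟨k, hk⟩ x).2.1 a)) ((hP ⟨k, hk⟩ x a).1 s)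
    · exact le_rfl

lemma sum_stateOcc {P : Model S A H} (hP : IsStochastic P) (s₁ : S) (π : Policy S A H) (h : ℕ)
    (hh : h ≤ H) : ∑ s, stateOcc P s₁ π h s = 1 := by
  induction h with
  | zero => simp [stateOcc]
  | succ k ih =>
    have h1 := sum_occ_expect P s₁ π ⟨k, hh⟩ (fun _ => 1)
    simp only [mul_one, expect_const (hP _ _ _).2, occ_sum_action] at h1
    rw [← h1, ih (by omega)]

lemma occ_nonneg {P : Model S A H} (hP : IsStochastic P) (s₁ : S) (π : Policy S A H) (h : Fin H)
    (s : S) (a : A) : 0 ≤ occ P s₁ π h s a :=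
  mul_nonneg (stateOcc_nonneg hP s₁ π h s) ((π h s).2.1 a)

lemma stateOcc_le_one {P : Model S A H} (hP : IsStochastic P) (s₁ : S) (π : Policy S A H) (h : ℕ)
    (hh : h ≤ H) (s : S) : stateOcc P s₁ π h s ≤ 1 := by
  rw [← sum_stateOcc hP s₁ π h hh]
  exact Finset.single_le_sum (fun x _ => stateOcc_nonneg hP s₁ π h x) (Finset.mem_univ s)

lemma value_nonneg {P : Model S A H} (hP : IsStochastic P) (s₁ : S) (π : Policy S A H)
    {r : Table S A H} (h : ∀ h s a, 0 ≤ r h s a) : 0 ≤ value P s₁ π r :=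
  Finset.sum_nonneg fun _ _ => Finset.sum_nonneg fun _ _ => Finset.sum_nonneg fun _ _ =>
    mul_nonneg (occ_nonneg hP _ _ _ _ _) (h _ _ _)

lemma value_add (P : Model S A H) (s₁ : S) (π : Policy S A H) (r r' : Table S A H) :
    value P s₁ π (fun h s a => r h s a + r' h s a) = value P s₁ π r + value P s₁ π r' := by
  simp only [value, mul_add, Finset.sum_add_distrib]

lemma value_smul (P : Model S A H) (s₁ : S) (π : Policy S A H) (c : ℝ) (r : Table S A H) :
    value P s₁ π (fun h s a => c * r h s a) = c * value P s₁ π r := by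
  simp only [value, Finset.mul_sum, mul_left_comm]

/-! ### Rewards with total mass at most one -/

/-- Nonnegative rewards whose sum along any trajectory is at most `1`. -/
def IsBudget (r : Table S A H) : Prop :=
  ∃ m : Fin H → ℝ, (∀ h s a, 0 ≤ r h s a ∧ r h s a ≤ m h) ∧ (∀ h, 0 ≤ m h) ∧ ∑ h, m h ≤ 1

lemma IsBudget.trajReturn_nonneg {r : Table S A H} (hr : IsBudget r) (e : Episode S A H) :
    0 ≤ trajReturn r e := by
  obtain ⟨m, h1, -, -⟩ := hr
  exact Finset.sum_nonneg fun h _ => (h1 _ _ _).1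

lemma IsBudget.trajReturn_le_one {r : Table S A H} (hr : IsBudget r) (e : Episode S A H) :
    trajReturn r e ≤ 1 := by
  obtain ⟨m, h1, -, h2⟩ := hr
  exact (Finset.sum_le_sum fun h _ => (h1 _ _ _).2).trans h2

/-- The rewards that can still be collected from stage `h` on. -/
def tailBudget (m : Fin H → ℝ) (h : ℕ) : ℝ := ∑ i : Fin H with h ≤ i.val, m i

lemma tailBudget_succ (m : Fin H → ℝ) (h : Fin H) :
    tailBudget m h = m h + tailBudget m (h + 1) := by
  unfold tailBudget
  have : (Finset.univ.filter fun i : Fin H => h.val ≤ i.val) =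
      insert h (Finset.univ.filter fun i : Fin H => h.val + 1 ≤ i.val) := by
    ext i
    simp only [Finset.mem_filter, Finset.mem_univ, true_and, Finset.mem_insert, Fin.ext_iff]
    omega
  rw [this, Finset.sum_insert (by simp)]

lemma tailBudget_end (m : Fin H → ℝ) : tailBudget m H = 0 := by
  unfold tailBudget
  refine Finset.sum_eq_zero fun i hi => ?_
  have := (Finset.mem_filter.1 hi).2
  omega

lemma tailBudget_nonneg {m : Fin H → ℝ} (hm : ∀ h, 0 ≤ m h) (h : ℕ) : 0 ≤ tailBudget m h :=
  Finset.sum_nonneg fun i _ => hm i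

lemma tailBudget_le {m : Fin H → ℝ} (hm : ∀ h, 0 ≤ m h) (h : ℕ) : tailBudget m h ≤ ∑ i, m i :=
  Finset.sum_le_sum_of_subset_of_nonneg (Finset.filter_subset _ _) fun i _ _ => hm i

lemma backV_nonneg {P : Model S A H} (hP : IsStochastic P) (π : Policy S A H) {r : Table S A H}
    (hr : ∀ h s a, 0 ≤ r h s a) : ∀ h ≤ H, ∀ s, 0 ≤ backV P π r h s := by
  refine stage_induction (fun s => (backV_of_ge P π r le_rfl s).ge) fun h ih s => ?_
  rw [backV_of_lt]
  exact Finset.sum_nonneg fun a _ => mul_nonneg ((π h s).2.1 a)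
    (add_nonneg (hr _ _ _) (expect_nonneg (hP h s a).1 ih))

lemma backV_le_tailBudget {P : Model S A H} (hP : IsStochastic P) (π : Policy S A H)
    {r : Table S A H} {m : Fin H → ℝ} (hr : ∀ h s a, r h s a ≤ m h) :
    ∀ h ≤ H, ∀ s, backV P π r h s ≤ tailBudget m h := by
  refine stage_induction (fun s => ?_) fun h ih s => ?_
  · rw [backV_of_ge P π r le_rfl, tailBudget_end]
  · rw [backV_of_lt, tailBudget_succ]
    calc _ ≤ ∑ a, (π h s).1 a * (m h + tailBudget m (h + 1)) := by
          refine Finset.sum_le_sum fun a _ => mul_le_mul_of_nonneg_left ?_ ((π h s).2.1 a)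
          exact add_le_add (hr _ _ _) (expect_le (hP h s a).1 (hP h s a).2 ih)
      _ = _ := by rw [← Finset.sum_mul, (π h s).2.2, one_mul]

/-- The one-step variances of the value function of a policy. -/
def varTable (P : Model S A H) (π : Policy S A H) (r : Table S A H) : Table S A H :=
  fun h s a => variance (P h s a) (backV P π r (h + 1))

/-- The law of total variance, as an upper bound. -/
lemma backV_varTable_le {P : Model S A H} (hP : IsStochastic P) (π : DetPolicy S A H)
    {r : Table S A H} {m : Fin H → ℝ} (hr : ∀ h s a, 0 ≤ r h s a ∧ r h s a ≤ m h)
    (hm : ∀ h, 0 ≤ m h) : ∀ h ≤ H, ∀ s,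
      backV P π.toPolicy (varTable P π.toPolicy r) h s + backV P π.toPolicy r h s ^ 2 ≤
        tailBudget m h * backV P π.toPolicy r h s := by
  refine stage_induction (fun s => ?_) fun h ih s => ?_
  · simp [backV_of_ge]
  · rw [backV_toPolicy, backV_toPolicy, tailBudget_succ]
    set a := π h s
    set p := P h s a with hp
    set V := backV P π.toPolicy r (h + 1) with hV
    set G := backV P π.toPolicy (varTable P π.toPolicy r) (h + 1) with hG
    set c := tailBudget m (h + 1) with hc
    have hc0 : 0 ≤ c := tailBudget_nonneg hm _
    -- The square of the value is carried in the induction hypothesis because it cancels the E V² in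
    -- the one-step variance; what remains is r² + 2 r E V, absorbed by r ≤ m and E V ≤ c.
    have h1 : expect p G + expect p (fun x => V x ^ 2) ≤ c * expect p V := by
      unfold expect
      rw [← Finset.sum_add_distrib, Finset.mul_sum]
      refine Finset.sum_le_sum fun x _ => ?_
      have := mul_le_mul_of_nonneg_left (ih x) ((hP h s a).1 x)
      calc _ = p x * (G x + V x ^ 2) := by ring
        _ ≤ _ := this
        _ = _ := by ring
    have h2 : varTable P π.toPolicy r h s a = expect p (fun x => V x ^ 2) - expect p V ^ 2 :=
      variance_eq (hP h s a).2 V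
    have h3 : expect p V ≤ c := expect_le (hP h s a).1 (hP h s a).2
      (backV_le_tailBudget hP π.toPolicy (fun h s a => (hr h s a).2) (h + 1) h.2)
    have h4 : 0 ≤ expect p V := expect_nonneg (hP h s a).1
      (backV_nonneg hP π.toPolicy (fun h s a => (hr h s a).1) (h + 1) h.2)
    obtain ⟨h5, h6⟩ := hr h s a
    rw [h2]
    nlinarith [mul_le_mul_of_nonneg_left h6 h5, mul_le_mul_of_nonneg_left h3 h5,
      mul_le_mul_of_nonneg_right h6 h4, mul_nonneg hc0 h5]

/-- With a budget of 1 the variances along a trajectory cost no more than the value itself. They can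
thus be charged to the value of the played policy, which yields the factor 5/4 in place of a √T
term. -/
lemma value_varTable_le {P : Model S A H} (hP : IsStochastic P) (s₁ : S) (π : DetPolicy S A H)
    {r : Table S A H} (hr : IsBudget r) :
    value P s₁ π.toPolicy (varTable P π.toPolicy r) ≤ value P s₁ π.toPolicy r := by
  obtain ⟨m, h1, h2, h3⟩ := hr
  have h := backV_varTable_le hP π h1 h2 0 (Nat.zero_le _) s₁
  have h4 := (tailBudget_le h2 0).trans h3
  have h5 := backV_nonneg hP π.toPolicy (fun h s a => (h1 h s a).1) 0 (Nat.zero_le _) s₁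
  rw [value_eq_backV, value_eq_backV]
  nlinarith [sq_nonneg (backV P π.toPolicy r 0 s₁)]

/-- Local errors add up like rewards under the true transitions, inflated by κ per stage; it is used
with κ = 1 + 1/H, so the total inflation is at most 3. -/
lemma unroll_recursion {P : Model S A H} (hP : IsStochastic P) (π : DetPolicy S A H)
    {g : Table S A H} (hg : ∀ h s a, 0 ≤ g h s a) {κ : ℝ} (hκ : 1 ≤ κ) (Δ : ℕ → S → ℝ)
    (hend : ∀ s, Δ H s ≤ 0)
    (hΔ : ∀ (h : Fin H) s, Δ h s ≤ g h s (π h s) + κ * expect (P h s (π h s)) (Δ (h + 1))) :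
    ∀ h ≤ H, ∀ s, Δ h s ≤ κ ^ (H - h) * backV P π.toPolicy g h s := by
  refine stage_induction (fun s => ?_) fun h ih s => ?_
  · rw [backV_of_ge P _ g le_rfl, mul_zero]; exact hend s
  · rw [backV_toPolicy]
    have hp := (hP h s (π h s)).1
    have e1 : H - h = (H - (h + 1)) + 1 := by omega
    calc Δ h s ≤ g h s (π h s) + κ * expect (P h s (π h s)) (Δ (h + 1)) := hΔ h s
      _ ≤ g h s (π h s) + κ * expect (P h s (π h s))
            (fun x => κ ^ (H - (h + 1)) * backV P π.toPolicy g (h + 1) x) := by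
          gcongr
          exact expect_mono hp ih
      _ = g h s (π h s) + κ ^ (H - h) * expect (P h s (π h s)) (backV P π.toPolicy g (h + 1)) := by
          rw [e1, pow_succ]
          unfold expect
          simp only [Finset.mul_sum]
          congr 1
          exact Finset.sum_congr rfl fun x _ => by ring
      _ ≤ κ ^ (H - h) * g h s (π h s) +
            κ ^ (H - h) * expect (P h s (π h s)) (backV P π.toPolicy g (h + 1)) := by
          gcongr
          exact le_mul_of_one_le_left (hg _ _ _) (one_le_pow₀ hκ)
      _ = _ := by ring

/-! ### UCBVI for one dataset and one reward -/

/-- The optimistic state values. -/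
def ucbV (D : List (Episode S A H)) (δ : ℝ) (r : Table S A H) (h : ℕ) : S → ℝ :=
  if hh : h < H then fun s => ⨆ b, ucbQ D δ r ⟨h, hh⟩ s b else fun _ => 0

lemma ucbV_of_lt (D : List (Episode S A H)) (δ : ℝ) (r : Table S A H) (h : Fin H) (s : S) :
    ucbV D δ r h s = ⨆ b, ucbQ D δ r h s b := by
  rw [ucbV, dif_pos h.2]

lemma ucbQ_le_ucbV (D : List (Episode S A H)) (δ : ℝ) (r : Table S A H) (h : Fin H) (s : S)
    (a : A) : ucbQ D δ r h s a ≤ ucbV D δ r h s := by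
  rw [ucbV_of_lt]
  exact le_ciSup (Set.finite_range _).bddAbove a

lemma ucbV_eq_ucbQ [Nonempty A] {sel : (A → ℝ) → A} (hsel : IsArgmaxRule sel)
    (D : List (Episode S A H)) (δ : ℝ) (r : Table S A H) (h : Fin H) (s : S) :
    ucbV D δ r h s = ucbQ D δ r h s (ucbviPolicy sel D δ r h s) := by
  refine le_antisymm ?_ (ucbQ_le_ucbV _ _ _ _ _ _)
  rw [ucbV_of_lt]
  exact ciSup_le fun b => hsel _ b

lemma ucbQ_of_count_pos (D : List (Episode S A H)) (δ : ℝ) (r : Table S A H) (h : Fin H) (s : S)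
    (a : A) (hh : (h : ℕ) + 1 < H) (hn : count D h s a ≠ 0) :
    ucbQ D δ r h s a = min (r h s a + expect (empirical D h s a) (ucbV D δ r (h + 1)) +
      bonus A H δ (count D h s a) (empirical D h s a) (ucbV D δ r (h + 1))) 1 := by
  have e : ucbV D δ r (h + 1) = fun x => ⨆ b, ucbQ D δ r ⟨h + 1, hh⟩ x b := by
    rw [ucbV, dif_pos hh]
  rw [ucbQ, dif_pos hh, if_neg hn, e]

lemma ucbQ_of_count_zero (D : List (Episode S A H)) (δ : ℝ) (r : Table S A H) (h : Fin H) (s : S)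
    (a : A) (hh : (h : ℕ) + 1 < H) (hn : count D h s a = 0) : ucbQ D δ r h s a = 1 := by
  rw [ucbQ, dif_pos hh, if_pos hn]

lemma ucbQ_last (D : List (Episode S A H)) (δ : ℝ) (r : Table S A H) (h : Fin H) (s : S)
    (a : A) (hh : ¬ (h : ℕ) + 1 < H) : ucbQ D δ r h s a = r h s a := by
  rw [ucbQ, dif_neg hh]

lemma IsBudget.nonneg {r : Table S A H} (hr : IsBudget r) (h : Fin H) (s : S) (a : A) :
    0 ≤ r h s a := by
  obtain ⟨m, h1, -, -⟩ := hr
  exact (h1 h s a).1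

lemma IsBudget.le_one {r : Table S A H} (hr : IsBudget r) (h : Fin H) (s : S) (a : A) :
    r h s a ≤ 1 := by
  obtain ⟨m, h1, h2, h3⟩ := hr
  exact (h1 h s a).2.trans
    ((Finset.single_le_sum (fun i _ => h2 i) (Finset.mem_univ h)).trans h3)

lemma ucbV_le_one [Nonempty A] (D : List (Episode S A H)) (δ : ℝ) {r : Table S A H}
    (hr : IsBudget r) (h : ℕ) (s : S) : ucbV D δ r h s ≤ 1 := by
  unfold ucbV
  split_ifs with hh
  · refine ciSup_le fun b => ?_
    by_cases h1 : h + 1 < H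
    · by_cases hn : count D ⟨h, hh⟩ s b = 0
      · rw [ucbQ_of_count_zero _ _ _ _ _ _ h1 hn]
      · rw [ucbQ_of_count_pos _ _ _ _ _ _ h1 hn]
        exact min_le_right _ _
    · rw [ucbQ_last _ _ _ _ _ _ h1]
      exact hr.le_one _ _ _
  · exact zero_le_one

lemma bonus_eq (A : Type*) [Fintype A] (H : ℕ) (δ : ℝ) (n : ℕ) (q V : S → ℝ) :
    bonus A H δ n q V =
      max (Real.sqrt (8 * variance q V * (ucbviThreshold S A H n δ / n)))
        (8 * (ucbviThreshold S A H n δ / n)) := by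
  unfold bonus
  rw [mul_div_assoc, mul_div_assoc]

/-- All the transition probabilities are in their confidence regions. -/
def HellGood (P : Model S A H) (D : List (Episode S A H)) (δ : ℝ) : Prop :=
  ∀ h s a, 0 < count D h s a →
    hell (empirical D h s a) (P h s a) ≤ ucbviThreshold S A H (count D h s a) δ / count D h s a

/-- Optimism, by backward induction with `expect_le_optimistic` at each stage. Truncating at 1 is
harmless since the budget keeps all true values below 1. -/
lemma backV_le_ucbV [Nonempty A] {P : Model S A H} (hP : IsStochastic P)
    {D : List (Episode S A H)} {δ : ℝ} (hD : HellGood P D δ) {r : Table S A H} (hr : IsBudget r)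
    (ρ : Policy S A H) : ∀ h ≤ H, ∀ s, backV P ρ r h s ≤ ucbV D δ r h s := by
  refine stage_induction (fun s => ?_) fun h ih s => ?_
  · rw [backV_of_ge P ρ r le_rfl, ucbV, dif_neg (lt_irrefl _)]
  · have hne : Nonempty S := ⟨s⟩
    obtain ⟨m, hm1, hm2, hm3⟩ := id hr
    have hub : ∀ k ≤ H, ∀ x, backV P ρ r k x ≤ 1 := fun k hk x =>
      (backV_le_tailBudget hP ρ (fun h s a => (hm1 h s a).2) k hk x).trans
        ((tailBudget_le hm2 k).trans hm3)
    have hnn := backV_nonneg hP ρ hr.nonneg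
    rw [backV_of_lt]
    have key : ∀ a, r h s a + expect (P h s a) (backV P ρ r (h + 1)) ≤ ucbV D δ r h s := by
      intro a
      refine le_trans ?_ (ucbQ_le_ucbV D δ r h s a)
      have hle1 : r h s a + expect (P h s a) (backV P ρ r (h + 1)) ≤ 1 := by
        have h1 : expect (P h s a) (backV P ρ r (h + 1)) ≤ tailBudget m (h + 1) :=
          expect_le (hP h s a).1 (hP h s a).2
            (backV_le_tailBudget hP ρ (fun h s a => (hm1 h s a).2) (h + 1) h.2)
        have h2 := (tailBudget_le hm2 h).trans hm3
        rw [tailBudget_succ] at h2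
        linarith [(hm1 h s a).2]
      by_cases h1 : (h : ℕ) + 1 < H
      · by_cases hn : count D h s a = 0
        · rw [ucbQ_of_count_zero _ _ _ _ _ _ h1 hn]
          exact hle1
        · rw [ucbQ_of_count_pos _ _ _ _ _ _ h1 hn]
          refine le_min ?_ hle1
          rw [add_assoc, bonus_eq]
          gcongr
          exact expect_le_optimistic (hP h s a).1 (hP h s a).2 (empirical_nonneg D h s a)
            (sum_empirical D h s a) (hnn (h + 1) h.2) (hub (h + 1) h.2) ih
            (hD h s a (Nat.pos_of_ne_zero hn))
      · rw [ucbQ_last _ _ _ _ _ _ h1]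
        have : backV P ρ r (h + 1) = fun _ => 0 := by
          funext x; exact backV_of_ge P ρ r (by omega) x
        rw [this, expect_const (hP h s a).2, add_zero]
    calc _ ≤ ∑ a, (ρ h s).1 a * ucbV D δ r h s :=
          Finset.sum_le_sum fun a _ => mul_le_mul_of_nonneg_left (key a) ((ρ h s).2.1 a)
      _ = _ := by rw [← Finset.sum_mul, (ρ h s).2.2, one_mul]

/-- The truncated width of the confidence regions. -/
def width (D : List (Episode S A H)) (δ : ℝ) : Table S A H :=
  fun h s a => if count D h s a = 0 then 1
    else min 1 (ucbviThreshold S A H (count D h s a) δ / count D h s a)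

lemma width_le_one (D : List (Episode S A H)) (δ : ℝ) (h : Fin H) (s : S) (a : A) :
    width D δ h s a ≤ 1 := by
  unfold width; split_ifs
  · exact le_rfl
  · exact min_le_left _ _

lemma one_add_one_div_pow_le (hH : 0 < H) : (1 + 1 / (H : ℝ)) ^ H ≤ 3 := by
  have hH' : (0 : ℝ) < H := by exact_mod_cast hH
  calc (1 + 1 / (H : ℝ)) ^ H ≤ Real.exp (1 / H) ^ H := by
        gcongr
        linarith [Real.add_one_le_exp (1 / (H : ℝ))]
    _ = Real.exp 1 := by
        rw [← Real.exp_nat_mul]; congr 1; field_simp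
    _ ≤ 3 := by linarith [Real.exp_one_lt_d9]

/-- The loss of the policy of UCBVI with respect to any policy. -/
theorem value_le_ucbvi [Nonempty A] {P : Model S A H} (hP : IsStochastic P) (hH : 0 < H) (s₁ : S)
    {sel : (A → ℝ) → A} (hsel : IsArgmaxRule sel) {D : List (Episode S A H)} {δ : ℝ}
    (hD : HellGood P D δ) (hwidth : ∀ h s a, 0 ≤ width D δ h s a)
    {r : Table S A H} (hr : IsBudget r) (ρ : Policy S A H) :
    value P s₁ ρ r ≤ 5 / 4 * value P s₁ (ucbviPolicy sel D δ r).toPolicy r +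
      288 * H * value P s₁ (ucbviPolicy sel D δ r).toPolicy (width D δ) := by
  have hH' : (1 : ℝ) ≤ H := by exact_mod_cast hH
  have hne : Nonempty S := ⟨s₁⟩
  set π := ucbviPolicy sel D δ r with hπ
  set Vp := backV P π.toPolicy r with hVp
  set Vb := ucbV D δ r with hVb
  -- The local error of `optimistic_gap` for n = H. After the inflation by 3 the coefficients become
  -- 1/4 and 288 H.
  let g : Table S A H := fun h s a =>
    1 / 12 * varTable P π.toPolicy r h s a + 96 * H * width D δ h s a
  have hvar : ∀ h s a, 0 ≤ varTable P π.toPolicy r h s a := fun h s a =>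
    variance_nonneg (hP h s a).1 _
  have hg : ∀ h s a, 0 ≤ g h s a := fun h s a => by
    have h1 := hvar h s a
    have h2 := hwidth h s a
    simp only [g]; positivity
  have hle := backV_le_ucbV hP hD hr π.toPolicy
  have hnn := backV_nonneg hP π.toPolicy hr.nonneg
  have hκ : (1 : ℝ) ≤ 1 + 1 / (H : ℝ) := by
    have : (0 : ℝ) ≤ 1 / (H : ℝ) := by positivity
    linarith
  have hun := unroll_recursion hP π hg hκ (fun h s => Vb h s - Vp h s)
    (fun s => by
      simp only [hVb, hVp]
      rw [ucbV, dif_neg (lt_irrefl _), backV_of_ge P _ r le_rfl, sub_zero])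
    (fun h s => by
      have e1 : Vb h s = ucbQ D δ r h s (π h s) := ucbV_eq_ucbQ hsel D δ r h s
      have e2 : Vp h s = r h s (π h s) + expect (P h s (π h s)) (Vp (h + 1)) :=
        backV_toPolicy P π r h s
      set a := π h s with ha
      have hp := hP h s a
      have hgap0 : 0 ≤ expect (P h s a) (fun x => Vb (h + 1) x - Vp (h + 1) x) :=
        expect_nonneg hp.1 fun x => sub_nonneg.2 (hle (h + 1) h.2 x)
      have hprod : 0 ≤ (1 + 1 / (H : ℝ)) *
          expect (P h s a) (fun x => Vb (h + 1) x - Vp (h + 1) x) :=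
        mul_nonneg (by linarith) hgap0
      -- Where the width is truncated, the gap is at most 1, already below 96 H.
      have hbig : width D δ h s a = 1 → Vb h s - Vp h s ≤ g h s a +
          (1 + 1 / (H : ℝ)) * expect (P h s a) (fun x => Vb (h + 1) x - Vp (h + 1) x) := by
        intro hw
        have h1 := hvar h s a
        have h2 : Vb h s ≤ 1 := ucbV_le_one D δ hr h s
        have h3 : 0 ≤ Vp h s := hnn h h.2.le s
        simp only [g, hw]
        linarith
      by_cases h1 : (h : ℕ) + 1 < H
      · by_cases hn : count D h s a = 0
        · exact hbig (by rw [width, if_pos hn])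
        · by_cases hx : ucbviThreshold S A H (count D h s a) δ / count D h s a ≤ 1
          · have hw : width D δ h s a = ucbviThreshold S A H (count D h s a) δ / count D h s a := by
              rw [width, if_neg hn, min_eq_right hx]
            rw [e1, e2, ucbQ_of_count_pos _ _ _ _ _ _ h1 hn, bonus_eq]
            have h2 := optimistic_gap hp.1 hp.2 (empirical_nonneg D h s a) (sum_empirical D h s a)
              (hnn (h + 1) h.2) (fun x => ucbV_le_one D δ hr (h + 1) x) (hle (h + 1) h.2)
              (hD h s a (Nat.pos_of_ne_zero hn)) hH'
            have h3 := min_le_left (r h s a + expect (empirical D h s a) (ucbV D δ r (h + 1)) +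
              max (Real.sqrt (8 * variance (empirical D h s a) (ucbV D δ r (h + 1)) *
                (ucbviThreshold S A H (count D h s a) δ / count D h s a)))
                (8 * (ucbviThreshold S A H (count D h s a) δ / count D h s a))) 1
            rw [← hw] at h2 h3
            simp only [g, varTable]
            rw [← hw]
            linarith
          · exact hbig (by rw [width, if_neg hn, min_eq_left (not_le.1 hx).le])
      · rw [e1, e2, ucbQ_last _ _ _ _ _ _ h1]
        have h2 := hg h s a
        have : Vp (h + 1) = fun _ => 0 := by
          funext x; exact backV_of_ge P _ r (by omega) x
        rw [this, expect_const hp.2, ← this]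
        linarith)
    0 (Nat.zero_le _) s₁
  have hρ := backV_le_ucbV hP hD hr ρ 0 (Nat.zero_le _) s₁
  have hg0 : 0 ≤ backV P π.toPolicy g 0 s₁ := backV_nonneg hP _ hg 0 (Nat.zero_le _) s₁
  have h3 : (1 + 1 / (H : ℝ)) ^ (H - 0) * backV P π.toPolicy g 0 s₁ ≤
      3 * backV P π.toPolicy g 0 s₁ :=
    mul_le_mul_of_nonneg_right (one_add_one_div_pow_le hH) hg0
  rw [← value_eq_backV] at h3 hg0
  have h4 : value P s₁ π.toPolicy g = 1 / 12 * value P s₁ π.toPolicy (varTable P π.toPolicy r) +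
      96 * H * value P s₁ π.toPolicy (width D δ) := by
    simp only [g]
    rw [value_add, value_smul, value_smul]
  have h5 := value_varTable_le hP s₁ π hr
  rw [value_eq_backV P s₁ ρ]
  rw [← value_eq_backV] at hun
  simp only [hVp, ← value_eq_backV] at hun
  linarith

end

section

open scoped Classical


variable {S A : Type*} [Fintype S] [Fintype A] {H : ℕ}

/-! ### The regret of UCBVI -/

lemma log_conf_nonneg [Nonempty S] [Nonempty A] (hH : 0 < H) {δ : ℝ} (hδ : 0 < δ) (hδ1 : δ ≤ 1) :
    Real.log (2 / δ) ≤ Real.log (2 * Fintype.card S * Fintype.card A * H / δ) ∧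
      0 ≤ Real.log (2 / δ) := by
  have h1 : (1 : ℝ) ≤ Fintype.card S := by exact_mod_cast Fintype.card_pos
  have h2 : (1 : ℝ) ≤ Fintype.card A := by exact_mod_cast Fintype.card_pos
  have h3 : (1 : ℝ) ≤ H := by exact_mod_cast hH
  refine ⟨Real.log_le_log (by positivity) ?_, Real.log_nonneg ?_⟩
  · gcongr
    have := one_le_mul_of_one_le_of_one_le (one_le_mul_of_one_le_of_one_le h1 h2) h3
    nlinarith
  · rw [le_div_iff₀ hδ]; linarith

lemma log_eight_mul (n : ℕ) :
    Real.log (8 * Real.exp 1 * ((n : ℝ) + 1)) = Real.log 8 + 1 + Real.log (n + 1) := by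
  rw [Real.log_mul (by positivity) (by positivity), Real.log_mul (by norm_num) (by positivity),
    Real.log_exp]

lemma ucbviThreshold_mono (δ : ℝ) {n n' : ℕ} (h : n ≤ n') :
    ucbviThreshold S A H n δ ≤ ucbviThreshold S A H n' δ := by
  unfold ucbviThreshold
  gcongr

lemma ucbviThreshold_nonneg [Nonempty S] [Nonempty A] (hH : 0 < H) {δ : ℝ} (hδ : 0 < δ)
    (hδ1 : δ ≤ 1) (n : ℕ) : 0 ≤ ucbviThreshold S A H n δ := by
  obtain ⟨h1, h2⟩ := log_conf_nonneg (S := S) (A := A) hH hδ hδ1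
  unfold ucbviThreshold
  rw [log_eight_mul]
  have h3 : 0 ≤ Real.log 8 := Real.log_nonneg (by norm_num)
  have h4 : 0 ≤ Real.log ((n : ℝ) + 1) := Real.log_nonneg (by linarith [Nat.cast_nonneg (α := ℝ) n])
  have h5 := h2.trans h1
  positivity

lemma width_nonneg [Nonempty S] [Nonempty A] (hH : 0 < H) {δ : ℝ} (hδ : 0 < δ) (hδ1 : δ ≤ 1)
    (D : List (Episode S A H)) (h : Fin H) (s : S) (a : A) : 0 ≤ width D δ h s a := by
  unfold width
  split_ifs
  · exact zero_le_one
  · exact le_min zero_le_one (div_nonneg (ucbviThreshold_nonneg hH hδ hδ1 _) (Nat.cast_nonneg _))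

/-- The sum of the widths met in the first `n` visits. -/
def widthSum (S A : Type*) [Fintype S] [Fintype A] (H : ℕ) (δ : ℝ) (N : ℕ) : ℝ :=
  ∑ n ∈ Finset.range N, if n = 0 then 1 else min 1 (ucbviThreshold S A H n δ / n)

/-- The width met at a triplet depends only on the number of its earlier visits, so the sum over
time is regrouped triplet by triplet. -/
lemma pathSum_width (δ : ℝ) (D : List (Episode S A H)) :
    pathSum (fun D e => trajReturn (width D δ) e) D =
      ∑ h : Fin H, ∑ s, ∑ a, widthSum S A H δ (count D h s a) := by
  induction D using List.reverseRecOn with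
  | nil => simp [widthSum]
  | append_singleton D e ih =>
    rw [pathSum_append, ih]
    unfold trajReturn
    rw [← Finset.sum_add_distrib]
    refine Finset.sum_congr rfl fun h _ => ?_
    have h1 : ∀ s a, widthSum S A H δ (count (D ++ [e]) h s a) =
        widthSum S A H δ (count D h s a) +
          if s = e.state h.castSucc then (if a = e.action h then width D δ h s a else 0) else 0 := by
      intro s a
      rw [count_append]
      by_cases h2 : e.state h.castSucc = s
      · by_cases h3 : e.action h = a
        · rw [if_pos ⟨h2, h3⟩, if_pos h2.symm, if_pos h3.symm, widthSum, Finset.sum_range_succ]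
          rfl
        · rw [if_neg (fun h' => h3 h'.2), if_pos h2.symm, if_neg (fun h' => h3 h'.symm)]; simp
      · rw [if_neg (fun h' => h2 h'.1), if_neg (fun h' => h2 h'.symm)]; simp
    simp only [h1, Finset.sum_add_distrib]
    congr 1
    simp

/-- The first visit costs 1 and the others form a harmonic sum. -/
lemma widthSum_le [Nonempty S] [Nonempty A] (hH : 0 < H) {δ : ℝ} (hδ : 0 < δ) (hδ1 : δ ≤ 1)
    {N T : ℕ} (hN : N ≤ T) : widthSum S A H δ N ≤
      1 + ucbviThreshold S A H T δ * (1 + Real.log (T + 1)) := by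
  have hb := ucbviThreshold_nonneg (S := S) (A := A) hH hδ hδ1 T
  have h1 : widthSum S A H δ N ≤ ∑ n ∈ Finset.range (T + 1),
      ((if n = 0 then 1 else 0) + ucbviThreshold S A H T δ * (if n = 0 then 0 else (n : ℝ)⁻¹)) := by
    refine le_trans (Finset.sum_le_sum fun n hn => ?_)
      (Finset.sum_le_sum_of_subset_of_nonneg (Finset.range_mono (Nat.le_succ_of_le hN)) ?_)
    · have hn' : n < N := Finset.mem_range.1 hn
      split_ifs with h0
      · simp
      · refine (min_le_right _ _).trans ?_
        rw [zero_add, div_eq_mul_inv]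
        gcongr
        exact ucbviThreshold_mono δ (by omega)
    · intro n _ _
      split_ifs
      · simp
      · positivity
  refine h1.trans ?_
  rw [Finset.sum_add_distrib, ← Finset.mul_sum]
  have h2 : ∑ n ∈ Finset.range (T + 1), (if n = 0 then (1 : ℝ) else 0) = 1 := by simp
  have h3 : ∑ n ∈ Finset.range (T + 1), (if n = 0 then (0 : ℝ) else (n : ℝ)⁻¹) =
      ((harmonic T : ℚ) : ℝ) := by
    rw [Finset.sum_range_succ', harmonic]
    push_cast
    simp
  rw [h2, h3]
  gcongr
  refine (harmonic_le_one_add_log T).trans ?_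
  rcases Nat.eq_zero_or_pos T with h0 | h0
  · simp [h0]
  · gcongr; linarith

lemma regret_arith [Nonempty S] [Nonempty A] (hH : 0 < H) {δ : ℝ} (hδ : 0 < δ) (hδ1 : δ ≤ 1)
    {T : ℕ} (hT : 0 < T) :
    288 * (H : ℝ) * (8 / 5 * (Fintype.card S * Fintype.card A * H *
      (1 + ucbviThreshold S A H T δ * (1 + Real.log (T + 1))) + H * Real.log (2 / δ))) ≤
      ucbviRegret S A H δ T := by
  obtain ⟨hl1, hl0⟩ := log_conf_nonneg (S := S) (A := A) hH hδ hδ1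
  have h1 : (1 : ℝ) ≤ Fintype.card S := by exact_mod_cast Fintype.card_pos
  have h2 : (1 : ℝ) ≤ Fintype.card A := by exact_mod_cast Fintype.card_pos
  have h3 : (1 : ℝ) ≤ H := by exact_mod_cast hH
  have hT' : (1 : ℝ) ≤ T := by exact_mod_cast hT
  unfold ucbviRegret ucbviThreshold
  rw [log_eight_mul]
  set l := Real.log (2 * Fintype.card S * Fintype.card A * H / δ) with hl
  set y := Real.log ((T : ℝ) + 1) with hy
  -- As T ≥ 1, log(T+1) ≥ log 2. Hence (1 + y)² and 1 are bounded by multiples of y², and everything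
  -- fits under the single factor log(T+1)².
  have hy0 : 0.69 ≤ y := by
    have : Real.log 2 ≤ y := Real.log_le_log (by norm_num) (by linarith)
    linarith [Real.log_two_gt_d9]
  have h8 : Real.log 8 ≤ 2.1 := by
    rw [show (8 : ℝ) = 2 ^ 3 by norm_num, Real.log_pow]
    have := Real.log_two_lt_d9
    push_cast; linarith
  have h80 : 0 ≤ Real.log 8 := Real.log_nonneg (by norm_num)
  set s : ℝ := (Fintype.card S : ℝ) with hs
  set k : ℝ := (Fintype.card A : ℝ) with hk
  have hsk : 1 ≤ s * k := one_le_mul_of_one_le_of_one_le h1 h2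
  have hl0' : 0 ≤ l := hl0.trans hl1
  have hQ : 6 ≤ l + 6 * s := by linarith
  have hb0 : 0 ≤ l + s * (Real.log 8 + 1 + y) := by positivity
  have hb : l + s * (Real.log 8 + 1 + y) ≤ (l + 6 * s) * (1 + y) := by nlinarith
  have hscal : 288 * (8 / 5) * (1 + (l + s * (Real.log 8 + 1 + y)) * (1 + y) + l) ≤
      65536 * (l + 6 * s) * y ^ 2 := by
    have e1 : (l + s * (Real.log 8 + 1 + y)) * (1 + y) ≤ (l + 6 * s) * (1 + y) * (1 + y) := by
      gcongr
    have e2 : (1 + y) * (1 + y) ≤ 6.1 * y ^ 2 := by nlinarith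
    have e3 : (l + 6 * s) * (1 + y) * (1 + y) ≤ (l + 6 * s) * (6.1 * y ^ 2) := by
      rw [mul_assoc]; gcongr
    have e4 : (1 : ℝ) ≤ 2.2 * y ^ 2 := by nlinarith
    have e5 : 1 + l ≤ (l + 6 * s) * (2.2 * y ^ 2) :=
      (by linarith : 1 + l ≤ l + 6 * s).trans (le_mul_of_one_le_right (by linarith) e4)
    have e6 : 0 ≤ (l + 6 * s) * y ^ 2 := by positivity
    nlinarith
  have hHl : H * Real.log (2 / δ) ≤ s * k * H * l := by
    calc H * Real.log (2 / δ) ≤ H * l := by gcongr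
      _ ≤ (s * k) * (H * l) := le_mul_of_one_le_left (by positivity) hsk
      _ = _ := by ring
  calc 288 * (H : ℝ) * (8 / 5 * (s * k * H *
        (1 + (l + s * (Real.log 8 + 1 + y)) * (1 + y)) + H * Real.log (2 / δ)))
      ≤ 288 * (H : ℝ) * (8 / 5 * (s * k * H * (1 + (l + s * (Real.log 8 + 1 + y)) * (1 + y)) + s * k * H * l)) := by gcongr
    _ = (s * k * (H : ℝ) ^ 2) *
        (288 * (8 / 5) * (1 + (l + s * (Real.log 8 + 1 + y)) * (1 + y) + l)) := by ring
    _ ≤ (s * k * (H : ℝ) ^ 2) * (65536 * (l + 6 * s) * y ^ 2) := by gcongr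
    _ = _ := by ring

variable [MeasurableSpace S] [DiscreteMeasurableSpace S]

/-- UCBVI with rewards chosen from the past and its own data. -/
def ucbviAlg (sel : (A → ℝ) → A) (δ : ℝ) (rew : List (Episode S A H) → Table S A H) :
    List (Episode S A H) → DetPolicy S A H :=
  fun D => ucbviPolicy sel D δ (rew D)

/-- The rewards may depend on the past because the confidence regions concern the transitions only.
The sum runs over an arbitrary set `I` of rounds: the loss is bounded round by round through
nonnegative widths, so restricting to `I` is free. CovGame needs this for the rounds spent at one
level. -/
theorem law_ucbvi_regret [Nonempty A] (M : MDP S A H) (hH : 0 < H) {sel : (A → ℝ) → A}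
    (hsel : IsArgmaxRule sel) {δ : ℝ} (hδ : 0 < δ) (hδ1 : δ ≤ 1)
    (rew : List (Episode S A H) → Table S A H) (hr : ∀ D, IsBudget (rew D)) :
    M.law {ω | ¬ ∀ T, ∀ I ⊆ Finset.range T, ∀ ρ : Policy S A H,
      ∑ t ∈ I, value M.model M.init ρ (rew (runData (ucbviAlg sel δ rew) (M.env ω) t)) ≤
      5 / 4 * ∑ t ∈ I, value M.model M.init
        (ucbviAlg sel δ rew (runData (ucbviAlg sel δ rew) (M.env ω) t)).toPolicy
        (rew (runData (ucbviAlg sel δ rew) (M.env ω) t)) + ucbviRegret S A H δ T} ≤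
      ENNReal.ofReal δ := by
  have hne : Nonempty S := ⟨M.init⟩
  have hH' : (0 : ℝ) < H := by exact_mod_cast hH
  set alg := ucbviAlg sel δ rew with halg
  have hw0 := fun D : List (Episode S A H) => width_nonneg hH hδ hδ1 D
  -- The widths sum to at most H along an episode; the scaling brings returns into [0,1], as the
  -- supermartingale requires.
  let tab : List (Episode S A H) → Table S A H := fun D h s a => (H : ℝ)⁻¹ * width D δ h s a
  have htab : ∀ D e, trajReturn (tab D) e = (H : ℝ)⁻¹ * trajReturn (width D δ) e := by
    intro D e
    simp only [trajReturn, tab, Finset.mul_sum]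
  have hret0 : ∀ D e, 0 ≤ trajReturn (tab D) e := by
    intro D e
    rw [htab]
    exact mul_nonneg (by positivity) (Finset.sum_nonneg fun h _ => hw0 D _ _ _)
  have hret1 : ∀ D e, trajReturn (tab D) e ≤ 1 := by
    intro D e
    rw [htab, inv_mul_le_iff₀ hH', mul_one]
    calc trajReturn (width D δ) e ≤ ∑ _h : Fin H, (1 : ℝ) :=
          Finset.sum_le_sum fun h _ => width_le_one D δ _ _ _
      _ = H := by simp
  have hA := law_hell M hH alg (half_pos hδ)
  have hB := sum_value_le_sum_return M alg tab hret0 hret1 (half_pos hδ)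
  have hsum : ENNReal.ofReal δ = ENNReal.ofReal (δ / 2) + ENNReal.ofReal (δ / 2) := by
    rw [← ENNReal.ofReal_add (by positivity) (by positivity), add_halves]
  rw [hsum]
  refine le_trans (measure_mono ?_) ((measure_union_le _ _).trans (add_le_add hA hB))
  intro ω hω
  by_contra hcon
  simp only [Set.mem_union, Set.mem_ofPred_eq, not_or, not_exists, not_not, not_le] at hcon
  obtain ⟨hell, hmart⟩ := hcon
  refine hω fun T I hI ρ => ?_
  set D : ℕ → List (Episode S A H) := runData alg (M.env ω) with hD
  -- At `T = 0` the regret rate vanishes and `regret_arith` is unavailable, but the sums are empty.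
  rcases Nat.eq_zero_or_pos T with rfl | hT
  · obtain rfl : I = ∅ := by simpa using hI
    simp [ucbviRegret]
  have hgood : ∀ t, HellGood M.model (D t) δ := by
    intro t h s a hn
    have hn' : (0 : ℝ) < count (D t) h s a := by exact_mod_cast hn
    rw [le_div_iff₀ hn', mul_comm]
    refine (hell t h s a hn).trans ?_
    unfold ucbviThreshold
    rw [log_eight_mul]
    have e1 : (Fintype.card S : ℝ) * Fintype.card A * H / (δ / 2) =
        2 * Fintype.card S * Fintype.card A * H / δ := by field_simp
    rw [e1]
    gcongr
    have : 0 ≤ Real.log 8 := Real.log_nonneg (by norm_num)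
    linarith
  have hstep := fun t => value_le_ucbvi M.isStochastic hH M.init hsel (hgood t) (hw0 (D t))
    (hr (D t)) ρ
  have hw := hmart T
  have hvw : ∀ t, value M.model M.init (alg (D t)).toPolicy (tab (D t)) =
      (H : ℝ)⁻¹ * value M.model M.init (alg (D t)).toPolicy (width (D t) δ) :=
    fun t => value_smul _ _ _ _ _
  simp only [hvw, htab, ← Finset.mul_sum] at hw
  have hpath := pathSum_runData (fun D e => trajReturn (width D δ) e) alg (M.env ω) T
  rw [pathSum_width] at hpath
  have hpig : ∑ t ∈ Finset.range T, trajReturn (width (D t) δ) (M.env ω t (alg (D t))) ≤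
      Fintype.card S * Fintype.card A * H *
        (1 + ucbviThreshold S A H T δ * (1 + Real.log (T + 1))) := by
    rw [← hpath]
    calc _ ≤ ∑ _h : Fin H, ∑ _s : S, ∑ _a : A,
          (1 + ucbviThreshold S A H T δ * (1 + Real.log (T + 1))) := by
          refine Finset.sum_le_sum fun h _ => Finset.sum_le_sum fun s _ =>
            Finset.sum_le_sum fun a _ => widthSum_le hH hδ hδ1 ?_
          refine (count_le_length _ _ _ _).trans (length_runData _ _ _).le
      _ = _ := by
          simp only [Finset.sum_const, Finset.card_univ, Fintype.card_fin, nsmul_eq_mul]; ring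
  have hwtot : ∑ t ∈ Finset.range T, value M.model M.init (alg (D t)).toPolicy (width (D t) δ) ≤
      8 / 5 * (Fintype.card S * Fintype.card A * H *
        (1 + ucbviThreshold S A H T δ * (1 + Real.log (T + 1))) + H * Real.log (2 / δ)) := by
    rw [inv_mul_lt_iff₀ hH'] at hw
    refine hw.le.trans ?_
    have e1 : (1 : ℝ) / (δ / 2) = 2 / δ := by field_simp
    rw [e1]
    have e2 : ∀ z : ℝ, (H : ℝ) * (8 / 5 * ((H : ℝ)⁻¹ * z + Real.log (2 / δ))) =
        8 / 5 * (z + H * Real.log (2 / δ)) := fun z => by field_simp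
    rw [e2]
    gcongr
  have hwI : ∑ t ∈ I, value M.model M.init (alg (D t)).toPolicy (width (D t) δ) ≤
      ∑ t ∈ Finset.range T, value M.model M.init (alg (D t)).toPolicy (width (D t) δ) :=
    Finset.sum_le_sum_of_subset_of_nonneg hI fun t _ _ =>
      value_nonneg M.isStochastic _ _ (hw0 (D t))
  have har := regret_arith (S := S) (A := A) hH hδ hδ1 hT
  calc ∑ t ∈ I, value M.model M.init ρ (rew (D t))
      ≤ ∑ t ∈ I, (5 / 4 * value M.model M.init (alg (D t)).toPolicy (rew (D t)) +
          288 * H * value M.model M.init (alg (D t)).toPolicy (width (D t) δ)) :=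
        Finset.sum_le_sum fun t _ => hstep t
    _ = 5 / 4 * ∑ t ∈ I, value M.model M.init (alg (D t)).toPolicy (rew (D t)) +
          288 * H * ∑ t ∈ I, value M.model M.init (alg (D t)).toPolicy (width (D t) δ) := by
        rw [Finset.sum_add_distrib, ← Finset.mul_sum, ← Finset.mul_sum]
    _ ≤ _ := by
        gcongr
        refine le_trans ?_ har
        gcongr
        exact hwI.trans hwtot

end

section

open scoped Classical


/-! ### Comparison of squared logarithms and linear functions -/

/-- Write log z = 4 log z^(1/4) and use log w ≤ w. -/
lemma log_sq_le_sqrt {z : ℝ} (hz : 1 ≤ z) : Real.log z ^ 2 ≤ 16 * Real.sqrt z := by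
  set w := Real.sqrt (Real.sqrt z) with hw
  have hw1 : 1 ≤ w := by
    rw [hw, Real.one_le_sqrt, Real.one_le_sqrt]; exact hz
  have hw2 : w ^ 2 = Real.sqrt z := Real.sq_sqrt (Real.sqrt_nonneg _)
  have hz' : z = w ^ 4 := by
    rw [show w ^ 4 = (w ^ 2) ^ 2 by ring, hw2, Real.sq_sqrt (by linarith)]
  have h1 : Real.log z = 4 * Real.log w := by rw [hz', Real.log_pow]; norm_num
  have h2 : Real.log w ≤ w := (Real.log_le_sub_one_of_pos (by linarith)).trans (by linarith)
  have h3 : 0 ≤ Real.log w := Real.log_nonneg hw1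
  rw [h1, ← hw2]
  nlinarith

/-- It makes the set that defines `reachEpisodes` nonempty, and it is what forces CovGame to
terminate. -/
lemma exists_log_sq_le {c d e : ℝ} (hc : 0 ≤ c) (hd : 0 ≤ d) (he : 0 < e) :
    ∃ T : ℕ, c * Real.log (T + 1) ^ 2 + d ≤ e * T := by
  obtain ⟨m, hm⟩ := exists_nat_ge ((16 * c + d + e) / e)
  have hm1 : (1 : ℝ) ≤ m := by
    refine le_trans ?_ hm
    rw [le_div_iff₀ he]; linarith
  have hm1' : 1 ≤ m := by exact_mod_cast hm1
  -- Then `T + 1` is a perfect square and the squared logarithm is at most 16 m.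
  refine ⟨m ^ 2 - 1, ?_⟩
  have hcast : ((m ^ 2 - 1 : ℕ) : ℝ) = (m : ℝ) ^ 2 - 1 := by
    rw [Nat.cast_sub (Nat.one_le_pow _ _ hm1')]; push_cast; ring
  rw [hcast, sub_add_cancel]
  have h1 := log_sq_le_sqrt (z := (m : ℝ) ^ 2) (by nlinarith)
  rw [Real.sqrt_sq (by linarith)] at h1
  rw [div_le_iff₀ he] at hm
  nlinarith [mul_le_mul_of_nonneg_left h1 hc]

variable {S A : Type*} [Fintype S] [Fintype A] {H : ℕ}

/-! ### Estimation of the reachability -/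

lemma isBudget_reachReward (h : Fin H) (s : S) : IsBudget (reachReward A h s) := by
  refine ⟨fun g => if g = h then 1 else 0, fun g x a => ?_, fun g => ?_, ?_⟩
  · unfold reachReward
    by_cases h1 : g = h <;> by_cases h2 : x = s <;> simp [h1, h2]
  · positivity
  · simp

lemma reachData_eq_runData [MeasurableSpace S] [DiscreteMeasurableSpace S] (sel : (A → ℝ) → A)
    (env : Env S A H) (δ : ℝ) (h : Fin H) (s : S)
    (t : ℕ) : reachData sel env δ h s t =
      runData (ucbviAlg sel (δ / 2) fun _ => reachReward A h s) env t := by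
  induction t with
  | zero => rfl
  | succ t ih => rw [reachData, runData, ih]; rfl

lemma trajReturn_reachReward (h : Fin H) (s : S) (e : Episode S A H) :
    trajReturn (reachReward A h s) e = if e.state h.castSucc = s then 1 else 0 := by
  unfold trajReturn reachReward
  rw [Finset.sum_eq_single h]
  · simp
  · intro b _ hb; simp [hb]
  · simp

lemma pathSum_reachReward (h : Fin H) (s : S) (D : List (Episode S A H)) :
    pathSum (fun _ e => trajReturn (reachReward A h s) e) D = visits D h s := by
  induction D using List.reverseRecOn with
  | nil => simp [visits]
  | append_singleton D e ih =>
    rw [pathSum_append, ih, visits_append, trajReturn_reachReward]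
    push_cast; rfl

lemma value_reachReward (P : Model S A H) (s₁ : S) (π : Policy S A H) (h : Fin H) (s : S) :
    value P s₁ π (reachReward A h s) = stateOcc P s₁ π h s := by
  unfold value reachReward
  rw [Finset.sum_eq_single h, Finset.sum_eq_single s]
  · simp [occ_sum_action]
  · intro x _ hx; simp [hx]
  · simp
  · intro b _ hb; simp [hb]
  · simp

lemma bddAbove_stateOcc (M : MDP S A H) (h : Fin H) (s : S) :
    BddAbove (Set.range fun π : Policy S A H => stateOcc M.model M.init π h s) := by
  refine ⟨1, ?_⟩
  rintro _ ⟨π, rfl⟩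
  exact stateOcc_le_one M.isStochastic _ _ _ h.2.le _

lemma stateOcc_le_maxReach (M : MDP S A H) (π : Policy S A H) (h : Fin H) (s : S) :
    stateOcc M.model M.init π h s ≤ M.maxReach h s :=
  le_ciSup (bddAbove_stateOcc M h s) π

instance [Nonempty A] : Nonempty (Policy S A H) :=
  ⟨DetPolicy.toPolicy fun _ _ => Classical.arbitrary A⟩

lemma maxReach_le_one [Nonempty A] (M : MDP S A H) (h : Fin H) (s : S) : M.maxReach h s ≤ 1 :=
  ciSup_le fun _ => stateOcc_le_one M.isStochastic _ _ _ h.2.le _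

lemma maxReach_nonneg [Nonempty A] (M : MDP S A H) (h : Fin H) (s : S) : 0 ≤ M.maxReach h s :=
  (stateOcc_nonneg M.isStochastic _ (Classical.arbitrary _) _ _).trans
    (stateOcc_le_maxReach M (Classical.arbitrary _) h s)

lemma ucbviRegret_nonneg [Nonempty S] [Nonempty A] (hH : 0 < H) {δ : ℝ} (hδ : 0 < δ) (hδ1 : δ ≤ 1)
    (T : ℕ) : 0 ≤ ucbviRegret S A H δ T := by
  obtain ⟨h1, h2⟩ := log_conf_nonneg (S := S) (A := A) hH hδ hδ1
  have h3 := h2.trans h1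
  unfold ucbviRegret
  positivity

/-- The infimum is attained, since the set is not empty; `T = 0` is excluded because log(4/δ) > 0.
Positivity is needed as the estimates divide by `T`. -/
lemma reachEpisodes_spec [Nonempty S] [Nonempty A] (hH : 0 < H) {ε₀ δ : ℝ} (hε : 0 < ε₀)
    (hδ : 0 < δ) (hδ1 : δ ≤ 1) :
    4 * ucbviRegret S A H (δ / 2) (reachEpisodes S A H ε₀ δ) + 6 * Real.log (4 / δ) ≤
      ε₀ / 4 * reachEpisodes S A H ε₀ δ ∧ 0 < reachEpisodes S A H ε₀ δ := by
  have hl : 0 < Real.log (4 / δ) := Real.log_pos (by rw [lt_div_iff₀ hδ]; linarith)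
  have hmem : 4 * ucbviRegret S A H (δ / 2) (reachEpisodes S A H ε₀ δ) + 6 * Real.log (4 / δ) ≤
      ε₀ / 4 * reachEpisodes S A H ε₀ δ := by
    refine Nat.sInf_mem (s := {T : ℕ | 4 * ucbviRegret S A H (δ / 2) T + 6 * Real.log (4 / δ) ≤
      ε₀ / 4 * T}) ?_
    obtain ⟨h1, h2⟩ := log_conf_nonneg (S := S) (A := A) hH (half_pos hδ) (by linarith)
    have h3 := h2.trans h1
    obtain ⟨T, hT⟩ := exists_log_sq_le (c := 4 * (65536 * Fintype.card S * Fintype.card A *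
      (H : ℝ) ^ 2 * (Real.log (2 * Fintype.card S * Fintype.card A * H / (δ / 2)) +
      6 * Fintype.card S))) (d := 6 * Real.log (4 / δ)) (e := ε₀ / 4) (by positivity) (by positivity)
      (by positivity)
    refine ⟨T, le_trans (le_of_eq ?_) hT⟩
    unfold ucbviRegret; ring
  refine ⟨hmem, Nat.pos_of_ne_zero fun h0 => ?_⟩
  rw [h0] at hmem
  simp [ucbviRegret] at hmem
  linarith

/-- The upper bound exceeds the lower bound by a bounded factor, up to the precision. -/
lemma reachUpper_le (sel : (A → ℝ) → A) (env : Env S A H) (ε₀ δ : ℝ) (h : Fin H) (s : S) :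
    reachUpper sel env ε₀ δ h s ≤ 4 * reachLower sel env ε₀ δ h s + ε₀ / 2 := by
  unfold reachUpper reachLower
  refine (min_le_left _ _).trans ?_
  have h1 := le_max_left ((visits (reachData sel env δ h s (reachEpisodes S A H ε₀ δ)) h s : ℝ) /
    (2 * reachEpisodes S A H ε₀ δ) - ε₀ / 16) 0
  have h2 : 2 * (visits (reachData sel env δ h s (reachEpisodes S A H ε₀ δ)) h s : ℝ) /
      (reachEpisodes S A H ε₀ δ) = 4 * ((visits (reachData sel env δ h s
        (reachEpisodes S A H ε₀ δ)) h s : ℝ) / (2 * reachEpisodes S A H ε₀ δ)) := by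
    ring
  linarith

variable [MeasurableSpace S] [DiscreteMeasurableSpace S]

/-- Let W be the reachability, V the summed values of the played policies and n the visits. The
regret gives T W ≤ (5/4) V + R, concentration gives V ≤ (8/5)(n + log(4/δ)) and n ≤ (7/4) V +
log(4/δ), and V ≤ T W. So W ≤ 2n/T and n/(2T) ≤ (7/8) W, up to errors which the choice of T makes at
most ε₀/4 and ε₀/16. -/
theorem law_reach [Nonempty A] (M : MDP S A H) (hH : 0 < H) {sel : (A → ℝ) → A}
    (hsel : IsArgmaxRule sel) {ε₀ δ : ℝ} (hε : 0 < ε₀) (hδ : 0 < δ) (hδ1 : δ ≤ 1)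
    (h : Fin H) (s : S) :
    M.law {ω | ¬ (reachLower sel (M.env ω) ε₀ δ h s ≤ M.maxReach h s ∧
      M.maxReach h s ≤ reachUpper sel (M.env ω) ε₀ δ h s)} ≤ ENNReal.ofReal δ := by
  have hne : Nonempty S := ⟨M.init⟩
  set r := reachReward A h s with hr
  set alg := ucbviAlg (H := H) sel (δ / 2) (fun _ => r) with halg
  have hb : IsBudget r := isBudget_reachReward h s
  have hA := law_ucbvi_regret M hH hsel (half_pos hδ) (by linarith) (fun _ => r) (fun _ => hb)
  have hδ4 : 0 < δ / 4 := by positivity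
  have hB := sum_value_le_sum_return M alg (fun _ => r) (fun _ => hb.trajReturn_nonneg)
    (fun _ => hb.trajReturn_le_one) hδ4
  have hC := sum_return_le_sum_value M alg (fun _ => r) (fun _ => hb.trajReturn_nonneg)
    (fun _ => hb.trajReturn_le_one) hδ4
  have hsum : ENNReal.ofReal δ =
      ENNReal.ofReal (δ / 2) + (ENNReal.ofReal (δ / 4) + ENNReal.ofReal (δ / 4)) := by
    rw [← ENNReal.ofReal_add (by positivity) (by positivity),
      ← ENNReal.ofReal_add (by positivity) (by positivity)]
    congr 1; ring
  rw [hsum]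
  refine le_trans (measure_mono ?_) ((measure_union_le _ _).trans
    (add_le_add hA ((measure_union_le _ _).trans (add_le_add hB hC))))
  intro ω hω
  by_contra hcon
  simp only [Set.mem_union, Set.mem_ofPred_eq, not_or, not_exists, not_not, not_le] at hcon
  obtain ⟨hreg, hlow, hupp⟩ := hcon
  apply hω
  obtain ⟨hspec, hTpos⟩ := reachEpisodes_spec (S := S) (A := A) hH hε hδ hδ1
  set T := reachEpisodes S A H ε₀ δ with hT
  have hT' : (0 : ℝ) < T := by exact_mod_cast hTpos
  replace hlow := hlow T
  replace hupp := hupp T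
  have hpath := pathSum_runData (fun _ e => trajReturn r e) alg (M.env ω) T
  rw [pathSum_reachReward] at hpath
  set n : ℝ := (visits (runData alg (M.env ω) T) h s : ℝ) with hn
  rw [← hpath] at hlow hupp
  have hdata : (visits (reachData sel (M.env ω) δ h s T) h s : ℝ) = n := by
    rw [reachData_eq_runData]
  set V := ∑ t ∈ Finset.range T, value M.model M.init
    (alg (runData alg (M.env ω) t)).toPolicy r with hV
  set W := M.maxReach h s with hW
  have hVW : V ≤ T * W := by
    calc V ≤ ∑ _t ∈ Finset.range T, W := Finset.sum_le_sum fun t _ => by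
          rw [hr, value_reachReward]; exact stateOcc_le_maxReach M _ h s
      _ = _ := by simp
  have hWV : T * W ≤ 5 / 4 * V + ucbviRegret S A H (δ / 2) T := by
    rw [mul_comm, ← le_div_iff₀ hT']
    refine ciSup_le fun ρ => ?_
    rw [le_div_iff₀ hT']
    have := hreg T (Finset.range T) subset_rfl ρ
    rw [hr, value_reachReward, Finset.sum_const, Finset.card_range, nsmul_eq_mul] at this
    rw [mul_comm]
    exact this
  have e1 : (1 : ℝ) / (δ / 4) = 4 / δ := by field_simp
  rw [e1] at hlow hupp
  have hl : 0 < Real.log (4 / δ) := Real.log_pos (by rw [lt_div_iff₀ hδ]; linarith)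
  have hR := ucbviRegret_nonneg (S := S) (A := A) hH (half_pos hδ) (by linarith) T
  unfold reachLower reachUpper
  rw [← hT, hdata]
  constructor
  · refine max_le ?_ (maxReach_nonneg M h s)
    rw [sub_le_iff_le_add, div_le_iff₀ (by positivity)]
    linarith
  · refine le_min ?_ (maxReach_le_one M h s)
    have : W ≤ (2 * n + ε₀ / 4 * T) / T := by
      rw [le_div_iff₀ hT']; linarith
    refine this.trans (le_of_eq ?_)
    field_simp

end

section

open scoped Classical


/-! ### The weighted majority forecaster -/

section Forecaster

variable {ι : Type*}

/-- The mixability potential `-(1/η) log ((1/N) ∑ exp (-η L))`. -/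
def mixLoss (X : Finset ι) (η : ℝ) (L : ι → ℝ) : ℝ :=
  -(1 / η) * Real.log (∑ x ∈ X, (1 / (X.card : ℝ)) * Real.exp (-(η * L x)))

lemma mixLoss_zero {X : Finset ι} (hX : X.Nonempty) (η : ℝ) : mixLoss X η (fun _ => 0) = 0 := by
  have : (X.card : ℝ) ≠ 0 := by exact_mod_cast hX.card_pos.ne'
  simp [mixLoss, this]

/-- Only the term of the expert `x` is kept in the sum. -/
lemma mixLoss_le {X : Finset ι} {η : ℝ} (hη : 0 < η) (L : ι → ℝ) {x : ι} (hx : x ∈ X) :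
    mixLoss X η L ≤ L x + Real.log X.card / η := by
  have hc : (0 : ℝ) < X.card := by exact_mod_cast Finset.card_pos.2 ⟨x, hx⟩
  have h1 : Real.log ((1 / (X.card : ℝ)) * Real.exp (-(η * L x))) ≤
      Real.log (∑ x ∈ X, (1 / (X.card : ℝ)) * Real.exp (-(η * L x))) := by
    apply Real.log_le_log (by positivity)
    exact Finset.single_le_sum (f := fun x => (1 / (X.card : ℝ)) * Real.exp (-(η * L x)))
      (fun y _ => by positivity) hx
  rw [Real.log_mul (by positivity) (by positivity), Real.log_exp, one_div, Real.log_inv] at h1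
  unfold mixLoss
  have h2 : 0 < 1 / η := by positivity
  have h3 := mul_le_mul_of_nonneg_left h1 h2.le
  have h4 : 1 / η * (-Real.log X.card + -(η * L x)) = -(L x + Real.log X.card / η) := by
    field_simp; ring
  simp only [one_div] at h3 h4 ⊢
  linarith

/-- The power mean inequality for exp(-η' L). A decreasing learning rate therefore only raises the
potential, in favour of the forecaster. -/
lemma mixLoss_anti {X : Finset ι} (hX : X.Nonempty) {η η' : ℝ} (hη' : 0 < η') (h : η' ≤ η)
    (L : ι → ℝ) : mixLoss X η L ≤ mixLoss X η' L := by
  have hc : (0 : ℝ) < X.card := by exact_mod_cast hX.card_pos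
  have hη : 0 < η := hη'.trans_le h
  have hpos : ∀ η : ℝ, 0 < ∑ x ∈ X, (1 / (X.card : ℝ)) * Real.exp (-(η * L x)) := fun η =>
    Finset.sum_pos (fun x _ => by positivity) hX
  have h1 := Real.rpow_arith_mean_le_arith_mean_rpow X (fun _ => 1 / (X.card : ℝ))
    (fun x => Real.exp (-(η' * L x))) (fun _ _ => by positivity)
    (by rw [Finset.sum_const, nsmul_eq_mul]; field_simp) (fun _ _ => (Real.exp_pos _).le)
    (p := η / η') (by rw [le_div_iff₀ hη', one_mul]; exact h)
  have h2 : ∀ x, Real.exp (-(η' * L x)) ^ (η / η') = Real.exp (-(η * L x)) := by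
    intro x
    rw [← Real.exp_mul]
    congr 1; field_simp
  simp only [h2] at h1
  have h3 := Real.log_le_log (Real.rpow_pos_of_pos (hpos η') _) h1
  rw [Real.log_rpow (hpos η')] at h3
  unfold mixLoss
  have h4 : 0 < 1 / η := by positivity
  have h5 := mul_le_mul_of_nonneg_left h3 h4.le
  have h6 : ∀ z, 1 / η * (η / η' * z) = 1 / η' * z := fun z => by field_simp
  rw [h6] at h5
  linarith

/-- The weights of the forecaster. -/
def expWeight (X : Finset ι) (η : ℝ) (L : ι → ℝ) (x : ι) : ℝ :=
  Real.exp (-(η * L x)) / ∑ y ∈ X, Real.exp (-(η * L y))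

lemma expWeight_nonneg (X : Finset ι) (η : ℝ) (L : ι → ℝ) (x : ι) : 0 ≤ expWeight X η L x :=
  div_nonneg (Real.exp_pos _).le (Finset.sum_nonneg fun _ _ => (Real.exp_pos _).le)

lemma sum_expWeight {X : Finset ι} (hX : X.Nonempty) (η : ℝ) (L : ι → ℝ) :
    ∑ x ∈ X, expWeight X η L x = 1 := by
  unfold expWeight
  rw [← Finset.sum_div, div_self]
  exact (Finset.sum_pos (fun x _ => Real.exp_pos _) hX).ne'

/-- In one round the potential grows by the mean loss up to η times the variance of the losses,
because exp(-z) ≤ 1 - z + z² for |z| ≤ 1; here η ≤ 1 and losses in [0,1] are used. -/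
lemma mixLoss_add {X : Finset ι} (hX : X.Nonempty) {η : ℝ} (hη : 0 < η) (hη1 : η ≤ 1)
    (L l : ι → ℝ) (hl0 : ∀ x, 0 ≤ l x) (hl1 : ∀ x, l x ≤ 1) {m : ℝ}
    (hm : m = ∑ x ∈ X, expWeight X η L x * l x) :
    mixLoss X η L + m - η * ∑ x ∈ X, expWeight X η L x * (l x - m) ^ 2 ≤
      mixLoss X η (fun x => L x + l x) := by
  set w := expWeight X η L with hw
  have hw0 : ∀ x, 0 ≤ w x := expWeight_nonneg X η L
  have hw1 : ∑ x ∈ X, w x = 1 := sum_expWeight hX η L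
  have hc : (0 : ℝ) < X.card := by exact_mod_cast hX.card_pos
  have hm0 : 0 ≤ m := by rw [hm]; exact Finset.sum_nonneg fun x _ => mul_nonneg (hw0 x) (hl0 x)
  have hm1 : m ≤ 1 := by
    rw [hm, ← hw1]
    exact Finset.sum_le_sum fun x _ => mul_le_of_le_one_right (hw0 x) (hl1 x)
  set v := ∑ x ∈ X, w x * (l x - m) ^ 2 with hv
  have hZ : 0 < ∑ y ∈ X, Real.exp (-(η * L y)) := Finset.sum_pos (fun x _ => Real.exp_pos _) hX
  have hS : 0 < ∑ x ∈ X, w x * Real.exp (-(η * l x)) := by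
    refine Finset.sum_pos (fun x _ => ?_) hX
    exact mul_pos (div_pos (Real.exp_pos _) hZ) (Real.exp_pos _)
  have hratio : ∑ x ∈ X, (1 / (X.card : ℝ)) * Real.exp (-(η * (L x + l x))) =
      (∑ x ∈ X, (1 / (X.card : ℝ)) * Real.exp (-(η * L x))) *
        ∑ x ∈ X, w x * Real.exp (-(η * l x)) := by
    rw [← Finset.mul_sum, ← Finset.mul_sum, mul_assoc]
    congr 1
    rw [Finset.mul_sum]
    refine Finset.sum_congr rfl fun x _ => ?_
    rw [hw, expWeight, mul_add, neg_add, Real.exp_add]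
    field_simp
  have hbound : ∑ x ∈ X, w x * Real.exp (-(η * l x)) ≤ Real.exp (-(η * m) + η ^ 2 * v) := by
    have h1 : ∀ x, Real.exp (-(η * l x)) ≤
        Real.exp (-(η * m)) * (1 - η * (l x - m) + η ^ 2 * (l x - m) ^ 2) := by
      intro x
      have h2 : Real.exp (-(η * l x)) = Real.exp (-(η * m)) * Real.exp (-(η * (l x - m))) := by
        rw [← Real.exp_add]; congr 1; ring
      rw [h2]
      gcongr
      have habs : |(-(η * (l x - m)))| ≤ 1 := by
        rw [abs_neg, abs_mul, abs_of_pos hη]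
        have : |l x - m| ≤ 1 := abs_le.2 ⟨by linarith [hl0 x], by linarith [hl1 x]⟩
        nlinarith [abs_nonneg (l x - m)]
      have h3 := (abs_le.1 (Real.abs_exp_sub_one_sub_id_le habs)).2
      nlinarith
    calc ∑ x ∈ X, w x * Real.exp (-(η * l x))
        ≤ ∑ x ∈ X, w x * (Real.exp (-(η * m)) * (1 - η * (l x - m) + η ^ 2 * (l x - m) ^ 2)) :=
          Finset.sum_le_sum fun x _ => mul_le_mul_of_nonneg_left (h1 x) (hw0 x)
      _ = Real.exp (-(η * m)) * (1 + η ^ 2 * v) := by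
          have h2 : ∀ x, w x * (Real.exp (-(η * m)) *
              (1 - η * (l x - m) + η ^ 2 * (l x - m) ^ 2)) = Real.exp (-(η * m)) *
              (w x * (1 + η * m) - η * (w x * l x) + η ^ 2 * (w x * (l x - m) ^ 2)) :=
            fun x => by ring
          simp only [h2, ← Finset.mul_sum, Finset.sum_add_distrib, Finset.sum_sub_distrib,
            ← Finset.sum_mul, hw1, ← hm]
          rw [hv]; ring
      _ ≤ Real.exp (-(η * m)) * Real.exp (η ^ 2 * v) := by
          gcongr
          linarith [Real.add_one_le_exp (η ^ 2 * v)]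
      _ = _ := by rw [← Real.exp_add]
  unfold mixLoss
  have hA : 0 < ∑ x ∈ X, (1 / (X.card : ℝ)) * Real.exp (-(η * L x)) :=
    Finset.sum_pos (fun x _ => by positivity) hX
  rw [hratio, Real.log_mul hA.ne' hS.ne']
  have h3 : Real.log (∑ x ∈ X, w x * Real.exp (-(η * l x))) ≤ -(η * m) + η ^ 2 * v := by
    rw [← Real.log_exp (-(η * m) + η ^ 2 * v)]
    exact Real.log_le_log hS hbound
  have h4 : 0 < 1 / η := by positivity
  have h5 := mul_le_mul_of_nonneg_left h3 h4.le
  have h6 : 1 / η * (-(η * m) + η ^ 2 * v) = -m + η * v := by field_simp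
  rw [h6] at h5
  linarith

end Forecaster

/-! ### The variance-dependent learning rate. -/

section LearningRate

/-- The precise constant plays no role: only that it is at least 1 and its square at most 2. -/
lemma learningRate_const : 1 ≤ Real.sqrt (2 * (Real.sqrt 2 - 1) / (Real.exp 1 - 2)) ∧
    Real.sqrt (2 * (Real.sqrt 2 - 1) / (Real.exp 1 - 2)) ^ 2 ≤ 2 := by
  have h1 := Real.exp_one_gt_d9
  have h2 := Real.exp_one_lt_d9
  have h3 : 1.41 ≤ Real.sqrt 2 := Real.le_sqrt_of_sq_le (by norm_num)
  have h4 : Real.sqrt 2 ≤ 1.42 := Real.sqrt_le_iff.2 (by norm_num)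
  have h5 : 0 < Real.exp 1 - 2 := by linarith
  constructor
  · rw [Real.one_le_sqrt, le_div_iff₀ h5]; linarith
  · rw [Real.sq_sqrt (div_nonneg (by linarith) h5.le), div_le_iff₀ h5]; linarith

lemma learningRate_le_one (N : ℕ) (V : ℝ) : learningRate N V ≤ 1 := by
  unfold learningRate
  split_ifs
  · exact le_rfl
  · exact min_le_left _ _

lemma learningRate_pos {N : ℕ} (hN : 2 ≤ N) {V : ℝ} (hV : 0 ≤ V) : 0 < learningRate N V := by
  unfold learningRate
  split_ifs with h
  · exact one_pos
  · have hV' : 0 < V := lt_of_le_of_ne hV (Ne.symm h)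
    have hN' : 0 < Real.log N := Real.log_pos (by exact_mod_cast hN)
    have h1 := learningRate_const.1
    have h2 : 0 < Real.sqrt (Real.log N / V) := Real.sqrt_pos.2 (by positivity)
    exact lt_min one_pos (by positivity)

lemma learningRate_anti (N : ℕ) {V V' : ℝ} (hV : 0 ≤ V) (h : V ≤ V') :
    learningRate N V' ≤ learningRate N V := by
  by_cases h0 : V = 0
  · conv_rhs => rw [learningRate, if_pos h0]
    exact learningRate_le_one _ _
  · have hV' : 0 < V := lt_of_le_of_ne hV (Ne.symm h0)
    unfold learningRate
    rw [if_neg h0, if_neg (by linarith)]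
    have : 0 ≤ Real.log N := Real.log_natCast_nonneg N
    gcongr

lemma log_div_learningRate_le {N : ℕ} (hN : 2 ≤ N) {V : ℝ} (hV : 0 ≤ V) :
    Real.log N / learningRate N V ≤ Real.log N + Real.sqrt (V * Real.log N) := by
  have hN' : 0 < Real.log N := Real.log_pos (by exact_mod_cast hN)
  have hs : 0 ≤ Real.sqrt (V * Real.log N) := Real.sqrt_nonneg _
  unfold learningRate
  split_ifs with h
  · rw [div_one]; linarith
  · have hV' : 0 < V := lt_of_le_of_ne hV (Ne.symm h)
    rcases min_choice 1 (Real.sqrt (2 * (Real.sqrt 2 - 1) / (Real.exp 1 - 2)) *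
      Real.sqrt (Real.log N / V)) with h1 | h1
    · rw [h1, div_one]; linarith
    · rw [h1]
      have hc := learningRate_const.1
      have h2 : 0 < Real.sqrt (Real.log N / V) := Real.sqrt_pos.2 (by positivity)
      have h3 : Real.sqrt (V * Real.log N) * Real.sqrt (Real.log N / V) = Real.log N := by
        rw [← Real.sqrt_mul (by positivity), show V * Real.log N * (Real.log N / V) =
          Real.log N ^ 2 by field_simp, Real.sqrt_sq hN'.le]
      rw [div_le_iff₀ (by positivity)]
      set c := Real.sqrt (2 * (Real.sqrt 2 - 1) / (Real.exp 1 - 2))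
      set z := Real.sqrt (Real.log N / V)
      have h4 : 0 ≤ Real.log N * (c * z) := by positivity
      nlinarith [mul_le_mul_of_nonneg_right hc hN'.le]

/-- The second-order costs η v telescope: with a = √(V+v) and b = √V one has v = (a - b)(a + b), and
η (a + b) ≤ 4 √(log N). -/
lemma learningRate_mul_le {N : ℕ} (hN : 2 ≤ N) {V v : ℝ} (hV : 0 ≤ V) (hv : 0 ≤ v)
    (hv1 : v ≤ 1) : learningRate N V * v ≤
      4 * (Real.sqrt ((V + v) * Real.log N) - Real.sqrt (V * Real.log N)) := by
  have hN' : Real.log 2 ≤ Real.log N := Real.log_le_log (by norm_num) (by exact_mod_cast hN)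
  have hlog : 0.69 ≤ Real.log N := by linarith [Real.log_two_gt_d9]
  rw [Real.sqrt_mul (by positivity), Real.sqrt_mul hV]
  set y := Real.sqrt (Real.log N) with hy
  have hy0 : 0 ≤ y := Real.sqrt_nonneg _
  have hy2 : y ^ 2 = Real.log N := Real.sq_sqrt (by linarith)
  set a := Real.sqrt (V + v) with ha
  set b := Real.sqrt V with hb
  have ha0 : 0 ≤ a := Real.sqrt_nonneg _
  have hb0 : 0 ≤ b := Real.sqrt_nonneg _
  have ha2 : a ^ 2 = V + v := Real.sq_sqrt (by positivity)
  have hb2 : b ^ 2 = V := Real.sq_sqrt hV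
  have hba : b ≤ a := Real.sqrt_le_sqrt (by linarith)
  have hη0 := learningRate_pos hN hV
  set η := learningRate N V with hη
  have hη1 : η ≤ 1 := learningRate_le_one N V
  -- For V ≤ 1 it follows from η ≤ 1 and V + v ≤ 2; for V ≥ 1 from v ≤ V and the explicit form of
  -- the rate.
  have hkey : η * a ≤ 2 * y := by
    rw [← abs_of_nonneg (show 0 ≤ η * a by positivity), ← abs_of_nonneg (show 0 ≤ 2 * y by positivity),
      ← sq_le_sq, mul_pow, mul_pow, ha2, hy2]
    rcases le_total V 1 with h1 | h1
    · have : η ^ 2 ≤ 1 := by nlinarith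
      nlinarith
    · have h2 : η ≤ Real.sqrt (2 * (Real.sqrt 2 - 1) / (Real.exp 1 - 2)) *
          Real.sqrt (Real.log N / V) := by
        rw [hη, learningRate, if_neg (by linarith)]; exact min_le_right _ _
      have h3 : η ^ 2 ≤ 2 * (Real.log N / V) := by
        calc η ^ 2 ≤ (Real.sqrt (2 * (Real.sqrt 2 - 1) / (Real.exp 1 - 2)) *
              Real.sqrt (Real.log N / V)) ^ 2 := by gcongr
          _ = Real.sqrt (2 * (Real.sqrt 2 - 1) / (Real.exp 1 - 2)) ^ 2 * (Real.log N / V) := by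
              rw [mul_pow, Real.sq_sqrt (div_nonneg (by linarith) hV)]
          _ ≤ _ := by
              gcongr
              exact learningRate_const.2
      calc η ^ 2 * (V + v) ≤ 2 * (Real.log N / V) * (V + V) := by
            gcongr
            linarith
        _ = 2 ^ 2 * Real.log N := by field_simp; ring
  have hv' : v = (a - b) * (a + b) := by nlinarith
  rw [hv']
  have h4 : 0 ≤ a - b := by linarith
  have h5 : η * (a + b) ≤ 4 * y := by nlinarith
  calc η * ((a - b) * (a + b)) = (a - b) * (η * (a + b)) := by ring
    _ ≤ (a - b) * (4 * y) := by gcongr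
    _ = _ := by ring

end LearningRate

/-! ### The invariants of the forecaster -/

section Invariant

variable {ι : Type*}

/-- The invariants that relate the cumulated loss `Λ` of the forecaster, the losses `L` of the
experts and the cumulated variance `V`. -/
structure ForecasterInv (X : Finset ι) (L : ι → ℝ) (V Λ : ℝ) : Prop where
  var_nonneg : 0 ≤ V
  var_le : V ≤ Λ
  var_single : X.card = 1 → V = 0
  loss_le : Λ ≤ mixLoss X (learningRate X.card V) L + 4 * Real.sqrt (V * Real.log X.card)

lemma ForecasterInv.init {X : Finset ι} (hX : X.Nonempty) :
    ForecasterInv X (fun _ => 0) 0 0 where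
  var_nonneg := le_rfl
  var_le := le_rfl
  var_single _ := rfl
  loss_le := by simp [mixLoss_zero hX]

/-- With a single expert log N = 0, and the rate would vanish if V were not 0; this is what the
field `var_single` is for. -/
lemma ForecasterInv.rate_pos {X : Finset ι} (hX : X.Nonempty) {L : ι → ℝ} {V Λ : ℝ}
    (h : ForecasterInv X L V Λ) : 0 < learningRate X.card V := by
  rcases Nat.lt_or_ge 1 X.card with h1 | h1
  · exact learningRate_pos h1 h.var_nonneg
  · have := hX.card_pos
    rw [h.var_single (by omega), learningRate, if_pos rfl]
    exact one_pos

/-- Losses in [0,1] have variance at most their mean, which preserves V ≤ Λ. The bound on Λ combines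
`mixLoss_add` at the old rate, `mixLoss_anti` to pass to the new rate, and the telescoping
`learningRate_mul_le`. -/
lemma ForecasterInv.step {X : Finset ι} (hX : X.Nonempty) {L : ι → ℝ} {V Λ : ℝ}
    (h : ForecasterInv X L V Λ) {l : ι → ℝ} (hl0 : ∀ x, 0 ≤ l x) (hl1 : ∀ x, l x ≤ 1) {m v : ℝ}
    (hm : m = ∑ x ∈ X, expWeight X (learningRate X.card V) L x * l x)
    (hv : v = ∑ x ∈ X, expWeight X (learningRate X.card V) L x * (l x - m) ^ 2) :
    ForecasterInv X (fun x => L x + l x) (V + v) (Λ + m) := by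
  have hη := h.rate_pos hX
  set η := learningRate X.card V with hηdef
  set w := expWeight X η L with hw
  have hw0 : ∀ x, 0 ≤ w x := expWeight_nonneg X η L
  have hw1 : ∑ x ∈ X, w x = 1 := sum_expWeight hX η L
  have hv0 : 0 ≤ v := by
    rw [hv]; exact Finset.sum_nonneg fun x _ => mul_nonneg (hw0 x) (sq_nonneg _)
  have hm1 : m ≤ 1 := by
    rw [hm, ← hw1]
    exact Finset.sum_le_sum fun x _ => mul_le_of_le_one_right (hw0 x) (hl1 x)
  have hvm : v ≤ m := by
    have h1 : v = ∑ x ∈ X, w x * l x ^ 2 - m ^ 2 := by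
      have h2 : ∀ x, w x * (l x - m) ^ 2 =
          w x * l x ^ 2 - 2 * m * (w x * l x) + m ^ 2 * w x := fun x => by ring
      rw [hv]
      simp only [h2, Finset.sum_add_distrib, Finset.sum_sub_distrib, ← Finset.mul_sum, hw1, ← hm]
      ring
    have h3 : ∑ x ∈ X, w x * l x ^ 2 ≤ m := by
      rw [hm]
      refine Finset.sum_le_sum fun x _ => mul_le_mul_of_nonneg_left ?_ (hw0 x)
      nlinarith [hl0 x, hl1 x]
    nlinarith [sq_nonneg m]
  have hsingle : X.card = 1 → v = 0 := by
    intro hc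
    obtain ⟨x, rfl⟩ := Finset.card_eq_one.1 hc
    rw [Finset.sum_singleton] at hw1 hm hv
    rw [hv, hm, hw1]; ring
  refine ⟨add_nonneg h.var_nonneg hv0, add_le_add h.var_le hvm, fun hc => ?_, ?_⟩
  · rw [h.var_single hc, hsingle hc, add_zero]
  · have h1 := mixLoss_add hX hη (learningRate_le_one _ _) L l hl0 hl1 hm
    rw [← hw, ← hv] at h1
    have hη' : 0 < learningRate X.card (V + v) := by
      rcases Nat.lt_or_ge 1 X.card with hc | hc
      · exact learningRate_pos hc (add_nonneg h.var_nonneg hv0)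
      · have := hX.card_pos
        have hc1 : X.card = 1 := by omega
        rw [h.var_single hc1, hsingle hc1, add_zero, learningRate, if_pos rfl]
        exact one_pos
    have h2 := mixLoss_anti hX hη' (learningRate_anti X.card h.var_nonneg (le_add_of_nonneg_right hv0))
      (fun x => L x + l x)
    have h3 : η * v ≤ 4 * (Real.sqrt ((V + v) * Real.log X.card) -
        Real.sqrt (V * Real.log X.card)) := by
      rcases Nat.lt_or_ge 1 X.card with hc | hc
      · exact learningRate_mul_le hc h.var_nonneg hv0 (hvm.trans hm1)
      · have := hX.card_pos
        rw [hsingle (by omega)]; simp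
    have h4 := h.loss_le
    rw [← hηdef] at h2 h4
    linarith

/-- The small-loss bound: the invariants give Λ ≤ L + log N + 5 √(V log N) with V ≤ Λ, and half of Λ
absorbs the square root. -/
lemma ForecasterInv.loss_bound {X : Finset ι} {L : ι → ℝ} {V Λ : ℝ}
    (h : ForecasterInv X L V Λ) {x : ι} (hx : x ∈ X) (hL : 0 ≤ L x) :
    Λ ≤ 2 * L x + 36 * Real.log X.card := by
  have hX : X.Nonempty := ⟨x, hx⟩
  have hη := h.rate_pos hX
  have h1 := h.loss_le.trans (add_le_add_left (mixLoss_le hη L hx) _)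
  have hlog : 0 ≤ Real.log X.card := Real.log_natCast_nonneg _
  rcases Nat.lt_or_ge 1 X.card with hc | hc
  · have h2 := log_div_learningRate_le hc h.var_nonneg
    have h3 : Real.sqrt (V * Real.log X.card) ≤ Λ / 10 + 5 / 2 * Real.log X.card := by
      apply Real.sqrt_le_iff.2
      have hΛ : 0 ≤ Λ := h.var_nonneg.trans h.var_le
      refine ⟨by positivity, ?_⟩
      nlinarith [sq_nonneg (Λ / 10 - 5 / 2 * Real.log X.card),
        mul_le_mul_of_nonneg_right h.var_le hlog]
    linarith
  · have hc1 : X.card = 1 := by have := hX.card_pos; omega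
    rw [hc1, h.var_single hc1] at h1
    simp at h1
    linarith

end Invariant

end

section

open scoped Classical


variable {S A : Type*} [Fintype S] [Fintype A] {H : ℕ}

/-! ### Levels of CovGame -/

lemma level_anti (c : Table S A H) {j k : ℕ} (h : j ≤ k) : level c k ⊆ level c j := by
  intro x hx
  simp only [level, Finset.mem_filter, Finset.mem_univ, true_and] at hx ⊢
  have h1 : 1 ≤ cmin c := le_max_right _ _
  by_cases hj : j = 0
  · rw [if_pos hj]
    split_ifs at hx with hk
    · exact hx
    · exact lt_trans (by positivity) hx
  · rw [if_neg hj]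
    rw [if_neg (by omega)] at hx
    refine lt_of_le_of_lt ?_ hx
    gcongr
    norm_num

lemma mem_level_zero {c : Table S A H} {x : Fin H × S × A} :
    x ∈ level c 0 ↔ 0 < c x.1 x.2.1 x.2.2 := by
  simp [level]

lemma mem_level_pos {c : Table S A H} {k : ℕ} (hk : k ≠ 0) {x : Fin H × S × A} :
    x ∈ level c k ↔ cmin c * 2 ^ k < c x.1 x.2.1 x.2.2 := by
  simp [level, hk]

/-- Some positive target is not met by the data. -/
def Undone (c : Table S A H) (D : List (Episode S A H)) : Prop :=
  ∃ x ∈ level c 0, (count D x.1 x.2.1 x.2.2 : ℝ) < c x.1 x.2.1 x.2.2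

lemma not_undone_iff {c : Table S A H} {D : List (Episode S A H)} :
    ¬ Undone c D ↔ ∀ h s a, c h s a ≤ count D h s a := by
  unfold Undone
  push Not
  constructor
  · intro h h' s a
    by_cases hc : 0 < c h' s a
    · exact h (h', s, a) (mem_level_zero.2 hc)
    · exact (not_lt.1 hc).trans (Nat.cast_nonneg _)
  · intro h x _
    exact h _ _ _

lemma Undone.of_append {c : Table S A H} {D D' : List (Episode S A H)} (h : Undone c (D ++ D')) :
    Undone c D := by
  obtain ⟨x, hx, h1⟩ := h
  refine ⟨x, hx, lt_of_le_of_lt ?_ h1⟩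
  rw [count_append_list]
  exact_mod_cast Nat.le_add_right _ _

/-- The levels such that the targets outside of them are met. -/
def coveredLevels (c : Table S A H) (D : List (Episode S A H)) : Set ℕ :=
  {j : ℕ | ∀ x ∈ level c 0, x ∉ level c j → c x.1 x.2.1 x.2.2 ≤ count D x.1 x.2.1 x.2.2}

lemma nextLevel_eq (c : Table S A H) (D : List (Episode S A H)) :
    nextLevel c D = sSup (coveredLevels c D) := rfl

lemma zero_mem_coveredLevels (c : Table S A H) (D : List (Episode S A H)) :
    0 ∈ coveredLevels c D := fun _ hx hx' => absurd hx hx'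

/-- Once all targets are met every level is covered, and `sSup` of an unbounded set of naturals is
0. Statements on `nextLevel` therefore carry the hypothesis `Undone`. -/
lemma Undone.bddAbove {c : Table S A H} {D : List (Episode S A H)} (h : Undone c D) :
    BddAbove (coveredLevels c D) := by
  obtain ⟨x, hx, h1⟩ := h
  obtain ⟨n, hn⟩ := pow_unbounded_of_one_lt (c x.1 x.2.1 x.2.2) (one_lt_two (α := ℝ))
  refine ⟨n, fun j hj => ?_⟩
  by_contra hcon
  push Not at hcon
  refine absurd (hj x hx fun hxj => ?_) (not_le.2 h1)
  rw [mem_level_pos (by omega)] at hxj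
  have h2 : (1 : ℝ) ≤ cmin c := le_max_right _ _
  have h3 : (2 : ℝ) ^ n ≤ 2 ^ j := pow_le_pow_right₀ one_le_two hcon.le
  nlinarith [pow_pos (zero_lt_two (α := ℝ)) j]

/-- By maximality of the level j, some triplet in X_j outside X_(j+1) lacks visits; it is the good
expert for the forecaster. -/
lemma Undone.exists_uncovered {c : Table S A H} {D : List (Episode S A H)} (h : Undone c D) :
    ∃ x ∈ level c (nextLevel c D), x ∉ level c (nextLevel c D + 1) ∧
      (count D x.1 x.2.1 x.2.2 : ℝ) < c x.1 x.2.1 x.2.2 := by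
  have hmem : nextLevel c D ∈ coveredLevels c D :=
    Nat.sSup_mem ⟨0, zero_mem_coveredLevels c D⟩ h.bddAbove
  have hnot : nextLevel c D + 1 ∉ coveredLevels c D := by
    intro h1
    have := le_csSup h.bddAbove h1
    rw [← nextLevel_eq] at this
    omega
  unfold coveredLevels at hnot
  simp only [Set.mem_ofPred_eq] at hnot
  push Not at hnot
  obtain ⟨x, hx, hx1, hx2⟩ := hnot
  refine ⟨x, ?_, hx1, hx2⟩
  by_contra hcon
  exact absurd (hmem x hx hcon) (not_le.2 hx2)

lemma nextLevel_mono {c : Table S A H} {D D' : List (Episode S A H)} (h : Undone c (D ++ D')) :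
    nextLevel c D ≤ nextLevel c (D ++ D') := by
  refine csSup_le_csSup h.bddAbove ⟨0, zero_mem_coveredLevels c D⟩ fun j hj x hx hxj => ?_
  refine (hj x hx hxj).trans ?_
  rw [count_append_list]
  exact_mod_cast Nat.le_add_right _ _

lemma cmin_le_two_mul {c : Table S A H} (h : (level c 0).Nonempty) :
    ∃ x ∈ level c 0, c x.1 x.2.1 x.2.2 ≤ cmin c ∧ ∀ y ∈ level c 0,
      c x.1 x.2.1 x.2.2 ≤ c y.1 y.2.1 y.2.2 := by
  obtain ⟨x, hx, hmin⟩ := Finset.exists_min_image (level c 0)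
    (fun x => c x.1 x.2.1 x.2.2) h
  refine ⟨x, hx, le_max_of_le_left ?_, hmin⟩
  refine le_csInf ⟨_, x.1, x.2.1, x.2.2, mem_level_zero.1 hx, rfl⟩ ?_
  rintro y ⟨h', s, a, hpos, rfl⟩
  exact hmin (h', s, a) (mem_level_zero.2 hpos)

/-- At level 0 the targets are not bounded below by c_min, which may be the artificial value 1; this
costs an additive 1 in `CovEvent.rounds_le`. -/
lemma cmin_le_of_one_lt {c : Table S A H} {x : Fin H × S × A} (hx : x ∈ level c 0) :
    cmin c = 1 ∨ cmin c ≤ c x.1 x.2.1 x.2.2 := by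
  unfold cmin
  rcases max_choice (sInf {y : ℝ | ∃ h s a, 0 < c h s a ∧ y = c h s a}) 1 with h | h
  · right
    rw [h]
    refine csInf_le ⟨0, ?_⟩ ⟨x.1, x.2.1, x.2.2, mem_level_zero.1 hx, rfl⟩
    rintro y ⟨h', s, a, hpos, rfl⟩
    exact hpos.le
  · exact Or.inl h

/-- A triplet with the smallest positive target lies outside X_j for all j ≥ 1 and is not yet
visited. So the initial level of CovGame agrees with `nextLevel`, and the level becomes a function
of the data. -/
lemma nextLevel_nil {c : Table S A H} (h : (level c 0).Nonempty) :
    nextLevel c ([] : List (Episode S A H)) = 0 := by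
  have hund : Undone c ([] : List (Episode S A H)) := by
    obtain ⟨x, hx⟩ := h
    exact ⟨x, hx, by simpa using mem_level_zero.1 hx⟩
  obtain ⟨x, hx, hle, -⟩ := cmin_le_two_mul h
  by_contra h0
  have hmem : nextLevel c ([] : List (Episode S A H)) ∈ coveredLevels c [] :=
    Nat.sSup_mem ⟨0, zero_mem_coveredLevels c []⟩ hund.bddAbove
  have h1 := hmem x hx fun hxj => ?_
  · rw [count_nil, Nat.cast_zero] at h1
    exact absurd (mem_level_zero.1 hx) (not_lt.2 h1)
  · rw [mem_level_pos h0] at hxj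
    have h2 : (1 : ℝ) ≤ cmin c := le_max_right _ _
    have h3 : (1 : ℝ) ≤ 2 ^ nextLevel c ([] : List (Episode S A H)) := one_le_pow₀ one_le_two
    nlinarith

/-! ### The states of CovGame as functions of the data -/

/-- The state of CovGame after the episodes of a dataset. -/
def covFold (c : Table S A H) (D : List (Episode S A H)) : CovState S A H :=
  D.foldl (covUpdate c) { data := [], lvl := 0, loss := fun _ _ _ => 0, var := 0 }

lemma covFold_append (c : Table S A H) (D : List (Episode S A H)) (e : Episode S A H) :
    covFold c (D ++ [e]) = covUpdate c (covFold c D) e := by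
  unfold covFold; rw [List.foldl_append]; rfl

@[simp] lemma covFold_data (c : Table S A H) (D : List (Episode S A H)) :
    (covFold c D).data = D := by
  induction D using List.reverseRecOn with
  | nil => rfl
  | append_singleton D e ih =>
    rw [covFold_append, covUpdate]
    split_ifs <;> simp [ih]

lemma covFold_lvl {c : Table S A H} (h : (level c 0).Nonempty) (D : List (Episode S A H)) :
    (covFold c D).lvl = nextLevel c D := by
  induction D using List.reverseRecOn with
  | nil => exact (nextLevel_nil h).symm
  | append_singleton D e ih =>
    rw [covFold_append, covUpdate]
    split_ifs with h1
    · rw [covFold_data] at h1; exact h1.symm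
    · simp

/-- The rewards played by CovGame as a function of the data. -/
def covReward (c : Table S A H) (D : List (Episode S A H)) : Table S A H := weights c (covFold c D)

lemma sum_table (X : Finset (Fin H × S × A)) (f : Fin H → S → A → ℝ)
    (hf : ∀ h s a, (h, s, a) ∉ X → f h s a = 0) :
    ∑ h, ∑ s, ∑ a, f h s a = ∑ x ∈ X, f x.1 x.2.1 x.2.2 := by
  have h1 : ∑ h, ∑ s, ∑ a, f h s a = ∑ x : Fin H × S × A, f x.1 x.2.1 x.2.2 := by
    simp_rw [Fintype.sum_prod_type]
  rw [h1]
  exact (Finset.sum_subset (Finset.subset_univ X) fun x _ hx => hf _ _ _ hx).symm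

lemma weights_of_mem {c : Table S A H} {σ : CovState S A H} {x : Fin H × S × A}
    (hx : x ∈ level c σ.lvl) : weights c σ x.1 x.2.1 x.2.2 =
      expWeight (level c σ.lvl) (learningRate (level c σ.lvl).card σ.var)
        (fun x => σ.loss x.1 x.2.1 x.2.2) x := by
  rw [weights, if_pos hx]; rfl

lemma weights_of_notMem {c : Table S A H} {σ : CovState S A H} {h : Fin H} {s : S} {a : A}
    (hx : (h, s, a) ∉ level c σ.lvl) : weights c σ h s a = 0 := by
  rw [weights, if_neg hx]

lemma sum_weights {c : Table S A H} {σ : CovState S A H} (hX : (level c σ.lvl).Nonempty) :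
    ∑ h, ∑ s, ∑ a, weights c σ h s a = 1 := by
  rw [sum_table (level c σ.lvl) _ fun h s a hx => weights_of_notMem hx,
    Finset.sum_congr rfl fun x hx => weights_of_mem hx]
  exact sum_expWeight hX _ _

lemma weights_nonneg (c : Table S A H) (σ : CovState S A H) (h : Fin H) (s : S) (a : A) :
    0 ≤ weights c σ h s a := by
  by_cases hx : (h, s, a) ∈ level c σ.lvl
  · rw [weights_of_mem hx]; exact expWeight_nonneg _ _ _ _
  · rw [weights_of_notMem hx]

/-- The weights have total mass at most 1, so the mass of a stage bounds its rewards. -/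
lemma isBudget_weights (c : Table S A H) (σ : CovState S A H) : IsBudget (weights c σ) := by
  refine ⟨fun h => ∑ s, ∑ a, weights c σ h s a, fun h s a => ⟨weights_nonneg c σ h s a, ?_⟩,
    fun h => Finset.sum_nonneg fun s _ => Finset.sum_nonneg fun a _ => weights_nonneg c σ h s a, ?_⟩
  · refine le_trans ?_ (Finset.single_le_sum (f := fun s => ∑ a, weights c σ h s a)
      (fun s _ => Finset.sum_nonneg fun a _ => weights_nonneg c σ h s a) (Finset.mem_univ s))
    exact Finset.single_le_sum (f := fun a => weights c σ h s a)
      (fun a _ => weights_nonneg c σ h s a) (Finset.mem_univ a)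
  · rcases (level c σ.lvl).eq_empty_or_nonempty with h0 | h0
    · refine le_trans (le_of_eq ?_) zero_le_one
      refine Finset.sum_eq_zero fun h _ => Finset.sum_eq_zero fun s _ =>
        Finset.sum_eq_zero fun a _ => weights_of_notMem ?_
      rw [h0]; exact Finset.notMem_empty _
    · exact (sum_weights h0).le

lemma trajReturn_eq_meanLoss (w : Table S A H) (e : Episode S A H) :
    trajReturn w e = meanLoss w e := by
  unfold trajReturn meanLoss hit
  refine Finset.sum_congr rfl fun h _ => ?_
  rw [Finset.sum_eq_single (e.state h.castSucc), Finset.sum_eq_single (e.action h)]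
  · simp
  · intro b _ hb; simp [hb.symm]
  · simp
  · intro b _ hb; simp [hb.symm]
  · simp

/-- The total loss of the forecaster in the rounds played at level `j`. -/
def levelLoss (c : Table S A H) (j : ℕ) : List (Episode S A H) → ℝ :=
  pathSum fun D e => if nextLevel c D = j then meanLoss (covReward c D) e else 0

lemma levelLoss_eq_zero {c : Table S A H} {j : ℕ} {D : List (Episode S A H)} (hD : Undone c D)
    (hj : nextLevel c D < j) : levelLoss c j D = 0 := by
  induction D using List.reverseRecOn with
  | nil => rfl
  | append_singleton D e ih =>
    have h1 := nextLevel_mono hD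
    unfold levelLoss at ih ⊢
    rw [pathSum_append, ih hD.of_append (by omega), if_neg (by omega), add_zero]

lemma hit_nonneg (e : Episode S A H) (h : Fin H) (s : S) (a : A) : 0 ≤ hit e h s a := by
  unfold hit; split_ifs <;> norm_num

lemma hit_le_one (e : Episode S A H) (h : Fin H) (s : S) (a : A) : hit e h s a ≤ 1 := by
  unfold hit; split_ifs <;> norm_num

lemma count_append_hit (D : List (Episode S A H)) (e : Episode S A H) (h : Fin H) (s : S) (a : A) :
    (count (D ++ [e]) h s a : ℝ) = count D h s a + hit e h s a := by
  rw [count_append]; unfold hit; push_cast; rfl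

lemma covFold_loss (c : Table S A H) (D : List (Episode S A H)) (h : Fin H) (s : S) (a : A) :
    0 ≤ (covFold c D).loss h s a ∧ (covFold c D).loss h s a ≤ count D h s a := by
  induction D using List.reverseRecOn with
  | nil => simp [covFold]
  | append_singleton D e ih =>
    rw [covFold_append, covUpdate, count_append_hit]
    have h1 := hit_nonneg e h s a
    have h2 : (0 : ℝ) ≤ count D h s a := Nat.cast_nonneg _
    split_ifs
    · exact ⟨add_nonneg ih.1 h1, by simpa using ih.2⟩
    · exact ⟨le_rfl, add_nonneg h2 h1⟩

/-- Levels never decrease while some target is unmet, so a level is visited during one block of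
rounds, and all cumulated quantities of a newly reached level start from zero together with the
reset forecaster. -/
lemma forecasterInv_covFold {c : Table S A H} {D : List (Episode S A H)} (hD : Undone c D) :
    ForecasterInv (level c (nextLevel c D)) (fun x => (covFold c D).loss x.1 x.2.1 x.2.2)
      (covFold c D).var (levelLoss c (nextLevel c D) D) := by
  have h0 : (level c 0).Nonempty := by obtain ⟨x, hx, -⟩ := hD; exact ⟨x, hx⟩
  have hne : (level c (nextLevel c D)).Nonempty := by
    obtain ⟨x, hx, -⟩ := hD.exists_uncovered; exact ⟨x, hx⟩
  induction D using List.reverseRecOn with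
  | nil => exact ForecasterInv.init hne
  | append_singleton D e ih =>
    have hD' := hD.of_append
    have hne' : (level c (nextLevel c D)).Nonempty := by
      obtain ⟨x, hx, -⟩ := hD'.exists_uncovered; exact ⟨x, hx⟩
    have hlvl := covFold_lvl h0 D
    by_cases heq : nextLevel c (D ++ [e]) = nextLevel c D
    · have hupd : covFold c (D ++ [e]) =
          { data := D ++ [e]
            lvl := (covFold c D).lvl
            loss := fun h s a => (covFold c D).loss h s a + hit e h s a
            var := (covFold c D).var + varLoss (weights c (covFold c D)) e } := by
        rw [covFold_append, covUpdate, covFold_data, if_pos (by rw [hlvl, heq])]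
      have hΛ : levelLoss c (nextLevel c (D ++ [e])) (D ++ [e]) =
          levelLoss c (nextLevel c D) D + meanLoss (covReward c D) e := by
        rw [heq]; unfold levelLoss; rw [pathSum_append, if_pos rfl]
      rw [hΛ, hupd, heq]
      have hw : ∀ x ∈ level c (nextLevel c D), weights c (covFold c D) x.1 x.2.1 x.2.2 =
          expWeight (level c (nextLevel c D))
            (learningRate (level c (nextLevel c D)).card (covFold c D).var)
            (fun x => (covFold c D).loss x.1 x.2.1 x.2.2) x := by
        intro x hx
        rw [← hlvl] at hx ⊢
        exact weights_of_mem hx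
      refine (ih hD' hne').step hne' (l := fun x => hit e x.1 x.2.1 x.2.2)
        (fun x => hit_nonneg _ _ _ _) (fun x => hit_le_one _ _ _ _) ?_ ?_
      · unfold meanLoss covReward
        rw [sum_table (level c (nextLevel c D)) _ fun h s a hx => by
          rw [weights_of_notMem (by rw [hlvl]; exact hx), zero_mul]]
        exact Finset.sum_congr rfl fun x hx => by rw [hw x hx]
      · unfold varLoss
        rw [sum_table (level c (nextLevel c D)) _ fun h s a hx => by
          rw [weights_of_notMem (by rw [hlvl]; exact hx), zero_mul]]
        exact Finset.sum_congr rfl fun x hx => by rw [hw x hx]; rfl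
    · have hupd : covFold c (D ++ [e]) =
          { data := D ++ [e]
            lvl := nextLevel c (D ++ [e])
            loss := fun _ _ _ => 0
            var := 0 } := by
        rw [covFold_append, covUpdate, covFold_data, if_neg (by rw [hlvl]; exact heq)]
      have hlt : nextLevel c D < nextLevel c (D ++ [e]) :=
        lt_of_le_of_ne (nextLevel_mono hD) (Ne.symm heq)
      have hΛ : levelLoss c (nextLevel c (D ++ [e])) (D ++ [e]) = 0 := by
        have := levelLoss_eq_zero hD' hlt
        unfold levelLoss at this ⊢
        rw [pathSum_append, this, if_neg hlt.ne, add_zero]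
      rw [hΛ, hupd]
      exact ForecasterInv.init hne

lemma meanLoss_le_one (c : Table S A H) (D : List (Episode S A H)) (e : Episode S A H) :
    meanLoss (covReward c D) e ≤ 1 := by
  rw [← trajReturn_eq_meanLoss]
  exact (isBudget_weights c _).trajReturn_le_one e

/-- The uncovered triplet has fewer than c ≤ c_min 2^(j+1) visits in all, hence at most that loss
since the reset; the factor 2 of `ForecasterInv.loss_bound` gives 4 c_min 2^j. -/
lemma levelLoss_le_of_undone {c : Table S A H} {D : List (Episode S A H)} (hD : Undone c D) :
    levelLoss c (nextLevel c D) D ≤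
      4 * (cmin c * 2 ^ nextLevel c D) + 36 * Real.log (level c (nextLevel c D)).card := by
  obtain ⟨x, hx, hx1, hx2⟩ := hD.exists_uncovered
  have h1 := (forecasterInv_covFold hD).loss_bound hx (covFold_loss c D _ _ _).1
  have h2 := (covFold_loss c D x.1 x.2.1 x.2.2).2
  rw [mem_level_pos (by omega), not_lt, pow_succ] at hx1
  linarith

/-- Only the data before the last episode are assumed incomplete, so the final round is included; a
round adds at most 1 to the bound valid just before it. -/
lemma levelLoss_le {c : Table S A H} {D : List (Episode S A H)} {e : Episode S A H}
    (hD : Undone c D) (j : ℕ) :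
    levelLoss c j (D ++ [e]) ≤ 4 * (cmin c * 2 ^ j) + 36 * Real.log (level c j).card + 1 := by
  have hpos : ∀ j, 0 ≤ 4 * (cmin c * 2 ^ j) + 36 * Real.log (level c j).card + 1 := by
    intro j
    have h1 : (1 : ℝ) ≤ cmin c := le_max_right _ _
    have h2 : 0 ≤ Real.log (level c j).card := Real.log_natCast_nonneg _
    positivity
  induction D using List.reverseRecOn generalizing e with
  | nil =>
    unfold levelLoss
    rw [pathSum_append, pathSum_nil, zero_add]
    split_ifs with h1
    · refine (meanLoss_le_one c _ e).trans ?_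
      have h1 : (1 : ℝ) ≤ cmin c := le_max_right _ _
      have h2 : 0 ≤ Real.log (level c j).card := Real.log_natCast_nonneg _
      have : 0 ≤ 4 * (cmin c * 2 ^ j) := by positivity
      linarith
    · exact hpos j
  | append_singleton D e' ih =>
    by_cases h1 : nextLevel c (D ++ [e']) = j
    · have h2 := levelLoss_le_of_undone hD
      have h3 := meanLoss_le_one c (D ++ [e']) e
      unfold levelLoss at h2 ⊢
      rw [pathSum_append, if_pos h1]
      rw [h1] at h2
      linarith
    · have h2 := ih (e := e') hD.of_append
      unfold levelLoss at h2 ⊢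
      rw [pathSum_append, if_neg h1, add_zero]
      exact h2

end

section

open scoped Classical


variable {S A : Type*} [Fintype S] [Fintype A] {H : ℕ}

/-! ### Mixtures of state-action distributions -/

/-- The convex hull of the state-action distributions of the policies. -/
def MDP.mixOcc (M : MDP S A H) : Set (Table S A H) :=
  convexHull ℝ (Set.range fun π : Policy S A H => occ M.model M.init π)

/-- The pairing of a state-action distribution and a reward function. -/
def pairing (o r : Table S A H) : ℝ := ∑ h, ∑ s, ∑ a, o h s a * r h s a

lemma pairing_combo (x y : ℝ) (o o' r : Table S A H) :
    pairing (x • o + y • o') r = x * pairing o r + y * pairing o' r := by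
  simp only [pairing, Pi.add_apply, Pi.smul_apply, smul_eq_mul, add_mul, Finset.sum_add_distrib,
    Finset.mul_sum, mul_assoc]

lemma occ_mem_mixOcc (M : MDP S A H) (π : Policy S A H) : occ M.model M.init π ∈ M.mixOcc :=
  subset_convexHull ℝ _ ⟨π, rfl⟩

/-- A bound on a sum of values which holds for all policies holds for all mixtures. -/
lemma sum_pairing_le_of_mem_mixOcc (M : MDP S A H) {ι : Type*} (I : Finset ι) (r : ι → Table S A H)
    (B : ℝ) (h : ∀ π : Policy S A H, ∑ i ∈ I, value M.model M.init π (r i) ≤ B) {o : Table S A H}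
    (ho : o ∈ M.mixOcc) : ∑ i ∈ I, pairing o (r i) ≤ B := by
  have hsub : M.mixOcc ⊆ {o | ∑ i ∈ I, pairing o (r i) ≤ B} := by
    refine convexHull_min ?_ ?_
    · rintro _ ⟨π, rfl⟩
      exact h π
    · intro o ho o' ho' x y hx hy hxy
      simp only [Set.mem_ofPred_eq] at ho ho' ⊢
      simp only [pairing_combo, Finset.sum_add_distrib, ← Finset.mul_sum]
      calc x * ∑ i ∈ I, pairing o (r i) + y * ∑ i ∈ I, pairing o' (r i) ≤ x * B + y * B := by gcongr
        _ = B := by rw [← add_mul, hxy, one_mul]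
  exact hsub ho

lemma half_add_half_mem_mixOcc (M : MDP S A H) {o o' : Table S A H} (ho : o ∈ M.mixOcc)
    (ho' : o' ∈ M.mixOcc) : (1 / 2 : ℝ) • o + (1 / 2 : ℝ) • o' ∈ M.mixOcc :=
  convex_convexHull ℝ _ ho ho' (by norm_num) (by norm_num) (by norm_num)

/-! ### CovGame -/

/-- CovGame is thereby a UCBVI learner whose reward is a function of its data, so `law_ucbvi_regret`
applies. -/
lemma covState_eq (sel : (A → ℝ) → A) (env : Env S A H) (c : Table S A H) (δ : ℝ) (t : ℕ) :
    covState sel env c δ t = covFold c (runData (ucbviAlg sel (δ / 2) (covReward c)) env t) := by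
  induction t with
  | zero => rfl
  | succ t ih =>
    rw [covState, runData, covFold_append, ih, covFold_data]
    rfl

lemma covState_data (sel : (A → ℝ) → A) (env : Env S A H) (c : Table S A H) (δ : ℝ) (t : ℕ) :
    (covState sel env c δ t).data = runData (ucbviAlg sel (δ / 2) (covReward c)) env t := by
  rw [covState_eq, covFold_data]

/-- The confidence parameter of the concentration inequality at level `j`. -/
def levelConf (δ : ℝ) (j : ℕ) : ℝ := δ / (2 * (j + 1) * (j + 2))

lemma levelConf_pos {δ : ℝ} (hδ : 0 < δ) (j : ℕ) : 0 < levelConf δ j := by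
  unfold levelConf; positivity

/-- 1/((j+1)(j+2)) telescopes. -/
lemma tsum_levelConf_le {δ : ℝ} (hδ : 0 < δ) :
    ∑' j, ENNReal.ofReal (levelConf δ j) ≤ ENNReal.ofReal (δ / 2) := by
  refine ENNReal.tsum_le_of_sum_range_le fun n => ?_
  rw [← ENNReal.ofReal_sum_of_nonneg fun j _ => (levelConf_pos hδ j).le]
  apply ENNReal.ofReal_le_ofReal
  have h : ∑ j ∈ Finset.range n, levelConf δ j = δ / 2 - δ / (2 * (n + 1)) := by
    induction n with
    | zero => simp
    | succ n ih =>
      rw [Finset.sum_range_succ, ih, levelConf]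
      push_cast
      field_simp
      ring
  rw [h]
  have : 0 < δ / (2 * ((n : ℝ) + 1)) := by positivity
  linarith

/-- The inequalities satisfied by the interaction of CovGame with high probability. -/
structure CovEvent (M : MDP S A H) (sel : (A → ℝ) → A) (c : Table S A H) (δ : ℝ)
    (env : Env S A H) : Prop where
  regret : ∀ T, ∀ I ⊆ Finset.range T, ∀ ρ : Policy S A H,
    ∑ t ∈ I, value M.model M.init ρ
        (covReward c (runData (ucbviAlg sel (δ / 2) (covReward c)) env t)) ≤
      5 / 4 * ∑ t ∈ I, value M.model M.init
        ((ucbviAlg sel (δ / 2) (covReward c)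
          (runData (ucbviAlg sel (δ / 2) (covReward c)) env t)).toPolicy)
        (covReward c (runData (ucbviAlg sel (δ / 2) (covReward c)) env t)) +
      ucbviRegret S A H (δ / 2) T
  atLevel : ∀ j T, ∑ t ∈ Finset.range T with
        nextLevel c (runData (ucbviAlg sel (δ / 2) (covReward c)) env t) = j,
        value M.model M.init
        ((ucbviAlg sel (δ / 2) (covReward c)
          (runData (ucbviAlg sel (δ / 2) (covReward c)) env t)).toPolicy)
        (covReward c (runData (ucbviAlg sel (δ / 2) (covReward c)) env t)) ≤
      8 / 5 * (levelLoss c j (runData (ucbviAlg sel (δ / 2) (covReward c)) env T) +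
        Real.log (1 / levelConf δ j))

lemma value_zero (P : Model S A H) (s₁ : S) (π : Policy S A H) :
    value P s₁ π (fun _ _ _ => 0) = 0 := by simp [value]

lemma isBudget_zero : IsBudget (fun _ _ _ => 0 : Table S A H) :=
  ⟨fun _ => 0, fun _ _ _ => ⟨le_rfl, le_rfl⟩, fun _ => le_rfl, by simp⟩

/-- Half of δ goes to the regret bound and half to the comparison of values and losses. The latter
is applied once per level, to rewards set to zero outside the rounds of that level. -/
theorem law_covEvent [MeasurableSpace S] [DiscreteMeasurableSpace S] [Nonempty A] (M : MDP S A H)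
    (hH : 0 < H) {sel : (A → ℝ) → A} (hsel : IsArgmaxRule sel) (c : Table S A H) {δ : ℝ}
    (hδ : 0 < δ) (hδ1 : δ ≤ 1) :
    M.law {ω | ¬ CovEvent M sel c δ (M.env ω)} ≤ ENNReal.ofReal δ := by
  set alg := ucbviAlg sel (δ / 2) (covReward c) with halg
  have hA := law_ucbvi_regret M hH hsel (half_pos hδ) (by linarith) (covReward c)
    (fun D => isBudget_weights c _)
  let tab : ℕ → List (Episode S A H) → Table S A H := fun j D =>
    if nextLevel c D = j then covReward c D else fun _ _ _ => 0
  have htab : ∀ j D, IsBudget (tab j D) := fun j D => by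
    simp only [tab]
    split_ifs
    · exact isBudget_weights c _
    · exact isBudget_zero
  have hB := fun j => sum_value_le_sum_return M alg (tab j)
    (fun D => (htab j D).trajReturn_nonneg) (fun D => (htab j D).trajReturn_le_one)
    (levelConf_pos hδ j)
  have hsum : ENNReal.ofReal δ = ENNReal.ofReal (δ / 2) + ENNReal.ofReal (δ / 2) := by
    rw [← ENNReal.ofReal_add (by positivity) (by positivity), add_halves]
  rw [hsum]
  refine le_trans (measure_mono ?_) ((measure_union_le _ _).trans (add_le_add hA
    ((measure_iUnion_le _).trans ((ENNReal.tsum_le_tsum hB).trans (tsum_levelConf_le hδ)))))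
  intro ω hω
  by_contra hcon
  simp only [Set.mem_union, Set.mem_iUnion, Set.mem_ofPred_eq, not_or, not_exists, not_not,
    not_le] at hcon
  refine hω ⟨hcon.1, fun j T => ?_⟩
  have h1 := (hcon.2 j T).le
  have h2 : ∀ t, trajReturn (tab j (runData alg (M.env ω) t))
        (M.env ω t (alg (runData alg (M.env ω) t))) =
      if nextLevel c (runData alg (M.env ω) t) = j then
        meanLoss (covReward c (runData alg (M.env ω) t))
          (M.env ω t (alg (runData alg (M.env ω) t))) else 0 := fun t => by
    simp only [tab]
    split_ifs
    · exact trajReturn_eq_meanLoss _ _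
    · simp [trajReturn]
  have h3 : ∀ t, value M.model M.init (alg (runData alg (M.env ω) t)).toPolicy
        (tab j (runData alg (M.env ω) t)) =
      if nextLevel c (runData alg (M.env ω) t) = j then
        value M.model M.init (alg (runData alg (M.env ω) t)).toPolicy
        (covReward c (runData alg (M.env ω) t)) else 0 := fun t => by
    simp only [tab]
    split_ifs
    · rfl
    · exact value_zero _ _ _
  rw [Finset.sum_congr rfl fun t _ => h2 t, Finset.sum_congr rfl fun t _ => h3 t,
    ← Finset.sum_filter] at h1
  unfold levelLoss
  rw [pathSum_runData]
  exact h1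

lemma nextLevel_le {c : Table S A H} {D : List (Episode S A H)} (hD : Undone c D) {J : ℕ}
    (hJ : ∀ x ∈ level c 0, c x.1 x.2.1 x.2.2 ≤ 2 ^ J) : nextLevel c D ≤ J := by
  obtain ⟨x, hx, -, -⟩ := hD.exists_uncovered
  by_contra hcon
  push Not at hcon
  have h1 := hJ x (level_anti c (Nat.zero_le _) hx)
  rw [mem_level_pos (by omega)] at hx
  have h2 : (1 : ℝ) ≤ cmin c := le_max_right _ _
  have h3 : (2 : ℝ) ^ J ≤ 2 ^ nextLevel c D := pow_le_pow_right₀ one_le_two hcon.le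
  nlinarith [pow_pos (zero_lt_two (α := ℝ)) J]

lemma log_card_level_le [Nonempty S] [Nonempty A] (hH : 0 < H) (c : Table S A H) (j : ℕ) :
    Real.log (level c j).card ≤ Real.log (Fintype.card S * Fintype.card A * H) := by
  have hle : (level c j).card ≤ H * (Fintype.card S * Fintype.card A) := by
    refine (Finset.card_le_univ _).trans (le_of_eq ?_)
    simp
  rcases Nat.eq_zero_or_pos (level c j).card with h0 | h0
  · rw [h0, Nat.cast_zero, Real.log_zero]
    have : 1 ≤ Fintype.card S * Fintype.card A * H :=
      Nat.mul_pos (Nat.mul_pos Fintype.card_pos Fintype.card_pos) hH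
    exact Real.log_nonneg (by exact_mod_cast this)
  · apply Real.log_le_log (by exact_mod_cast h0)
    calc ((level c j).card : ℝ) ≤ ((H * (Fintype.card S * Fintype.card A) : ℕ) : ℝ) := by
          exact_mod_cast hle
      _ = _ := by push_cast; ring

/-- The lower-order terms of the sample complexity of CovGame are dominated by the regret. -/
lemma log_terms_le_ucbviRegret [Nonempty S] [Nonempty A] (hH : 0 < H) {δ : ℝ} (hδ : 0 < δ)
    (hδ1 : δ ≤ 1) {T : ℕ} (hT : 0 < T) :
    10 + 72 * Real.log (Fintype.card S * Fintype.card A * H) + 2 * Real.log (2 / δ) ≤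
      ucbviRegret S A H (δ / 2) T := by
  have hS : (1 : ℝ) ≤ Fintype.card S := by exact_mod_cast Fintype.card_pos
  have hA : (1 : ℝ) ≤ Fintype.card A := by exact_mod_cast Fintype.card_pos
  have hH' : (1 : ℝ) ≤ H := by exact_mod_cast hH
  set N : ℝ := (Fintype.card S : ℝ) * Fintype.card A * H with hN
  have hN1 : 1 ≤ N := by
    rw [hN]; nlinarith [mul_le_mul hS hA zero_le_one (by linarith)]
  have hlogN : 0 ≤ Real.log N := Real.log_nonneg hN1
  have hl2 : 0 < Real.log (2 / δ) := Real.log_pos (by rw [lt_div_iff₀ hδ]; linarith)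
  have hsplit : Real.log (2 * Fintype.card S * Fintype.card A * H / (δ / 2)) =
      Real.log N + Real.log (2 / δ) + Real.log 2 := by
    rw [← Real.log_mul (by positivity) (by positivity),
      ← Real.log_mul (by positivity) (by positivity)]
    congr 1; rw [hN]; field_simp
  have hlog2 := Real.log_two_gt_d9
  have hlT : Real.log 2 ≤ Real.log ((T : ℝ) + 1) := by
    apply Real.log_le_log (by norm_num)
    have : (1 : ℝ) ≤ T := by exact_mod_cast hT
    linarith
  have hsq : (1 / 4 : ℝ) ≤ Real.log ((T : ℝ) + 1) ^ 2 := by nlinarith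
  unfold ucbviRegret
  rw [hsplit]
  have hpre : (1 : ℝ) ≤ Fintype.card S * Fintype.card A * (H : ℝ) ^ 2 := by
    have h1 : N ≤ Fintype.card S * Fintype.card A * (H : ℝ) ^ 2 := by
      rw [hN, pow_two, ← mul_assoc]
      exact le_mul_of_one_le_right (by positivity) hH'
    linarith
  set Q := Real.log N + Real.log (2 / δ) + Real.log 2 + 6 * Fintype.card S with hQ
  have hQ1 : Real.log N + Real.log (2 / δ) + 6 ≤ Q := by rw [hQ]; linarith
  calc 10 + 72 * Real.log N + 2 * Real.log (2 / δ) ≤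
        65536 * 1 * (Real.log N + Real.log (2 / δ) + 6) * (1 / 4) := by nlinarith
    _ ≤ 65536 * (Fintype.card S * Fintype.card A * (H : ℝ) ^ 2) * Q *
        Real.log ((T : ℝ) + 1) ^ 2 := by gcongr
    _ = _ := by ring

lemma log_levelConf_le {δ : ℝ} (hδ : 0 < δ) {j J : ℕ} (hj : j ≤ J) :
    Real.log (1 / levelConf δ j) ≤ Real.log (2 / δ) + 2 * (J + 1) := by
  have h0 : (1 : ℝ) / levelConf δ j = 2 / δ * ((j + 1) * (j + 2)) := by
    unfold levelConf; field_simp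
  have h1 : Real.log ((j : ℝ) + 1) ≤ j := by
    have := Real.log_le_sub_one_of_pos (show (0 : ℝ) < j + 1 by positivity); linarith
  have h2 : Real.log ((j : ℝ) + 2) ≤ j + 1 := by
    have := Real.log_le_sub_one_of_pos (show (0 : ℝ) < j + 2 by positivity); linarith
  have h3 : (j : ℝ) ≤ J := by exact_mod_cast hj
  rw [h0, Real.log_mul (by positivity) (by positivity), Real.log_mul (by positivity) (by positivity)]
  linarith

/-- As long as CovGame does not terminate, the number of rounds is bounded in terms of the regret
and of two comparators, one proportional to the target and one which explores everything. -/
lemma CovEvent.rounds_le [Nonempty S] [Nonempty A] {M : MDP S A H} (hH : 0 < H)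
    {sel : (A → ℝ) → A} {c : Table S A H}
    {δ : ℝ} (hδ : 0 < δ) (hδ1 : δ ≤ 1) {env : Env S A H} (hE : CovEvent M sel c δ env) {T : ℕ}
    (hT : 0 < T)
    (hU : ∀ t < T, Undone c (runData (ucbviAlg sel (δ / 2) (covReward c)) env t))
    {φ μ : ℝ} (hμ : 0 < μ) (hφ : 0 ≤ φ) {J : ℕ} {o₁ o₂ : Table S A H}
    (ho₁ : o₁ ∈ M.mixOcc) (ho₂ : o₂ ∈ M.mixOcc)
    (h1pos : ∀ x ∈ level c 0, 0 ≤ o₁ x.1 x.2.1 x.2.2)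
    (h1 : ∀ x ∈ level c 0, c x.1 x.2.1 x.2.2 ≤ φ * o₁ x.1 x.2.1 x.2.2)
    (h2 : ∀ x ∈ level c 0, μ ≤ o₂ x.1 x.2.1 x.2.2)
    (hJ : ∀ x ∈ level c 0, c x.1 x.2.1 x.2.2 ≤ 2 ^ J) :
    (T : ℝ) ≤ (J + 1) * (16 * φ + (4 * ucbviRegret S A H (δ / 2) T + 8 * (J + 1)) / μ) := by
  set alg := ucbviAlg sel (δ / 2) (covReward c) with halg
  set D := runData alg env with hD
  set R := ucbviRegret S A H (δ / 2) T with hR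
  have hR0 : 0 ≤ R := ucbviRegret_nonneg hH (half_pos hδ) (by linarith) T
  have hne0 : (level c 0).Nonempty := by
    obtain ⟨x, hx, -⟩ := hU 0 hT; exact ⟨x, hx⟩
  -- One comparator with both qualities, each halved: it dominates c/(2φ) and μ/2 on the positive
  -- targets.
  set o : Table S A H := (1 / 2 : ℝ) • o₁ + (1 / 2 : ℝ) • o₂ with ho
  have homem : o ∈ M.mixOcc := half_add_half_mem_mixOcc M ho₁ ho₂
  have hox : ∀ h s a, o h s a = 1 / 2 * o₁ h s a + 1 / 2 * o₂ h s a := fun h s a => rfl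
  have hlvl : ∀ j ≤ J, (((Finset.range T).filter fun t => nextLevel c (D t) = j).card : ℝ) ≤
      16 * φ + (4 * R + 8 * (J + 1)) / μ := by
    intro j hjJ
    set I := (Finset.range T).filter fun t => nextLevel c (D t) = j with hI
    rcases I.eq_empty_or_nonempty with hemp | ⟨t₀, ht₀⟩
    · rw [hemp, Finset.card_empty, Nat.cast_zero]; positivity
    have hjne : (level c j).Nonempty := by
      rw [hI, Finset.mem_filter, Finset.mem_range] at ht₀
      obtain ⟨x, hx, -⟩ := (hU t₀ ht₀.1).exists_uncovered
      rw [← ht₀.2]; exact ⟨x, hx⟩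
    obtain ⟨x, hx, hmin⟩ := Finset.exists_min_image (level c j)
      (fun x => o x.1 x.2.1 x.2.2) hjne
    set m := o x.1 x.2.1 x.2.2 with hm
    have hx0 := level_anti c (Nat.zero_le j) hx
    have hmμ : μ / 2 ≤ m := by
      rw [hm, hox]; have a1 := h1pos x hx0; have a2 := h2 x hx0; linarith
    have hm0 : 0 < m := by linarith
    -- The smallest visit probability m over X_j controls the scale of the level, since targets in
    -- X_j exceed c_min 2^j for j ≥ 1.
    have hmφ : cmin c * 2 ^ j ≤ 2 * φ * m + 1 := by
      have a1 : c x.1 x.2.1 x.2.2 ≤ 2 * φ * m := by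
        have a2 := h1 x hx0
        have a3 : 0 ≤ φ * o₂ x.1 x.2.1 x.2.2 := mul_nonneg hφ (hμ.le.trans (h2 x hx0))
        rw [hm, hox]; nlinarith
      by_cases hj0 : j = 0
      · rw [hj0, pow_zero, mul_one]
        rcases cmin_le_of_one_lt hx0 with h | h
        · rw [h]; have : 0 ≤ 2 * φ * m := by positivity
          linarith
        · linarith
      · rw [mem_level_pos hj0] at hx
        linarith
    -- The weights are a probability vector on X_j, so the comparator earns at least m whatever the
    -- forecaster plays.
    have hlow : (I.card : ℝ) * m ≤ ∑ t ∈ I, pairing o (covReward c (D t)) := by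
      rw [← nsmul_eq_mul]
      refine Finset.card_nsmul_le_sum _ _ _ fun t ht => ?_
      rw [hI, Finset.mem_filter, Finset.mem_range] at ht
      have hl : (covFold c (D t)).lvl = j := by rw [covFold_lvl hne0, ht.2]
      have hsum : ∑ h, ∑ s, ∑ a, covReward c (D t) h s a = 1 :=
        sum_weights (by rw [hl]; exact hjne)
      calc m = m * ∑ h, ∑ s, ∑ a, covReward c (D t) h s a := by rw [hsum, mul_one]
        _ ≤ _ := by
          unfold pairing
          simp only [Finset.mul_sum]
          refine Finset.sum_le_sum fun h _ => Finset.sum_le_sum fun s _ =>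
            Finset.sum_le_sum fun a _ => ?_
          by_cases hmem : (h, s, a) ∈ level c j
          · exact mul_le_mul_of_nonneg_right (hmin _ hmem) (weights_nonneg _ _ _ _ _)
          · have : covReward c (D t) h s a = 0 := weights_of_notMem (by rw [hl]; exact hmem)
            rw [this, mul_zero, mul_zero]
    -- The regret bound is linear in the occupancy of the comparator, so it extends from policies to
    -- their mixtures.
    have hup := sum_pairing_le_of_mem_mixOcc M I (fun t => covReward c (D t)) _
      (fun ρ => hE.regret T I (Finset.filter_subset _ _) ρ) homem
    have hlev := hE.atLevel j T
    have hloss : levelLoss c j (D T) ≤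
        4 * (cmin c * 2 ^ j) + 36 * Real.log (level c j).card + 1 := by
      obtain ⟨T', rfl⟩ : ∃ T', T = T' + 1 := ⟨T - 1, by omega⟩
      exact levelLoss_le (hU T' (Nat.lt_succ_self _)) j
    have hN := log_card_level_le (S := S) (A := A) hH c j
    have hlc := log_levelConf_le hδ hjJ
    have hdom := log_terms_le_ucbviRegret (S := S) (A := A) hH hδ hδ1 hT
    rw [← hR] at hdom
    -- As 5/4 · 8/5 = 2, the left-hand side is at most twice the loss at the level, hence at most 8
    -- c_min 2^j ≤ 16 φ m + 8 plus logarithms, plus R; constants and logarithms are absorbed by a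
    -- second R.
    have hfin : (I.card : ℝ) * m ≤ 16 * φ * m + (2 * R + 4 * (J + 1)) := by
      have e1 := hlow.trans hup
      rw [← halg, ← hD, ← hI] at hlev
      rw [← halg, ← hD, ← hR] at e1
      linarith
    have hfin2 : (2 * R + 4 * ((J : ℝ) + 1)) ≤ (4 * R + 8 * (J + 1)) / μ * m := by
      rw [div_mul_eq_mul_div, le_div_iff₀ hμ]
      have : 0 ≤ 2 * R + 4 * ((J : ℝ) + 1) := by positivity
      nlinarith
    refine le_of_mul_le_mul_right ?_ hm0
    rw [add_mul]
    linarith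
  have hcard : T = ∑ j ∈ Finset.range (J + 1),
      ((Finset.range T).filter fun t => nextLevel c (D t) = j).card := by
    rw [← Finset.card_eq_sum_card_fiberwise (f := fun t => nextLevel c (D t)), Finset.card_range]
    intro t ht
    have ht' : t < T := by simpa using ht
    have := nextLevel_le (hU t ht') hJ
    simp only [Finset.coe_range, Set.mem_Iio]
    omega
  calc (T : ℝ) = ∑ j ∈ Finset.range (J + 1),
        (((Finset.range T).filter fun t => nextLevel c (D t) = j).card : ℝ) := by exact_mod_cast hcard
    _ ≤ ∑ _j ∈ Finset.range (J + 1), (16 * φ + (4 * R + 8 * (J + 1)) / μ) :=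
        Finset.sum_le_sum fun j hj => hlvl j (by rw [Finset.mem_range] at hj; omega)
    _ = _ := by rw [Finset.sum_const, Finset.card_range, nsmul_eq_mul]; push_cast; ring

/-- CovGame covers its target within a number of rounds that is controlled by the coverage of the
target by mixtures of policies. -/
structure CovSuccess (M : MDP S A H) (c : Table S A H) (δ : ℝ) (D : List (Episode S A H)) :
    Prop where
  covers : ∀ h s a, c h s a ≤ count D h s a
  length_le : ∀ (φ μ : ℝ) (J : ℕ), ∀ o₁ ∈ M.mixOcc, ∀ o₂ ∈ M.mixOcc, 0 < μ → 0 ≤ φ →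
    (∀ x ∈ level c 0, 0 ≤ o₁ x.1 x.2.1 x.2.2) →
    (∀ x ∈ level c 0, c x.1 x.2.1 x.2.2 ≤ φ * o₁ x.1 x.2.1 x.2.2) →
    (∀ x ∈ level c 0, μ ≤ o₂ x.1 x.2.1 x.2.2) →
    (∀ x ∈ level c 0, c x.1 x.2.1 x.2.2 ≤ 2 ^ J) →
    (D.length : ℝ) ≤ 1 + (J + 1) *
      (16 * φ + (4 * ucbviRegret S A H (δ / 2) D.length + 8 * (J + 1)) / μ)

lemma covDone_iff (sel : (A → ℝ) → A) (env : Env S A H) (c : Table S A H) (δ : ℝ) (t : ℕ) :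
    CovDone sel env c δ t ↔
      1 ≤ t ∧ ¬ Undone c (runData (ucbviAlg sel (δ / 2) (covReward c)) env t) := by
  rw [CovDone, not_undone_iff, covState_data]

lemma undone_of_not_covDone {sel : (A → ℝ) → A} {env : Env S A H} {c : Table S A H} {δ : ℝ} {t : ℕ}
    (h : ¬ CovDone sel env c δ t) (hne : (level c 0).Nonempty) :
    Undone c (runData (ucbviAlg sel (δ / 2) (covReward c)) env t) := by
  rw [covDone_iff] at h
  by_contra hcon
  rcases Nat.eq_zero_or_pos t with rfl | ht
  · obtain ⟨x, hx⟩ := hne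
    exact hcon ⟨x, hx, by simpa [runData] using mem_level_zero.1 hx⟩
  · exact h ⟨ht, hcon⟩

/-- Without termination `rounds_le`, with the explorer as both comparators, would bound every T by a
constant plus a multiple of log(T+1)². The bound on the length is `rounds_le` at the stopping time.
-/
theorem CovEvent.success [Nonempty S] [Nonempty A] {M : MDP S A H} (hH : 0 < H)
    {sel : (A → ℝ) → A} {c : Table S A H}
    {δ : ℝ} (hδ : 0 < δ) (hδ1 : δ ≤ 1) {env : Env S A H} (hE : CovEvent M sel c δ env)
    (hc : ∃ μ > 0, ∃ o ∈ M.mixOcc, ∀ x ∈ level c 0, μ ≤ o x.1 x.2.1 x.2.2) :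
    ∃ D, covGame sel env c δ = some D ∧ CovSuccess M c δ D := by
  have hterm : ∃ t, CovDone sel env c δ t := by
    by_contra hcon
    push Not at hcon
    by_cases hne : (level c 0).Nonempty
    · obtain ⟨μ, hμ, o, ho, hμo⟩ := hc
      obtain ⟨y, -, hy⟩ := Finset.exists_max_image (level c 0) (fun x => c x.1 x.2.1 x.2.2) hne
      obtain ⟨J, hJ⟩ := pow_unbounded_of_one_lt (c y.1 y.2.1 y.2.2) (one_lt_two (α := ℝ))
      have hJ' : ∀ x ∈ level c 0, c x.1 x.2.1 x.2.2 ≤ 2 ^ J := fun x hx => (hy x hx).trans hJ.le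
      have hb : ∀ T : ℕ, 0 < T → (T : ℝ) ≤ (J + 1) *
          (16 * (2 ^ J / μ) + (4 * ucbviRegret S A H (δ / 2) T + 8 * (J + 1)) / μ) := fun T hT =>
        hE.rounds_le hH hδ hδ1 hT (fun t _ => undone_of_not_covDone (hcon t) hne) hμ
          (by positivity) ho ho (fun x hx => hμ.le.trans (hμo x hx))
          (fun x hx => (hJ' x hx).trans (by
            rw [div_mul_eq_mul_div, le_div_iff₀ hμ]
            exact mul_le_mul_of_nonneg_left (hμo x hx) (by positivity))) hμo hJ'
      obtain ⟨h1, h2⟩ := log_conf_nonneg (S := S) (A := A) hH (half_pos hδ) (by linarith)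
      have h3 := h2.trans h1
      obtain ⟨T, hT⟩ := exists_log_sq_le (c := (J + 1) * (4 / μ) *
        (65536 * Fintype.card S * Fintype.card A *
        (H : ℝ) ^ 2 * (Real.log (2 * Fintype.card S * Fintype.card A * H / (δ / 2)) +
        6 * Fintype.card S)))
        (d := (J + 1) * (16 * (2 ^ J / μ) + 8 * (J + 1) / μ) + 1)
        (e := 1) (by positivity) (by positivity) (by positivity)
      have hTpos : 0 < T := by
        rcases Nat.eq_zero_or_pos T with h0 | h0
        · rw [h0] at hT
          simp only [Nat.cast_zero, zero_add, Real.log_one, mul_zero, ne_eq, OfNat.ofNat_ne_zero,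
            not_false_eq_true, zero_pow] at hT
          have : (0 : ℝ) ≤ (J + 1) * (16 * (2 ^ J / μ) + 8 * (J + 1) / μ) := by positivity
          linarith
        · exact h0
      have := hb T hTpos
      unfold ucbviRegret at this
      have e1 : ((J : ℝ) + 1) * (16 * (2 ^ J / μ) + (4 * (65536 * Fintype.card S * Fintype.card A *
        (H : ℝ) ^ 2 * (Real.log (2 * Fintype.card S * Fintype.card A * H / (δ / 2)) +
        6 * Fintype.card S) * Real.log (T + 1) ^ 2) + 8 * (J + 1)) / μ) =
        (J + 1) * (4 / μ) * (65536 * Fintype.card S * Fintype.card A *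
        (H : ℝ) ^ 2 * (Real.log (2 * Fintype.card S * Fintype.card A * H / (δ / 2)) +
        6 * Fintype.card S)) * Real.log (T + 1) ^ 2 +
        (J + 1) * (16 * (2 ^ J / μ) + 8 * (J + 1) / μ) := by ring
      rw [e1] at this
      linarith
    · refine hcon 1 ((covDone_iff _ _ _ _ _).2 ⟨le_rfl, ?_⟩)
      rintro ⟨x, hx, -⟩
      exact hne ⟨x, hx⟩
  refine ⟨_, dif_pos hterm, ?_⟩
  have hspec := Nat.find_spec hterm
  set T := Nat.find hterm with hT
  have hlen : (covState sel env c δ T).data.length = T := by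
    rw [covState_data, length_runData]
  refine ⟨hspec.2, ?_⟩
  intro φ μ J o₁ ho₁ o₂ ho₂ hμ hφ h0 h1 h2 h3
  rw [hlen]
  have hR0 := ucbviRegret_nonneg (S := S) (A := A) hH (half_pos hδ) (by linarith) T
  by_cases hne : (level c 0).Nonempty
  · have := hE.rounds_le hH hδ hδ1 hspec.1
      (fun t ht => undone_of_not_covDone (Nat.find_min hterm ht) hne) hμ hφ ho₁ ho₂ h0 h1 h2 h3
    linarith
  -- Without positive targets the test succeeds at its first opportunity, after round 1.
  · have hT1 : T ≤ 1 := by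
      refine Nat.find_min' hterm ((covDone_iff _ _ _ _ _).2 ⟨le_rfl, ?_⟩)
      rintro ⟨x, hx, -⟩
      exact hne ⟨x, hx⟩
    have hT1' : (T : ℝ) ≤ 1 := by exact_mod_cast hT1
    have : 0 ≤ ((J : ℝ) + 1) *
        (16 * φ + (4 * ucbviRegret S A H (δ / 2) T + 8 * (J + 1)) / μ) := by positivity
    linarith

end

section

open scoped Classical


/-! ### The Gaussian mixture -/

/-- The mixture `√(v/2π) ∫ exp(g y - v (n+1) g²/2) dg`. -/
def gaussMix (v : ℝ) (n : ℕ) (y : ℝ) : ℝ :=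
  Real.exp (y ^ 2 / (2 * v * (n + 1))) / Real.sqrt (n + 1)

lemma gaussMix_pos (v : ℝ) (n : ℕ) (y : ℝ) : 0 < gaussMix v n y := by
  unfold gaussMix; positivity

lemma gaussian_square {b : ℝ} (hb : 0 < b) (y g : ℝ) :
    Real.exp (g * y - b * g ^ 2) =
      Real.exp (y ^ 2 / (4 * b)) * Real.exp (-b * (g - y / (2 * b)) ^ 2) := by
  rw [← Real.exp_add]; congr 1; field_simp; ring

lemma integrable_gaussian_shift {b : ℝ} (hb : 0 < b) (y : ℝ) :
    Integrable fun g : ℝ => Real.exp (g * y - b * g ^ 2) := by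
  simp only [gaussian_square hb]
  exact ((integrable_exp_neg_mul_sq hb).comp_sub_right (y / (2 * b))).const_mul _

lemma integral_gaussian_shift {b : ℝ} (hb : 0 < b) (y : ℝ) :
    ∫ g : ℝ, Real.exp (g * y - b * g ^ 2) =
      Real.exp (y ^ 2 / (4 * b)) * Real.sqrt (Real.pi / b) := by
  simp only [gaussian_square hb]
  rw [integral_const_mul, integral_sub_right_eq_self (fun g : ℝ => Real.exp (-b * g ^ 2)),
    integral_gaussian]

lemma gaussMix_eq {v : ℝ} (hv : 0 < v) (n : ℕ) (y : ℝ) :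
    gaussMix v n y = Real.sqrt (v / (2 * Real.pi)) *
      ∫ g : ℝ, Real.exp (g * y - v * (n + 1) / 2 * g ^ 2) := by
  have hb : 0 < v * ((n : ℝ) + 1) / 2 := by positivity
  have hpi := Real.pi_pos
  rw [integral_gaussian_shift hb, mul_left_comm, ← Real.sqrt_mul (by positivity), gaussMix,
    div_eq_mul_inv, ← Real.sqrt_inv]
  congr 2
  · congr 1; ring
  · field_simp

/-- For fixed g, exp(g y - v (n+1) g²/2) does not increase in mean under increments that are
sub-Gaussian with variance proxy `v`; integrating over g keeps this. The `+ 1` acts as one virtual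
visit and makes the mixing density proper. -/
lemma gaussMix_step {S : Type*} [Fintype S] {v : ℝ} (hv : 0 < v) {p ξ : S → ℝ}
    (hmgf : ∀ g : ℝ, ∑ x, p x * Real.exp (g * ξ x) ≤ Real.exp (v * g ^ 2 / 2)) (n : ℕ) (y : ℝ) :
    ∑ x, p x * gaussMix v (n + 1) (y + ξ x) ≤ gaussMix v n y := by
  have hb : ∀ n : ℕ, 0 < v * ((n : ℝ) + 1) / 2 := fun n => by positivity
  simp only [gaussMix_eq hv, mul_left_comm (p _), ← Finset.mul_sum]
  refine mul_le_mul_of_nonneg_left ?_ (Real.sqrt_nonneg _)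
  simp only [← integral_const_mul]
  rw [← integral_finsetSum _ fun x _ => (integrable_gaussian_shift (hb _) _).const_mul _]
  refine integral_mono (integrable_finsetSum _ fun x _ =>
    (integrable_gaussian_shift (hb _) _).const_mul _) (integrable_gaussian_shift (hb _) _) ?_
  intro g
  have h1 : ∀ x, p x * Real.exp (g * (y + ξ x) - v * (((n + 1 : ℕ) : ℝ) + 1) / 2 * g ^ 2) =
      Real.exp (g * y - v * (n + 1 + 1) / 2 * g ^ 2) * (p x * Real.exp (g * ξ x)) := by
    intro x
    rw [mul_left_comm, ← Real.exp_add]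
    congr 2; push_cast; ring
  simp only [h1, ← Finset.mul_sum]
  refine (mul_le_mul_of_nonneg_left (hmgf g) (Real.exp_pos _).le).trans (le_of_eq ?_)
  rw [← Real.exp_add]; congr 1; ring

section

variable {S A : Type*} [Fintype S] [Fintype A] {H : ℕ}
variable [MeasurableSpace S] [DiscreteMeasurableSpace S]

/-- Hoeffding's lemma for the transitions of an MDP. -/
lemma MDP.sum_exp_le (M : MDP S A H) (h : Fin H) (s : S) (a : A) {V : S → ℝ} {B : ℝ} (hB : 0 ≤ B)
    (hV : ∀ x, V x ∈ Set.Icc 0 B) (g : ℝ) :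
    ∑ x, M.model h s a x * Real.exp (g * (V x - expect (M.model h s a) V)) ≤
      Real.exp (B ^ 2 / 4 * g ^ 2 / 2) := by
  have h1 := (ProbabilityTheory.hasSubgaussianMGF_of_mem_Icc (μ := (M.trans h s a).toMeasure)
    (X := V) (a := 0) (b := B) (measurable_of_finite V).aemeasurable
    (Filter.Eventually.of_forall hV)).mgf_le g
  unfold ProbabilityTheory.mgf at h1
  rw [PMF.integral_eq_sum, PMF.integral_eq_sum] at h1
  simp only [smul_eq_mul] at h1
  refine h1.trans (le_of_eq ?_)
  congr 1
  push_cast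
  rw [sub_zero, Real.norm_of_nonneg hB]
  ring

end

variable {S A : Type*} [Fintype S] [Fintype A] {H : ℕ}

/-! ### Deviations of the empirical model -/

/-- The sum, over the visits of `(h, s, π_h(s))`, of the deviations of the values at the next
state from their mean. -/
def deviation (P : Model S A H) (D : List (Episode S A H)) (π : DetPolicy S A H)
    (V : Fin H → S → ℝ) (h : Fin H) (s : S) : ℝ :=
  ∑ x, (countNext D h s (π h s) x : ℝ) * (V h x - expect (P h s (π h s)) (V h))

lemma deviation_nil (P : Model S A H) (π : DetPolicy S A H) (V : Fin H → S → ℝ) (h : Fin H)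
    (s : S) : deviation P [] π V h s = 0 := by simp [deviation]

lemma deviation_append (P : Model S A H) (D : List (Episode S A H)) (e : Episode S A H)
    (π : DetPolicy S A H) (V : Fin H → S → ℝ) (h : Fin H) (s : S) :
    deviation P (D ++ [e]) π V h s = deviation P D π V h s +
      if e.state h.castSucc = s ∧ e.action h = π h s then
        V h (e.state h.succ) - expect (P h s (π h s)) (V h) else 0 := by
  unfold deviation
  simp only [countNext_append, Nat.cast_add, add_mul, Finset.sum_add_distrib]
  congr 1
  split_ifs with hc
  · rw [Finset.sum_eq_single (e.state h.succ)]
    · simp [hc.1, hc.2]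
    · intro x _ hx
      rw [if_neg fun h' => hx h'.2.2.symm]; simp
    · simp
  · refine Finset.sum_eq_zero fun x _ => ?_
    rw [if_neg fun h' => hc ⟨h'.1, h'.2.1⟩]; simp

lemma deviation_eq (P : Model S A H) (D : List (Episode S A H)) (π : DetPolicy S A H)
    (V : Fin H → S → ℝ) (h : Fin H) (s : S) (hn : count D h s (π h s) ≠ 0) :
    deviation P D π V h s = count D h s (π h s) *
      (expect (empirical D h s (π h s)) (V h) - expect (P h s (π h s)) (V h)) := by
  have hn' : (count D h s (π h s) : ℝ) ≠ 0 := by exact_mod_cast hn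
  unfold deviation
  simp only [mul_sub, Finset.sum_sub_distrib, ← Finset.sum_mul]
  rw [← Nat.cast_sum, sum_countNext]
  congr 1
  rw [expect, Finset.mul_sum]
  refine Finset.sum_congr rfl fun x _ => ?_
  rw [empirical, if_neg hn]
  field_simp

/-- The mixture martingale of a policy and a family of values. -/
def mixProd (P : Model S A H) (v : ℝ) (π : DetPolicy S A H) (V : Fin H → S → ℝ)
    (D : List (Episode S A H)) : ℝ :=
  ∏ h, ∏ s, gaussMix v (count D h s (π h s)) (deviation P D π V h s)

lemma mixProd_pos (P : Model S A H) (v : ℝ) (π : DetPolicy S A H) (V : Fin H → S → ℝ)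
    (D : List (Episode S A H)) : 0 < mixProd P v π V D :=
  Finset.prod_pos fun _ _ => Finset.prod_pos fun _ _ => gaussMix_pos _ _ _

/-- Per stage only the occupied state changes its factor, and only if the action is that of `π`;
thus the multiplier is a `trajProd`. A product over all `(h, s)` bounds the sum of the squared
deviations with a single log(1/δ). -/
lemma mixProd_append (P : Model S A H) (v : ℝ) (π : DetPolicy S A H) (V : Fin H → S → ℝ)
    (D : List (Episode S A H)) (e : Episode S A H) :
    mixProd P v π V (D ++ [e]) = mixProd P v π V D * trajProd (fun h s a x =>
      if a = π h s then gaussMix v (count D h s (π h s) + 1)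
        (deviation P D π V h s + (V h x - expect (P h s (π h s)) (V h))) /
        gaussMix v (count D h s (π h s)) (deviation P D π V h s) else 1) e := by
  unfold mixProd trajProd
  rw [← Finset.prod_mul_distrib]
  refine Finset.prod_congr rfl fun h _ => ?_
  have h1 : ∀ s, gaussMix v (count (D ++ [e]) h s (π h s)) (deviation P (D ++ [e]) π V h s) =
      gaussMix v (count D h s (π h s)) (deviation P D π V h s) *
      if e.state h.castSucc = s then
        (if e.action h = π h s then gaussMix v (count D h s (π h s) + 1)
        (deviation P D π V h s + (V h (e.state h.succ) - expect (P h s (π h s)) (V h))) /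
        gaussMix v (count D h s (π h s)) (deviation P D π V h s) else 1) else 1 := by
    intro s
    have hg := (gaussMix_pos v (count D h s (π h s)) (deviation P D π V h s)).ne'
    rw [count_append, deviation_append]
    by_cases h2 : e.state h.castSucc = s <;> by_cases h3 : e.action h = π h s
    · simp only [h2, h3, and_self, if_true]
      rw [mul_div_cancel₀ _ hg]
    all_goals simp [h2, h3]
  rw [Finset.prod_congr rfl fun s _ => h1 s, Finset.prod_mul_distrib, Finset.prod_ite_eq,
    if_pos (Finset.mem_univ _)]

lemma sum_count_policy_le (D : List (Episode S A H)) (π : DetPolicy S A H) (h : Fin H) :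
    ∑ s, count D h s (π h s) ≤ D.length := by
  induction D using List.reverseRecOn with
  | nil => simp
  | append_singleton D e ih =>
    simp only [count_append, Finset.sum_add_distrib, List.length_append, List.length_singleton]
    refine add_le_add ih ?_
    calc ∑ s, (if e.state h.castSucc = s ∧ e.action h = π h s then 1 else 0)
        ≤ ∑ s, (if e.state h.castSucc = s then 1 else 0) := by
          refine Finset.sum_le_sum fun s _ => ?_
          split_ifs with h1 h2 h2
          · exact le_rfl
          · exact absurd h1.1 h2
          · exact Nat.zero_le _
          · exact le_rfl
      _ = 1 := by simp

/-- A bound on the mixture martingale yields a bound on the weighted deviations. -/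
lemma sum_dev_sq_le {P : Model S A H} {B δ : ℝ} (hB : 0 < B) {π : DetPolicy S A H}
    {V : Fin H → S → ℝ} {D : List (Episode S A H)}
    (hZ : mixProd P (B ^ 2 / 4) π V D ≤ 1 / δ) :
    ∑ h, ∑ s, (count D h s (π h s) : ℝ) *
        (expect (empirical D h s (π h s)) (V h) - expect (P h s (π h s)) (V h)) ^ 2 ≤
      B ^ 2 * (Real.log (1 / δ) + H * Fintype.card S / 2 * Real.log (1 + D.length)) := by
  have h1 := Real.log_le_log (mixProd_pos _ _ _ _ _) hZ
  unfold mixProd at h1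
  rw [Real.log_prod fun h _ => (Finset.prod_pos fun s _ => gaussMix_pos _ _ _).ne'] at h1
  simp only [Real.log_prod fun s _ => (gaussMix_pos _ _ _).ne'] at h1
  have h2 : ∀ h s, (count D h s (π h s) : ℝ) *
        (expect (empirical D h s (π h s)) (V h) - expect (P h s (π h s)) (V h)) ^ 2 ≤
      B ^ 2 * (Real.log (gaussMix (B ^ 2 / 4) (count D h s (π h s)) (deviation P D π V h s)) +
        1 / 2 * Real.log (1 + D.length)) := by
    intro h s
    set n := count D h s (π h s) with hn
    have hnD : (n : ℝ) ≤ D.length := by exact_mod_cast count_le_length D h s (π h s)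
    have hn0 : (0 : ℝ) ≤ n := Nat.cast_nonneg _
    have h3 : Real.log (gaussMix (B ^ 2 / 4) n (deviation P D π V h s)) =
        2 * deviation P D π V h s ^ 2 / (B ^ 2 * (n + 1)) - 1 / 2 * Real.log (n + 1) := by
      unfold gaussMix
      rw [Real.log_div (Real.exp_pos _).ne' (by positivity), Real.log_exp, Real.log_sqrt
        (by positivity)]
      congr 1
      · field_simp; ring
      · ring
    have h4 : Real.log ((n : ℝ) + 1) ≤ Real.log (1 + D.length) :=
      Real.log_le_log (by positivity) (by linarith)
    -- The virtual visit turns n into n²/(n+1), which is at least n/2 for n ≥ 1.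
    have h5 : (n : ℝ) * (expect (empirical D h s (π h s)) (V h) -
        expect (P h s (π h s)) (V h)) ^ 2 ≤ 2 * deviation P D π V h s ^ 2 / (n + 1) := by
      by_cases h0 : n = 0
      · rw [h0]; simp only [Nat.cast_zero, zero_mul]; positivity
      · rw [deviation_eq P D π V h s h0, ← hn, le_div_iff₀ (by positivity)]
        have h6 : (1 : ℝ) ≤ n := by exact_mod_cast Nat.one_le_iff_ne_zero.2 h0
        set z := (expect (empirical D h s (π h s)) (V h) - expect (P h s (π h s)) (V h)) ^ 2
          with hz
        have hz0 : 0 ≤ z := sq_nonneg _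
        rw [mul_pow, ← hz]
        have : (n : ℝ) * (n + 1) ≤ 2 * n ^ 2 := by nlinarith
        nlinarith [mul_le_mul_of_nonneg_right this hz0]
    rw [h3]
    have h7 : 2 * deviation P D π V h s ^ 2 / (n + 1) =
        B ^ 2 * (2 * deviation P D π V h s ^ 2 / (B ^ 2 * (n + 1))) := by field_simp
    rw [h7] at h5
    have h8 : 0 ≤ B ^ 2 := sq_nonneg B
    nlinarith [mul_le_mul_of_nonneg_left h4 h8]
  calc _ ≤ ∑ h, ∑ s, B ^ 2 * (Real.log (gaussMix (B ^ 2 / 4) (count D h s (π h s))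
        (deviation P D π V h s)) + 1 / 2 * Real.log (1 + D.length)) :=
        Finset.sum_le_sum fun h _ => Finset.sum_le_sum fun s _ => h2 h s
    _ = B ^ 2 * (∑ h, ∑ s, Real.log (gaussMix (B ^ 2 / 4) (count D h s (π h s))
        (deviation P D π V h s)) + H * Fintype.card S / 2 * Real.log (1 + D.length)) := by
        simp only [← Finset.mul_sum, Finset.sum_add_distrib, Finset.sum_const, Finset.card_univ,
          Fintype.card_fin, nsmul_eq_mul]
        ring
    _ ≤ _ := by gcongr

/-- Values rounded to a grid of mesh `H / q`. -/
def gridValue (q : ℕ) (g : Fin H → S → Fin (q + 1)) : Fin H → S → ℝ :=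
  fun h x => H * (g h x : ℕ) / q

lemma gridValue_mem {q : ℕ} (g : Fin H → S → Fin (q + 1)) (h : Fin H) (x : S) :
    gridValue q g h x ∈ Set.Icc (0 : ℝ) H := by
  unfold gridValue
  refine ⟨by positivity, div_le_of_le_mul₀ (by positivity) (by positivity) ?_⟩
  have : ((g h x : ℕ) : ℝ) ≤ q := by exact_mod_cast Nat.lt_succ_iff.1 (g h x).2
  gcongr

lemma exists_gridValue (hH : 0 < H) {q : ℕ} (hq : 0 < q) {V : Fin H → S → ℝ}
    (hV : ∀ h x, V h x ∈ Set.Icc (0 : ℝ) H) :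
    ∃ g : Fin H → S → Fin (q + 1), ∀ h x,
      V h x - gridValue q g h x ∈ Set.Icc (0 : ℝ) (H / q) := by
  have hH' : (0 : ℝ) < H := by exact_mod_cast hH
  have hq' : (0 : ℝ) < q := by exact_mod_cast hq
  have hnn : ∀ h x, 0 ≤ V h x * q / H := fun h x =>
    div_nonneg (mul_nonneg (hV h x).1 hq'.le) hH'.le
  refine ⟨fun h x => ⟨⌊V h x * q / H⌋₊, Nat.lt_succ_of_le ?_⟩, fun h x => ?_⟩
  · refine Nat.floor_le_of_le ?_
    rw [div_le_iff₀ hH']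
    nlinarith [(hV h x).2]
  · have h1 := Nat.floor_le (hnn h x)
    have h2 := (Nat.lt_floor_add_one (V h x * q / H)).le
    unfold gridValue
    simp only
    set f : ℝ := (⌊V h x * q / H⌋₊ : ℝ) with hf
    rw [le_div_iff₀ hH'] at h1
    rw [div_le_iff₀ hH'] at h2
    constructor
    · rw [sub_nonneg, div_le_iff₀ hq']; linarith
    · rw [sub_le_iff_le_add, ← add_div, le_div_iff₀ hq']; linarith

variable [MeasurableSpace S] [DiscreteMeasurableSpace S]

lemma law_mixProd (M : MDP S A H) (hH : 0 < H) (alg : List (Episode S A H) → DetPolicy S A H)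
    (π : DetPolicy S A H) {V : Fin H → S → ℝ} (hV : ∀ h x, V h x ∈ Set.Icc (0 : ℝ) H) {δ : ℝ}
    (hδ : 0 < δ) :
    M.law {ω | ∃ t, 1 / δ ≤ mixProd M.model ((H : ℝ) ^ 2 / 4) π V (runData alg (M.env ω) t)} ≤
      ENNReal.ofReal δ := by
  have hH' : (0 : ℝ) < H := by exact_mod_cast hH
  refine ville M (mixProd M.model ((H : ℝ) ^ 2 / 4) π V) (fun D => (mixProd_pos _ _ _ _ _).le)
    alg ?_ ?_ hδ
  · intro D
    simp only [mixProd_append]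
    rw [integral_const_mul]
    refine mul_le_of_le_one_right (mixProd_pos _ _ _ _ _).le (integral_trajProd_le M _ _ ?_ ?_)
    · intro h s a x
      split_ifs
      · exact (div_pos (gaussMix_pos _ _ _) (gaussMix_pos _ _ _)).le
      · exact zero_le_one
    · intro h s a
      by_cases ha : a = π h s
      · subst ha
        simp only [if_true, mul_div_assoc', ← Finset.sum_div]
        rw [div_le_one (gaussMix_pos _ _ _)]
        exact gaussMix_step (by positivity) (fun g => M.sum_exp_le h s _ hH'.le (hV h) g) _ _
      · simp only [if_neg ha, mul_one, M.sum_model, le_refl]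
  · simp [mixProd, deviation_nil, gaussMix]

/-- Concentration of the empirical model, uniformly in time, over deterministic policies and over
values. -/
theorem law_transition_error [Nonempty A] (M : MDP S A H) (hH : 0 < H)
    (alg : List (Episode S A H) → DetPolicy S A H) {δ : ℝ} (hδ : 0 < δ) (hδ1 : δ ≤ 1) :
    M.law {ω | ¬ ∀ t, ∀ π : DetPolicy S A H, ∀ V : Fin H → S → ℝ,
      (∀ h x, V h x ∈ Set.Icc (0 : ℝ) H) →
      ∑ h, ∑ s, (count (runData alg (M.env ω) t) h s (π h s) : ℝ) *
        (expect (empirical (runData alg (M.env ω) t) h s (π h s)) (V h) -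
          expect (M.model h s (π h s)) (V h)) ^ 2 ≤ betaRF S A H t δ / 2} ≤ ENNReal.ofReal δ := by
  have hne : Nonempty S := ⟨M.init⟩
  have hH' : (1 : ℝ) ≤ H := by exact_mod_cast hH
  have hS : (1 : ℝ) ≤ Fintype.card S := by exact_mod_cast Fintype.card_pos
  have hA : (1 : ℝ) ≤ Fintype.card A := by exact_mod_cast Fintype.card_pos
  have hl0 : 0 ≤ Real.log (1 / δ) := Real.log_nonneg (by rw [le_div_iff₀ hδ]; linarith)
  -- A union bound over policies and values on a grid of mesh H/q, for every q at once; at time `t`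
  -- the grid with q = t is used.
  let N : ℕ → ℕ := fun q => Fintype.card (DetPolicy S A H × (Fin H → S → Fin (q + 1)))
  have hN : ∀ q, 0 < N q := fun q => Fintype.card_pos
  have hNeq : ∀ q, (N q : ℝ) = (Fintype.card A * (1 + q : ℝ)) ^ (Fintype.card S * H) := by
    intro q
    simp only [N, Fintype.card_prod, Fintype.card_fun, Fintype.card_fin]
    push_cast
    rw [← pow_mul, ← pow_mul, mul_pow, add_comm (q : ℝ)]
  -- `levelConf (2 * δ)` sums to δ over q.
  let c : ℕ → ℝ := fun q => levelConf (2 * δ) q / N q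
  have hc : ∀ q, 0 < c q := fun q =>
    div_pos (levelConf_pos (by positivity) q) (by exact_mod_cast hN q)
  have hsub : {ω | ¬ ∀ t, ∀ π : DetPolicy S A H, ∀ V : Fin H → S → ℝ,
      (∀ h x, V h x ∈ Set.Icc (0 : ℝ) H) →
      ∑ h, ∑ s, (count (runData alg (M.env ω) t) h s (π h s) : ℝ) *
        (expect (empirical (runData alg (M.env ω) t) h s (π h s)) (V h) -
          expect (M.model h s (π h s)) (V h)) ^ 2 ≤ betaRF S A H t δ / 2} ⊆
      ⋃ q, ⋃ j : DetPolicy S A H × (Fin H → S → Fin (q + 1)), {ω | ∃ t, 1 / c q ≤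
        mixProd M.model ((H : ℝ) ^ 2 / 4) j.1 (gridValue q j.2) (runData alg (M.env ω) t)} := by
    intro ω hω
    by_contra hcon
    simp only [Set.mem_iUnion, Set.mem_ofPred_eq, not_exists, not_le] at hcon
    refine hω fun t π V hV => ?_
    set D := runData alg (M.env ω) t with hD
    have hlen : D.length = t := length_runData _ _ _
    -- At time 0 the mesh H/t makes no sense, but all counts vanish.
    rcases Nat.eq_zero_or_pos t with h0 | ht
    · have hz : ∀ h s, count D h s (π h s) = 0 := fun h s =>
        Nat.le_zero.1 ((count_le_length _ _ _ _).trans (by rw [hlen, h0]))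
      simp only [hz, Nat.cast_zero, zero_mul, Finset.sum_const_zero]
      unfold betaRF
      have : 0 ≤ Real.log (Fintype.card A * (1 + (t : ℝ))) := by
        rw [h0]; exact Real.log_nonneg (by simpa using hA)
      positivity
    obtain ⟨g, hg⟩ := exists_gridValue hH ht hV
    have ht' : (1 : ℝ) ≤ t := by exact_mod_cast ht
    have hb := sum_dev_sq_le (P := M.model) (B := H) (by linarith) (hcon t (π, g) t).le
    simp only at hb
    rw [← hD, hlen] at hb
    set W := gridValue t g with hW
    have hterm : ∀ h s, (count D h s (π h s) : ℝ) *
        (expect (empirical D h s (π h s)) (V h) - expect (M.model h s (π h s)) (V h)) ^ 2 ≤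
        2 * ((count D h s (π h s) : ℝ) *
        (expect (empirical D h s (π h s)) (W h) - expect (M.model h s (π h s)) (W h)) ^ 2) +
        2 * ((H : ℝ) / t) ^ 2 * count D h s (π h s) := by
      intro h s
      have e1 : ∀ p : S → ℝ, (∀ x, 0 ≤ p x) → ∑ x, p x = 1 →
          expect p (V h) - expect p (W h) ∈ Set.Icc (0 : ℝ) (H / t) := by
        intro p hp hp1
        have : expect p (V h) - expect p (W h) = ∑ x, p x * (V h x - W h x) := by
          simp only [expect, mul_sub, Finset.sum_sub_distrib]
        rw [this]
        refine ⟨Finset.sum_nonneg fun x _ => mul_nonneg (hp x) (hg h x).1, ?_⟩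
        calc _ ≤ ∑ x, p x * (H / t : ℝ) :=
              Finset.sum_le_sum fun x _ => mul_le_mul_of_nonneg_left (hg h x).2 (hp x)
          _ = _ := by rw [← Finset.sum_mul, hp1, one_mul]
      have a1 := e1 _ (empirical_nonneg D h s (π h s)) (sum_empirical D h s (π h s))
      have a2 := e1 _ (M.model_nonneg h s (π h s)) (M.sum_model h s (π h s))
      set b : ℝ := (H : ℝ) / t
      set u := expect (empirical D h s (π h s)) (V h)
      set u' := expect (empirical D h s (π h s)) (W h)
      set w := expect (M.model h s (π h s)) (V h)
      set w' := expect (M.model h s (π h s)) (W h)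
      have a3 : (u - w) ^ 2 ≤ 2 * (u' - w') ^ 2 + 2 * b ^ 2 := by
        have a4 : ((u - w) - (u' - w')) ^ 2 ≤ b ^ 2 := by
          apply sq_le_sq'
          · linarith [a1.1, a2.2]
          · linarith [a1.2, a2.1]
        nlinarith [sq_nonneg ((u - w) - 2 * (u' - w'))]
      have a5 : (0 : ℝ) ≤ count D h s (π h s) := Nat.cast_nonneg _
      nlinarith [mul_le_mul_of_nonneg_left a3 a5]
    have hcnt : ∑ h, ∑ s, (count D h s (π h s) : ℝ) ≤ H * t := by
      calc _ ≤ ∑ _h : Fin H, (t : ℝ) := Finset.sum_le_sum fun h _ => by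
            have := sum_count_policy_le D π h
            rw [hlen] at this
            exact_mod_cast this
        _ = _ := by simp
    set L := Real.log (Fintype.card A * (1 + (t : ℝ))) with hL
    have hL2 : (0.69 : ℝ) ≤ L := by
      have := Real.log_two_gt_d9
      have h2 : Real.log 2 ≤ L := Real.log_le_log (by norm_num) (by nlinarith)
      linarith
    have hLt : Real.log (1 + (t : ℝ)) ≤ L :=
      Real.log_le_log (by positivity) (by nlinarith)
    have hlogc : Real.log (1 / c t) ≤ Real.log (1 / δ) + (3 + Fintype.card S * H) * L := by
      have e1 : 1 / c t = 1 / δ * ((t + 1) * (t + 2) * N t) := by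
        have : (N t : ℝ) ≠ 0 := by exact_mod_cast (hN t).ne'
        simp only [c, levelConf]; field_simp
      have e2 : Real.log (N t) = Fintype.card S * H * L := by
        rw [hNeq, Real.log_pow]; push_cast; ring
      have e3 : Real.log ((t : ℝ) + 2) ≤ 2 * Real.log (1 + (t : ℝ)) := by
        rw [← Real.log_rpow (by positivity)]
        apply Real.log_le_log (by positivity)
        norm_num
        nlinarith
      have hNpos : (0 : ℝ) < N t := by exact_mod_cast hN t
      rw [e1, Real.log_mul (by positivity) (by positivity), Real.log_mul (by positivity)
        hNpos.ne', Real.log_mul (by positivity) (by positivity), e2, add_comm (t : ℝ) 1]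
      linarith
    have hfin : ∑ h, ∑ s, (count D h s (π h s) : ℝ) *
        (expect (empirical D h s (π h s)) (V h) - expect (M.model h s (π h s)) (V h)) ^ 2 ≤
        2 * ((H : ℝ) ^ 2 * (Real.log (1 / c t) +
          H * Fintype.card S / 2 * Real.log (1 + t))) + 2 * ((H : ℝ) / t) ^ 2 * (H * t) := by
      calc _ ≤ ∑ h, ∑ s, (2 * ((count D h s (π h s) : ℝ) *
        (expect (empirical D h s (π h s)) (W h) - expect (M.model h s (π h s)) (W h)) ^ 2) +
        2 * ((H : ℝ) / t) ^ 2 * count D h s (π h s)) :=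
            Finset.sum_le_sum fun h _ => Finset.sum_le_sum fun s _ => hterm h s
        _ = 2 * (∑ h, ∑ s, (count D h s (π h s) : ℝ) *
        (expect (empirical D h s (π h s)) (W h) - expect (M.model h s (π h s)) (W h)) ^ 2) +
        2 * ((H : ℝ) / t) ^ 2 * ∑ h, ∑ s, (count D h s (π h s) : ℝ) := by
            simp only [Finset.sum_add_distrib, ← Finset.mul_sum]
        _ ≤ _ := by gcongr
    refine hfin.trans ?_
    -- At most H t visits are made, each with rounding error at most H/t: the total stays bounded in
    -- `t`.
    have hlast : 2 * ((H : ℝ) / t) ^ 2 * (H * t) ≤ 2 * (H : ℝ) ^ 3 := by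
      have : 2 * ((H : ℝ) / t) ^ 2 * (H * t) = 2 * (H : ℝ) ^ 3 / t := by field_simp
      rw [this]
      exact div_le_self (by positivity) ht'
    set K : ℝ := Fintype.card S * (H : ℝ) ^ 3 with hK
    have hK1 : (H : ℝ) ^ 3 ≤ K := le_mul_of_one_le_left (by positivity) hS
    have hK2 : (H : ℝ) ^ 2 ≤ K := by
      refine le_trans ?_ hK1
      exact pow_le_pow_right₀ hH' (by norm_num)
    have e1 : 2 * ((H : ℝ) ^ 2 * (Real.log (1 / c t) + H * Fintype.card S / 2 * Real.log (1 + t))) ≤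
        2 * (H : ℝ) ^ 2 * Real.log (1 / δ) + 6 * ((H : ℝ) ^ 2 * L) + 3 * (K * L) := by
      have e2 : 2 * ((H : ℝ) ^ 2 * (Real.log (1 / δ) + (3 + Fintype.card S * H) * L +
          H * Fintype.card S / 2 * L)) =
        2 * (H : ℝ) ^ 2 * Real.log (1 / δ) + 6 * ((H : ℝ) ^ 2 * L) + 3 * (K * L) := by
        rw [hK]; ring
      rw [← e2]
      gcongr
    have e3 : (H : ℝ) ^ 2 * L ≤ K * L := mul_le_mul_of_nonneg_right hK2 (by linarith)
    have e4 : (H : ℝ) ^ 3 ≤ 1.45 * (K * L) := by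
      have : 0 ≤ K := le_trans (by positivity) hK1
      nlinarith
    have e5 : betaRF S A H t δ / 2 = 2 * (H : ℝ) ^ 2 * Real.log (1 / δ) + 12 * (K * L) := by
      unfold betaRF; rw [hK]; ring
    rw [e5]
    have e6 : 0 ≤ K * L := mul_nonneg (le_trans (by positivity) hK1) (by linarith)
    linarith
  refine (measure_mono hsub).trans ((measure_iUnion_le _).trans ?_)
  calc _ ≤ ∑' q, ENNReal.ofReal (levelConf (2 * δ) q) := by
        refine ENNReal.tsum_le_tsum fun q => (measure_iUnion_fintype_le _ _).trans ?_
        calc _ ≤ ∑ _j : DetPolicy S A H × (Fin H → S → Fin (q + 1)), ENNReal.ofReal (c q) :=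
              Finset.sum_le_sum fun j _ =>
                law_mixProd M hH alg j.1 (fun h x => gridValue_mem j.2 h x) (hc q)
          _ = _ := by
              rw [Finset.sum_const, nsmul_eq_mul, ← ENNReal.ofReal_natCast,
                ← ENNReal.ofReal_mul (by positivity), Finset.card_univ]
              congr 1
              exact mul_div_cancel₀ _ (by exact_mod_cast (hN q).ne')
    _ ≤ ENNReal.ofReal (2 * δ / 2) := tsum_levelConf_le (by positivity)
    _ = _ := by rw [mul_div_cancel_left₀ _ two_ne_zero]

end

section

open scoped Classical


variable {S A : Type*} [Fintype S] [Fintype A] {H : ℕ}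

/-! ### Locality -/

lemma runData_congr (alg : List (Episode S A H) → DetPolicy S A H) {env env' : Env S A H} {m : ℕ}
    (h : ∀ t < m, env t = env' t) {t : ℕ} (ht : t ≤ m) :
    runData alg env t = runData alg env' t := by
  induction t with
  | zero => rfl
  | succ t ih => rw [runData, runData, ih (by omega), h t (by omega)]

lemma Env.shift_shift (env : Env S A H) (m n : ℕ) : (env.shift m).shift n = env.shift (m + n) := by
  funext t
  simp only [Env.shift, Nat.add_assoc]

/-- Expressed through the returned data alone, the outcome visibly depends only on the episodes
played, as a stopping time should. -/
lemma covGame_eq_some_iff (sel : (A → ℝ) → A) (env : Env S A H) (c : Table S A H) (δ : ℝ)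
    (D : List (Episode S A H)) :
    covGame sel env c δ = some D ↔ 1 ≤ D.length ∧
      runData (ucbviAlg sel (δ / 2) (covReward c)) env D.length = D ∧ ¬ Undone c D ∧
      ∀ t, 1 ≤ t → t < D.length →
        Undone c (runData (ucbviAlg sel (δ / 2) (covReward c)) env t) := by
  constructor
  · intro h
    unfold covGame at h
    split_ifs at h with hterm
    have hD := Option.some.inj h
    rw [covState_data] at hD
    have hspec := Nat.find_spec hterm
    have hmin := fun t => Nat.find_min (m := t) hterm
    set T := Nat.find hterm
    have hlen : D.length = T := by rw [← hD, length_runData]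
    rw [covDone_iff, hD] at hspec
    rw [hlen]
    refine ⟨hspec.1, hD, hspec.2, fun t ht htT => ?_⟩
    have := hmin t htT
    rw [covDone_iff] at this
    by_contra hcon
    exact this ⟨ht, hcon⟩
  · rintro ⟨h1, h2, h3, h4⟩
    have hdone : CovDone sel env c δ D.length := by
      rw [covDone_iff, h2]; exact ⟨h1, h3⟩
    have hterm : ∃ t, CovDone sel env c δ t := ⟨_, hdone⟩
    have hfind : Nat.find hterm = D.length := by
      rw [Nat.find_eq_iff]
      refine ⟨hdone, fun t ht hcon => ?_⟩
      rw [covDone_iff] at hcon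
      exact hcon.2 (h4 t hcon.1 ht)
    unfold covGame
    rw [dif_pos hterm, hfind, covState_data, h2]

lemma covGame_congr {sel : (A → ℝ) → A} {env env' : Env S A H} {c : Table S A H} {δ : ℝ}
    {D : List (Episode S A H)} (hD : covGame sel env c δ = some D)
    (h : ∀ t < D.length, env t = env' t) : covGame sel env' c δ = some D := by
  rw [covGame_eq_some_iff] at hD ⊢
  refine ⟨hD.1, ?_, hD.2.2.1, fun t h1 h2 => ?_⟩
  · rw [← runData_congr _ h le_rfl]; exact hD.2.1
  · rw [← runData_congr _ h h2.le]; exact hD.2.2.2 t h1 h2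

/-! ### Successive runs of CovGame -/

/-- The data of successive runs of CovGame with targets `c k` and confidence parameters `conf k`. -/
def phaseData (sel : (A → ℝ) → A) (c : ℕ → Table S A H) (conf : ℕ → ℝ) (env : Env S A H) :
    ℕ → Option (List (Episode S A H))
  | 0 => covGame sel env (c 0) (conf 0)
  | k + 1 =>
      (phaseData sel c conf env k).bind fun D =>
        (covGame sel (env.shift D.length) (c (k + 1)) (conf (k + 1))).map fun D₂ => D ++ D₂

lemma phaseData_succ_eq_some_iff {sel : (A → ℝ) → A} {c : ℕ → Table S A H} {conf : ℕ → ℝ}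
    {env : Env S A H} {k : ℕ} {D : List (Episode S A H)} :
    phaseData sel c conf env (k + 1) = some D ↔ ∃ D₁ D₂, phaseData sel c conf env k = some D₁ ∧
      covGame sel (env.shift D₁.length) (c (k + 1)) (conf (k + 1)) = some D₂ ∧ D = D₁ ++ D₂ := by
  rw [phaseData, Option.bind_eq_some_iff]
  constructor
  · rintro ⟨D₁, h1, h2⟩
    rw [Option.map_eq_some_iff] at h2
    obtain ⟨D₂, h3, h4⟩ := h2
    exact ⟨D₁, D₂, h1, h3, h4.symm⟩
  · rintro ⟨D₁, D₂, h1, h3, h4⟩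
    exact ⟨D₁, h1, Option.map_eq_some_iff.2 ⟨D₂, h3, h4.symm⟩⟩

lemma phaseData_congr {sel : (A → ℝ) → A} {c : ℕ → Table S A H} {conf : ℕ → ℝ}
    {env env' : Env S A H} {k : ℕ} {D : List (Episode S A H)}
    (hD : phaseData sel c conf env k = some D) (h : ∀ t < D.length, env t = env' t) :
    phaseData sel c conf env' k = some D := by
  induction k generalizing D with
  | zero => exact covGame_congr hD h
  | succ k ih =>
    rw [phaseData_succ_eq_some_iff] at hD ⊢
    obtain ⟨D₁, D₂, h1, h2, rfl⟩ := hD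
    rw [List.length_append] at h
    refine ⟨D₁, D₂, ih h1 fun t ht => h t (by omega), covGame_congr h2 fun t ht => ?_, rfl⟩
    exact h _ (by omega)

/-- One step of the bookkeeping of the successive runs: the number of the current run and the data
collected in it. -/
def phaseStep (c : ℕ → Table S A H) (σ : ℕ × List (Episode S A H)) (e : Episode S A H) :
    ℕ × List (Episode S A H) :=
  if Undone (c σ.1) (σ.2 ++ [e]) then (σ.1, σ.2 ++ [e]) else (σ.1 + 1, [])

/-- The number of the current run and the data collected in it, as a function of all the data. -/
def phaseFold (c : ℕ → Table S A H) (D : List (Episode S A H)) : ℕ × List (Episode S A H) :=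
  D.foldl (phaseStep c) (0, [])

lemma phaseFold_append (c : ℕ → Table S A H) (D : List (Episode S A H)) (e : Episode S A H) :
    phaseFold c (D ++ [e]) = phaseStep c (phaseFold c D) e := by
  unfold phaseFold; rw [List.foldl_append]; rfl

/-- The successive runs of CovGame as one learner. -/
def phaseAlg (sel : (A → ℝ) → A) (c : ℕ → Table S A H) (conf : ℕ → ℝ) :
    List (Episode S A H) → DetPolicy S A H := fun D =>
  ucbviAlg sel (conf (phaseFold c D).1 / 2) (covReward (c (phaseFold c D).1)) (phaseFold c D).2

/-- Seeing the successive runs as one learner lets `law_transition_error` apply to all their data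
together. `phaseStep` tests after appending the episode, which agrees with the rule that a run lasts
at least one round. -/
lemma runData_phaseAlg {sel : (A → ℝ) → A} {c : ℕ → Table S A H} {conf : ℕ → ℝ}
    {env : Env S A H} {k m : ℕ} (hk : phaseFold c (runData (phaseAlg sel c conf) env m) = (k, []))
    {D : List (Episode S A H)} (hD : covGame sel (env.shift m) (c k) (conf k) = some D) :
    runData (phaseAlg sel c conf) env (m + D.length) =
        runData (phaseAlg sel c conf) env m ++ D ∧
      phaseFold c (runData (phaseAlg sel c conf) env (m + D.length)) = (k + 1, []) := by
  rw [covGame_eq_some_iff] at hD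
  obtain ⟨h1, h2, h3, h4⟩ := hD
  set alg := ucbviAlg sel (conf k / 2) (covReward (c k)) with halg
  have key : ∀ t < D.length, runData (phaseAlg sel c conf) env (m + t) =
        runData (phaseAlg sel c conf) env m ++ runData alg (env.shift m) t ∧
      phaseFold c (runData (phaseAlg sel c conf) env (m + t)) =
        (k, runData alg (env.shift m) t) := by
    intro t
    induction t with
    | zero => intro _; simpa [runData] using hk
    | succ t ih =>
      intro ht
      obtain ⟨e1, e2⟩ := ih (by omega)
      have e3 : phaseAlg sel c conf (runData (phaseAlg sel c conf) env (m + t)) =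
          alg (runData alg (env.shift m) t) := by
        rw [phaseAlg, e2]
      rw [← Nat.add_assoc, runData, e3, phaseFold_append, e2]
      have hund := h4 (t + 1) (by omega) ht
      rw [runData] at hund ⊢
      refine ⟨?_, ?_⟩
      · rw [e1, List.append_assoc]; rfl
      · rw [phaseStep]; exact if_pos hund
  obtain ⟨T, hT⟩ : ∃ T, D.length = T + 1 := ⟨D.length - 1, by omega⟩
  obtain ⟨e1, e2⟩ := key T (by omega)
  have e3 : phaseAlg sel c conf (runData (phaseAlg sel c conf) env (m + T)) =
      alg (runData alg (env.shift m) T) := by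
    rw [phaseAlg, e2]
  rw [hT, runData] at h2
  rw [hT, ← Nat.add_assoc, runData, e3, phaseFold_append, e2]
  refine ⟨?_, ?_⟩
  · rw [e1, List.append_assoc]
    congr 1
  · rw [phaseStep]
    refine if_neg ?_
    rw [← h2] at h3
    exact h3

lemma phaseData_eq_runData {sel : (A → ℝ) → A} {c : ℕ → Table S A H} {conf : ℕ → ℝ}
    {env : Env S A H} {k : ℕ} {D : List (Episode S A H)}
    (hD : phaseData sel c conf env k = some D) :
    runData (phaseAlg sel c conf) env D.length = D ∧ phaseFold c D = (k + 1, []) := by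
  induction k generalizing D with
  | zero =>
    have hs : env.shift 0 = env := by funext t; simp [Env.shift]
    have := runData_phaseAlg (sel := sel) (c := c) (conf := conf) (env := env) (k := 0) (m := 0)
      rfl (D := D) (by rw [hs]; exact hD)
    simp only [Nat.zero_add, runData, List.nil_append] at this
    exact ⟨this.1, by rw [this.1] at this; exact this.2⟩
  | succ k ih =>
    obtain ⟨D₁, D₂, h1, h2, rfl⟩ := phaseData_succ_eq_some_iff.1 hD
    obtain ⟨e1, e2⟩ := ih h1
    have := runData_phaseAlg (sel := sel) (c := c) (conf := conf) (env := env) (k := k + 1)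
      (m := D₁.length) (by rw [e1]; exact e2) h2
    rw [← List.length_append, e1] at this
    exact ⟨this.1, by rw [this.1] at this; exact this.2⟩

variable [MeasurableSpace S] [DiscreteMeasurableSpace S]

/-- The confidence parameters of the runs of CovGame in PCE. -/
def phaseConf (δ : ℝ) : ℕ → ℝ
  | 0 => δ / 6
  | k + 1 => δ / (6 * ((k : ℝ) + 2) ^ 2)

lemma phaseConf_pos {δ : ℝ} (hδ : 0 < δ) (k : ℕ) : 0 < phaseConf δ k := by
  cases k <;> simp only [phaseConf] <;> positivity

lemma phaseConf_le {δ : ℝ} (hδ : 0 < δ) (k : ℕ) : phaseConf δ k ≤ δ := by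
  cases k with
  | zero => simp only [phaseConf]; linarith
  | succ k =>
    simp only [phaseConf]
    refine div_le_self hδ.le ?_
    have : (0 : ℝ) ≤ k := Nat.cast_nonneg _
    nlinarith

/-- (k+2)² ≥ (k+1)(k+2), so the later phases spend at most δ/6 in total. -/
lemma phaseConf_succ_le {δ : ℝ} (hδ : 0 < δ) (k : ℕ) :
    phaseConf δ (k + 1) ≤ levelConf (δ / 3) k := by
  simp only [phaseConf, levelConf]
  rw [div_div]
  have : (0 : ℝ) ≤ k := Nat.cast_nonneg _
  apply div_le_div_of_nonneg_left hδ.le (by positivity)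
  nlinarith

/-- The events on which the analysis of the successive runs of CovGame relies. -/
structure PhaseEvent (M : MDP S A H) (sel : (A → ℝ) → A) (δ : ℝ) (c : ℕ → Table S A H)
    (env : Env S A H) : Prop where
  phase_zero : CovEvent M sel (c 0) (phaseConf δ 0) env
  phase_succ : ∀ k D, phaseData sel c (phaseConf δ) env k = some D →
    CovEvent M sel (c (k + 1)) (phaseConf δ (k + 1)) (env.shift D.length)
  model : ∀ k D, phaseData sel c (phaseConf δ) env k = some D →
    ∀ π : DetPolicy S A H, ∀ V : Fin H → S → ℝ, (∀ h x, V h x ∈ Set.Icc (0 : ℝ) H) →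
      ∑ h, ∑ s, (count D h s (π h s) : ℝ) *
        (expect (empirical D h s (π h s)) (V h) - expect (M.model h s (π h s)) (V h)) ^ 2 ≤
      betaRF S A H D.length (δ / 3) / 2

/-- The budget is δ/6 for phase 0, δ/6 for the later phases and δ/3 for the model. Phase k+1 starts
at the random length of the data up to phase k, which is handled by `strong_markov`. -/
theorem law_phaseEvent [Nonempty A] (M : MDP S A H) (hH : 0 < H) {sel : (A → ℝ) → A}
    (hsel : IsArgmaxRule sel) {δ : ℝ} (hδ : 0 < δ) (hδ1 : δ ≤ 1) (c : ℕ → Table S A H) :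
    M.law {ω | ¬ PhaseEvent M sel δ c (M.env ω)} ≤ ENNReal.ofReal (2 * δ / 3) := by
  have hcov := fun k => law_covEvent M hH hsel (c k) (phaseConf_pos hδ k)
    ((phaseConf_le hδ k).trans hδ1)
  have hsucc : ∀ k, M.law {ω | ∃ m, ω ∈ {ω | ∃ D, phaseData sel c (phaseConf δ) (M.env ω) k = some D
      ∧ D.length = m} ∧ shiftSeed m ω ∈
        {ω | ¬ CovEvent M sel (c (k + 1)) (phaseConf δ (k + 1)) (M.env ω)}} ≤
      ENNReal.ofReal (levelConf (δ / 3) k) := by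
    intro k
    refine strong_markov M _
      (fun m => {ω | ∃ D, phaseData sel c (phaseConf δ) (M.env ω) k = some D ∧ D.length = m})
      (fun _ _ => {ω | ¬ CovEvent M sel (c (k + 1)) (phaseConf δ (k + 1)) (M.env ω)}) ?_ ?_ ?_
    · rintro m ω ω' hag ⟨D, hD, rfl⟩
      refine ⟨⟨D, phaseData_congr hD fun t ht => ?_, rfl⟩, rfl⟩
      funext π
      simp only [MDP.env, hag t ht]
    · rintro m m' ω ⟨D, hD, rfl⟩ ⟨D', hD', rfl⟩
      rw [Option.some.inj (hD.symm.trans hD')]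
    · intro m ω _
      exact (hcov (k + 1)).trans (ENNReal.ofReal_le_ofReal (phaseConf_succ_le hδ k))
  have hmodel := law_transition_error M hH (phaseAlg sel c (phaseConf δ)) (δ := δ / 3)
    (by positivity) (by linarith)
  have hsum : ENNReal.ofReal (2 * δ / 3) = ENNReal.ofReal (δ / 6) +
      (ENNReal.ofReal (δ / 3 / 2) + ENNReal.ofReal (δ / 3)) := by
    rw [← ENNReal.ofReal_add (by positivity) (by positivity),
      ← ENNReal.ofReal_add (by positivity) (by positivity)]
    congr 1; ring
  rw [hsum]
  refine le_trans (measure_mono ?_) ((measure_union_le _ _).trans (add_le_add (hcov 0)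
    ((measure_union_le _ _).trans (add_le_add ((measure_iUnion_le _).trans
      ((ENNReal.tsum_le_tsum hsucc).trans (tsum_levelConf_le (by positivity)))) hmodel))))
  intro ω hω
  by_contra hcon
  simp only [Set.mem_union, Set.mem_iUnion, Set.mem_ofPred_eq, not_or, not_exists, not_not] at hcon
  obtain ⟨h0, h1, h2⟩ := hcon
  refine hω ⟨h0, fun k D hD => ?_, fun k D hD π V hV => ?_⟩
  · by_contra hcon
    exact h1 k D.length ⟨⟨D, hD, rfl⟩, hcon⟩
  · have := h2 D.length π V hV
    rw [(phaseData_eq_runData hD).1] at this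
    exact this

/-! ### PCE -/

lemma pceData_eq_phaseData (sel : (A → ℝ) → A) (env : Env S A H) (ε δ : ℝ) (k : ℕ) :
    pceData sel env ε δ k = phaseData sel (pceTarget sel env ε δ) (phaseConf δ)
      (env.shift (pceInit S A H ε δ)) k := by
  induction k with
  | zero => rfl
  | succ k ih =>
    rw [pceData, phaseData, ih]
    simp only [Env.shift_shift]
    rfl

lemma reachData_congr (sel : (A → ℝ) → A) {env env' : Env S A H} (δ : ℝ) (h : Fin H) (s : S)
    {m : ℕ} (hag : ∀ t < m, env t = env' t) {t : ℕ} (ht : t ≤ m) :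
    reachData sel env δ h s t = reachData sel env' δ h s t := by
  rw [reachData_eq_runData, reachData_eq_runData, runData_congr _ hag ht]

/-- The targets are decided by the reachability phase, whose duration is deterministic. They can
thus be treated as fixed in the analysis of the later episodes. -/
lemma pceTarget_congr (sel : (A → ℝ) → A) {env env' : Env S A H} (ε δ : ℝ)
    (hag : ∀ t < pceInit S A H ε δ, env t = env' t) :
    pceTarget sel env ε δ = pceTarget sel env' ε δ := by
  have hdata : ∀ h s, reachData sel (pceReachEnv env ε δ h s) (pceReachConf S H δ) h s
      (pceReachEpisodes S A H ε δ) = reachData sel (pceReachEnv env' ε δ h s)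
      (pceReachConf S H δ) h s (pceReachEpisodes S A H ε δ) := by
    intro h s
    refine reachData_congr sel _ h s (fun t ht => ?_) le_rfl
    simp only [pceReachEnv, Env.shift]
    refine hag _ ?_
    have h1 : (Fintype.equivFin (Fin H × S) (h, s) : ℕ) + 1 ≤ Fintype.card (Fin H × S) :=
      (Fintype.equivFin (Fin H × S) (h, s)).2
    unfold pceInit
    calc _ < (Fintype.equivFin (Fin H × S) (h, s) : ℕ) * pceReachEpisodes S A H ε δ +
          pceReachEpisodes S A H ε δ := by omega
      _ = ((Fintype.equivFin (Fin H × S) (h, s) : ℕ) + 1) * pceReachEpisodes S A H ε δ := by ring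
      _ ≤ _ := Nat.mul_le_mul_right _ h1
  have hlow : ∀ h s, pceLower sel env ε δ h s = pceLower sel env' ε δ h s := by
    intro h s
    have := hdata h s
    unfold pceReachEpisodes at this
    unfold pceLower reachLower
    rw [this]
  have hupp : ∀ h s, pceUpper sel env ε δ h s = pceUpper sel env' ε δ h s := by
    intro h s
    have := hdata h s
    unfold pceReachEpisodes at this
    unfold pceUpper reachUpper
    rw [this]
  funext k h s a
  simp only [pceTarget, hlow, hupp]

/-- The events on which the analysis of PCE relies. -/
structure PCEEvent (M : MDP S A H) (sel : (A → ℝ) → A) (ε δ : ℝ) (env : Env S A H) : Prop where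
  reach : ∀ h s, pceLower sel env ε δ h s ≤ M.maxReach h s ∧
    M.maxReach h s ≤ pceUpper sel env ε δ h s
  phase : PhaseEvent M sel δ (pceTarget sel env ε δ) (env.shift (pceInit S A H ε δ))

/-- SH reachability estimates at δ/(3SH) each, plus 2δ/3 for the phases, make exactly δ. -/
theorem law_pceEvent [Nonempty A] (M : MDP S A H) (hH : 0 < H) {sel : (A → ℝ) → A}
    (hsel : IsArgmaxRule sel) {ε δ : ℝ} (hε : 0 < ε) (hδ : 0 < δ) (hδ1 : δ ≤ 1) :
    M.law {ω | ¬ PCEEvent M sel ε δ (M.env ω)} ≤ ENNReal.ofReal δ := by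
  have hne : Nonempty S := ⟨M.init⟩
  have hH' : (1 : ℝ) ≤ H := by exact_mod_cast hH
  have hS : (1 : ℝ) ≤ Fintype.card S := by exact_mod_cast Fintype.card_pos
  have hconf : 0 < pceReachConf S H δ := by unfold pceReachConf; positivity
  have hconf1 : pceReachConf S H δ ≤ 1 := by
    unfold pceReachConf
    refine (div_le_self hδ.le ?_).trans hδ1
    nlinarith
  have hthr : 0 < pceThreshold S H ε := by unfold pceThreshold; positivity
  have hreach : ∀ j : Fin H × S, M.law {ω | ¬ (pceLower sel (M.env ω) ε δ j.1 j.2 ≤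
      M.maxReach j.1 j.2 ∧ M.maxReach j.1 j.2 ≤ pceUpper sel (M.env ω) ε δ j.1 j.2)} ≤
      ENNReal.ofReal (pceReachConf S H δ) := by
    intro j
    exact law_shift_le M _ ((Fintype.equivFin (Fin H × S) (j.1, j.2) : ℕ) *
      pceReachEpisodes S A H ε δ) (fun _ => {ω | ¬ (reachLower sel (M.env ω) (pceThreshold S H ε)
        (pceReachConf S H δ) j.1 j.2 ≤ M.maxReach j.1 j.2 ∧ M.maxReach j.1 j.2 ≤
        reachUpper sel (M.env ω) (pceThreshold S H ε) (pceReachConf S H δ) j.1 j.2)})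
      (fun _ _ _ => rfl) (fun _ => law_reach M hH hsel hthr hconf hconf1 j.1 j.2)
  have hphase : M.law {ω | ¬ PhaseEvent M sel δ (pceTarget sel (M.env ω) ε δ)
      ((M.env ω).shift (pceInit S A H ε δ))} ≤ ENNReal.ofReal (2 * δ / 3) :=
    law_shift_le M _ (pceInit S A H ε δ)
      (fun ω => {ω' | ¬ PhaseEvent M sel δ (pceTarget sel (M.env ω) ε δ) (M.env ω')})
      (fun ω ω' hag => by
        have : pceTarget sel (M.env ω) ε δ = pceTarget sel (M.env ω') ε δ :=
          pceTarget_congr sel ε δ fun t ht => by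
            funext π; simp only [MDP.env, hag t ht]
        simp only [this])
      (fun ω => law_phaseEvent M hH hsel hδ hδ1 _)
  have hsum : ENNReal.ofReal δ = ∑ _j : Fin H × S, ENNReal.ofReal (pceReachConf S H δ) +
      ENNReal.ofReal (2 * δ / 3) := by
    rw [Finset.sum_const, nsmul_eq_mul, ← ENNReal.ofReal_natCast,
      ← ENNReal.ofReal_mul (by positivity), ← ENNReal.ofReal_add (by positivity) (by positivity),
      Finset.card_univ, Fintype.card_prod, Fintype.card_fin]
    congr 1
    unfold pceReachConf
    push_cast
    field_simp
    ring
  rw [hsum]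
  refine le_trans (measure_mono ?_) ((measure_union_le _ _).trans (add_le_add
    ((measure_iUnion_fintype_le _ _).trans (Finset.sum_le_sum fun j _ => hreach j)) hphase))
  intro ω hω
  by_contra hcon
  simp only [Set.mem_union, Set.mem_iUnion, Set.mem_ofPred_eq, not_or, not_exists, not_not] at hcon
  exact hω ⟨fun h s => hcon.1 (h, s), hcon.2⟩

end

section

open scoped Classical


variable {S A : Type*} [Fintype S] [Fintype A] {H : ℕ}

/-! ### Exploring mixtures -/

lemma stateOcc_congr (P : Model S A H) (s₁ : S) {π π' : Policy S A H} {h : ℕ}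
    (hπ : ∀ k : Fin H, (k : ℕ) < h → π k = π' k) (s : S) :
    stateOcc P s₁ π h s = stateOcc P s₁ π' h s := by
  induction h generalizing s with
  | zero => rfl
  | succ n ih =>
    unfold stateOcc
    split_ifs with hn
    · refine Finset.sum_congr rfl fun x _ => Finset.sum_congr rfl fun a _ => ?_
      rw [ih (fun k hk => hπ k (by omega)), hπ ⟨n, hn⟩ (Nat.lt_succ_self n)]
    · rfl

/-- A policy that nearly attains the reachability is changed at stage `h` only, to play `a`; this
does not affect the probability of being in `s`. The factor 1/2 avoids showing that the supremum is
attained. -/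
lemma exists_occ_ge [Nonempty A] (M : MDP S A H) (h : Fin H) (s : S) (a : A) :
    ∃ π : Policy S A H, M.maxReach h s / 2 ≤ occ M.model M.init π h s a := by
  obtain ⟨π, hπ⟩ : ∃ π : Policy S A H, M.maxReach h s / 2 ≤ stateOcc M.model M.init π h s := by
    rcases (maxReach_nonneg M h s).eq_or_lt with h0 | h0
    · refine ⟨Classical.arbitrary _, ?_⟩
      rw [← h0, zero_div]
      exact stateOcc_nonneg M.isStochastic _ _ _ _
    · obtain ⟨π, hπ⟩ := exists_lt_of_lt_ciSup (show M.maxReach h s / 2 <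
        ⨆ π : Policy S A H, stateOcc M.model M.init π h s from half_lt_self h0)
      exact ⟨π, hπ.le⟩
  refine ⟨Function.update π h ((DetPolicy.toPolicy fun _ _ => a : Policy S A H) h), ?_⟩
  unfold occ
  rw [Function.update_self, DetPolicy.toPolicy_apply, if_pos rfl, mul_one,
    ← stateOcc_congr M.model M.init (π := π) fun k hk => (Function.update_of_ne (by
      rintro rfl; exact lt_irrefl _ hk) _ _).symm]
  exact hπ

lemma nonneg_of_mem_mixOcc (M : MDP S A H) {o : Table S A H} (ho : o ∈ M.mixOcc) (h : Fin H) (s : S)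
    (a : A) : 0 ≤ o h s a := by
  have hsub : M.mixOcc ⊆ {o | 0 ≤ o h s a} := by
    refine convexHull_min ?_ ?_
    · rintro _ ⟨π, rfl⟩
      exact occ_nonneg M.isStochastic _ _ _ _ _
    · intro o ho o' ho' x y hx hy _
      exact add_nonneg (mul_nonneg hx ho) (mul_nonneg hy ho')
  exact hsub ho

/-- Some mixture visits every triplet with a probability proportional to its reachability. -/
lemma exists_explorer [Nonempty A] (M : MDP S A H) (hH : 0 < H) :
    ∃ o ∈ M.mixOcc, ∀ h s a,
      M.maxReach h s / (2 * (Fintype.card S * Fintype.card A * H)) ≤ o h s a := by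
  have hne : Nonempty S := ⟨M.init⟩
  have hne' : Nonempty (Fin H) := ⟨⟨0, hH⟩⟩
  choose π hπ using fun x : Fin H × S × A => exists_occ_ge M x.1 x.2.1 x.2.2
  set N : ℝ := (Fintype.card (Fin H × S × A) : ℝ) with hN
  have hN0 : 0 < N := by rw [hN]; exact_mod_cast Fintype.card_pos
  have hN' : N = Fintype.card S * Fintype.card A * H := by
    rw [hN, Fintype.card_prod, Fintype.card_prod, Fintype.card_fin]; push_cast; ring
  refine ⟨∑ x, N⁻¹ • occ M.model M.init (π x), ?_, fun h s a => ?_⟩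
  · refine (convex_convexHull ℝ _).sum_mem (fun _ _ => by positivity) ?_
      fun x _ => occ_mem_mixOcc M (π x)
    rw [Finset.sum_const, Finset.card_univ, nsmul_eq_mul]
    exact mul_inv_cancel₀ hN0.ne'
  · rw [← hN']
    have h1 : (∑ x, N⁻¹ • occ M.model M.init (π x)) h s a =
        ∑ x, N⁻¹ * occ M.model M.init (π x) h s a := by
      simp only [Finset.sum_apply, Pi.smul_apply, smul_eq_mul]
    rw [h1]
    calc M.maxReach h s / (2 * N) = N⁻¹ * (M.maxReach h s / 2) := by field_simp
      _ ≤ N⁻¹ * occ M.model M.init (π (h, s, a)) h s a := by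
          have := hπ (h, s, a); gcongr
      _ ≤ _ := Finset.single_le_sum (f := fun x => N⁻¹ * occ M.model M.init (π x) h s a)
          (fun x _ => mul_nonneg (by positivity) (occ_nonneg M.isStochastic _ _ _ _ _))
          (Finset.mem_univ _)

/-! ### The phases of PCE -/

/-- The state `s` passes the reachability test of PCE at stage `h`. -/
def Reachable (sel : (A → ℝ) → A) (env : Env S A H) (ε δ : ℝ) (h : Fin H) (s : S) : Prop :=
  ε / (32 * Fintype.card S * (H : ℝ) ^ 2) ≤ pceLower sel env ε δ h s

lemma pceTarget_pos {sel : (A → ℝ) → A} {env : Env S A H} {ε δ : ℝ} {h : Fin H} {s : S}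
    (hr : Reachable sel env ε δ h s) {k : ℕ} (hk : k ≠ 0) (a : A) :
    pceTarget sel env ε δ k h s a = 2 ^ k * pceUpper sel env ε δ h s := by
  unfold Reachable at hr
  unfold pceTarget; rw [if_pos hr, if_neg hk]

lemma reachable_of_mem_level {sel : (A → ℝ) → A} {env : Env S A H} {ε δ : ℝ} {k : ℕ}
    {x : Fin H × S × A} (hx : x ∈ level (pceTarget sel env ε δ k) 0) :
    Reachable sel env ε δ x.1 x.2.1 := by
  by_contra hcon
  unfold Reachable at hcon
  rw [mem_level_zero, pceTarget, if_neg hcon] at hx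
  exact lt_irrefl _ hx

lemma pceTarget_le (sel : (A → ℝ) → A) (env : Env S A H) (ε δ : ℝ) (k : ℕ) (h : Fin H) (s : S)
    (a : A) : pceTarget sel env ε δ k h s a ≤ 2 ^ k := by
  unfold pceTarget
  split_ifs with h1 h2
  · rw [h2, pow_zero]
  · have : pceUpper sel env ε δ h s ≤ 1 := min_le_right _ _
    nlinarith [pow_pos (zero_lt_two (α := ℝ)) k]
  · positivity

lemma reachable_threshold [Nonempty S] (hH : 0 < H) (ε : ℝ) :
    ε / (32 * Fintype.card S * (H : ℝ) ^ 2) = pceThreshold S H ε / 8 := by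
  have hH' : (0 : ℝ) < H := by exact_mod_cast hH
  have hS : (0 : ℝ) < Fintype.card S := by exact_mod_cast Fintype.card_pos
  unfold pceThreshold
  field_simp
  ring

/-- The lower bound is at least ε₀/8, so the additive ε₀/2 in `reachUpper_le` costs at most another
factor 4. -/
lemma PCEEvent.upper_le_of_reachable [Nonempty S] (hH : 0 < H) {M : MDP S A H} {sel : (A → ℝ) → A}
    {ε δ : ℝ} {env : Env S A H} (hE : PCEEvent M sel ε δ env) {h : Fin H} {s : S}
    (hr : Reachable sel env ε δ h s) : pceUpper sel env ε δ h s ≤ 8 * M.maxReach h s := by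
  have h1 : pceUpper sel env ε δ h s ≤ 4 * pceLower sel env ε δ h s + pceThreshold S H ε / 2 :=
    reachUpper_le _ _ _ _ _ _
  unfold Reachable at hr
  rw [reachable_threshold hH] at hr
  linarith [(hE.reach h s).1]

/-- 4 · ε₀/8 + ε₀/2 = ε₀. -/
lemma PCEEvent.maxReach_le_of_not_reachable [Nonempty S] (hH : 0 < H) {M : MDP S A H}
    {sel : (A → ℝ) → A} {ε δ : ℝ} {env : Env S A H} (hE : PCEEvent M sel ε δ env) {h : Fin H} {s : S}
    (hr : ¬ Reachable sel env ε δ h s) : M.maxReach h s ≤ pceThreshold S H ε := by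
  have h1 : pceUpper sel env ε δ h s ≤ 4 * pceLower sel env ε δ h s + pceThreshold S H ε / 2 :=
    reachUpper_le _ _ _ _ _ _
  unfold Reachable at hr
  rw [reachable_threshold hH, not_le] at hr
  linarith [(hE.reach h s).2]

/-- The visit probability that some mixture achieves on all the triplets that are targeted. -/
def exploreProb (S A : Type*) [Fintype S] [Fintype A] (H : ℕ) (ε : ℝ) : ℝ :=
  ε / (64 * (Fintype.card S : ℝ) ^ 2 * Fintype.card A * (H : ℝ) ^ 3)

lemma exploreProb_pos [Nonempty S] [Nonempty A] (hH : 0 < H) {ε : ℝ} (hε : 0 < ε) :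
    0 < exploreProb S A H ε := by
  have hS : 0 < Fintype.card S := Fintype.card_pos
  have hA : 0 < Fintype.card A := Fintype.card_pos
  unfold exploreProb; positivity

lemma PCEEvent.exists_mix [Nonempty A] (hH : 0 < H) {M : MDP S A H} {sel : (A → ℝ) → A}
    {ε δ : ℝ} {env : Env S A H} (hE : PCEEvent M sel ε δ env) :
    ∃ o ∈ M.mixOcc, ∀ k, ∀ x ∈ level (pceTarget sel env ε δ k) 0,
      exploreProb S A H ε ≤ o x.1 x.2.1 x.2.2 := by
  have hne : Nonempty S := ⟨M.init⟩
  have hS : 0 < Fintype.card S := Fintype.card_pos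
  have hA : 0 < Fintype.card A := Fintype.card_pos
  have hH' : (0 : ℝ) < H := by exact_mod_cast hH
  obtain ⟨o, ho, hoW⟩ := exists_explorer M hH
  refine ⟨o, ho, fun k x hx => le_trans ?_ (hoW _ _ _)⟩
  have h1 := (show _ ≤ _ from reachable_of_mem_level hx).trans (hE.reach x.1 x.2.1).1
  calc exploreProb S A H ε = ε / (32 * Fintype.card S * (H : ℝ) ^ 2) /
        (2 * (Fintype.card S * Fintype.card A * H)) := by
        unfold exploreProb; field_simp; ring
    _ ≤ _ := by gcongr

/-- The runs of CovGame made by PCE, if it is never stopped: `E k` are the data of phase `k`, and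
`F k` are all the data up to phase `k`. -/
structure PhaseRuns (M : MDP S A H) (sel : (A → ℝ) → A) (ε δ : ℝ) (env : Env S A H)
    (E F : ℕ → List (Episode S A H)) : Prop where
  pceData_eq : ∀ k, pceData sel env ε δ k = some (F k)
  zero : F 0 = E 0
  succ : ∀ k, F (k + 1) = F k ++ E (k + 1)
  success : ∀ k, CovSuccess M (pceTarget sel env ε δ k) (phaseConf δ k) (E k)

/-- `pceData` ignores the stopping rule, so all phases exist as soon as each CovGame ends; the
explorer of `exists_mix` guarantees that. Termination of PCE can then be discussed along a full
sequence. -/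
lemma PCEEvent.exists_phaseRuns [MeasurableSpace S] [DiscreteMeasurableSpace S] [Nonempty A]
    (hH : 0 < H) {M : MDP S A H} {sel : (A → ℝ) → A}
    {ε δ : ℝ} (hε : 0 < ε) (hδ : 0 < δ) (hδ1 : δ ≤ 1) {env : Env S A H}
    (hE : PCEEvent M sel ε δ env) : ∃ E F, PhaseRuns M sel ε δ env E F := by
  have hne : Nonempty S := ⟨M.init⟩
  obtain ⟨o, ho, hoμ⟩ := hE.exists_mix hH
  have hmix : ∀ k, ∃ μ > 0, ∃ o ∈ M.mixOcc, ∀ x ∈ level (pceTarget sel env ε δ k) 0,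
      μ ≤ o x.1 x.2.1 x.2.2 := fun k => ⟨_, exploreProb_pos hH hε, o, ho, hoμ k⟩
  have h0 := hE.phase.phase_zero.success hH (phaseConf_pos hδ 0) ((phaseConf_le hδ 0).trans hδ1)
    (hmix 0)
  have hs := fun k D hD => (hE.phase.phase_succ k D hD).success hH (phaseConf_pos hδ (k + 1))
    ((phaseConf_le hδ (k + 1)).trans hδ1) (hmix (k + 1))
  set env' := env.shift (pceInit S A H ε δ) with henv'
  set c := pceTarget sel env ε δ with hc
  have hex : ∀ k, ∃ D, phaseData sel c (phaseConf δ) env' k = some D := by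
    intro k
    induction k with
    | zero => obtain ⟨D, hD, -⟩ := h0; exact ⟨D, hD⟩
    | succ k ih =>
      obtain ⟨D, hD⟩ := ih
      obtain ⟨D₂, h2, -⟩ := hs k D hD
      exact ⟨D ++ D₂, phaseData_succ_eq_some_iff.2 ⟨D, D₂, hD, h2, rfl⟩⟩
  choose F hF using hex
  choose G hG using fun k => hs k (F k) (hF k)
  refine ⟨fun k => Nat.casesOn k (F 0) G, F, fun k => ?_, rfl, fun k => ?_, fun k => ?_⟩
  · rw [pceData_eq_phaseData]; exact hF k
  · refine Option.some.inj ((hF (k + 1)).symm.trans ?_)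
    exact phaseData_succ_eq_some_iff.2 ⟨F k, G k, hF k, (hG k).1, rfl⟩
  · cases k with
    | zero =>
      obtain ⟨D, hD, hsucc⟩ := h0
      have : F 0 = D := Option.some.inj ((hF 0).symm.trans hD)
      simp only
      rw [this]; exact hsucc
    | succ k => exact (hG k).2

lemma PhaseRuns.target_le_count {M : MDP S A H} {sel : (A → ℝ) → A} {ε δ : ℝ} {env : Env S A H}
    {E F : ℕ → List (Episode S A H)} (hR : PhaseRuns M sel ε δ env E F) (k : ℕ) (h : Fin H) (s : S)
    (a : A) : pceTarget sel env ε δ k h s a ≤ count (F k) h s a := by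
  refine ((hR.success k).covers h s a).trans ?_
  cases k with
  | zero => rw [hR.zero]
  | succ k =>
    rw [hR.succ, count_append_list]
    push_cast
    linarith [Nat.cast_nonneg (α := ℝ) (count (F k) h s a)]

/-! ### Accuracy of the estimated model -/

lemma abs_expect_sub_expect_le {p q V : S → ℝ} (hp : ∀ x, 0 ≤ p x) (hp1 : ∑ x, p x = 1)
    (hq : ∀ x, 0 ≤ q x) (hq1 : ∑ x, q x = 1) {B : ℝ} (hV : ∀ x, V x ∈ Set.Icc 0 B) :
    |expect q V - expect p V| ≤ B := by
  have key : ∀ p : S → ℝ, (∀ x, 0 ≤ p x) → ∑ x, p x = 1 → expect p V ∈ Set.Icc 0 B := by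
    intro p hp hp1
    refine ⟨Finset.sum_nonneg fun x _ => mul_nonneg (hp x) (hV x).1, ?_⟩
    calc expect p V ≤ ∑ x, p x * B :=
          Finset.sum_le_sum fun x _ => mul_le_mul_of_nonneg_left (hV x).2 (hp x)
      _ = B := by rw [← Finset.sum_mul, hp1, one_mul]
  have h1 := key p hp hp1
  have h2 := key q hq hq1
  rw [abs_le]
  constructor <;> linarith [h1.1, h1.2, h2.1, h2.2]

lemma backV_mem_Icc {P : Model S A H} (hP : IsStochastic P) (π : Policy S A H) {r : Table S A H}
    (hr : ∀ h s a, r h s a ∈ Set.Icc (0 : ℝ) 1) {h : ℕ} (hh : h ≤ H) (s : S) :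
    backV P π r h s ∈ Set.Icc (0 : ℝ) H := by
  refine ⟨backV_nonneg hP π (fun h s a => (hr h s a).1) h hh s, ?_⟩
  refine (backV_le_tailBudget hP π (m := fun _ => 1) (fun h s a => (hr h s a).2) h hh s).trans ?_
  refine (tailBudget_le (fun _ => zero_le_one) h).trans (le_of_eq ?_)
  simp

/-- If every pair which is not hard to reach has been visited in proportion to its reachability, the
values of all policies in the estimated model are accurate. -/
lemma abs_value_sub_value_le [Nonempty A] (hH : 0 < H) {M : MDP S A H}
    {D : List (Episode S A H)} {ε : ℝ} (hε : 0 < ε) {β : ℝ} {k : ℕ}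
    (hconc : ∀ π : DetPolicy S A H, ∀ V : Fin H → S → ℝ, (∀ h x, V h x ∈ Set.Icc (0 : ℝ) H) →
      ∑ h, ∑ s, (count D h s (π h s) : ℝ) *
        (expect (empirical D h s (π h s)) (V h) - expect (M.model h s (π h s)) (V h)) ^ 2 ≤ β / 2)
    (hβ : 16 * H * β ≤ ε ^ 2 * 2 ^ k) {X : Fin H → S → Prop}
    (hX : ∀ h s, X h s → ∀ a, 2 ^ k * M.maxReach h s ≤ count D h s a)
    (hX' : ∀ h s, ¬ X h s → M.maxReach h s ≤ pceThreshold S H ε)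
    {r : Table S A H} (hr : ∀ h s a, r h s a ∈ Set.Icc (0 : ℝ) 1) (π : Policy S A H) :
    |value (empirical D) M.init π r - value M.model M.init π r| ≤ ε / 2 := by
  have hne : Nonempty S := ⟨M.init⟩
  have hH' : (0 : ℝ) < H := by exact_mod_cast hH
  have hS : (0 : ℝ) < Fintype.card S := by exact_mod_cast Fintype.card_pos
  set V : Fin H → S → ℝ := fun h => backV (empirical D) π r (h + 1) with hV
  have hVm : ∀ h x, V h x ∈ Set.Icc (0 : ℝ) H := fun h x =>
    backV_mem_Icc (isStochastic_empirical D) π hr h.2 x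
  let d : Fin H → S → A → ℝ := fun h s a =>
    expect (empirical D h s a) (V h) - expect (M.model h s a) (V h)
  have hdH : ∀ h s a, |d h s a| ≤ H := fun h s a =>
    abs_expect_sub_expect_le (M.model_nonneg h s a) (M.sum_model h s a)
      (empirical_nonneg D h s a) (sum_empirical D h s a) (hVm h)
  -- Concentration is known for deterministic policies. Taking in each state the action with the
  -- worst error covers every stochastic `π`; the data-dependent `V` is allowed since the bound is
  -- uniform in values.
  choose π' hπ' using fun h s => Finite.exists_max fun a => |d h s a|
  set p : Fin H → S → ℝ := fun h s => stateOcc M.model M.init π h s with hp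
  have hp0 : ∀ h s, 0 ≤ p h s := fun h s => stateOcc_nonneg M.isStochastic _ _ _ _
  have hpW : ∀ h s, p h s ≤ M.maxReach h s := fun h s => stateOcc_le_maxReach M π h s
  have hsum : ∀ h : Fin H, ∑ s, p h s = 1 := fun h => sum_stateOcc M.isStochastic _ _ _ h.2.le
  have h1 : |value (empirical D) M.init π r - value M.model M.init π r| ≤
      ∑ h, ∑ s, p h s * |d h s (π' h s)| := by
    rw [value_sub_value]
    refine (Finset.abs_sum_le_sum_abs _ _).trans (Finset.sum_le_sum fun h _ => ?_)
    refine (Finset.abs_sum_le_sum_abs _ _).trans (Finset.sum_le_sum fun s _ => ?_)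
    refine (Finset.abs_sum_le_sum_abs _ _).trans ?_
    calc _ ≤ ∑ a, occ M.model M.init π h s a * |d h s (π' h s)| := by
          refine Finset.sum_le_sum fun a _ => ?_
          rw [abs_mul, abs_of_nonneg (occ_nonneg M.isStochastic _ _ _ _ _)]
          exact mul_le_mul_of_nonneg_left (hπ' h s a) (occ_nonneg M.isStochastic _ _ _ _ _)
      _ = _ := by rw [← Finset.sum_mul, occ_sum_action]
  -- Parameter of |d| ≤ y/2 + d²/(2y). The error splits into ε/4 for the discarded states (HS terms
  -- of size at most ε₀ H), ε/12 for the linear part and at most 3ε/32 for the quadratic part.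
  set y : ℝ := ε / (6 * H) with hy
  have hy0 : 0 < y := by positivity
  have h2k : (0 : ℝ) < 2 ^ k := by positivity
  have h2 : ∀ h s, p h s * |d h s (π' h s)| ≤ pceThreshold S H ε * H + (y / 2 * p h s +
      (count D h s (π' h s) : ℝ) * d h s (π' h s) ^ 2 / (2 * 2 ^ k * y)) := by
    intro h s
    have hthr : 0 ≤ pceThreshold S H ε * H := by unfold pceThreshold; positivity
    by_cases hXs : X h s
    · have a1 : 2 ^ k * p h s ≤ count D h s (π' h s) :=
        (mul_le_mul_of_nonneg_left (hpW h s) h2k.le).trans (hX h s hXs (π' h s))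
      have a2 : p h s * d h s (π' h s) ^ 2 / (2 * y) ≤
          (count D h s (π' h s) : ℝ) * d h s (π' h s) ^ 2 / (2 * 2 ^ k * y) := by
        rw [div_le_div_iff₀ (by positivity) (by positivity)]
        have := mul_le_mul_of_nonneg_right a1 (show 0 ≤ d h s (π' h s) ^ 2 * (2 * y) by positivity)
        linarith
      have a3 : |d h s (π' h s)| ≤ y / 2 + d h s (π' h s) ^ 2 / (2 * y) := by
        rw [← sub_le_iff_le_add', le_div_iff₀ (by positivity), ← sq_abs (d h s (π' h s))]
        nlinarith [sq_nonneg (|d h s (π' h s)| - y)]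
      have a4 := mul_le_mul_of_nonneg_left a3 (hp0 h s)
      have a5 : p h s * (y / 2 + d h s (π' h s) ^ 2 / (2 * y)) =
        y / 2 * p h s + p h s * d h s (π' h s) ^ 2 / (2 * y) := by ring
      linarith
    · have a1 := (hpW h s).trans (hX' h s hXs)
      have a2 : p h s * |d h s (π' h s)| ≤ pceThreshold S H ε * H :=
        mul_le_mul a1 (hdH _ _ _) (abs_nonneg _) ((hp0 h s).trans a1)
      have a3 : 0 ≤ y / 2 * p h s := mul_nonneg (by positivity) (hp0 h s)
      have a4 : 0 ≤ (count D h s (π' h s) : ℝ) * d h s (π' h s) ^ 2 / (2 * 2 ^ k * y) := by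
        positivity
      linarith
  have h3 := hconc π' V hVm
  calc _ ≤ ∑ h, ∑ s, p h s * |d h s (π' h s)| := h1
    _ ≤ ∑ h, ∑ s, (pceThreshold S H ε * H + (y / 2 * p h s +
        (count D h s (π' h s) : ℝ) * d h s (π' h s) ^ 2 / (2 * 2 ^ k * y))) :=
        Finset.sum_le_sum fun h _ => Finset.sum_le_sum fun s _ => h2 h s
    _ = H * Fintype.card S * (pceThreshold S H ε * H) + (H * (y / 2) +
        (∑ h, ∑ s, (count D h s (π' h s) : ℝ) * d h s (π' h s) ^ 2) / (2 * 2 ^ k * y)) := by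
        simp only [Finset.sum_add_distrib, ← Finset.mul_sum, hsum, ← Finset.sum_div,
          Finset.sum_const, Finset.card_univ, Fintype.card_fin, nsmul_eq_mul]
        ring
    _ ≤ H * Fintype.card S * (pceThreshold S H ε * H) + (H * (y / 2) +
        (β / 2) / (2 * 2 ^ k * y)) := by gcongr
    _ ≤ ε / 4 + (ε / 12 + ε * (3 / 32)) := by
        gcongr
        · refine le_of_eq ?_
          unfold pceThreshold
          field_simp
        · refine le_of_eq ?_
          rw [hy]; field_simp; norm_num
        · rw [div_le_iff₀ (by positivity), hy]
          have : ε * (3 / 32) * (2 * 2 ^ k * (ε / (6 * H))) = ε ^ 2 * 2 ^ k / (32 * H) := by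
            field_simp; norm_num
          rw [this, le_div_iff₀ (by positivity)]
          linarith
    _ ≤ ε / 2 := by linarith

end

section

open scoped Classical


/-! ### Elementary growth bounds -/

lemma le_sq_of_le_mul_sqrt {x B : ℝ} (hx : 0 ≤ x) (h : x ≤ B * Real.sqrt x) : x ≤ B ^ 2 := by
  rcases hx.eq_or_lt with h0 | h0
  · rw [← h0]; positivity
  · have hs : 0 < Real.sqrt x := Real.sqrt_pos.2 h0
    have h1 : Real.sqrt x ≤ B := by
      by_contra hcon
      push Not at hcon
      have := Real.mul_self_sqrt hx
      nlinarith
    calc x = Real.sqrt x ^ 2 := (Real.sq_sqrt hx).symm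
      _ ≤ B ^ 2 := by gcongr

lemma nat_le_pow_of_exp_le {z : ℝ} (hz : Real.exp 1 ≤ z) {c : ℝ} {n : ℕ}
    (h : c ≤ 2.7182818283 ^ n) : c ≤ z ^ n := by
  refine h.trans ?_
  have := Real.exp_one_gt_d9
  gcongr
  linarith

variable {S A : Type*} [Fintype S] [Fintype A] {H : ℕ}

/-- A deliberately crude bound with `z` above every parameter; only the logarithm of the resulting
episode counts matters. -/
lemma ucbviRegret_le_pow {z : ℝ} (hz : Real.exp 1 ≤ z) (hS : (Fintype.card S : ℝ) ≤ z)
    (hA : (Fintype.card A : ℝ) ≤ z) (hH : (H : ℝ) ≤ z) {δ : ℝ}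
    (hlog : Real.log (2 * Fintype.card S * Fintype.card A * H / δ) ≤ 10 * z) (T : ℕ) :
    ucbviRegret S A H δ T ≤ z ^ 22 * Real.sqrt (T + 1) := by
  have hz0 : 0 < z := (Real.exp_pos 1).trans_le hz
  have h1 := log_sq_le_sqrt (z := (T : ℝ) + 1) (by linarith [Nat.cast_nonneg (α := ℝ) T])
  have h2 : (16777216 : ℝ) ≤ z ^ 17 := nat_le_pow_of_exp_le hz (by norm_num)
  have h3 : Real.log (2 * Fintype.card S * Fintype.card A * H / δ) + 6 * Fintype.card S ≤
      16 * z := by linarith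
  have h4 : 0 ≤ 65536 * Fintype.card S * Fintype.card A * (H : ℝ) ^ 2 * Real.log (T + 1) ^ 2 := by
    positivity
  unfold ucbviRegret
  calc _ = 65536 * Fintype.card S * Fintype.card A * (H : ℝ) ^ 2 * Real.log (T + 1) ^ 2 *
        (Real.log (2 * Fintype.card S * Fintype.card A * H / δ) + 6 * Fintype.card S) := by ring
    _ ≤ 65536 * Fintype.card S * Fintype.card A * (H : ℝ) ^ 2 * Real.log (T + 1) ^ 2 * (16 * z) :=
        mul_le_mul_of_nonneg_left h3 h4
    _ ≤ 65536 * z * z * z ^ 2 * (16 * Real.sqrt (T + 1)) * (16 * z) := by gcongr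
    _ = 16777216 * (z ^ 5 * Real.sqrt (T + 1)) := by ring
    _ ≤ z ^ 17 * (z ^ 5 * Real.sqrt (T + 1)) := by gcongr
    _ = _ := by ring

/-! ### The logarithmic factor -/

section LogFactor

variable [Nonempty S] [Nonempty A]

lemma logFactor_bounds {ε δ : ℝ} (hδ : 0 < δ) (hδ1 : δ < 1) :
    1 ≤ logFactor S A H ε δ ∧
    Real.log (Fintype.card S) + Real.log (Fintype.card A) + Real.log H ≤
      logFactor S A H ε δ - 1 ∧
    |Real.log ε| ≤ logFactor S A H ε δ ∧
    Real.log (1 + Real.log (1 / δ)) ≤ logFactor S A H ε δ ∧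
    0 ≤ Real.log (1 / δ) ∧ 0 ≤ Real.log (Fintype.card S) ∧ 0 ≤ Real.log (Fintype.card A) ∧
    0 ≤ Real.log H := by
  have h1 : 0 ≤ Real.log (Fintype.card S) := Real.log_natCast_nonneg _
  have h2 : 0 ≤ Real.log (Fintype.card A) := Real.log_natCast_nonneg _
  have h3 : 0 ≤ Real.log (H : ℝ) := Real.log_natCast_nonneg _
  have h4 : 0 ≤ Real.log (1 / δ) := Real.log_nonneg (by rw [le_div_iff₀ hδ]; linarith)
  have h5 : 0 ≤ Real.log (1 + Real.log (1 / δ)) := Real.log_nonneg (by linarith)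
  have h6 := abs_nonneg (Real.log ε)
  unfold logFactor
  refine ⟨?_, ?_, ?_, ?_, h4, h1, h2, h3⟩ <;> linarith

lemma le_exp_logFactor (hH : 0 < H) {ε δ : ℝ} (hε : 0 < ε) (hδ : 0 < δ) (hδ1 : δ < 1) :
    (Fintype.card S : ℝ) ≤ Real.exp (logFactor S A H ε δ) ∧
    (Fintype.card A : ℝ) ≤ Real.exp (logFactor S A H ε δ) ∧
    (H : ℝ) ≤ Real.exp (logFactor S A H ε δ) ∧
    1 / ε ≤ Real.exp (logFactor S A H ε δ) ∧
    1 + Real.log (1 / δ) ≤ Real.exp (logFactor S A H ε δ) := by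
  obtain ⟨h1, h2, h3, h4, h5, h6, h7, h8⟩ := logFactor_bounds (S := S) (A := A) (H := H) (ε := ε) hδ hδ1
  have hS : (0 : ℝ) < Fintype.card S := by exact_mod_cast Fintype.card_pos
  have hA : (0 : ℝ) < Fintype.card A := by exact_mod_cast Fintype.card_pos
  have hH' : (0 : ℝ) < H := by exact_mod_cast hH
  refine ⟨?_, ?_, ?_, ?_, ?_⟩
  · rw [← Real.log_le_iff_le_exp hS]; linarith
  · rw [← Real.log_le_iff_le_exp hA]; linarith
  · rw [← Real.log_le_iff_le_exp hH']; linarith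
  · rw [← Real.log_le_iff_le_exp (by positivity), one_div, Real.log_inv]
    linarith [neg_abs_le (Real.log ε)]
  · rw [← Real.log_le_iff_le_exp (by linarith)]; exact h4

lemma phaseConf_eq (δ : ℝ) (k : ℕ) : phaseConf δ k = δ / (6 * ((k : ℝ) + 1) ^ 2) := by
  cases k with
  | zero => simp [phaseConf]
  | succ k => simp only [phaseConf]; push_cast; congr 3; ring

lemma log_phaseConf_le (hH : 0 < H) {ε δ : ℝ} (hδ : 0 < δ) (hδ1 : δ < 1) (k : ℕ) :
    Real.log (2 * Fintype.card S * Fintype.card A * H / (phaseConf δ k / 2)) ≤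
      Real.log (1 / δ) + 5 * (logFactor S A H ε δ + k) := by
  obtain ⟨h1, h2, -, -, h5, -⟩ := logFactor_bounds (S := S) (A := A) (H := H) (ε := ε) hδ hδ1
  have hS : (0 : ℝ) < Fintype.card S := by exact_mod_cast Fintype.card_pos
  have hA : (0 : ℝ) < Fintype.card A := by exact_mod_cast Fintype.card_pos
  have hH' : (0 : ℝ) < H := by exact_mod_cast hH
  have e1 : 2 * Fintype.card S * Fintype.card A * H / (phaseConf δ k / 2) =
      24 * ((k : ℝ) + 1) ^ 2 * (Fintype.card S * (Fintype.card A * (H * (1 / δ)))) := by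
    rw [phaseConf_eq]; field_simp; ring
  rw [e1, Real.log_mul (by positivity) (by positivity), Real.log_mul (by norm_num) (by positivity),
    Real.log_mul (by positivity) (by positivity), Real.log_mul (by positivity) (by positivity),
    Real.log_mul (by positivity) (by positivity), Real.log_pow]
  have e2 : Real.log ((k : ℝ) + 1) ≤ k := by
    have := Real.log_le_sub_one_of_pos (show (0 : ℝ) < k + 1 by positivity); linarith
  have e3 : Real.log 24 ≤ 5 := by
    rw [Real.log_le_iff_le_exp (by norm_num)]
    have : Real.exp 5 = Real.exp 1 ^ 5 := by rw [← Real.exp_nat_mul]; norm_num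
    rw [this]
    exact nat_le_pow_of_exp_le le_rfl (by norm_num)
  have hk : (0 : ℝ) ≤ k := Nat.cast_nonneg _
  push_cast
  linarith

lemma inv_exploreProb_le (hH : 0 < H) {ε δ : ℝ} (hε : 0 < ε) (hδ : 0 < δ) (hδ1 : δ < 1) {z : ℝ}
    (hz : Real.exp (logFactor S A H ε δ) ≤ z) : (exploreProb S A H ε)⁻¹ ≤ z ^ 12 := by
  obtain ⟨h1, h2, h3, h4, -⟩ := le_exp_logFactor (S := S) (A := A) hH hε hδ hδ1
  have hL := (logFactor_bounds (S := S) (A := A) (H := H) (ε := ε) hδ hδ1).1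
  have hz0 : 0 < z := (Real.exp_pos _).trans_le hz
  have hz1 : Real.exp 1 ≤ z := (Real.exp_le_exp.2 hL).trans hz
  have h64 : (64 : ℝ) ≤ z ^ 5 := nat_le_pow_of_exp_le hz1 (by norm_num)
  have e1 : (exploreProb S A H ε)⁻¹ =
      64 * (Fintype.card S : ℝ) ^ 2 * Fintype.card A * (H : ℝ) ^ 3 * (1 / ε) := by
    unfold exploreProb; field_simp
  rw [e1]
  calc _ ≤ z ^ 5 * z ^ 2 * z * z ^ 3 * z := by
        gcongr
        · exact h1.trans hz
        · exact h2.trans hz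
        · exact h3.trans hz
        · exact h4.trans hz
    _ = z ^ 12 := by ring

end LogFactor

/-! ### Growth of the number of episodes -/

/-- The round bound of CovGame has the length on both sides, through log(T+1)². Bounding that by
√(T+1) gives T + 1 ≤ z^39 √(T+1), hence a polynomial in z. -/
lemma PCEEvent.length_le [Nonempty A] (hH : 0 < H) {M : MDP S A H}
    {sel : (A → ℝ) → A} {ε δ : ℝ} (hε : 0 < ε) (hδ : 0 < δ) (hδ1 : δ < 1) {env : Env S A H}
    (hE : PCEEvent M sel ε δ env) {E F : ℕ → List (Episode S A H)}
    (hR : PhaseRuns M sel ε δ env E F) (k : ℕ) :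
    ((E k).length : ℝ) + 1 ≤ Real.exp (logFactor S A H ε δ + k) ^ 78 := by
  have hne : Nonempty S := ⟨M.init⟩
  have hL := (logFactor_bounds (S := S) (A := A) (H := H) (ε := ε) hδ hδ1).1
  obtain ⟨b1, b2, b3, b4, b5⟩ := le_exp_logFactor (S := S) (A := A) hH hε hδ hδ1
  have hlogc := log_phaseConf_le (S := S) (A := A) (ε := ε) hH hδ hδ1 k
  obtain ⟨o, ho, hoμ⟩ := hE.exists_mix hH
  set L := logFactor S A H ε δ with hLdef
  set z := Real.exp (L + k) with hz
  have hk : (0 : ℝ) ≤ k := Nat.cast_nonneg _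
  have hLz : Real.exp L ≤ z := Real.exp_le_exp.2 (by linarith)
  have hz1 : Real.exp 1 ≤ z := Real.exp_le_exp.2 (by linarith)
  have hz0 : 0 < z := Real.exp_pos _
  have hz2 : 1 ≤ z := (Real.one_le_exp zero_le_one).trans hz1
  have hLkz : L + k + 1 ≤ z := Real.add_one_le_exp _
  have hμ := exploreProb_pos (S := S) (A := A) hH hε
  have hμz := inv_exploreProb_le (S := S) (A := A) hH hε hδ hδ1 hLz
  set μ := exploreProb S A H ε with hμdef
  have h2k : (2 : ℝ) ^ k ≤ z := by
    have : (2 : ℝ) ^ k ≤ Real.exp 1 ^ k := by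
      gcongr; linarith [Real.exp_one_gt_d9]
    refine this.trans ?_
    rw [← Real.exp_nat_mul, mul_one]
    exact Real.exp_le_exp.2 (by linarith)
  set T := (E k).length with hT
  -- Targets are at most 2^k and the explorer visits with probability at least μ, so it also
  -- dominates the target with φ = 2^k/μ.
  have hlen := (hR.success k).length_le (2 ^ k * μ⁻¹) μ k o ho o ho hμ (by positivity)
    (fun x hx => hμ.le.trans (hoμ k x hx))
    (fun x hx => (pceTarget_le sel env ε δ k _ _ _).trans (by
      rw [mul_assoc]
      refine le_mul_of_one_le_right (by positivity) ?_
      rw [inv_mul_eq_div, one_le_div hμ]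
      exact hoμ k x hx))
    (hoμ k) (fun x _ => pceTarget_le sel env ε δ k _ _ _)
  have hreg := ucbviRegret_le_pow (S := S) (A := A) (H := H) hz1 (b1.trans hLz) (b2.trans hLz)
    (b3.trans hLz) (δ := phaseConf δ k / 2) (by linarith) T
  rw [← hT] at hlen
  have hs1 : 1 ≤ Real.sqrt ((T : ℝ) + 1) := by
    rw [Real.one_le_sqrt]; linarith [Nat.cast_nonneg (α := ℝ) T]
  set w := Real.sqrt ((T : ℝ) + 1) with hw
  have hkz : (k : ℝ) + 1 ≤ z := by linarith
  have hmain : (T : ℝ) + 1 ≤ z ^ 39 * w := by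
    have h30 : (30 : ℝ) ≤ z ^ 4 := nat_le_pow_of_exp_le hz1 (by norm_num)
    calc (T : ℝ) + 1 ≤ 2 + (k + 1) * (16 * (2 ^ k * μ⁻¹) +
          (4 * ucbviRegret S A H (phaseConf δ k / 2) T + 8 * (k + 1)) * μ⁻¹) := by
          rw [div_eq_mul_inv] at hlen; linarith
      _ ≤ 2 * (z ^ 35 * w) + z * (16 * (z * z ^ 12) + (4 * (z ^ 22 * w) + 8 * z) * z ^ 12) := by
          have h1 : 1 ≤ z ^ 35 * w := one_le_mul_of_one_le_of_one_le (one_le_pow₀ hz2) hs1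
          have h2 : 0 ≤ ucbviRegret S A H (phaseConf δ k / 2) T := ucbviRegret_nonneg hH
            (half_pos (phaseConf_pos hδ k)) (by linarith [phaseConf_le hδ k, phaseConf_pos hδ k]) T
          gcongr
          linarith
      _ = 2 * (z ^ 35 * w) + 4 * (z ^ 35 * w) + 24 * (z ^ 14 * 1) := by ring
      _ ≤ 2 * (z ^ 35 * w) + 4 * (z ^ 35 * w) + 24 * (z ^ 35 * w) := by
          gcongr
          norm_num
      _ = 30 * (z ^ 35 * w) := by ring
      _ ≤ z ^ 4 * (z ^ 35 * w) := by gcongr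
      _ = _ := by ring
  have := le_sq_of_le_mul_sqrt (by positivity) hmain
  rw [← pow_mul] at this
  exact this

lemma PhaseRuns.length_eq {M : MDP S A H} {sel : (A → ℝ) → A} {ε δ : ℝ} {env : Env S A H}
    {E F : ℕ → List (Episode S A H)} (hR : PhaseRuns M sel ε δ env E F) (k : ℕ) :
    (F k).length = ∑ i ∈ Finset.range (k + 1), (E i).length := by
  induction k with
  | zero => simp [hR.zero]
  | succ k ih => rw [hR.succ, List.length_append, ih, Finset.sum_range_succ _ (k + 1)]

lemma PCEEvent.log_length_le [Nonempty A] (hH : 0 < H) {M : MDP S A H}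
    {sel : (A → ℝ) → A} {ε δ : ℝ} (hε : 0 < ε) (hδ : 0 < δ) (hδ1 : δ < 1) {env : Env S A H}
    (hE : PCEEvent M sel ε δ env) {E F : ℕ → List (Episode S A H)}
    (hR : PhaseRuns M sel ε δ env E F) (k : ℕ) :
    Real.log ((E k).length + 1) ≤ 78 * (logFactor S A H ε δ + k) ∧
      Real.log (1 + (F k).length) ≤ 80 * (logFactor S A H ε δ + k) := by
  have hne : Nonempty S := ⟨M.init⟩
  have hL := (logFactor_bounds (S := S) (A := A) (H := H) (ε := ε) hδ hδ1).1
  have hlen := hE.length_le hH hε hδ hδ1 hR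
  set L := logFactor S A H ε δ with hLdef
  have hexp : ∀ n : ℕ, Real.log (Real.exp (L + k) ^ n) = n * (L + k) := fun n => by
    rw [Real.log_pow, Real.log_exp]
  constructor
  · refine (Real.log_le_log (by positivity) (hlen k)).trans (le_of_eq ?_)
    rw [hexp]; norm_num
  · have hz1 : Real.exp 1 ≤ Real.exp (L + k) :=
      Real.exp_le_exp.2 (by linarith [Nat.cast_nonneg (α := ℝ) k])
    have hLkz : L + k + 1 ≤ Real.exp (L + k) := Real.add_one_le_exp _
    set z := Real.exp (L + k) with hz
    have hz0 : 0 < z := Real.exp_pos _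
    have h2z : 2 ≤ z := by linarith [Real.exp_one_gt_d9]
    have hsum : ((F k).length : ℝ) ≤ z ^ 79 := by
      rw [hR.length_eq]
      push_cast
      calc ∑ i ∈ Finset.range (k + 1), ((E i).length : ℝ) ≤ ∑ _i ∈ Finset.range (k + 1), z ^ 78 := by
            refine Finset.sum_le_sum fun i hi => ?_
            have hik : (i : ℝ) ≤ k := by
              rw [Finset.mem_range] at hi; exact_mod_cast Nat.lt_succ_iff.1 hi
            have h1 : Real.exp (L + i) ^ 78 ≤ z ^ 78 := by
              gcongr
              exact Real.exp_le_exp.2 (by linarith)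
            linarith [hlen i]
        _ = (k + 1) * z ^ 78 := by rw [Finset.sum_const, Finset.card_range, nsmul_eq_mul]; push_cast; ring
        _ ≤ z * z ^ 78 := by gcongr; linarith
        _ = _ := by ring
    have h3 : 1 + ((F k).length : ℝ) ≤ z ^ 80 := by
      have h4 : 1 ≤ z ^ 79 := one_le_pow₀ (by linarith)
      calc 1 + ((F k).length : ℝ) ≤ 2 * z ^ 79 := by linarith
        _ ≤ z * z ^ 79 := by gcongr
        _ = _ := by ring
    refine (Real.log_le_log (by positivity) h3).trans (le_of_eq ?_)
    rw [hexp]; norm_num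

/-! ### Termination of PCE -/

/-- The stopping threshold sees the data only through the logarithm of their number, which is of
order L + k. -/
lemma PCEEvent.betaRF_le [Nonempty A] (hH : 0 < H) {M : MDP S A H}
    {sel : (A → ℝ) → A} {ε δ : ℝ} (hε : 0 < ε) (hδ : 0 < δ) (hδ1 : δ < 1) {env : Env S A H}
    (hE : PCEEvent M sel ε δ env) {E F : ℕ → List (Episode S A H)}
    (hR : PhaseRuns M sel ε δ env E F) (k : ℕ) :
    H * betaRF S A H (F k).length (δ / 3) ≤
      2000 * ((H : ℝ) ^ 3 * Real.log (1 / δ) + Fintype.card S * (H : ℝ) ^ 4) *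
        (logFactor S A H ε δ + k) := by
  have hne : Nonempty S := ⟨M.init⟩
  obtain ⟨hL, h2, -, -, h5, h6, h7, h8⟩ :=
    logFactor_bounds (S := S) (A := A) (H := H) (ε := ε) hδ hδ1
  have hlen := (hE.log_length_le hH hε hδ hδ1 hR k).2
  set L := logFactor S A H ε δ with hLdef
  have hS : (1 : ℝ) ≤ Fintype.card S := by exact_mod_cast Fintype.card_pos
  have hA : (0 : ℝ) < Fintype.card A := by exact_mod_cast Fintype.card_pos
  have hH' : (1 : ℝ) ≤ H := by exact_mod_cast hH
  have hk : (0 : ℝ) ≤ k := Nat.cast_nonneg _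
  have e1 : Real.log (1 / (δ / 3)) ≤ 2 + Real.log (1 / δ) := by
    have : 1 / (δ / 3) = 3 * (1 / δ) := by field_simp
    rw [this, Real.log_mul (by norm_num) (by positivity)]
    linarith [Real.log_le_sub_one_of_pos (show (0 : ℝ) < 3 by norm_num)]
  have e2 : Real.log (Fintype.card A * (1 + ((F k).length : ℝ))) ≤ 81 * (L + k) := by
    rw [Real.log_mul hA.ne' (by positivity)]
    linarith
  have e3 : (H : ℝ) ^ 3 ≤ Fintype.card S * (H : ℝ) ^ 4 := by
    calc (H : ℝ) ^ 3 ≤ (H : ℝ) ^ 4 := pow_le_pow_right₀ hH' (by norm_num)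
      _ ≤ _ := le_mul_of_one_le_left (by positivity) hS
  set K := Fintype.card S * (H : ℝ) ^ 4 with hK
  have hK0 : 0 ≤ K := by rw [hK]; positivity
  calc H * betaRF S A H (F k).length (δ / 3) = 4 * (H : ℝ) ^ 3 * Real.log (1 / (δ / 3)) +
        24 * K * Real.log (Fintype.card A * (1 + ((F k).length : ℝ))) := by
        unfold betaRF; rw [hK]; ring
    _ ≤ 4 * (H : ℝ) ^ 3 * (2 + Real.log (1 / δ)) + 24 * K * (81 * (L + k)) := by gcongr
    _ = 4 * ((H : ℝ) ^ 3 * Real.log (1 / δ)) * 1 + 8 * (H : ℝ) ^ 3 * 1 + 1944 * K * (L + k) := by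
        ring
    _ ≤ 4 * ((H : ℝ) ^ 3 * Real.log (1 / δ)) * (L + k) + 8 * K * (L + k) + 1944 * K * (L + k) := by
        gcongr <;> linarith
    _ ≤ 2000 * ((H : ℝ) ^ 3 * Real.log (1 / δ)) * (L + k) + 2000 * K * (L + k) := by
        have : 0 ≤ (H : ℝ) ^ 3 * Real.log (1 / δ) * (L + k) := by
          have : 0 ≤ L + k := by linarith
          positivity
        have : 0 ≤ K * (L + k) := mul_nonneg hK0 (by linarith)
        linarith
    _ = _ := by ring

lemma PhaseRuns.pceDone_iff {M : MDP S A H} {sel : (A → ℝ) → A} {ε δ : ℝ} (hε : 0 < ε)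
    {env : Env S A H} {E F : ℕ → List (Episode S A H)} (hR : PhaseRuns M sel ε δ env E F) (k : ℕ) :
    PCEDone sel env ε δ k ↔
      1 ≤ k ∧ 16 * H * betaRF S A H (F k).length (δ / 3) ≤ ε ^ 2 * 2 ^ k := by
  have hpow : (2 : ℝ) ^ ((4 : ℤ) - k) = 16 / 2 ^ k := by
    rw [zpow_sub₀ two_ne_zero, zpow_natCast]; norm_num
  have hiff : ∀ β : ℝ, Real.sqrt (H * β * (2 : ℝ) ^ ((4 : ℤ) - k)) ≤ ε ↔
      16 * H * β ≤ ε ^ 2 * 2 ^ k := by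
    intro β
    rw [Real.sqrt_le_iff, hpow, mul_div_assoc', div_le_iff₀ (by positivity)]
    constructor
    · rintro ⟨-, h⟩; linarith
    · intro h; exact ⟨hε.le, by linarith⟩
  unfold PCEDone
  refine and_congr_right fun _ => ?_
  constructor
  · rintro ⟨D, hD, h⟩
    rw [hR.pceData_eq, Option.some_inj] at hD
    subst hD
    exact (hiff _).1 h
  · intro h
    exact ⟨F k, hR.pceData_eq k, (hiff _).2 h⟩

/-- A phase at which PCE does not stop is logarithmically early. -/
lemma lt_of_two_pow_lt {L k a ε : ℝ} (hL : 1 ≤ L) (hk : 0 ≤ k) (hε : 0 < ε)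
    (hε' : 1 / ε ≤ Real.exp L) (ha : a ≤ 2 * Real.exp L ^ 5)
    (h : ε ^ 2 * Real.exp (k * Real.log 2) < 32000 * a * (L + k)) : k < 47 * L := by
  have h1 : Real.exp (k * Real.log 2) < Real.exp L ^ 2 * (32000 * (2 * Real.exp L ^ 5) *
      (Real.exp L * (1 + k))) := by
    have e1 : 1 ≤ Real.exp L ^ 2 * ε ^ 2 := by
      rw [← mul_pow]
      refine one_le_pow₀ ?_
      rwa [div_le_iff₀ hε] at hε'
    have e2 : L + k ≤ Real.exp L * (1 + k) := by
      have := Real.add_one_le_exp L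
      nlinarith
    calc Real.exp (k * Real.log 2) ≤ Real.exp L ^ 2 * ε ^ 2 * Real.exp (k * Real.log 2) :=
          le_mul_of_one_le_left (Real.exp_pos _).le e1
      _ = Real.exp L ^ 2 * (ε ^ 2 * Real.exp (k * Real.log 2)) := by ring
      _ < Real.exp L ^ 2 * (32000 * a * (L + k)) := by gcongr
      _ ≤ _ := by gcongr
  have h2 : Real.exp L ^ 2 * (32000 * (2 * Real.exp L ^ 5) * (Real.exp L * (1 + k))) =
      64000 * (Real.exp L ^ 8 * (1 + k)) := by ring
  rw [h2, ← Real.lt_log_iff_exp_lt (by positivity), Real.log_mul (by norm_num) (by positivity),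
    Real.log_mul (by positivity) (by positivity), Real.log_pow, Real.log_exp] at h1
  have h3 : Real.log 64000 ≤ 12 := by
    rw [Real.log_le_iff_le_exp (by norm_num)]
    have : Real.exp 12 = Real.exp 1 ^ 12 := by rw [← Real.exp_nat_mul]; norm_num
    rw [this]
    exact nat_le_pow_of_exp_le le_rfl (by norm_num)
  -- The tangent of the logarithm at 4: its slope 1/4 is below log 2, so k can be isolated.
  have h4 : Real.log (1 + k) ≤ (1 + k) / 4 + 2 * Real.log 2 - 1 := by
    have e1 := Real.log_le_sub_one_of_pos (show 0 < (1 + k) / 4 by positivity)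
    rw [Real.log_div (by positivity) (by norm_num),
      show (4 : ℝ) = 2 ^ 2 by norm_num, Real.log_pow] at e1
    push_cast at e1
    norm_num at e1 ⊢
    linarith
  have h5 := Real.log_two_gt_d9
  have h6 := Real.log_two_lt_d9
  push_cast at h1
  nlinarith

lemma PCEEvent.lt_of_not_done [Nonempty A] (hH : 0 < H) {M : MDP S A H}
    {sel : (A → ℝ) → A} {ε δ : ℝ} (hε : 0 < ε) (hδ : 0 < δ) (hδ1 : δ < 1) {env : Env S A H}
    (hE : PCEEvent M sel ε δ env) {E F : ℕ → List (Episode S A H)}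
    (hR : PhaseRuns M sel ε δ env E F) {k : ℕ}
    (hk : ε ^ 2 * 2 ^ k < 16 * H * betaRF S A H (F k).length (δ / 3)) :
    (k : ℝ) < 47 * logFactor S A H ε δ := by
  have hne : Nonempty S := ⟨M.init⟩
  obtain ⟨hL, h2, -, -, h5, -⟩ := logFactor_bounds (S := S) (A := A) (H := H) (ε := ε) hδ hδ1
  obtain ⟨b1, b2, b3, b4, b5⟩ := le_exp_logFactor (S := S) (A := A) hH hε hδ hδ1
  have hβ := hE.betaRF_le hH hε hδ hδ1 hR k
  have hpow : (2 : ℝ) ^ k = Real.exp (k * Real.log 2) := by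
    rw [mul_comm, Real.exp_mul, Real.exp_log two_pos, Real.rpow_natCast]
  rw [hpow] at hk
  refine lt_of_two_pow_lt hL (Nat.cast_nonneg _) hε b4
    (a := (H : ℝ) ^ 3 * Real.log (1 / δ) + Fintype.card S * (H : ℝ) ^ 4) ?_ (by linarith)
  set y := Real.exp (logFactor S A H ε δ) with hy
  have hy1 : 1 ≤ y := Real.one_le_exp (by linarith)
  calc (H : ℝ) ^ 3 * Real.log (1 / δ) + Fintype.card S * (H : ℝ) ^ 4 ≤ y ^ 3 * y + y * y ^ 4 := by
        gcongr
        linarith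
    _ = y ^ 4 + y ^ 5 := by ring
    _ ≤ y ^ 5 + y ^ 5 := by
        have : y ^ 4 ≤ y ^ 5 := pow_le_pow_right₀ hy1 (by norm_num)
        linarith
    _ = _ := by ring

/-- PCE stops, at the first phase that satisfies the stopping rule. -/
lemma PCEEvent.exists_run [MeasurableSpace S] [DiscreteMeasurableSpace S] [Nonempty A] (hH : 0 < H)
    {M : MDP S A H} {sel : (A → ℝ) → A} {ε δ : ℝ} (hε : 0 < ε) (hδ : 0 < δ) (hδ1 : δ < 1)
    {env : Env S A H} (hE : PCEEvent M sel ε δ env) :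
    ∃ E F, PhaseRuns M sel ε δ env E F ∧ ∃ K, 1 ≤ K ∧ pceRun sel env ε δ = some (F K) ∧
      16 * H * betaRF S A H (F K).length (δ / 3) ≤ ε ^ 2 * 2 ^ K ∧
      ∀ k, 1 ≤ k → k < K → ε ^ 2 * 2 ^ k < 16 * H * betaRF S A H (F k).length (δ / 3) := by
  obtain ⟨E, F, hR⟩ := hE.exists_phaseRuns hH hε hδ hδ1.le
  refine ⟨E, F, hR, ?_⟩
  have hex : ∃ k, PCEDone sel env ε δ k := by
    obtain ⟨k, hk⟩ := exists_nat_ge (max 1 (47 * logFactor S A H ε δ))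
    refine ⟨k, (hR.pceDone_iff hε k).2 ⟨by exact_mod_cast (le_max_left _ _).trans hk, ?_⟩⟩
    by_contra hcon
    push Not at hcon
    have := hE.lt_of_not_done hH hε hδ hδ1 hR hcon
    linarith [le_max_right 1 (47 * logFactor S A H ε δ)]
  have hspec := (hR.pceDone_iff hε _).1 (Nat.find_spec hex)
  refine ⟨Nat.find hex, hspec.1, ?_, hspec.2, fun k hk1 hk2 => ?_⟩
  · unfold pceRun
    rw [dif_pos hex, hR.pceData_eq]
  · have := Nat.find_min hex hk2
    rw [hR.pceDone_iff hε, not_and, not_le] at this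
    exact this hk1

/-- The model returned by PCE is accurate enough for all reward functions. -/
theorem PCEEvent.optimal [MeasurableSpace S] [DiscreteMeasurableSpace S] [Nonempty A] (hH : 0 < H)
    {M : MDP S A H} {sel : (A → ℝ) → A} {ε δ : ℝ} (hε : 0 < ε) (hδ : 0 < δ) (hδ1 : δ < 1)
    {env : Env S A H} (hE : PCEEvent M sel ε δ env) :
    ∃ P : Model S A H, pceOutput sel env ε δ = some P ∧
      ∀ r : Table S A H, (∀ h s a, r h s a ∈ Set.Icc (0 : ℝ) 1) →
        ∀ π : Policy S A H, IsOptimalPolicy P M.init r π →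
          |value M.model M.init π r - M.optValue r| ≤ ε := by
  have hne : Nonempty S := ⟨M.init⟩
  obtain ⟨E, F, hR, K, hK1, hrun, hdone, -⟩ := hE.exists_run hH hε hδ hδ1
  refine ⟨empirical (F K), by rw [pceOutput, hrun]; rfl, fun r hr π hπ => ?_⟩
  have hconc := hE.phase.model K (F K) (by rw [← pceData_eq_phaseData]; exact hR.pceData_eq K)
  have hacc := fun π' => abs_value_sub_value_le hH hε hconc hdone
    (X := Reachable sel env ε δ) (fun h s hX a => by
      refine le_trans ?_ (hR.target_le_count K h s a)
      rw [pceTarget_pos hX (by omega)]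
      exact mul_le_mul_of_nonneg_left (hE.reach h s).2 (by positivity))
    (fun h s hX => hE.maxReach_le_of_not_reachable hH hX) hr π'
  -- Two errors of ε/2, one for each policy. This bound also shows that the supremum defining the
  -- optimal value is over a bounded set.
  have hub : ∀ π' : Policy S A H, value M.model M.init π' r ≤ value M.model M.init π r + ε := by
    intro π'
    have h1 := abs_le.1 (hacc π')
    have h2 := abs_le.1 (hacc π)
    have h3 := hπ π'
    linarith [h1.1, h2.2]
  have h1 : M.optValue r ≤ value M.model M.init π r + ε := ciSup_le hub
  have h2 : value M.model M.init π r ≤ M.optValue r :=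
    le_ciSup (f := fun π' : Policy S A H => value M.model M.init π' r)
      ⟨_, by rintro _ ⟨π', rfl⟩; exact hub π'⟩ π
  rw [abs_le]
  constructor <;> linarith

end

section

open scoped Classical


variable {S A : Type*} [Fintype S] [Fintype A] {H : ℕ}

/-! ### Sample complexity of PCE -/

/-- The sharp counterpart of `ucbviRegret_le_pow`, usable once log(T+1) is known to be of order m:
the dependence on S, A, H and log(1/δ) is kept exact. -/
lemma ucbviRegret_le_cube [Nonempty S] {m l δ : ℝ} (hm : 1 ≤ m) (hl : 0 ≤ l)
    (hlog : Real.log (2 * Fintype.card S * Fintype.card A * H / δ) ≤ l + 5 * m) {T : ℕ}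
    (hT : Real.log (T + 1) ≤ 80 * m) :
    ucbviRegret S A H δ T ≤
      5000000000 * (Fintype.card S * Fintype.card A * (H : ℝ) ^ 2 * (l + Fintype.card S)) * m ^ 3 := by
  have hS : (1 : ℝ) ≤ Fintype.card S := by exact_mod_cast Fintype.card_pos
  have h0 : 0 ≤ Real.log ((T : ℝ) + 1) :=
    Real.log_nonneg (by linarith [Nat.cast_nonneg (α := ℝ) T])
  have h1 : Real.log (2 * Fintype.card S * Fintype.card A * H / δ) + 6 * Fintype.card S ≤
      11 * ((l + Fintype.card S) * m) := by
    nlinarith [mul_nonneg hl (sub_nonneg.2 hm), mul_nonneg (sub_nonneg.2 hS) (sub_nonneg.2 hm)]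
  have h2 : 0 ≤ 65536 * Fintype.card S * Fintype.card A * (H : ℝ) ^ 2 * Real.log (T + 1) ^ 2 := by
    positivity
  unfold ucbviRegret
  calc _ = 65536 * Fintype.card S * Fintype.card A * (H : ℝ) ^ 2 * Real.log (T + 1) ^ 2 *
        (Real.log (2 * Fintype.card S * Fintype.card A * H / δ) + 6 * Fintype.card S) := by ring
    _ ≤ 65536 * Fintype.card S * Fintype.card A * (H : ℝ) ^ 2 * Real.log (T + 1) ^ 2 *
        (11 * ((l + Fintype.card S) * m)) := mul_le_mul_of_nonneg_left h1 h2
    _ ≤ 65536 * Fintype.card S * Fintype.card A * (H : ℝ) ^ 2 * (80 * m) ^ 2 *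
        (11 * ((l + Fintype.card S) * m)) := by gcongr
    _ = 4613734400 * (Fintype.card S * Fintype.card A * (H : ℝ) ^ 2 * (l + Fintype.card S) * m ^ 3) := by
        ring
    _ ≤ 5000000000 * (Fintype.card S * Fintype.card A * (H : ℝ) ^ 2 * (l + Fintype.card S) * m ^ 3) := by
        gcongr; norm_num
    _ = _ := by ring

/-- The lower-order term of the sample complexity of PCE. -/
def burnIn (S A : Type*) [Fintype S] [Fintype A] (H : ℕ) (ε δ : ℝ) : ℝ :=
  (Fintype.card S : ℝ) ^ 3 * (Fintype.card A : ℝ) ^ 2 * (H : ℝ) ^ 5 *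
    (Real.log (1 / δ) + Fintype.card S) / ε

/-! ### Lower-order terms and the reachability phase. -/

section BurnIn

variable [Nonempty S] [Nonempty A]

lemma le_burnIn (hH : 0 < H) {ε δ : ℝ} (hε : 0 < ε) (hl : 0 ≤ Real.log (1 / δ)) {i j k : ℕ}
    (hi : i ≤ 3) (hj : j ≤ 2) (hk : k ≤ 5) :
    (Fintype.card S : ℝ) ^ i * (Fintype.card A : ℝ) ^ j * (H : ℝ) ^ k *
      (Real.log (1 / δ) + Fintype.card S) / ε ≤ burnIn S A H ε δ := by
  have hS : (1 : ℝ) ≤ Fintype.card S := by exact_mod_cast Fintype.card_pos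
  have hA : (1 : ℝ) ≤ Fintype.card A := by exact_mod_cast Fintype.card_pos
  have hH' : (1 : ℝ) ≤ H := by exact_mod_cast hH
  unfold burnIn
  gcongr

lemma le_burnIn' (hH : 0 < H) {ε δ : ℝ} (hε : 0 < ε) (hl : 0 ≤ Real.log (1 / δ)) {i j k : ℕ}
    (hi : i ≤ 3) (hj : j ≤ 2) (hk : k ≤ 5) :
    (Fintype.card S : ℝ) ^ i * (Fintype.card A : ℝ) ^ j * (H : ℝ) ^ k / ε ≤ burnIn S A H ε δ := by
  have hS : (1 : ℝ) ≤ Fintype.card S := by exact_mod_cast Fintype.card_pos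
  refine le_trans ?_ (le_burnIn (S := S) (A := A) hH hε hl hi hj hk)
  exact div_le_div_of_nonneg_right (le_mul_of_one_le_right (by positivity) (by linarith)) hε.le

lemma card_le_burnIn (hH : 0 < H) {ε δ : ℝ} (hε : 0 < ε) (hεH : ε ≤ H)
    (hl : 0 ≤ Real.log (1 / δ)) : H * Fintype.card S ≤ burnIn S A H ε δ := by
  refine le_trans ?_ (le_burnIn' (S := S) (A := A) hH hε hl (i := 1) (j := 0) (k := 2)
    (by norm_num) (by norm_num) (by norm_num))
  rw [le_div_iff₀ hε, pow_one, pow_zero, mul_one]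
  calc H * Fintype.card S * ε ≤ H * Fintype.card S * (H : ℝ) := by gcongr
    _ = _ := by ring

lemma one_le_burnIn (hH : 0 < H) {ε δ : ℝ} (hε : 0 < ε) (hεH : ε ≤ H)
    (hl : 0 ≤ Real.log (1 / δ)) : 1 ≤ burnIn S A H ε δ := by
  refine le_trans ?_ (card_le_burnIn (S := S) (A := A) hH hε hεH hl)
  have : 1 ≤ H * Fintype.card S := Nat.mul_pos hH Fintype.card_pos
  exact_mod_cast this

lemma log_reachConf_le (hH : 0 < H) {ε δ : ℝ} (hδ : 0 < δ) (hδ1 : δ < 1) :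
    Real.log (2 * Fintype.card S * Fintype.card A * H / (pceReachConf S H δ / 2)) ≤
      Real.log (1 / δ) + 5 * logFactor S A H ε δ ∧
    Real.log (4 / pceReachConf S H δ) ≤ Real.log (1 / δ) + 4 * logFactor S A H ε δ := by
  obtain ⟨hL, hlogs, -, -, hl, hlS, hlA, hlH⟩ :=
    logFactor_bounds (S := S) (A := A) (H := H) (ε := ε) hδ hδ1
  have hlog12 : Real.log 12 ≤ 3 := by
    rw [Real.log_le_iff_le_exp (by norm_num)]
    have : Real.exp 3 = Real.exp 1 ^ 3 := by rw [← Real.exp_nat_mul]; norm_num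
    rw [this]
    exact nat_le_pow_of_exp_le le_rfl (by norm_num)
  have hS0 : (0 : ℝ) < Fintype.card S := by exact_mod_cast Fintype.card_pos
  have hA0 : (0 : ℝ) < Fintype.card A := by exact_mod_cast Fintype.card_pos
  have hH0 : (0 : ℝ) < H := by exact_mod_cast hH
  constructor
  · have e1 : 2 * Fintype.card S * Fintype.card A * H / (pceReachConf S H δ / 2) =
        12 * ((Fintype.card S : ℝ) ^ 2 * (Fintype.card A * ((H : ℝ) ^ 2 * (1 / δ)))) := by
      unfold pceReachConf; field_simp; ring
    rw [e1, Real.log_mul (by norm_num) (by positivity), Real.log_mul (by positivity) (by positivity),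
      Real.log_mul (by positivity) (by positivity), Real.log_mul (by positivity) (by positivity),
      Real.log_pow, Real.log_pow]
    push_cast
    linarith
  · have e1 : 4 / pceReachConf S H δ = 12 * (Fintype.card S * (H * (1 / δ))) := by
      unfold pceReachConf; field_simp; ring
    rw [e1, Real.log_mul (by norm_num) (by positivity), Real.log_mul (by positivity) (by positivity),
      Real.log_mul (by positivity) (by positivity)]
    linarith

/-- The duration of the reachability phase is controlled by the regret one episode earlier. -/
lemma exists_pceReachEpisodes_eq (hH : 0 < H) {ε δ : ℝ} (hε : 0 < ε) (hδ : 0 < δ) (hδ1 : δ < 1) :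
    ∃ T : ℕ, pceReachEpisodes S A H ε δ = T + 1 ∧
      (T : ℝ) ≤ 16 * Fintype.card S * (H : ℝ) ^ 2 / ε *
        (4 * ucbviRegret S A H (pceReachConf S H δ / 2) T +
          6 * (Real.log (1 / δ) + 4 * logFactor S A H ε δ)) := by
  have hS : (1 : ℝ) ≤ Fintype.card S := by exact_mod_cast Fintype.card_pos
  have hH' : (1 : ℝ) ≤ H := by exact_mod_cast hH
  have hlogB := (log_reachConf_le (S := S) (A := A) (ε := ε) hH hδ hδ1).2
  have hδr0 : 0 < pceReachConf S H δ := by unfold pceReachConf; positivity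
  have hδr1 : pceReachConf S H δ ≤ 1 := by
    unfold pceReachConf
    refine (div_le_self hδ.le ?_).trans hδ1.le
    nlinarith
  have hε0 : 0 < pceThreshold S H ε := by unfold pceThreshold; positivity
  obtain ⟨-, hTpos⟩ := reachEpisodes_spec (S := S) (A := A) hH hε0 hδr0 hδr1
  obtain ⟨T, hT⟩ : ∃ T, pceReachEpisodes S A H ε δ = T + 1 :=
    ⟨pceReachEpisodes S A H ε δ - 1, (Nat.sub_add_cancel hTpos).symm⟩
  refine ⟨T, hT, ?_⟩
  -- One episode less than the minimum violates the defining inequality, which reads as an upper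
  -- bound on T.
  have hnot : T ∉ {T : ℕ | 4 * ucbviRegret S A H (pceReachConf S H δ / 2) T +
      6 * Real.log (4 / pceReachConf S H δ) ≤ pceThreshold S H ε / 4 * T} := by
    refine Nat.notMem_of_lt_sInf ?_
    unfold pceReachEpisodes reachEpisodes at hT
    rw [hT]
    exact Nat.lt_succ_self T
  simp only [Set.mem_ofPred_eq, not_le] at hnot
  have e1 : (T : ℝ) = 16 * Fintype.card S * (H : ℝ) ^ 2 / ε * (pceThreshold S H ε / 4 * T) := by
    unfold pceThreshold; field_simp; norm_num
  have h2 : pceThreshold S H ε / 4 * T ≤ 4 * ucbviRegret S A H (pceReachConf S H δ / 2) T +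
      6 * (Real.log (1 / δ) + 4 * logFactor S A H ε δ) := by linarith
  calc (T : ℝ) = _ := e1
    _ ≤ _ := mul_le_mul_of_nonneg_left h2 (by positivity)

/-- The same bootstrap as in `PCEEvent.length_le`: T + 1 ≤ z^33 √(T+1). -/
lemma log_reachEpisodes_le (hH : 0 < H) {ε δ : ℝ} (hε : 0 < ε) (hδ : 0 < δ) (hδ1 : δ < 1) {T : ℕ}
    (hTle : (T : ℝ) ≤ 16 * Fintype.card S * (H : ℝ) ^ 2 / ε *
        (4 * ucbviRegret S A H (pceReachConf S H δ / 2) T +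
          6 * (Real.log (1 / δ) + 4 * logFactor S A H ε δ))) :
    Real.log ((T : ℝ) + 1) ≤ 80 * logFactor S A H ε δ := by
  obtain ⟨hL, -, -, -, hl, -, -, -⟩ :=
    logFactor_bounds (S := S) (A := A) (H := H) (ε := ε) hδ hδ1
  obtain ⟨b1, b2, b3, b4, b5⟩ := le_exp_logFactor (S := S) (A := A) hH hε hδ hδ1
  have hlogA := (log_reachConf_le (S := S) (A := A) (ε := ε) hH hδ hδ1).1
  have hS : (1 : ℝ) ≤ Fintype.card S := by exact_mod_cast Fintype.card_pos
  have hH' : (1 : ℝ) ≤ H := by exact_mod_cast hH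
  have hδr0 : 0 < pceReachConf S H δ := by unfold pceReachConf; positivity
  have hδr1 : pceReachConf S H δ ≤ 1 := by
    unfold pceReachConf
    refine (div_le_self hδ.le ?_).trans hδ1.le
    nlinarith
  have hR0 : 0 ≤ ucbviRegret S A H (pceReachConf S H δ / 2) T :=
    ucbviRegret_nonneg hH (half_pos hδr0) (by linarith) T
  generalize logFactor S A H ε δ = L at *
  have hLz : L + 1 ≤ Real.exp L := Real.add_one_le_exp _
  have hz1 : Real.exp 1 ≤ Real.exp L := Real.exp_le_exp.2 hL
  have hz0 : 0 < Real.exp L := Real.exp_pos _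
  have hz2 : 1 ≤ Real.exp L := by linarith
  have hlogz := Real.log_exp L
  generalize Real.exp L = z at *
  have hreg := ucbviRegret_le_pow (S := S) (A := A) (H := H) hz1 b1 b2 b3
    (δ := pceReachConf S H δ / 2) (by linarith) T
  generalize ucbviRegret S A H (pceReachConf S H δ / 2) T = R at *
  have hs1 : 1 ≤ Real.sqrt ((T : ℝ) + 1) := by
    rw [Real.one_le_sqrt]; linarith [Nat.cast_nonneg (α := ℝ) T]
  have hgz : 16 * Fintype.card S * (H : ℝ) ^ 2 / ε ≤ 16 * z ^ 4 := by
    rw [div_eq_mul_one_div]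
    calc 16 * Fintype.card S * (H : ℝ) ^ 2 * (1 / ε) ≤ 16 * z * z ^ 2 * z := by gcongr
      _ = _ := by ring
  have hmain : (T : ℝ) + 1 ≤ z ^ 33 * Real.sqrt ((T : ℝ) + 1) := by
    generalize Real.sqrt ((T : ℝ) + 1) = w at *
    have h545 : (545 : ℝ) ≤ z ^ 7 := nat_le_pow_of_exp_le hz1 (by norm_num)
    have h1 : 1 ≤ z ^ 26 * w := one_le_mul_of_one_le_of_one_le (one_le_pow₀ hz2) hs1
    calc (T : ℝ) + 1 ≤ 16 * z ^ 4 * (4 * (z ^ 22 * w) + 6 * (5 * z)) + z ^ 26 * w := by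
          refine add_le_add (hTle.trans ?_) h1
          refine mul_le_mul hgz ?_ (by positivity) (by positivity)
          linarith
      _ = 65 * (z ^ 26 * w) + 480 * (z ^ 5 * 1) := by ring
      _ ≤ 65 * (z ^ 26 * w) + 480 * (z ^ 26 * w) := by
          gcongr
          norm_num
      _ = 545 * (z ^ 26 * w) := by ring
      _ ≤ z ^ 7 * (z ^ 26 * w) := by gcongr
      _ = _ := by ring
  have h1 := le_sq_of_le_mul_sqrt (by positivity) hmain
  rw [← pow_mul] at h1
  refine (Real.log_le_log (by positivity) h1).trans ?_
  rw [Real.log_pow, hlogz]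
  push_cast
  linarith

/-- The duration of the reachability phase. -/
lemma pceInit_le (hH : 0 < H) {ε δ : ℝ} (hε : 0 < ε) (hεH : ε ≤ H) (hδ : 0 < δ) (hδ1 : δ < 1) :
    (pceInit S A H ε δ : ℝ) ≤ 1000000000000 * logFactor S A H ε δ ^ 3 * burnIn S A H ε δ := by
  obtain ⟨hL, -, -, -, hl, -, -, -⟩ :=
    logFactor_bounds (S := S) (A := A) (H := H) (ε := ε) hδ hδ1
  have hB1 := card_le_burnIn (S := S) (A := A) hH hε hεH hl
  have hB2 := le_burnIn (S := S) (A := A) hH hε hl (i := 3) (j := 1) (k := 5)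
    (by norm_num) (by norm_num) (by norm_num)
  have hB3 := le_burnIn (S := S) (A := A) hH hε hl (i := 2) (j := 0) (k := 3)
    (by norm_num) (by norm_num) (by norm_num)
  have hS : (1 : ℝ) ≤ Fintype.card S := by exact_mod_cast Fintype.card_pos
  have hlogA := (log_reachConf_le (S := S) (A := A) (ε := ε) hH hδ hδ1).1
  obtain ⟨T, hT, hTle⟩ := exists_pceReachEpisodes_eq (S := S) (A := A) hH hε hδ hδ1
  have hlogT := log_reachEpisodes_le hH hε hδ hδ1 hTle
  have hinit : (pceInit S A H ε δ : ℝ) = H * Fintype.card S * (T + 1) := by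
    unfold pceInit
    rw [hT, Fintype.card_prod, Fintype.card_fin]
    push_cast; ring
  rw [hinit]
  generalize logFactor S A H ε δ = L at *
  generalize Real.log (1 / δ) = l at *
  generalize burnIn S A H ε δ = b at *
  have hreg := ucbviRegret_le_cube (S := S) (A := A) (H := H) hL hl hlogA hlogT
  have hL3 : L ≤ L ^ 3 := le_self_pow₀ hL (by norm_num)
  have hL31 : 1 ≤ L ^ 3 := one_le_pow₀ hL
  have hlL : l + 4 * L ≤ 4 * ((l + Fintype.card S) * L) := by
    nlinarith [mul_nonneg hl (sub_nonneg.2 hL), mul_nonneg (sub_nonneg.2 hS) (sub_nonneg.2 hL)]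
  have hb0 : 0 ≤ b := le_trans (by positivity) hB1
  calc H * Fintype.card S * ((T : ℝ) + 1) ≤ H * Fintype.card S *
        (16 * Fintype.card S * (H : ℝ) ^ 2 / ε * (4 * (5000000000 * (Fintype.card S * Fintype.card A * (H : ℝ) ^ 2 *
          (l + Fintype.card S)) * L ^ 3) + 6 * (4 * ((l + Fintype.card S) * L))) + 1) := by
        gcongr
        refine hTle.trans ?_
        gcongr
    _ = 320000000000 * L ^ 3 * ((Fintype.card S : ℝ) ^ 3 * (Fintype.card A : ℝ) ^ 1 * (H : ℝ) ^ 5 *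
          (l + Fintype.card S) / ε) + 384 * L * ((Fintype.card S : ℝ) ^ 2 *
          (Fintype.card A : ℝ) ^ 0 * (H : ℝ) ^ 3 * (l + Fintype.card S) / ε) +
          H * Fintype.card S := by ring
    _ ≤ 320000000000 * L ^ 3 * b + 384 * L ^ 3 * b + L ^ 3 * b := by
        refine add_le_add (by gcongr) (hB1.trans (le_mul_of_one_le_left hb0 hL31))
    _ = 320000000385 * (L ^ 3 * b) := by ring
    _ ≤ 1000000000000 * (L ^ 3 * b) := by gcongr; norm_num
    _ = _ := by ring

end BurnIn

/-- The duration of a phase, in terms of the coverage of the target of the lower bound. -/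
lemma PCEEvent.phase_length_le [MeasurableSpace S] [DiscreteMeasurableSpace S] [Nonempty A]
    (hH : 0 < H) {M : MDP S A H} {sel : (A → ℝ) → A} {ε δ : ℝ} (hε : 0 < ε)
    {env : Env S A H} (hE : PCEEvent M sel ε δ env)
    {E F : ℕ → List (Episode S A H)} (hR : PhaseRuns M sel ε δ env E F)
    {π : Policy S A H} {Φ : ℝ} (hΦ0 : 0 ≤ Φ)
    (hΦ : ∀ h s a, 0 < M.pceComplexityTarget ε h s a →
      M.pceComplexityTarget ε h s a ≤ Φ * occ M.model M.init π h s a) (k : ℕ) :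
    ((E k).length : ℝ) ≤ 1 + (k + 1) * (16 * (2 ^ k * (8 * ε ^ 2 * Φ)) +
      (4 * ucbviRegret S A H (phaseConf δ k / 2) (E k).length + 8 * (k + 1) + 16) /
        exploreProb S A H ε) := by
  have hne : Nonempty S := ⟨M.init⟩
  obtain ⟨o, ho, hoμ⟩ := hE.exists_mix hH
  have hμ := exploreProb_pos (S := S) (A := A) hH hε
  set μ := exploreProb S A H ε with hμdef
  have hk0 : (0 : ℝ) ≤ k := Nat.cast_nonneg _
  have hlen := fun φ o₁ h₁ => (hR.success k).length_le φ μ k o₁ h₁ o ho hμ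
  rcases Nat.eq_zero_or_pos k with hk | hk
  -- The burn-in targets are 1, not proportional to reachability. The explorer covers them with φ =
  -- 1/μ, whence the extra 16/μ.
  · have h1 := hlen μ⁻¹ o ho (by positivity) (fun x _ => nonneg_of_mem_mixOcc M ho _ _ _)
      (fun x hx => by
        rw [inv_mul_eq_div, le_div_iff₀ hμ]
        have h1 := pceTarget_le sel env ε δ k x.1 x.2.1 x.2.2
        rw [hk, pow_zero] at h1
        have h2 := hoμ k x hx
        rw [hk] at hx
        rw [hk]
        nlinarith)
      (hoμ k) (fun x _ => pceTarget_le sel env ε δ k _ _ _)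
    refine h1.trans ?_
    have e1 : 16 * μ⁻¹ + (4 * ucbviRegret S A H (phaseConf δ k / 2) (E k).length + 8 * (k + 1)) / μ =
        (4 * ucbviRegret S A H (phaseConf δ k / 2) (E k).length + 8 * (k + 1) + 16) / μ := by
      field_simp; ring
    rw [e1]
    gcongr
    have : 0 ≤ 16 * (2 ^ k * (8 * ε ^ 2 * Φ)) := by positivity
    linarith
  -- The target is at most 8 · 2^k W, and W/ε² is the complexity target, dominated by Φ times the
  -- occupancy of `π`.
  · have h1 := hlen (2 ^ k * (8 * ε ^ 2 * Φ)) (occ M.model M.init π) (occ_mem_mixOcc M π)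
      (by positivity) (fun x _ => occ_nonneg M.isStochastic _ _ _ _ _)
      (fun x hx => by
        have hr := reachable_of_mem_level hx
        rw [pceTarget_pos hr hk.ne', mul_assoc]
        refine mul_le_mul_of_nonneg_left ?_ (by positivity)
        have h1 := hE.upper_le_of_reachable hH hr
        have hW : ε / (32 * Fintype.card S * (H : ℝ) ^ 2) ≤ M.maxReach x.1 x.2.1 :=
          (show _ ≤ _ from hr).trans (hE.reach x.1 x.2.1).1
        have ht : M.pceComplexityTarget ε x.1 x.2.1 x.2.2 = M.maxReach x.1 x.2.1 / ε ^ 2 :=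
          if_pos hW
        have hS : (0 : ℝ) < Fintype.card S := by exact_mod_cast Fintype.card_pos
        have hH' : (0 : ℝ) < H := by exact_mod_cast hH
        have hW0 : 0 < M.maxReach x.1 x.2.1 := lt_of_lt_of_le (by positivity) hW
        have h2 := hΦ x.1 x.2.1 x.2.2 (by rw [ht]; positivity)
        rw [ht, div_le_iff₀ (by positivity)] at h2
        linarith)
      (hoμ k) (fun x _ => pceTarget_le sel env ε δ k _ _ _)
    have h2 : (4 * ucbviRegret S A H (phaseConf δ k / 2) (E k).length + 8 * (k + 1)) / μ ≤
        (4 * ucbviRegret S A H (phaseConf δ k / 2) (E k).length + 8 * (k + 1) + 16) / μ :=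
      div_le_div_of_nonneg_right (by linarith) hμ.le
    exact h1.trans (add_le_add le_rfl (mul_le_mul_of_nonneg_left (by linarith) (by linarith)))

/-- The sample complexity of PCE, in terms of the coverage of the target by one policy. -/
lemma PCEEvent.episodes_le [MeasurableSpace S] [DiscreteMeasurableSpace S] [Nonempty A]
    (hH : 0 < H) {M : MDP S A H} {sel : (A → ℝ) → A} {ε δ : ℝ} (hε : 0 < ε) (hεH : ε ≤ H)
    (hδ : 0 < δ) (hδ1 : δ < 1) {env : Env S A H} (hE : PCEEvent M sel ε δ env) :
    ∃ N : ℕ, pceEpisodes sel env ε δ = N ∧ ∀ (π : Policy S A H) (Φ : ℝ), 0 ≤ Φ →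
      (∀ h s a, 0 < M.pceComplexityTarget ε h s a →
        M.pceComplexityTarget ε h s a ≤ Φ * occ M.model M.init π h s a) →
      (N : ℝ) ≤ 10 ^ 21 * logFactor S A H ε δ ^ 5 *
        (((H : ℝ) ^ 3 * Real.log (1 / δ) + Fintype.card S * (H : ℝ) ^ 4) * Φ +
          burnIn S A H ε δ) := by
  have hne : Nonempty S := ⟨M.init⟩
  obtain ⟨E, F, hR, K, hK1, hrun, -, hbefore⟩ := hE.exists_run hH hε hδ hδ1
  refine ⟨pceInit S A H ε δ + (F K).length, by unfold pceEpisodes; rw [hrun], ?_⟩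
  intro π Φ hΦ0 hΦ
  obtain ⟨hL, -, -, -, hl, -⟩ := logFactor_bounds (S := S) (A := A) (H := H) (ε := ε) hδ hδ1
  have hinit := pceInit_le (S := S) (A := A) hH hε hεH hδ hδ1
  have hb1 := one_le_burnIn (S := S) (A := A) hH hε hεH hl
  have hBμ := le_burnIn' (S := S) (A := A) hH hε hl (i := 2) (j := 1) (k := 3)
    (by norm_num) (by norm_num) (by norm_num)
  have hS : (1 : ℝ) ≤ Fintype.card S := by exact_mod_cast Fintype.card_pos
  have hA : (1 : ℝ) ≤ Fintype.card A := by exact_mod_cast Fintype.card_pos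
  have hH' : (1 : ℝ) ≤ H := by exact_mod_cast hH
  have hlogc := log_phaseConf_le (S := S) (A := A) (ε := ε) hH hδ hδ1
  have hlogE := fun k => (hE.log_length_le hH hε hδ hδ1 hR k).1
  have hβ := hE.betaRF_le hH hε hδ hδ1 hR
  have hlt := fun k => hE.lt_of_not_done hH hε hδ hδ1 hR (k := k)
  set L := logFactor S A H ε δ with hLdef
  set l := Real.log (1 / δ) with hldef
  set b := burnIn S A H ε δ with hb
  set a : ℝ := (H : ℝ) ^ 3 * l + Fintype.card S * (H : ℝ) ^ 4 with ha
  have ha0 : 0 ≤ a := by positivity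
  have hK1' : (1 : ℝ) ≤ K := by exact_mod_cast hK1
  set m := L + K with hm
  have hm1 : 1 ≤ m := by linarith
  have hHa : (H : ℝ) ^ 2 ≤ a := by
    calc (H : ℝ) ^ 2 ≤ (H : ℝ) ^ 4 := pow_le_pow_right₀ hH' (by norm_num)
      _ ≤ Fintype.card S * (H : ℝ) ^ 4 := le_mul_of_one_le_left (by positivity) hS
      _ ≤ a := by rw [ha]; have : 0 ≤ (H : ℝ) ^ 3 * l := by positivity
                  linarith
  -- Phase K - 1 failed the stopping rule, which bounds its index and ε² 2^(K-1). For K = 1 there is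
  -- no earlier test, and ε ≤ H is used instead.
  have hKL : (K : ℝ) ≤ 47 * L + 1 ∧ ε ^ 2 * 2 ^ K ≤ 64000 * a * m := by
    rcases hK1.eq_or_lt with h1 | h1
    · rw [← h1]
      refine ⟨by push_cast; linarith, ?_⟩
      have : ε ^ 2 ≤ (H : ℝ) ^ 2 := by gcongr
      nlinarith
    · obtain ⟨k, rfl⟩ : ∃ k, K = k + 1 := ⟨K - 1, by omega⟩
      have h2 := hbefore k (by omega) (Nat.lt_succ_self k)
      have h3 := hlt k h2
      push_cast
      refine ⟨by linarith, ?_⟩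
      have h4 := hβ k
      have h5 : L + k ≤ m := by rw [hm]; push_cast; linarith
      have h6 : 2000 * a * (L + k) ≤ 2000 * a * m := by gcongr
      calc ε ^ 2 * 2 ^ (k + 1) = 2 * (ε ^ 2 * 2 ^ k) := by ring
        _ ≤ 64000 * a * m := by linarith
  obtain ⟨hK47, hKε⟩ := hKL
  have hK49 : (K : ℝ) + 1 ≤ 49 * L := by linarith
  have hm49 : m ≤ 49 * L := by rw [hm]; linarith
  have hphase : ∀ k ≤ K, ((E k).length : ℝ) ≤ 10 ^ 19 * L ^ 4 * (a * Φ + b) := by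
    intro k hk
    have hkK : (k : ℝ) ≤ K := by exact_mod_cast hk
    have hk0 : (0 : ℝ) ≤ k := Nat.cast_nonneg _
    have h1 := hE.phase_length_le hH hε hR hΦ0 hΦ k
    have hreg := ucbviRegret_le_cube (S := S) (A := A) (H := H) hm1 hl
      ((hlogc k).trans (by rw [hm]; linarith)) (T := (E k).length)
      ((hlogE k).trans (by rw [hm]; linarith))
    have hinv : (exploreProb S A H ε)⁻¹ =
        64 * ((Fintype.card S : ℝ) ^ 2 * (Fintype.card A : ℝ) ^ 1 * (H : ℝ) ^ 3 / ε) := by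
      unfold exploreProb; field_simp
    have hpow : (2 : ℝ) ^ k * (8 * ε ^ 2 * Φ) ≤ 512000 * (a * Φ) * m := by
      have : (2 : ℝ) ^ k ≤ 2 ^ K := pow_le_pow_right₀ one_le_two hk
      calc (2 : ℝ) ^ k * (8 * ε ^ 2 * Φ) ≤ 2 ^ K * (8 * ε ^ 2 * Φ) := by gcongr
        _ = 8 * Φ * (ε ^ 2 * 2 ^ K) := by ring
        _ ≤ 8 * Φ * (64000 * a * m) := by gcongr
        _ = _ := by ring
    have hμinv := (exploreProb_pos (S := S) (A := A) hH hε)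
    have hm3 : m ≤ m ^ 3 := le_self_pow₀ hm1 (by norm_num)
    have hb0 : 0 ≤ b := by linarith
    have hfrac : (4 * ucbviRegret S A H (phaseConf δ k / 2) (E k).length + 8 * (k + 1) + 16) /
        exploreProb S A H ε ≤ 1300000000000 * m ^ 3 * b := by
      rw [div_eq_mul_inv]
      calc (4 * ucbviRegret S A H (phaseConf δ k / 2) (E k).length + 8 * (k + 1) + 16) *
            (exploreProb S A H ε)⁻¹
          ≤ (4 * (5000000000 * (Fintype.card S * Fintype.card A * (H : ℝ) ^ 2 *
            (l + Fintype.card S)) * m ^ 3) + 24 * m) * (exploreProb S A H ε)⁻¹ := by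
            refine mul_le_mul_of_nonneg_right ?_ (inv_nonneg.2 hμinv.le)
            have : 8 * ((k : ℝ) + 1) + 16 ≤ 24 * m := by linarith
            linarith
        _ = 1280000000000 * m ^ 3 * ((Fintype.card S : ℝ) ^ 3 * (Fintype.card A : ℝ) ^ 2 *
              (H : ℝ) ^ 5 * (l + Fintype.card S) / ε) + 1536 * m * ((Fintype.card S : ℝ) ^ 2 *
              (Fintype.card A : ℝ) ^ 1 * (H : ℝ) ^ 3 / ε) := by rw [hinv]; ring
        _ ≤ 1280000000000 * m ^ 3 * b + 1536 * m ^ 3 * b := by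
            gcongr
            exact le_of_eq rfl
        _ = 1280000001536 * (m ^ 3 * b) := by ring
        _ ≤ 1300000000000 * (m ^ 3 * b) := by gcongr; norm_num
        _ = _ := by ring
    have hL4 : L ^ 2 ≤ L ^ 4 := pow_le_pow_right₀ hL (by norm_num)
    have hL41 : 1 ≤ L ^ 4 := one_le_pow₀ hL
    calc ((E k).length : ℝ) ≤ 1 + (49 * L) * (16 * (512000 * (a * Φ) * (49 * L)) +
          1300000000000 * (49 * L) ^ 3 * b) := by
          have e1 : (k : ℝ) + 1 ≤ 49 * L := by linarith
          have e2 : 1300000000000 * m ^ 3 * b ≤ 1300000000000 * (49 * L) ^ 3 * b := by gcongr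
          refine h1.trans (add_le_add le_rfl ?_)
          refine mul_le_mul e1 (add_le_add ?_ (hfrac.trans e2)) ?_ (by linarith)
          · refine mul_le_mul_of_nonneg_left (hpow.trans ?_) (by norm_num)
            gcongr
          · refine add_nonneg (by positivity) (div_nonneg ?_ hμinv.le)
            have := ucbviRegret_nonneg (S := S) (A := A) hH (half_pos (phaseConf_pos hδ k))
              (by linarith [phaseConf_le hδ k, phaseConf_pos hδ k]) (E k).length
            positivity
      _ = 1 * 1 + 19668992000 * L ^ 2 * (a * Φ) + 7494241300000000000 * L ^ 4 * b := by ring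
      _ ≤ L ^ 4 * b + 19668992000 * L ^ 4 * (a * Φ) + 7494241300000000000 * L ^ 4 * b := by
          gcongr
      _ = 19668992000 * (L ^ 4 * (a * Φ)) + 7494241300000000001 * (L ^ 4 * b) := by ring
      _ ≤ 10 ^ 19 * (L ^ 4 * (a * Φ)) + 10 ^ 19 * (L ^ 4 * b) := by
          gcongr <;> norm_num
      _ = _ := by ring
  have hF : ((F K).length : ℝ) ≤ 49 * L * (10 ^ 19 * L ^ 4 * (a * Φ + b)) := by
    have hb0 : 0 ≤ b := by linarith
    rw [hR.length_eq]
    push_cast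
    calc ∑ i ∈ Finset.range (K + 1), ((E i).length : ℝ) ≤
          ∑ _i ∈ Finset.range (K + 1), 10 ^ 19 * L ^ 4 * (a * Φ + b) :=
          Finset.sum_le_sum fun i hi => hphase i (by rw [Finset.mem_range] at hi; omega)
      _ = (K + 1) * (10 ^ 19 * L ^ 4 * (a * Φ + b)) := by
          rw [Finset.sum_const, Finset.card_range, nsmul_eq_mul]; push_cast; ring
      _ ≤ _ := by gcongr
  have hb0 : 0 ≤ b := by linarith
  have hL35 : L ^ 3 ≤ L ^ 5 := pow_le_pow_right₀ hL (by norm_num)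
  push_cast
  calc (pceInit S A H ε δ : ℝ) + (F K).length ≤ 1000000000000 * L ^ 3 * b +
        49 * L * (10 ^ 19 * L ^ 4 * (a * Φ + b)) := add_le_add hinit hF
    _ ≤ 1000000000000 * L ^ 5 * (a * Φ + b) + 49 * L * (10 ^ 19 * L ^ 4 * (a * Φ + b)) := by
        gcongr
        have : 0 ≤ a * Φ := by positivity
        linarith
    _ = 490000001000000000000 * (L ^ 5 * (a * Φ + b)) := by ring
    _ ≤ 10 ^ 21 * (L ^ 5 * (a * Φ + b)) := by gcongr; norm_num
    _ = _ := by ring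

/-- The number of episodes does not depend on the comparator policy, so the infimum over policies
may be taken last. -/
theorem PCEEvent.pceEpisodes_le [MeasurableSpace S] [DiscreteMeasurableSpace S] [Nonempty A]
    (hH : 0 < H) {M : MDP S A H} {sel : (A → ℝ) → A} {ε δ : ℝ} (hε : 0 < ε) (hεH : ε ≤ H)
    (hδ : 0 < δ) (hδ1 : δ < 1) {env : Env S A H} (hE : PCEEvent M sel ε δ env) :
    pceEpisodes sel env ε δ ≤ ENNReal.ofReal (10 ^ 21 * logFactor S A H ε δ ^ 5) *
      (ENNReal.ofReal ((H : ℝ) ^ 3 * Real.log (1 / δ) + Fintype.card S * (H : ℝ) ^ 4) *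
        M.coverage (M.pceComplexityTarget ε) + ENNReal.ofReal (burnIn S A H ε δ)) := by
  have hne : Nonempty S := ⟨M.init⟩
  obtain ⟨hL, -, -, -, hl, -⟩ := logFactor_bounds (S := S) (A := A) (H := H) (ε := ε) hδ hδ1
  have hb1 := one_le_burnIn (S := S) (A := A) hH hε hεH hl
  obtain ⟨N, hN, hbound⟩ := hE.episodes_le hH hε hεH hδ hδ1
  have hS : (0 : ℝ) < Fintype.card S := by exact_mod_cast Fintype.card_pos
  have hH' : (0 : ℝ) < H := by exact_mod_cast hH
  set a : ℝ := (H : ℝ) ^ 3 * Real.log (1 / δ) + Fintype.card S * (H : ℝ) ^ 4 with ha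
  have ha0 : 0 < a := by
    have : 0 ≤ (H : ℝ) ^ 3 * Real.log (1 / δ) := by positivity
    have : 0 < Fintype.card S * (H : ℝ) ^ 4 := by positivity
    rw [ha]; linarith
  have hC0 : 0 < 10 ^ 21 * logFactor S A H ε δ ^ 5 := by positivity
  rw [hN]
  unfold MDP.coverage
  rw [ENNReal.mul_iInf_of_ne (by simpa using ha0) ENNReal.ofReal_ne_top, ENNReal.iInf_add,
    ENNReal.mul_iInf_of_ne (by simpa using hC0) ENNReal.ofReal_ne_top]
  refine le_iInf fun π => ?_
  set Φ := ⨆ (h : Fin H) (s : S) (x : A) (_ : 0 < M.pceComplexityTarget ε h s x),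
    ENNReal.ofReal (M.pceComplexityTarget ε h s x) / ENNReal.ofReal (occ M.model M.init π h s x)
    with hΦ
  -- A policy that misses a targeted triplet gives the bound ∞; the coefficient of Φ is positive, so
  -- the product is ∞ and not 0 · ∞ = 0.
  by_cases htop : Φ = ⊤
  · rw [htop, ENNReal.mul_top (by simpa using ha0), top_add, ENNReal.mul_top (by simpa using hC0)]
    exact le_top
  · have h1 : ∀ h s x, 0 < M.pceComplexityTarget ε h s x →
        M.pceComplexityTarget ε h s x ≤ Φ.toReal * occ M.model M.init π h s x := by
      intro h s x hpos
      have hocc := occ_nonneg M.isStochastic M.init π h s x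
      have h2 : ENNReal.ofReal (M.pceComplexityTarget ε h s x) /
          ENNReal.ofReal (occ M.model M.init π h s x) ≤ Φ :=
        le_iSup_of_le h (le_iSup_of_le s (le_iSup_of_le x (le_iSup_of_le hpos le_rfl)))
      rw [ENNReal.div_le_iff_le_mul (Or.inr htop) (Or.inl ENNReal.ofReal_ne_top),
        ← ENNReal.ofReal_toReal htop, ← ENNReal.ofReal_mul ENNReal.toReal_nonneg,
        ENNReal.ofReal_le_ofReal_iff (mul_nonneg ENNReal.toReal_nonneg hocc)] at h2
      exact h2
    have h3 := hbound π Φ.toReal ENNReal.toReal_nonneg h1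
    have h4 : 0 ≤ a * Φ.toReal := mul_nonneg ha0.le ENNReal.toReal_nonneg
    rw [← ENNReal.ofReal_natCast, ← ENNReal.ofReal_toReal htop, ← ENNReal.ofReal_mul ha0.le,
      ← ENNReal.ofReal_add h4 (by linarith), ← ENNReal.ofReal_mul hC0.le]
    exact ENNReal.ofReal_le_ofReal h3

/-- `G` need not be measurable: subadditivity of the outer measure on `G` and its complement is
enough. -/
lemma one_sub_le_real_of_compl_le {Ω : Type*} [MeasurableSpace Ω] {μ : Measure Ω}
    [IsProbabilityMeasure μ] {G B : Set Ω} {δ : ℝ} (hδ : 0 ≤ δ) (hG : Gᶜ ⊆ B)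
    (hB : μ B ≤ ENNReal.ofReal δ) : 1 - δ ≤ μ.real G := by
  have h1 : (1 : ENNReal) ≤ μ G + ENNReal.ofReal δ := by
    calc (1 : ENNReal) = μ (G ∪ Gᶜ) := by rw [Set.union_compl_self, measure_univ]
      _ ≤ μ G + μ Gᶜ := measure_union_le _ _
      _ ≤ μ G + ENNReal.ofReal δ := by gcongr; exact (measure_mono hG).trans hB
  have h2 := ENNReal.toReal_mono (by finiteness) h1
  rw [ENNReal.toReal_add (by finiteness) (by finiteness), ENNReal.toReal_one,
    ENNReal.toReal_ofReal hδ] at h2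
  rw [measureReal_def]
  linarith

end

end RewardFree

end

theorem mainTheorem4 :
    ∃ (C : ℝ) (q : ℕ), 0 < C ∧
      ∀ (S A : Type*) [Fintype S] [Fintype A] [Nonempty A]
        [MeasurableSpace S] [DiscreteMeasurableSpace S]
        (H : ℕ) (_ : 0 < H) (M : RewardFree.MDP S A H)
        (sel : (A → ℝ) → A) (_ : RewardFree.IsArgmaxRule sel)
        (ε δ : ℝ) (_ : 0 < ε) (_ : 0 < δ) (_ : δ < 1),
        1 - δ ≤ M.law.real {ω | ∃ P : RewardFree.Model S A H,
            RewardFree.pceOutput sel (M.env ω) ε δ = some P ∧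
            ∀ r : RewardFree.Table S A H, (∀ h s a, r h s a ∈ Set.Icc (0 : ℝ) 1) →
              ∀ π : RewardFree.Policy S A H, RewardFree.IsOptimalPolicy P M.init r π →
                |RewardFree.value M.model M.init π r - M.optValue r| ≤ ε} ∧
        (ε ≤ H →
          1 - δ ≤ M.law.real {ω | RewardFree.pceEpisodes sel (M.env ω) ε δ ≤
            ENNReal.ofReal (C * RewardFree.logFactor S A H ε δ ^ q) *
              (ENNReal.ofReal ((H : ℝ) ^ 3 * Real.log (1 / δ) + Fintype.card S * (H : ℝ) ^ 4) *
                  M.coverage (M.pceComplexityTarget ε) +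
                ENNReal.ofReal ((Fintype.card S : ℝ) ^ 3 * (Fintype.card A : ℝ) ^ 2 *
                  (H : ℝ) ^ 5 * (Real.log (1 / δ) + Fintype.card S) / ε))}) := by
  refine ⟨10 ^ 21, 5, by norm_num, ?_⟩
  intro S A _ _ _ _ _ H hH M sel hsel ε δ hε hδ hδ1
  have hlaw := RewardFree.law_pceEvent M hH hsel hε hδ hδ1.le
  constructor
  · refine RewardFree.one_sub_le_real_of_compl_le hδ.le (fun ω hω => ?_) hlaw
    exact fun hE => hω (hE.optimal hH hε hδ hδ1)
  · intro hεH
    refine RewardFree.one_sub_le_real_of_compl_le hδ.le (fun ω hω => ?_) hlaw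
    exact fun hE => hω (hE.pceEpisodes_le hH hε hεH hδ hδ1)
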